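/- Let $n\ge 2$ and let $\alpha\ge 0$ if $n\ge 3$, $\alpha>0$ if $n=2$. Let $$0<\mu\le\mu^*(n,\alpha):=\frac{2n^2+(n+2+\alpha)(n\alpha+2+\alpha)}{(n+2+\alpha)(2+\alpha)},$$ and let $p=p_S(n+\mu,\alpha)$ be the positive root of $2+(n+\mu+1+2\alpha)p-(n+\mu-1)p^2=0$. For $f\in H^1(\mathbf R^n)$ consider the singular Cauchy problem $$u_{tt}-\Delta u+\frac{\mu}{t}u_t=t^\alpha|u|^p\quad(t>0,\ x\in\mathbf R^n),\qquad u(0,\cdot)=f,\quad u_t(0,\cdot)=0. \tag{1}$$ An energy solution of (1) over $[0,T)$ is a function $u\in C([0,T),H^1(\mathbf R^n))\cap C^1([0,T),L^2(\mathbf R^n))\cap L^p_{loc}((0,T)\times\mathbf R^n)$ with $u(0)=f$ and $u_t(0)=0$ such that for all $\phi\in C_0^\infty([0,T)\times\mathbf R^n)$ (not necessarily vanishing at $t=0$) $$\int_0^T\!\!ds\int_{\mathbf R^n}\{-u_t\phi_t+\nabla u\cdot\nabla\phi\}\,dx+\int_0^T\!\!ds\int_{\mathbf R^n}\frac{\mu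 u_t}{s}\phi\,dx=\int_0^T\!\!ds\int_{\mathbf R^n}s^\alpha|u|^p\phi\,dx,$$ where $s\mapsto\int_{\mathbf R^n}\frac{\mu u_t}{s}\phi\,dx$ is integrable on $(0,T)$ and $s^\alpha|u|^p\phi$ is integrable on $(0,T)\times\mathbf R^n$. If $n\ge3$ and $p>\frac n{n-2}$, only energy solutions that propagate with finite speed, i.e. with $u(t,x)=0$ for a.e. $|x|>t+1$ and every $t\in[0,T)$, are considered. Let $u_0\in H^1(\mathbf R^n)$ be nonnegative, not identically zero, and supported in $\{|x|\le 1\}$. For $\varepsilon>0$ let $T(\varepsilon)\in[0,\infty]$ be the lifespan for the data $f=\varepsilon u_0$, i.e. the supremum of all $T>0$ for which (1) has such an energy solution over $[0,T)$. Then there are constants $\varepsilon_0>0$ and $C>0$, depending only on $u_0,n,p,\mu,\alpha$, such that $$T(\varepsilon)\le\exp\left(C\varepsilon^{-p(p-1)}\right)\qquad\text{for all }0<\varepsilon\le\varepsilon_0 .$$ In particular, no such solution is global in time. -/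

import Mathlib

open MeasureTheory Set Filter Topology
open scoped ContDiff Gradient RealInnerProductSpace ENNReal

namespace EPD

/-- The space `ℝⁿ` with its Euclidean norm. -/
abbrev Space (n : ℕ) : Type := EuclideanSpace ℝ (Fin n)

/-- The quadratic polynomial whose positive root is the exponent `p_S(n + μ, α)`. -/
noncomputable def strauss (n : ℕ) (μ α p : ℝ) : ℝ :=
  2 + (n + μ + 1 + 2 * α) * p - (n + μ - 1) * p ^ 2

/-- The threshold `μ*(n, α)` for the size of the damping. -/
noncomputable def muStar (n : ℕ) (α : ℝ) : ℝ :=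
  (2 * (n : ℝ) ^ 2 + (n + 2 + α) * (n * α + 2 + α)) / ((n + 2 + α) * (2 + α))

/-- `g` is the weak (distributional) gradient of `f`; used for square integrable `f` and `g`. -/
def HasWeakGradient {n : ℕ} (f : Space n → ℝ) (g : Space n → Space n) : Prop :=
  ∀ ψ : Space n → ℝ, ContDiff ℝ ∞ ψ → HasCompactSupport ψ →
    ∫ x, f x • ∇ ψ x = -∫ x, ψ x • g x

/-- Membership in the Sobolev space `H¹(ℝⁿ)`. -/
def MemH1 {n : ℕ} (f : Space n → ℝ) : Prop :=
  MemLp f 2 volume ∧ ∃ g : Space n → Space n, MemLp g 2 volume ∧ HasWeakGradient f g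

/-- Test functions in `C₀^∞([0, T) × ℝⁿ)`, as restrictions of smooth functions on `ℝ × ℝⁿ` with
compact support in `(-∞, T) × ℝⁿ`; they need not vanish at time `0`. -/
def IsTest {n : ℕ} (T : ℝ) (φ : ℝ × Space n → ℝ) : Prop :=
  ContDiff ℝ ∞ φ ∧ HasCompactSupport φ ∧ tsupport φ ⊆ Iio T ×ˢ univ

/-- The weak form of `u_tt - Δu + (μ/t) u_t = t^α |u|^p`, `u_t(0) = 0`, on `[0, T) × ℝⁿ`, where `V`
is the time derivative and `G` the spatial gradient of `u`.  The two integrals that are singular at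
`t = 0` are required to converge. -/
def WeakForm {n : ℕ} (μ α p T : ℝ) (u V : ℝ → Space n → ℝ) (G : ℝ → Space n → Space n) : Prop :=
  ∀ φ : ℝ × Space n → ℝ, IsTest T φ →
    IntegrableOn (fun s : ℝ => ∫ x, μ * V s x / s * φ (s, x)) (Ioo 0 T) ∧
    IntegrableOn (fun z : ℝ × Space n => z.1 ^ α * |u z.1 z.2| ^ p * φ z) (Ioo 0 T ×ˢ univ) ∧
    (∫ s in Ioo 0 T, ∫ x, (-(V s x * deriv (fun τ => φ (τ, x)) s)
          + ⟪G s x, ∇ (fun y => φ (s, y)) x⟫))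
        + ∫ s in Ioo 0 T, ∫ x, μ * V s x / s * φ (s, x)
      = ∫ s in Ioo 0 T, ∫ x, s ^ α * |u s x| ^ p * φ (s, x)

/-- `u` is an energy solution over `[0, T)` of `u_tt - Δu + (μ/t) u_t = t^α |u|^p`, `u(0) = f`,
`u_t(0) = 0`: it lies in `C([0,T), H¹) ∩ C¹([0,T), L²) ∩ L^p_loc((0,T) × ℝⁿ)` and satisfies the
weak form of the equation.  `U`, `V`, `G` are the curves in `L²` given by `u`, `u_t` and `∇u`. -/
def IsEnergySolution {n : ℕ} (μ α p : ℝ) (f : Space n → ℝ) (T : ℝ) (u : ℝ → Space n → ℝ) : Prop :=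
  0 < T ∧
  AEStronglyMeasurable (Function.uncurry u) (volume.restrict (Ioo 0 T ×ˢ univ)) ∧
  LocallyIntegrableOn (fun z : ℝ × Space n => |u z.1 z.2| ^ p) (Ioo 0 T ×ˢ univ) ∧
  ∃ (U V : ℝ → Lp ℝ 2 (volume : Measure (Space n)))
    (G : ℝ → Lp (Space n) 2 (volume : Measure (Space n))),
    (∀ t ∈ Ico 0 T, u t =ᵐ[volume] U t) ∧
    (∀ t ∈ Ico 0 T, HasWeakGradient (U t) (G t)) ∧
    ContinuousOn U (Ico 0 T) ∧ ContinuousOn G (Ico 0 T) ∧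
    (∀ t ∈ Ico 0 T, HasDerivWithinAt U (V t) (Ico 0 T) t) ∧ ContinuousOn V (Ico 0 T) ∧
    U 0 =ᵐ[volume] f ∧ V 0 = 0 ∧
    WeakForm μ α p T u (fun t => V t) (fun t => G t)

/-- The powers for which the equation is locally well posed in the energy space:
`p ≤ n / (n - 2)` if `n ≥ 3`, and no restriction if `n = 2`. -/
def WellPosedPower (n : ℕ) (p : ℝ) : Prop := 3 ≤ n → p ≤ (n : ℝ) / ((n : ℝ) - 2)

/-- `u` vanishes outside the forward light cone `|x| ≤ t + 1` over the unit ball. -/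
def SupportedInCone {n : ℕ} (T : ℝ) (u : ℝ → Space n → ℝ) : Prop :=
  ∀ t ∈ Ico 0 T, ∀ᵐ x, t + 1 < ‖x‖ → u t x = 0

/-- The lifespan for the data `(f, 0)`: the supremum of all `T` such that an energy solution exists
over `[0, T)`.  Only for powers outside the well-posed range, where energy solutions are not known
to be unique, the solution has to propagate with finite speed by requirement. -/
noncomputable def lifespan {n : ℕ} (μ α p : ℝ) (f : Space n → ℝ) : ℝ≥0∞ :=
  sSup {τ | ∃ (T : ℝ) (u : ℝ → Space n → ℝ), τ = ENNReal.ofReal T ∧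
    IsEnergySolution μ α p f T u ∧ (¬ WellPosedPower n p → SupportedInCone T u)}

end EPD

/-! Multiplied by `t^μ` the equation becomes `(t^μ u_t)_t - t^μ Δu = t^(μ+α) |u|^p`, whose linear
part is symmetric. It is tested with `ϑ(t) η(t/R) e^(l x·e)`, where `‖e‖ = 1`, `η` is a cut-off and
`(t^μ ϑ')' = l² t^μ ϑ`. The choice is `ϑ(t) = b(lt)` with `b` the decaying solution of Bessel type.
It may be singular at `t = 0`, but `-t^μ ϑ'` stays bounded below there by a positive constant. So
the data contribute a positive boundary term although `u_t(0) = 0`, and all other terms carry a sign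
or live in `R/2 < t ≤ R` (`IsMoment.test_le`).

Put `N = (n - 1 + μ)/2` and `D = 2 + t - |x|`. Integrating over `l` with weight `l^(γ-1) e^(-2l)`,
where `γ = N - 1 - a`, and over all directions `e`, the time derivative of the superposition is at
most `C t^(-N) D^a` in the light cone, while the superposition itself is at least `c t^(-γ)`
(`kernelNegDeriv_le`, `kernel_le`, `kernel_lower`). This gives, with `δ` of size `ε`, `δ + ∫
t^(μ+α-γ) η |u|^p ≤ (C/R) ∫_(R/2<t≤R) t^(μ-N) D^a |u| (-η')^(1/p)` (`exists_stripMean`).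

Hölder's inequality is applied on the right. The quadratic equation for `p` says `N(p-1) = 1 + α +
1/p`, which is exactly what makes all powers of `R` cancel when the weight on the `L^p` side is
`t^(μ+α-(N-1/p))` (`strauss_scaling`, `scaling_holder`). What remains is `(∫_1^(R+2) s^(aq)
ds)^(1/q)` with `1/q = 1 - 1/p`. For `a = -1/q`, that is `γ = N - 1/p`, it is a power of `log R`,
and the nonlinear term on the left has the same weight. For `a` slightly smaller it is bounded, and
the term `δ` is kept instead. These are the two halves of `exists_iteration`.

Let `F(τ)` be the weighted cut-off norm of `u` at `R = e^τ`. Since `-η'` is the bump appearing on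
the right, `F'(τ)` is comparable to the norm over the strip, so `F' ≥ c δ^p` and `F' ≥ c τ^(1-p)
F^p`. A function with these properties cannot exist beyond a time `τ = log R` of order `δ^(-p(p-1))`
(`exists_blowUp_time`).

The bound `μ ≤ μ*` forces `p ≥ (n+2+α)/n`, and hence `μ - 1 ≤ N - 1/p` (`sub_one_le_of_le_muStar`).
Since `b'` behaves like `t^(-μ)` at `0`, the superposition with `γ = N - 1/p` converges at `l = 0`
when this is strict. In the case of equality the first half of the iteration is obtained from the
single function `ϑ = t^(1-μ)` with `l = 0`.

Testing with exponentials needs `u` to vanish outside the light cone. Where this is not assumed, `H¹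
⊂ L^(2p)`, and it follows from energy estimates with logistic weights `S`, `|∇S| ≤ Λ S`, as `Λ → ∞`
(`EnergyCurves.supportedInCone`). The nonlinearity costs only `C + ηΛ` with `η` as small as desired,
because on compact time intervals `u` is a bounded function plus a small one in `L^(2p)`
(`EnergyCurves.exists_absPow_le`). The energy inequality itself is proved by averaging in time. -/

namespace EPD

/-! ### The decaying solution of `b'' + (μ/t) b' = b` -/

/-- The measure `(z² - 1)^{μ/2 - 1} dz` on `(1, ∞)`. -/
noncomputable def besselMeasure (μ : ℝ) : Measure ℝ :=
  (volume.restrict (Ioi 1)).withDensity (fun z => ENNReal.ofReal ((z ^ 2 - 1) ^ (μ / 2 - 1)))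

/-- The Laplace transform of `besselMeasure`: a multiple of `t^{-ν} K_ν(t)`, `ν = (μ - 1)/2`. -/
noncomputable def bessel (μ t : ℝ) : ℝ := ∫ z, Real.exp (-t * z) ∂besselMeasure μ

/-- The negative derivative of `bessel`. -/
noncomputable def besselNegDeriv (μ t : ℝ) : ℝ := ∫ z, z * Real.exp (-t * z) ∂besselMeasure μ

lemma measurable_besselDensity (μ : ℝ) :
    Measurable (fun z : ℝ => (z ^ 2 - 1) ^ (μ / 2 - 1)) := by fun_prop

lemma integral_besselMeasure (μ : ℝ) (f : ℝ → ℝ) :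
    ∫ z, f z ∂besselMeasure μ = ∫ z in Ioi 1, (z ^ 2 - 1) ^ (μ / 2 - 1) * f z := by
  rw [besselMeasure, integral_withDensity_eq_integral_toReal_smul
    (measurable_besselDensity μ).ennreal_ofReal (by simp)]
  refine setIntegral_congr_fun measurableSet_Ioi fun z hz => ?_
  have hz' : (1 : ℝ) < z := hz
  have : 0 ≤ (z ^ 2 - 1) ^ (μ / 2 - 1) := Real.rpow_nonneg (by nlinarith) _
  simp [ENNReal.toReal_ofReal this]

lemma integrable_besselMeasure_iff (μ : ℝ) (f : ℝ → ℝ) :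
    Integrable f (besselMeasure μ) ↔
      IntegrableOn (fun z => (z ^ 2 - 1) ^ (μ / 2 - 1) * f z) (Ioi 1) := by
  rw [besselMeasure, integrable_withDensity_iff_integrable_smul'
    (measurable_besselDensity μ).ennreal_ofReal (by simp)]
  refine integrableOn_congr_fun (fun z hz => ?_) measurableSet_Ioi
  have hz' : (1 : ℝ) < z := hz
  have : 0 ≤ (z ^ 2 - 1) ^ (μ / 2 - 1) := Real.rpow_nonneg (by nlinarith) _
  simp [ENNReal.toReal_ofReal this]

lemma rpow_le_exp_bound (s : ℝ) {c : ℝ} (hc : 0 < c) :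
    ∃ C : ℝ, 0 < C ∧ ∀ x : ℝ, 1 ≤ x → x ^ s ≤ C * Real.exp (c * x) := by
  obtain ⟨m, hm⟩ := exists_nat_ge s
  refine ⟨m.factorial / c ^ m, by positivity, fun x hx => ?_⟩
  have h1 : x ^ s ≤ x ^ (m : ℝ) := Real.rpow_le_rpow_of_exponent_le hx hm
  rw [Real.rpow_natCast] at h1
  have h2 := Real.pow_div_factorial_le_exp (c * x) (by positivity) m
  refine h1.trans ?_
  rw [div_le_iff₀ (by positivity), mul_pow] at h2
  rw [div_mul_eq_mul_div, le_div_iff₀ (by positivity)]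
  linarith

lemma integrableOn_rpow_mul_exp {s c : ℝ} (hs : -1 < s) (hc : 0 < c) :
    IntegrableOn (fun x : ℝ => x ^ s * Real.exp (-c * x)) (Ioi 0) := by
  simpa using integrableOn_rpow_mul_exp_neg_mul_rpow hs one_pos hc

/-- In `z² - 1 = (z - 1)(z + 1)` the first factor is integrable at `z = 1` because `μ/2 - 1 > -1`;
the power of the second is absorbed by half of the exponential. -/
lemma integrable_exp_besselMeasure {μ t : ℝ} (hμ : 0 < μ) (ht : 0 < t) :
    Integrable (fun z => Real.exp (-t * z)) (besselMeasure μ) := by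
  rw [integrable_besselMeasure_iff]
  obtain ⟨C, hC, hb⟩ := rpow_le_exp_bound (μ / 2 - 1) (half_pos ht)
  -- The factor `Real.exp (t / 2 - t / 2)` is `1`.
  have h0 : IntegrableOn (fun z : ℝ => C * Real.exp (t / 2 - t / 2) * ((z - 1) ^ (μ / 2 - 1) *
      Real.exp (-(t / 2) * (z - 1)))) (Ioi 1) := by
    have := integrableOn_rpow_mul_exp (s := μ / 2 - 1) (by linarith) (half_pos ht)
    have h1 := ((measurePreserving_sub_right volume (1 : ℝ)).integrableOn_comp_preimage
      (measurableEmbedding_subRight 1)).2 this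
    simp only [Set.preimage_sub_const_Ioi, zero_add] at h1
    exact h1.const_mul _
  refine h0.mono' (by fun_prop) ?_
  refine (ae_restrict_iff' measurableSet_Ioi).2 (ae_of_all _ fun z hz => ?_)
  have hz' : (1 : ℝ) < z := hz
  have hfac : z ^ 2 - 1 = (z - 1) * (z + 1) := by ring
  rw [hfac, Real.mul_rpow (by linarith) (by linarith), Real.norm_of_nonneg (by
    have := Real.rpow_nonneg (show 0 ≤ z - 1 by linarith) (μ / 2 - 1)
    have := Real.rpow_nonneg (show 0 ≤ z + 1 by linarith) (μ / 2 - 1)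
    positivity)]
  have h2 := hb (z + 1) (by linarith)
  have h3 := Real.rpow_nonneg (show 0 ≤ z - 1 by linarith) (μ / 2 - 1)
  calc (z - 1) ^ (μ / 2 - 1) * (z + 1) ^ (μ / 2 - 1) * Real.exp (-t * z)
      ≤ (z - 1) ^ (μ / 2 - 1) * (C * Real.exp (t / 2 * (z + 1))) * Real.exp (-t * z) := by gcongr
    _ = C * (z - 1) ^ (μ / 2 - 1) * (Real.exp (t / 2 * (z + 1)) * Real.exp (-t * z)) := by ring
    _ = C * Real.exp (t / 2 - t / 2) * ((z - 1) ^ (μ / 2 - 1) *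
          Real.exp (-(t / 2) * (z - 1))) := by
        rw [← Real.exp_add]
        have : t / 2 * (z + 1) + -t * z = -(t / 2) * (z - 1) := by ring
        rw [this]; simp; ring

/-- Makes the calculus of moment generating functions available: all moments exist and may be
differentiated under the integral. -/
lemma integrableExpSet_besselMeasure {μ t : ℝ} (hμ : 0 < μ) (ht : 0 < t) :
    -t ∈ interior (ProbabilityTheory.integrableExpSet id (besselMeasure μ)) := by
  rw [mem_interior]
  refine ⟨Iio 0, fun s hs => ?_, isOpen_Iio, by simpa using ht⟩
  have := integrable_exp_besselMeasure hμ (t := -s) (by simpa using hs)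
  simpa [ProbabilityTheory.integrableExpSet] using this

lemma integrable_pow_mul_exp_besselMeasure {μ t : ℝ} (hμ : 0 < μ) (ht : 0 < t) (k : ℕ) :
    Integrable (fun z => z ^ k * Real.exp (-t * z)) (besselMeasure μ) :=
  ProbabilityTheory.integrable_pow_mul_exp_of_mem_interior_integrableExpSet
    (integrableExpSet_besselMeasure hμ ht) k

lemma hasDerivAt_integral_pow_mul_exp_besselMeasure {μ t : ℝ} (hμ : 0 < μ) (ht : 0 < t) (k : ℕ) :
    HasDerivAt (fun s => ∫ z, z ^ k * Real.exp (-s * z) ∂besselMeasure μ)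
      (-∫ z, z ^ (k + 1) * Real.exp (-t * z) ∂besselMeasure μ) t := by
  have h := ProbabilityTheory.hasDerivAt_integral_pow_mul_exp_real
    (integrableExpSet_besselMeasure hμ ht) k
  have h2 := h.scomp t (hasDerivAt_neg t)
  simpa [Function.comp_def] using h2

lemma hasDerivAt_bessel {μ t : ℝ} (hμ : 0 < μ) (ht : 0 < t) :
    HasDerivAt (bessel μ) (-besselNegDeriv μ t) t := by
  have h := hasDerivAt_integral_pow_mul_exp_besselMeasure hμ ht 0
  simp only [pow_zero, one_mul, zero_add, pow_one] at h
  exact h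

/-- The integral `∫_1^∞ e^{-tz} (z² - 1)^{μ/2} dz`. -/
lemma integral_sq_sub_one_besselMeasure {μ t : ℝ} (hμ : 0 < μ) (ht : 0 < t) :
    ∫ z, (z ^ 2 - 1) * Real.exp (-t * z) ∂besselMeasure μ = μ / t * besselNegDeriv μ t := by
  have hi1 : IntegrableOn (fun z => (z ^ 2 - 1) ^ (μ / 2 - 1) * (z * Real.exp (-t * z)))
      (Ioi 1) := by
    rw [← integrable_besselMeasure_iff]
    simpa using integrable_pow_mul_exp_besselMeasure hμ ht 1
  have hi2 : IntegrableOn (fun z => (z ^ 2 - 1) ^ (μ / 2 - 1) * ((z ^ 2 - 1) * Real.exp (-t * z)))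
      (Ioi 1) := by
    rw [← integrable_besselMeasure_iff]
    have := (integrable_pow_mul_exp_besselMeasure hμ ht 2).sub
      (integrable_pow_mul_exp_besselMeasure hμ ht 0)
    simpa [sub_mul] using! this
  -- This primitive vanishes at `1` and at infinity, so its derivative has integral zero; that is
  -- the claimed identity times `t`.
  have hderiv : ∀ z ∈ Ioi (1 : ℝ), HasDerivAt
      (fun z : ℝ => (z ^ 2 - 1) ^ (μ / 2) * Real.exp (-t * z))
      (μ * ((z ^ 2 - 1) ^ (μ / 2 - 1) * (z * Real.exp (-t * z)))
        - t * ((z ^ 2 - 1) ^ (μ / 2 - 1) * ((z ^ 2 - 1) * Real.exp (-t * z)))) z := by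
    intro z hz
    have hz' : (1 : ℝ) < z := hz
    have hpos : 0 < z ^ 2 - 1 := by nlinarith
    have h1 : HasDerivAt (fun z : ℝ => z ^ 2 - 1) (2 * z) z := by
      simpa using ((hasDerivAt_id z).pow 2).sub_const 1
    have h2 := h1.rpow_const (p := μ / 2) (Or.inl hpos.ne')
    have h3 : HasDerivAt (fun z : ℝ => Real.exp (-t * z)) (Real.exp (-t * z) * -t) z := by
      simpa using ((hasDerivAt_id z).const_mul (-t)).exp
    refine (h2.mul h3).congr_deriv ?_
    have : (z ^ 2 - 1) ^ (μ / 2) = (z ^ 2 - 1) ^ (μ / 2 - 1) * (z ^ 2 - 1) := by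
      rw [← Real.rpow_add_one hpos.ne']; ring_nf
    rw [this]; ring
  have hlim : Tendsto (fun z : ℝ => (z ^ 2 - 1) ^ (μ / 2) * Real.exp (-t * z)) atTop (𝓝 0) := by
    have h0 := tendsto_rpow_mul_exp_neg_mul_atTop_nhds_zero μ t ht
    refine squeeze_zero' ?_ ?_ h0
    · filter_upwards [eventually_ge_atTop 1] with z hz
      have := Real.rpow_nonneg (show 0 ≤ z ^ 2 - 1 by nlinarith) (μ / 2)
      positivity
    · filter_upwards [eventually_ge_atTop 1] with z hz
      have : (z ^ 2 - 1) ^ (μ / 2) ≤ z ^ μ := by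
        calc (z ^ 2 - 1) ^ (μ / 2) ≤ (z ^ 2) ^ (μ / 2) :=
              Real.rpow_le_rpow (by nlinarith) (by linarith) (by linarith)
          _ = z ^ μ := by
              rw [← Real.rpow_natCast, ← Real.rpow_mul (by linarith)]; congr 1; push_cast; ring
      gcongr
  have hcont : ContinuousWithinAt (fun z : ℝ => (z ^ 2 - 1) ^ (μ / 2) * Real.exp (-t * z))
      (Ici 1) 1 := by
    apply Continuous.continuousWithinAt
    exact ((by fun_prop : Continuous fun z : ℝ => z ^ 2 - 1).rpow_const
      (fun _ => Or.inr (by linarith))).mul (by fun_prop)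
  have := integral_Ioi_of_hasDerivAt_of_tendsto hcont hderiv
    ((hi1.const_mul μ).sub (hi2.const_mul t)) hlim
  rw [integral_sub (hi1.const_mul μ) (hi2.const_mul t), integral_const_mul, integral_const_mul]
    at this
  simp only [one_pow, sub_self, zero_sub] at this
  rw [Real.zero_rpow (by linarith), zero_mul, neg_zero] at this
  rw [integral_besselMeasure, besselNegDeriv, integral_besselMeasure]
  rw [div_mul_eq_mul_div, eq_div_iff ht.ne']
  linarith

/-- The equation `b'' + (μ/t) b' = b` in divergence form. It holds because `b'' - b` is the integral
of `z² - 1`, evaluated by `integral_sq_sub_one_besselMeasure`. -/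
lemma hasDerivAt_rpow_mul_besselNegDeriv {μ t : ℝ} (hμ : 0 < μ) (ht : 0 < t) :
    HasDerivAt (fun s => s ^ μ * besselNegDeriv μ s) (-(t ^ μ * bessel μ t)) t := by
  have h1 := hasDerivAt_integral_pow_mul_exp_besselMeasure hμ ht 1
  have h2 := (Real.hasDerivAt_rpow_const (p := μ) (Or.inl ht.ne')).mul h1
  have h3 := integral_sq_sub_one_besselMeasure hμ ht
  have h4 : ∫ z, (z ^ 2 - 1) * Real.exp (-t * z) ∂besselMeasure μ =
      ∫ z, z ^ 2 * Real.exp (-t * z) ∂besselMeasure μ - bessel μ t := by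
    simp only [sub_mul, one_mul]
    exact integral_sub (integrable_pow_mul_exp_besselMeasure hμ ht 2)
      (integrable_exp_besselMeasure hμ ht)
  simp only [pow_one] at h2
  refine HasDerivAt.congr_deriv (f := fun s => s ^ μ * besselNegDeriv μ s) h2 ?_
  · have e1 : ∫ z, z ^ 2 * Real.exp (-t * z) ∂besselMeasure μ =
      μ / t * besselNegDeriv μ t + bessel μ t := by linarith
    simp only [Nat.reduceAdd, e1]
    rw [Real.rpow_sub_one ht.ne']
    simp only [besselNegDeriv]
    ring

lemma ae_one_lt_besselMeasure (μ : ℝ) : ∀ᵐ z ∂besselMeasure μ, 1 < z := by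
  have : ∀ᵐ z ∂(volume.restrict (Ioi (1 : ℝ))), 1 < z := ae_restrict_mem measurableSet_Ioi
  exact (withDensity_absolutelyContinuous _ _).ae_le this

lemma bessel_le_besselNegDeriv {μ t : ℝ} (hμ : 0 < μ) (ht : 0 < t) :
    bessel μ t ≤ besselNegDeriv μ t := by
  refine integral_mono_ae (integrable_exp_besselMeasure hμ ht)
    (by simpa using integrable_pow_mul_exp_besselMeasure hμ ht 1) ?_
  filter_upwards [ae_one_lt_besselMeasure μ] with z hz
  nlinarith [Real.exp_pos (-t * z)]

lemma bessel_pos {μ t : ℝ} (hμ : 0 < μ) (ht : 0 < t) : 0 < bessel μ t := by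
  rw [bessel, integral_besselMeasure]
  have hi := (integrable_besselMeasure_iff μ _).1 (integrable_exp_besselMeasure hμ ht)
  rw [setIntegral_pos_iff_support_of_nonneg_ae _ hi]
  · have : Ioi (1 : ℝ) ⊆ (Function.support fun z : ℝ =>
        (z ^ 2 - 1) ^ (μ / 2 - 1) * Real.exp (-t * z)) ∩ Ioi 1 := by
      intro z hz
      have hz' : (1 : ℝ) < z := hz
      refine ⟨?_, hz⟩
      have := Real.rpow_pos_of_pos (show 0 < z ^ 2 - 1 by nlinarith) (μ / 2 - 1)
      exact (by positivity : 0 < (z ^ 2 - 1) ^ (μ / 2 - 1) * Real.exp (-t * z)).ne'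
    refine lt_of_lt_of_le ?_ (measure_mono this)
    simp
  · refine (ae_restrict_iff' measurableSet_Ioi).2 (ae_of_all _ fun z hz => ?_)
    have hz' : (1 : ℝ) < z := hz
    have := Real.rpow_nonneg (show 0 ≤ z ^ 2 - 1 by nlinarith) (μ / 2 - 1)
    simp only [Pi.zero_apply]
    positivity

lemma besselNegDeriv_pos {μ t : ℝ} (hμ : 0 < μ) (ht : 0 < t) : 0 < besselNegDeriv μ t :=
  (bessel_pos hμ ht).trans_le (bessel_le_besselNegDeriv hμ ht)

/-- The substitution `z = 1 + s` splits off the decay `e^{-t}` and leaves an integral comparable to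
Gamma integrals. -/
lemma besselNegDeriv_eq {μ t : ℝ} (hμ : 0 < μ) (ht : 0 < t) :
    besselNegDeriv μ t =
      t / μ * Real.exp (-t) * ∫ s in Ioi 0, (s * (2 + s)) ^ (μ / 2) * Real.exp (-t * s) := by
  have h := integral_sq_sub_one_besselMeasure hμ ht
  have h2 : ∫ z, (z ^ 2 - 1) * Real.exp (-t * z) ∂besselMeasure μ =
      ∫ z in Ioi 1, (z ^ 2 - 1) ^ (μ / 2) * Real.exp (-t * z) := by
    rw [integral_besselMeasure]
    refine setIntegral_congr_fun measurableSet_Ioi fun z hz => ?_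
    have hz' : (1 : ℝ) < z := hz
    have hpos : z ^ 2 - 1 ≠ 0 := by nlinarith
    rw [← mul_assoc, ← Real.rpow_add_one hpos]; ring_nf
  have h3 : ∫ z in Ioi 1, (z ^ 2 - 1) ^ (μ / 2) * Real.exp (-t * z) =
      Real.exp (-t) * ∫ s in Ioi 0, (s * (2 + s)) ^ (μ / 2) * Real.exp (-t * s) := by
    rw [← integral_const_mul]
    have := (measurePreserving_add_right volume (1 : ℝ)).setIntegral_preimage_emb
      (measurableEmbedding_addRight 1)
      (fun z => (z ^ 2 - 1) ^ (μ / 2) * Real.exp (-t * z)) (Ioi 1)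
    rw [← this]
    simp only [Set.preimage_add_const_Ioi, sub_self]
    refine setIntegral_congr_fun measurableSet_Ioi fun s _ => ?_
    have e : -t * (s + 1) = -t + -t * s := by ring
    rw [e, Real.exp_add]
    ring_nf
  rw [h2, h3] at h
  field_simp at h ⊢
  linarith

/-- From `s² ≤ s(2 + s)` and a Gamma integral. The bound is uniform as `t → 0`, which is what keeps
the data term in the tested equation. -/
lemma besselNegDeriv_lower {μ t : ℝ} (hμ : 0 < μ) (ht : 0 < t)  :
    Real.Gamma (μ + 1) / μ * Real.exp (-t) ≤ t ^ μ * besselNegDeriv μ t := by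
  have hG := Real.integral_rpow_mul_exp_neg_mul_Ioi (a := μ + 1) (by linarith) ht
  have hcmp : ∫ s in Ioi 0, s ^ (μ + 1 - 1) * Real.exp (-(t * s)) ≤
      ∫ s in Ioi 0, (s * (2 + s)) ^ (μ / 2) * Real.exp (-t * s) := by
    refine setIntegral_mono_on ?_ ?_ measurableSet_Ioi ?_
    · simpa using integrableOn_rpow_mul_exp (s := μ) (by linarith) ht
    -- Without integrability the integral would be `0` by convention, contradicting the positivity
    -- of `besselNegDeriv`.
    · by_contra hcon
      have h0 := besselNegDeriv_eq hμ ht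
      rw [integral_undef hcon] at h0
      have := besselNegDeriv_pos hμ ht
      simp at h0; linarith
    · intro s hs
      have hs' : (0 : ℝ) < s := hs
      have : s ^ (μ + 1 - 1) ≤ (s * (2 + s)) ^ (μ / 2) := by
        calc s ^ (μ + 1 - 1) = (s ^ 2) ^ (μ / 2) := by
              rw [← Real.rpow_natCast, ← Real.rpow_mul hs'.le]; congr 1; push_cast; ring
          _ ≤ _ := Real.rpow_le_rpow (by positivity) (by nlinarith) (by linarith)
      simp only [neg_mul]
      gcongr
  rw [besselNegDeriv_eq hμ ht]
  rw [hG] at hcmp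
  calc Real.Gamma (μ + 1) / μ * Real.exp (-t)
      = t ^ μ * (t / μ * Real.exp (-t) * ((1 / t) ^ (μ + 1) * Real.Gamma (μ + 1))) := by
        rw [Real.div_rpow one_pos.le ht.le, Real.one_rpow, Real.rpow_add_one ht.ne']
        have := Real.rpow_pos_of_pos ht μ
        field_simp
    _ ≤ _ := by
        have := Real.rpow_pos_of_pos ht μ
        gcongr

/-- The integrand is compared with `(4s)^{μ/2}` for `s ≤ 2` and with `(2s²)^{μ/2}` for `s ≥ 2`; the
two Gamma integrals produce the behaviour at infinity and at zero. -/
lemma besselNegDeriv_upper {μ : ℝ} (hμ : 0 < μ) :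
    ∃ C : ℝ, 0 < C ∧ ∀ t : ℝ, 0 < t →
      besselNegDeriv μ t ≤ C * Real.exp (-t) * (t ^ (-(μ / 2)) + t ^ (-μ)) := by
  refine ⟨(4 ^ (μ / 2) * Real.Gamma (μ / 2 + 1) + 2 ^ (μ / 2) * Real.Gamma (μ + 1)) / μ, ?_, ?_⟩
  · have := Real.Gamma_pos_of_pos (show 0 < μ / 2 + 1 by linarith)
    have := Real.Gamma_pos_of_pos (show 0 < μ + 1 by linarith)
    positivity
  intro t ht
  have hG1 := Real.integral_rpow_mul_exp_neg_mul_Ioi (a := μ / 2 + 1) (by linarith) ht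
  have hG2 := Real.integral_rpow_mul_exp_neg_mul_Ioi (a := μ + 1) (by linarith) ht
  have i1 : IntegrableOn (fun s : ℝ => 4 ^ (μ / 2) * (s ^ (μ / 2 + 1 - 1) * Real.exp (-(t * s))))
      (Ioi 0) := by
    simpa using! (integrableOn_rpow_mul_exp (s := μ / 2) (by linarith) ht).const_mul _
  have i2 : IntegrableOn (fun s : ℝ => 2 ^ (μ / 2) * (s ^ (μ + 1 - 1) * Real.exp (-(t * s))))
      (Ioi 0) := by
    simpa using! (integrableOn_rpow_mul_exp (s := μ) (by linarith) ht).const_mul _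
  have hpt : ∀ s ∈ Ioi (0 : ℝ), (s * (2 + s)) ^ (μ / 2) * Real.exp (-t * s) ≤
      4 ^ (μ / 2) * (s ^ (μ / 2 + 1 - 1) * Real.exp (-(t * s))) +
      2 ^ (μ / 2) * (s ^ (μ + 1 - 1) * Real.exp (-(t * s))) := by
    intro s hs
    have hs' : (0 : ℝ) < s := hs
    have hx : 0 ≤ (4 : ℝ) ^ (μ / 2) * s ^ (μ / 2) := by positivity
    have hy : 0 ≤ (2 : ℝ) ^ (μ / 2) * s ^ μ := by positivity
    have key : (s * (2 + s)) ^ (μ / 2) ≤ 4 ^ (μ / 2) * s ^ (μ / 2) + 2 ^ (μ / 2) * s ^ μ := by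
      have hsq : s ^ μ = (s ^ 2) ^ (μ / 2) := by
        rw [← Real.rpow_natCast, ← Real.rpow_mul hs'.le]; congr 1; push_cast; ring
      rcases le_total s 2 with h | h
      · have : (s * (2 + s)) ^ (μ / 2) ≤ (4 * s) ^ (μ / 2) :=
          Real.rpow_le_rpow (by positivity) (by nlinarith) (by linarith)
        rw [Real.mul_rpow (by norm_num) hs'.le] at this
        linarith
      · have : (s * (2 + s)) ^ (μ / 2) ≤ (2 * s ^ 2) ^ (μ / 2) :=
          Real.rpow_le_rpow (by positivity) (by nlinarith) (by linarith)
        rw [Real.mul_rpow (x := 2) (by norm_num) (by positivity), ← hsq] at this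
        linarith
    have hexp := Real.exp_pos (-(t * s))
    have e1 : μ / 2 + 1 - 1 = μ / 2 := by ring
    have e2 : μ + 1 - 1 = μ := by ring
    rw [e1, e2, neg_mul]
    nlinarith
  have hIntg : ∫ s in Ioi 0, (s * (2 + s)) ^ (μ / 2) * Real.exp (-t * s) ≤
      4 ^ (μ / 2) * ((1 / t) ^ (μ / 2 + 1) * Real.Gamma (μ / 2 + 1)) +
      2 ^ (μ / 2) * ((1 / t) ^ (μ + 1) * Real.Gamma (μ + 1)) := by
    rw [← hG1, ← hG2, ← integral_const_mul, ← integral_const_mul, ← integral_add i1 i2]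
    refine integral_mono_of_nonneg ?_ (i1.add i2) ?_
    · refine (ae_restrict_iff' measurableSet_Ioi).2 (ae_of_all _ fun s hs => ?_)
      have hs' : (0 : ℝ) < s := hs
      simp only [Pi.zero_apply]; positivity
    · exact (ae_restrict_iff' measurableSet_Ioi).2 (ae_of_all _ hpt)
  rw [besselNegDeriv_eq hμ ht]
  have hp1 := Real.rpow_pos_of_pos ht (μ / 2)
  have hp2 := Real.rpow_pos_of_pos ht μ
  have hg1 := Real.Gamma_pos_of_pos (show 0 < μ / 2 + 1 by linarith)
  have hg2 := Real.Gamma_pos_of_pos (show 0 < μ + 1 by linarith)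
  calc t / μ * Real.exp (-t) * ∫ s in Ioi 0, (s * (2 + s)) ^ (μ / 2) * Real.exp (-t * s)
      ≤ t / μ * Real.exp (-t) * (4 ^ (μ / 2) * ((1 / t) ^ (μ / 2 + 1) * Real.Gamma (μ / 2 + 1)) +
        2 ^ (μ / 2) * ((1 / t) ^ (μ + 1) * Real.Gamma (μ + 1))) := by gcongr
    _ = (4 ^ (μ / 2) * Real.Gamma (μ / 2 + 1) * t ^ (-(μ / 2)) +
          2 ^ (μ / 2) * Real.Gamma (μ + 1) * t ^ (-μ)) / μ * Real.exp (-t) := by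
        rw [Real.div_rpow one_pos.le ht.le, Real.div_rpow one_pos.le ht.le, Real.one_rpow,
          Real.one_rpow, Real.rpow_add_one ht.ne', Real.rpow_add_one ht.ne', Real.rpow_neg ht.le,
          Real.rpow_neg ht.le]
        field_simp
    _ ≤ (4 ^ (μ / 2) * Real.Gamma (μ / 2 + 1) * (t ^ (-(μ / 2)) + t ^ (-μ)) +
          2 ^ (μ / 2) * Real.Gamma (μ + 1) * (t ^ (-(μ / 2)) + t ^ (-μ))) / μ * Real.exp (-t) := by
        have := Real.rpow_pos_of_pos ht (-μ)
        have := Real.rpow_pos_of_pos ht (-(μ / 2))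
        gcongr <;> linarith
    _ = _ := by ring

end EPD

namespace EPD

/-! ### Spherical averages of exponentials -/

/-- The direction of a vector. -/
noncomputable def dir {n : ℕ} (y : Space n) : Space n := ‖y‖⁻¹ • y

lemma measurable_dir {n : ℕ} : Measurable (dir : Space n → Space n) := by
  unfold dir; fun_prop

lemma norm_dir_le {n : ℕ} (y : Space n) : ‖dir y‖ ≤ 1 := by
  rw [dir, norm_smul, norm_inv, norm_norm]
  exact inv_mul_le_one

lemma norm_dir {n : ℕ} {y : Space n} (hy : y ≠ 0) : ‖dir y‖ = 1 := by
  rw [dir, norm_smul, norm_inv, norm_norm, inv_mul_cancel₀ (norm_ne_zero_iff.2 hy)]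

lemma dir_smul {n : ℕ} {r : ℝ} (hr : 0 < r) (y : Space n) : dir (r • y) = dir y := by
  rw [dir, dir, norm_smul, Real.norm_of_nonneg hr.le, smul_smul, mul_inv]
  congr 1; field_simp

lemma inner_dir_le {n : ℕ} (x y : Space n) : ⟪x, dir y⟫ ≤ ‖x‖ :=
  (real_inner_le_norm _ _).trans (mul_le_of_le_one_right (norm_nonneg _) (norm_dir_le y))

lemma inner_dir_ge {n : ℕ} (x y : Space n) : -‖x‖ ≤ ⟪x, dir y⟫ := by
  have := inner_dir_le (-x) y
  rw [inner_neg_left, norm_neg] at this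
  linarith

lemma integrableOn_exp_dir {n : ℕ} (e : Space n) (he : ‖e‖ = 1) {k : ℝ} (hk : 0 < k)
    {s : Set (Space n)} (hs : volume s < ⊤) :
    IntegrableOn (fun y => Real.exp (-k * (1 - ⟪e, dir y⟫))) s := by
  refine Measure.integrableOn_of_bounded (M := 1) hs.ne ?_ (ae_of_all _ fun y => ?_)
  · have := measurable_dir (n := n)
    fun_prop
  · have := inner_dir_le e y
    rw [Real.norm_of_nonneg (Real.exp_pos _).le, Real.exp_le_one_iff]
    nlinarith

/-- The integrand is homogeneous of degree zero. Spherical averages are therefore written as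
integrals over a ball, and no surface measure is needed. -/
lemma setIntegral_exp_dir_ball {n : ℕ} (e : Space n) (k : ℝ) {R : ℝ} (hR : 0 < R) :
    ∫ y in Metric.ball 0 R, Real.exp (-k * (1 - ⟪e, dir y⟫)) =
      R ^ n * ∫ y in Metric.ball 0 1, Real.exp (-k * (1 - ⟪e, dir y⟫)) := by
  have h := Measure.setIntegral_comp_smul_of_pos (volume : Measure (Space n))
    (fun y => Real.exp (-k * (1 - ⟪e, dir y⟫))) (Metric.ball 0 1) hR
  simp only [dir_smul hR, smul_unitBall_of_pos hR, finrank_euclideanSpace, Fintype.card_fin,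
    smul_eq_mul] at h
  rw [h]
  field_simp

/-- The Laplace method on the sphere, in the form needed for plane waves. -/
lemma setIntegral_exp_dir_le_of_one_le {n : ℕ} (hn : 1 ≤ n) (e : Space n) (he : ‖e‖ = 1) {k : ℝ}
    (hk : 1 ≤ k) :
    ∫ y in Metric.ball 0 1, Real.exp (-(2 * k) * (1 - ⟪e, dir y⟫)) ≤
      Real.exp 1 * (2 * Real.pi) ^ ((n : ℝ) / 2) * k ^ (-(((n : ℝ) - 1) / 2)) := by
  -- The sphere is thickened to a shell of width `k^{-1/2}`, the scale on which the exponential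
  -- concentrates around `e`.
  set δ : ℝ := (Real.sqrt k)⁻¹ with hδ
  have hk0 : 0 < k := by linarith
  have hsq : 0 < Real.sqrt k := Real.sqrt_pos.2 hk0
  have hδ0 : 0 < δ := inv_pos.2 hsq
  have hδ1 : δ ≤ 1 := inv_le_one_of_one_le₀ (Real.one_le_sqrt.2 hk)
  have hkδ : k * δ ^ 2 = 1 := by
    rw [hδ, inv_pow, Real.sq_sqrt hk0.le]; exact mul_inv_cancel₀ hk0.ne'
  set F : Space n → ℝ := fun y => Real.exp (-(2 * k) * (1 - ⟪e, dir y⟫)) with hF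
  set S := ∫ y in Metric.ball 0 1, F y with hS
  have hS0 : 0 ≤ S := integral_nonneg fun y => (Real.exp_pos _).le
  have hFi : ∀ r : ℝ, IntegrableOn F (Metric.ball 0 r) := fun r =>
    integrableOn_exp_dir e he (by positivity) measure_ball_lt_top
  -- By homogeneity the shell carries a fraction at least `δ` of the ball, so the shell integral
  -- controls `δ * S`.
  have hshell : ∫ y in Metric.ball 0 (1 + δ) \ Metric.ball 0 1, F y = ((1 + δ) ^ n - 1) * S := by
    rw [setIntegral_sdiff measurableSet_ball (hFi _) (Metric.ball_subset_ball (by linarith)),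
      setIntegral_exp_dir_ball e (2 * k) (by linarith : 0 < 1 + δ)]
    ring
  have hbern : δ ≤ (1 + δ) ^ n - 1 := by
    have h1 := one_add_mul_le_pow (show (-2 : ℝ) ≤ δ by linarith) n
    have h2 : (1 : ℝ) ≤ n := by exact_mod_cast hn
    nlinarith
  have hgi : Integrable (fun z : Space n => Real.exp (-(k / 2) * ‖z - e‖ ^ 2)) := by
    have := (GaussianFourier.integrable_cexp_neg_mul_sq_norm_add (V := Space n) (b := (k / 2 : ℝ))
      (by simpa using hk0) 0 0).re
    have h2 : Integrable (fun z : Space n => Real.exp (-(k / 2) * ‖z‖ ^ 2)) := by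
      refine this.congr (ae_of_all _ fun z => ?_)
      simp only [inner_zero_left, Complex.ofReal_zero, mul_zero, add_zero]
      have : (-((k / 2 : ℝ) : ℂ) * (‖z‖ : ℂ) ^ 2) = ((-(k / 2) * ‖z‖ ^ 2 : ℝ) : ℂ) := by
        push_cast; ring
      rw [this, ← Complex.ofReal_exp]
      rfl
    exact h2.comp_sub_right e
  -- On the shell `‖z‖ ≤ 2` and `k(‖z‖ - 1)² ≤ 1`, so the angular exponent dominates a Gaussian in
  -- `z - e` up to a factor `e`.
  have hpt : ∀ z ∈ Metric.ball (0 : Space n) (1 + δ) \ Metric.ball 0 1,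
      F z ≤ Real.exp 1 * Real.exp (-(k / 2) * ‖z - e‖ ^ 2) := by
    rintro z ⟨hz1, hz2⟩
    simp only [Metric.mem_ball, dist_zero_right, not_lt] at hz1 hz2
    have hz0 : z ≠ 0 := by
      rintro rfl; simp at hz2; linarith
    have hin : ⟪e, z⟫ = ‖z‖ * ⟪e, dir z⟫ := by
      rw [dir, inner_smul_right, ← mul_assoc, mul_inv_cancel₀ (norm_ne_zero_iff.2 hz0), one_mul]
    have hns : ‖z - e‖ ^ 2 = (‖z‖ - 1) ^ 2 + 2 * ‖z‖ * (1 - ⟪e, dir z⟫) := by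
      rw [@norm_sub_sq ℝ, real_inner_comm, hin, he]; simp; ring
    have hle := inner_dir_le e z
    rw [he] at hle
    rw [hF, ← Real.exp_add, Real.exp_le_exp, hns]
    have h1 : k * (‖z‖ - 1) ^ 2 ≤ 1 := by
      rw [← hkδ]; gcongr; · linarith
      · linarith
    have h2 : 0 ≤ k * (1 - ⟪e, dir z⟫) * (2 - ‖z‖) :=
      mul_nonneg (mul_nonneg hk0.le (by linarith)) (by linarith)
    nlinarith
  have hmain : δ * S ≤ Real.exp 1 * (2 * Real.pi / k) ^ ((n : ℝ) / 2) := by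
    calc δ * S ≤ ((1 + δ) ^ n - 1) * S := by gcongr
      _ = ∫ y in Metric.ball 0 (1 + δ) \ Metric.ball 0 1, F y := hshell.symm
      _ ≤ ∫ z in Metric.ball (0 : Space n) (1 + δ) \ Metric.ball 0 1,
            Real.exp 1 * Real.exp (-(k / 2) * ‖z - e‖ ^ 2) :=
          setIntegral_mono_on ((hFi _).mono_set sdiff_subset) (hgi.const_mul _).integrableOn
            (measurableSet_ball.diff measurableSet_ball) hpt
      _ ≤ ∫ z : Space n, Real.exp 1 * Real.exp (-(k / 2) * ‖z - e‖ ^ 2) :=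
          setIntegral_le_integral (hgi.const_mul _) (ae_of_all _ fun z => by positivity)
      _ = Real.exp 1 * (2 * Real.pi / k) ^ ((n : ℝ) / 2) := by
          rw [integral_const_mul, integral_sub_right_eq_self
            (fun z : Space n => Real.exp (-(k / 2) * ‖z‖ ^ 2)),
            GaussianFourier.integral_rexp_neg_mul_sq_norm (by positivity)]
          simp only [finrank_euclideanSpace, Fintype.card_fin]
          congr 2; field_simp
  have : S ≤ Real.sqrt k * (Real.exp 1 * (2 * Real.pi / k) ^ ((n : ℝ) / 2)) := by
    calc S = Real.sqrt k * (δ * S) := by rw [hδ]; field_simp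
      _ ≤ _ := by gcongr
  refine this.trans (le_of_eq ?_)
  rw [Real.div_rpow (by positivity) hk0.le, Real.sqrt_eq_rpow,
    div_eq_mul_inv ((2 * Real.pi) ^ ((n : ℝ) / 2)), ← Real.rpow_neg hk0.le]
  have : k ^ (-(((n : ℝ) - 1) / 2)) = k ^ (1 / 2 : ℝ) * k ^ (-((n : ℝ) / 2)) := by
    rw [← Real.rpow_add hk0]; congr 1; ring
  rw [this]; ring

/-- For `k ≥ 2` this is the Laplace bound with `k / 2`; for smaller `k` the volume of the ball
suffices, as the power of `k / 2` is at least `1`. -/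
lemma setIntegral_exp_dir_le {n : ℕ} (hn : 1 ≤ n) :
    ∃ C : ℝ, 0 < C ∧ ∀ (e : Space n), ‖e‖ = 1 → ∀ k : ℝ, 0 < k →
      ∫ y in Metric.ball 0 1, Real.exp (-k * (1 - ⟪e, dir y⟫)) ≤
        C * k ^ (-(((n : ℝ) - 1) / 2)) := by
  have hn' : (1 : ℝ) ≤ n := by exact_mod_cast hn
  set v := volume.real (Metric.ball (0 : Space n) 1) with hv
  have hv0 : 0 ≤ v := measureReal_nonneg
  refine ⟨(Real.exp 1 * (2 * Real.pi) ^ ((n : ℝ) / 2) + v) * (1 / 2) ^ (-(((n : ℝ) - 1) / 2)),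
    by positivity, fun e he k hk => ?_⟩
  have hks : (1 / 2 : ℝ) ^ (-(((n : ℝ) - 1) / 2)) * k ^ (-(((n : ℝ) - 1) / 2)) =
      (k / 2) ^ (-(((n : ℝ) - 1) / 2)) := by
    rw [← Real.mul_rpow (by norm_num) hk.le]; congr 1; ring
  rw [mul_assoc, hks]
  have hp : 0 < (k / 2) ^ (-(((n : ℝ) - 1) / 2)) := by positivity
  rcases le_total 1 (k / 2) with h | h
  · have := setIntegral_exp_dir_le_of_one_le hn e he h
    rw [show -(2 * (k / 2)) = -k by ring] at this
    refine this.trans ?_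
    gcongr
    linarith
  · have h1 : ∫ y in Metric.ball 0 1, Real.exp (-k * (1 - ⟪e, dir y⟫)) ≤ v := by
      have := setIntegral_mono_on (s := Metric.ball 0 1) (integrableOn_exp_dir e he hk measure_ball_lt_top)
        (integrableOn_const (C := (1 : ℝ)) measure_ball_lt_top.ne) measurableSet_ball
        (fun y _ => show Real.exp (-k * (1 - ⟪e, dir y⟫)) ≤ 1 by
          have := inner_dir_le e y
          rw [Real.exp_le_one_iff]; nlinarith)
      simpa using this
    have h2 : 1 ≤ (k / 2) ^ (-(((n : ℝ) - 1) / 2)) :=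
      Real.one_le_rpow_of_pos_of_le_one_of_nonpos (by positivity) h (by linarith)
    have : 0 ≤ Real.exp 1 * (2 * Real.pi) ^ ((n : ℝ) / 2) := by positivity
    nlinarith

end EPD

namespace EPD

/-! ### Superpositions of plane wave solutions -/

instance (μ : ℝ) : SFinite (besselMeasure μ) := by unfold besselMeasure; infer_instance

lemma measurable_bessel (μ : ℝ) : Measurable (bessel μ) := by
  have : StronglyMeasurable (Function.uncurry fun t z : ℝ => Real.exp (-t * z)) :=
    Continuous.stronglyMeasurable (by fun_prop)
  exact this.integral_prod_right.measurable

lemma measurable_besselNegDeriv (μ : ℝ) : Measurable (besselNegDeriv μ) := by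
  have : StronglyMeasurable (Function.uncurry fun t z : ℝ => z * Real.exp (-t * z)) :=
    Continuous.stronglyMeasurable (by fun_prop)
  exact this.integral_prod_right.measurable

/-- A positive superposition of the solutions `b(lt) e^{l x·ω}` of the linear equation. -/
noncomputable def kernel {n : ℕ} (μ γ t : ℝ) (x : Space n) : ℝ≥0∞ :=
  ∫⁻ y in Metric.ball (0 : Space n) 1, ∫⁻ l in Ioi (0 : ℝ),
    ENNReal.ofReal (l ^ (γ - 1) * Real.exp (-2 * l) * bessel μ (l * t)
      * Real.exp (l * ⟪x, dir y⟫))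

/-- The absolute value of the time derivative of `kernel`. -/
noncomputable def kernelNegDeriv {n : ℕ} (μ γ t : ℝ) (x : Space n) : ℝ≥0∞ :=
  ∫⁻ y in Metric.ball (0 : Space n) 1, ∫⁻ l in Ioi (0 : ℝ),
    ENNReal.ofReal (l ^ (γ - 1) * Real.exp (-2 * l) * (l * besselNegDeriv μ (l * t))
      * Real.exp (l * ⟪x, dir y⟫))

lemma lintegral_rpow_mul_exp {s c A : ℝ} (hs : 0 < s) (hc : 0 < c) (hA : 0 ≤ A) :
    ∫⁻ l in Ioi (0 : ℝ), ENNReal.ofReal (A * (l ^ (s - 1) * Real.exp (-c * l))) =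
      ENNReal.ofReal (A * (Real.Gamma s * c ^ (-s))) := by
  rw [← ofReal_integral_eq_lintegral_ofReal]
  · rw [integral_const_mul]
    have := Real.integral_rpow_mul_exp_neg_mul_Ioi hs hc
    simp only [neg_mul]
    rw [this, Real.div_rpow one_pos.le hc.le, Real.one_rpow, Real.rpow_neg hc.le]
    congr 1; ring
  · exact (integrableOn_rpow_mul_exp (by linarith) hc).const_mul A
  · refine (ae_restrict_iff' measurableSet_Ioi).2 (ae_of_all _ fun l hl => ?_)
    have : (0 : ℝ) < l := hl
    simp only [Pi.zero_apply]; positivity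

lemma exp_le_rpow_neg (s : ℝ) (hs : 0 ≤ s) :
    ∃ C : ℝ, 0 < C ∧ ∀ k : ℝ, 0 < k → Real.exp (-(k / 4)) ≤ C * k ^ (-s) := by
  obtain ⟨C, hC, h⟩ := rpow_le_exp_bound s (show (0 : ℝ) < 1 / 4 by norm_num)
  refine ⟨max C 1, by positivity, fun k hk => ?_⟩
  have hks : 0 < k ^ s := Real.rpow_pos_of_pos hk s
  rw [Real.rpow_neg hk.le, ← div_eq_mul_inv, le_div_iff₀ hks, Real.exp_neg,
    inv_mul_le_iff₀ (Real.exp_pos _)]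
  rcases le_total 1 k with h1 | h1
  · calc k ^ s ≤ C * Real.exp (1 / 4 * k) := h k h1
      _ ≤ max C 1 * Real.exp (1 / 4 * k) := by gcongr; exact le_max_left _ _
      _ = Real.exp (k / 4) * max C 1 := by rw [mul_comm]; congr 2; ring
  · calc k ^ s ≤ 1 := Real.rpow_le_one hk.le h1 hs
      _ ≤ Real.exp (k / 4) * max C 1 :=
        one_le_mul_of_one_le_of_one_le (Real.one_le_exp (by positivity)) (le_max_right _ _)

/-- Angular integral of a plane wave, inside the light cone. -/
lemma lintegral_planeWave_le {n : ℕ} (hn : 1 ≤ n) :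
    ∃ C : ℝ, 0 < C ∧ ∀ (t : ℝ) (x : Space n) (l : ℝ), 1 ≤ t → ‖x‖ ≤ t + 1 → 0 < l →
      ∫⁻ y in Metric.ball (0 : Space n) 1,
        ENNReal.ofReal (Real.exp (-l * (2 + t) + l * ⟪x, dir y⟫)) ≤
      ENNReal.ofReal (C * ((l * t) ^ (-(((n : ℝ) - 1) / 2)) *
        Real.exp (-((2 + t - ‖x‖) / 2) * l))) := by
  have hn' : (1 : ℝ) ≤ n := by exact_mod_cast hn
  obtain ⟨C₁, hC₁, h₁⟩ := setIntegral_exp_dir_le hn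
  obtain ⟨C₂, hC₂, h₂⟩ := exp_le_rpow_neg (((n : ℝ) - 1) / 2) (by linarith)
  set v := volume.real (Metric.ball (0 : Space n) 1) with hv
  have hv0 : 0 ≤ v := measureReal_nonneg
  refine ⟨C₁ * (1 / 2) ^ (-(((n : ℝ) - 1) / 2)) + v * C₂, by positivity,
    fun t x l ht hx hl => ?_⟩
  have hlt : 0 < l * t := by positivity
  set q := -(((n : ℝ) - 1) / 2) with hq
  have hpq : 0 < (l * t) ^ q := Real.rpow_pos_of_pos hlt _
  -- Near the cone `‖x‖` is comparable to `t` and the Laplace bound applies with parameter `l‖x‖`.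
  -- For `‖x‖ ≤ t/2` the exponential leaves a spare factor `e^{-lt/4}`, which beats every power of
  -- `lt`.
  rcases le_total (t / 2) ‖x‖ with hr | hr
  · have hx0 : x ≠ 0 := by
      rintro rfl; simp at hr; linarith
    have hr0 : 0 < ‖x‖ := norm_pos_iff.2 hx0
    have hIntg : ∀ y : Space n, Real.exp (-l * (2 + t) + l * ⟪x, dir y⟫) =
        Real.exp (-l * (2 + t - ‖x‖)) * Real.exp (-(l * ‖x‖) * (1 - ⟪dir x, dir y⟫)) := by
      intro y
      have : ⟪x, dir y⟫ = ‖x‖ * ⟪dir x, dir y⟫ := by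
        conv_rhs => rw [dir, real_inner_smul_left, ← mul_assoc, mul_inv_cancel₀ hr0.ne', one_mul]
      rw [← Real.exp_add, this]; congr 1; ring
    simp only [hIntg]
    rw [← ofReal_integral_eq_lintegral_ofReal
      ((integrableOn_exp_dir _ (norm_dir hx0) (by positivity) measure_ball_lt_top).const_mul _)
      (ae_of_all _ fun y => by simp only [Pi.zero_apply]; positivity), integral_const_mul]
    apply ENNReal.ofReal_le_ofReal
    have h3 := h₁ (dir x) (norm_dir hx0) (l * ‖x‖) (by positivity)
    have h4 : (l * ‖x‖) ^ q ≤ (1 / 2) ^ q * (l * t) ^ q := by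
      rw [← Real.mul_rpow (by norm_num) hlt.le]
      exact Real.rpow_le_rpow_of_nonpos (by positivity) (by nlinarith) (by rw [hq]; linarith)
    have h5 : Real.exp (-l * (2 + t - ‖x‖)) ≤ Real.exp (-((2 + t - ‖x‖) / 2) * l) := by
      rw [Real.exp_le_exp]; nlinarith
    calc _ ≤ Real.exp (-((2 + t - ‖x‖) / 2) * l) * (C₁ * ((1 / 2) ^ q * (l * t) ^ q)) := by
          gcongr
          exact h3.trans (by gcongr)
      _ = C₁ * (1 / 2) ^ q * ((l * t) ^ q * Real.exp (-((2 + t - ‖x‖) / 2) * l)) := by ring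
      _ ≤ _ := by
          have : 0 ≤ v * C₂ := by positivity
          gcongr; linarith
  · have hle : ∀ y : Space n, Real.exp (-l * (2 + t) + l * ⟪x, dir y⟫) ≤
        C₂ * ((l * t) ^ q * Real.exp (-((2 + t - ‖x‖) / 2) * l)) := by
      intro y
      have h3 := h₂ (l * t) hlt
      have h4 := inner_dir_le x y
      calc Real.exp (-l * (2 + t) + l * ⟪x, dir y⟫)
          ≤ Real.exp (-(l * t / 4) + -((2 + t - ‖x‖) / 2) * l) := by
            rw [Real.exp_le_exp]; nlinarith
        _ = Real.exp (-(l * t / 4)) * Real.exp (-((2 + t - ‖x‖) / 2) * l) := Real.exp_add _ _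
        _ ≤ C₂ * (l * t) ^ q * Real.exp (-((2 + t - ‖x‖) / 2) * l) := by gcongr
        _ = _ := by ring
    calc _ ≤ ∫⁻ y in Metric.ball (0 : Space n) 1,
            ENNReal.ofReal (C₂ * ((l * t) ^ q * Real.exp (-((2 + t - ‖x‖) / 2) * l))) :=
          lintegral_mono fun y => ENNReal.ofReal_le_ofReal (hle y)
      _ = ENNReal.ofReal (C₂ * ((l * t) ^ q * Real.exp (-((2 + t - ‖x‖) / 2) * l)) * v) := by
          rw [lintegral_const, ENNReal.ofReal_mul (q := v) (by positivity), hv, Measure.restrict_apply_univ,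
            measureReal_def, ENNReal.ofReal_toReal measure_ball_lt_top.ne]
      _ ≤ _ := by
          apply ENNReal.ofReal_le_ofReal
          have : 0 ≤ C₁ * (1 / 2) ^ q * ((l * t) ^ q * Real.exp (-((2 + t - ‖x‖) / 2) * l)) := by
            positivity
          nlinarith

/-- The term `k^{-μ}` matters only for `k ≤ 1`, so it may carry an additional `e^{-k}`. This makes
its contribution to the superposition summable without any gain from the angular average. -/
lemma besselNegDeriv_upper_exp {μ : ℝ} (hμ : 0 < μ) :
    ∃ C : ℝ, 0 < C ∧ ∀ k : ℝ, 0 < k →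
      besselNegDeriv μ k ≤ C * Real.exp (-k) * (k ^ (-(μ / 2)) + k ^ (-μ) * Real.exp (-k)) := by
  obtain ⟨C, hC, h⟩ := besselNegDeriv_upper hμ
  refine ⟨3 * C, by positivity, fun k hk => (h k hk).trans ?_⟩
  have hp1 : 0 < k ^ (-(μ / 2)) := by positivity
  have hp2 : 0 < k ^ (-μ) := by positivity
  have key : k ^ (-(μ / 2)) + k ^ (-μ) ≤ 3 * (k ^ (-(μ / 2)) + k ^ (-μ) * Real.exp (-k)) := by
    rcases le_total k 1 with h1 | h1
    · have : 1 ≤ 3 * Real.exp (-k) := by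
        have h3 : Real.exp k ≤ 3 :=
          (Real.exp_le_exp.2 h1).trans (Real.exp_one_lt_d9.le.trans (by norm_num))
        rw [Real.exp_neg]
        have := Real.exp_pos k
        field_simp
        exact h3
      nlinarith
    · have : k ^ (-μ) ≤ k ^ (-(μ / 2)) := Real.rpow_le_rpow_of_exponent_le h1 (by linarith)
      have := Real.exp_pos (-k)
      nlinarith [mul_pos hp2 this]
  have hE : 0 < C * Real.exp (-k) := by positivity
  nlinarith

/-- The decay of `b'` contributes `(lt)^{-μ/2}` and the average over directions `(lt)^{-(n-1)/2}`,
together `t^{-N}` times a power of `l`. The remaining integral over `l` is `∫ l^{-a-1} e^{-Dl/2}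
dl`, a multiple of `D^a`. The condition `γ > μ - 1` is convergence at `l = 0`. -/
lemma kernelNegDeriv_le {n : ℕ} (hn : 1 ≤ n) {μ γ N a : ℝ} (hμ : 0 < μ)
    (hN : N = ((n : ℝ) - 1 + μ) / 2) (hγ : γ = N - 1 - a) (ha : a < 0) (hγμ : μ - 1 < γ) :
    ∃ C : ℝ, 0 < C ∧ ∀ (t : ℝ) (x : Space n), 1 ≤ t → ‖x‖ ≤ t + 1 →
      kernelNegDeriv μ γ t x ≤ ENNReal.ofReal (C * (t ^ (-N) * (2 + t - ‖x‖) ^ a)) := by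
  obtain ⟨C₀, hC₀, h₀⟩ := besselNegDeriv_upper_exp hμ
  obtain ⟨C₁, hC₁, h₁⟩ := lintegral_planeWave_le hn
  set v := volume.real (Metric.ball (0 : Space n) 1) with hv
  have hv0 : 0 ≤ v := measureReal_nonneg
  have hG1 : 0 < Real.Gamma (-a) := Real.Gamma_pos_of_pos (by linarith)
  have hG2 : 0 < Real.Gamma (γ + 1 - μ) := Real.Gamma_pos_of_pos (by linarith)
  refine ⟨C₀ * C₁ * Real.Gamma (-a) * (1 / 2) ^ a + C₀ * v * Real.Gamma (γ + 1 - μ) * (1 / 3) ^ a,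
    by positivity, fun t x ht hx => ?_⟩
  have ht0 : 0 < t := by linarith
  set D := 2 + t - ‖x‖ with hD
  have hD1 : 1 ≤ D := by linarith
  have hD3 : D ≤ 3 * t := by have := norm_nonneg x; linarith
  -- pointwise bound by two explicit terms
  have hpt : ∀ (y : Space n) (l : ℝ), l ∈ Ioi (0 : ℝ) →
      l ^ (γ - 1) * Real.exp (-2 * l) * (l * besselNegDeriv μ (l * t)) * Real.exp (l * ⟪x, dir y⟫) ≤
        C₀ * (l ^ γ * (l * t) ^ (-(μ / 2))) * Real.exp (-l * (2 + t) + l * ⟪x, dir y⟫) +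
        C₀ * t ^ (-μ) * (l ^ (γ + 1 - μ - 1) * Real.exp (-t * l)) := by
    intro y l hl
    have hl0 : (0 : ℝ) < l := hl
    have hlt : 0 < l * t := by positivity
    have e1 : l ^ (γ - 1) * l = l ^ γ := by rw [← Real.rpow_add_one hl0.ne']; ring_nf
    have e2 : l ^ γ * (l * t) ^ (-μ) = t ^ (-μ) * l ^ (γ + 1 - μ - 1) := by
      rw [Real.mul_rpow hl0.le ht0.le, ← mul_assoc, ← Real.rpow_add hl0]; ring_nf
    have e3 : Real.exp (-2 * l) * Real.exp (-(l * t)) * Real.exp (l * ⟪x, dir y⟫) =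
        Real.exp (-l * (2 + t) + l * ⟪x, dir y⟫) := by
      rw [← Real.exp_add, ← Real.exp_add]; congr 1; ring
    have e4 : Real.exp (-l * (2 + t) + l * ⟪x, dir y⟫) ≤ 1 := by
      have := inner_dir_le x y
      rw [Real.exp_le_one_iff]; nlinarith
    have hb := h₀ (l * t) hlt
    have hp : 0 < l ^ γ := by positivity
    have hp2 : 0 < (l * t) ^ (-μ) := by positivity
    calc _ = l ^ γ * Real.exp (-2 * l) * Real.exp (l * ⟪x, dir y⟫) * besselNegDeriv μ (l * t) := by
          rw [← e1]; ring
      _ ≤ l ^ γ * Real.exp (-2 * l) * Real.exp (l * ⟪x, dir y⟫) *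
          (C₀ * Real.exp (-(l * t)) * ((l * t) ^ (-(μ / 2)) +
            (l * t) ^ (-μ) * Real.exp (-(l * t)))) := by gcongr
      _ = C₀ * (l ^ γ * (l * t) ^ (-(μ / 2))) *
            (Real.exp (-2 * l) * Real.exp (-(l * t)) * Real.exp (l * ⟪x, dir y⟫)) +
          C₀ * (l ^ γ * (l * t) ^ (-μ)) * Real.exp (-(l * t)) *
            (Real.exp (-2 * l) * Real.exp (-(l * t)) * Real.exp (l * ⟪x, dir y⟫)) := by ring
      _ ≤ C₀ * (l ^ γ * (l * t) ^ (-(μ / 2))) * Real.exp (-l * (2 + t) + l * ⟪x, dir y⟫) +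
          C₀ * (l ^ γ * (l * t) ^ (-μ)) * Real.exp (-(l * t)) * 1 := by
          rw [e3]
          gcongr
      _ = _ := by
          rw [e2, show -t * l = -(l * t) by ring]; ring
  have hmd := measurable_dir (n := n)
  -- The main term: the angular integral is carried out first.
  have hA : ∫⁻ y in Metric.ball (0 : Space n) 1, ∫⁻ l in Ioi (0 : ℝ), ENNReal.ofReal
      (C₀ * (l ^ γ * (l * t) ^ (-(μ / 2))) * Real.exp (-l * (2 + t) + l * ⟪x, dir y⟫)) ≤
      ENNReal.ofReal (C₀ * C₁ * t ^ (-N) * (Real.Gamma (-a) * (D / 2) ^ (- -a))) := by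
    rw [lintegral_lintegral_swap (by fun_prop), ← lintegral_rpow_mul_exp (by linarith)
      (by positivity) (by positivity)]
    refine lintegral_mono_ae ((ae_restrict_iff' measurableSet_Ioi).2 (ae_of_all _ fun l hl => ?_))
    have hl0 : (0 : ℝ) < l := hl
    have hlt : 0 < l * t := by positivity
    have hc : 0 ≤ C₀ * (l ^ γ * (l * t) ^ (-(μ / 2))) := by positivity
    simp only [ENNReal.ofReal_mul hc]
    rw [lintegral_const_mul _ (by fun_prop)]
    refine (mul_le_mul_right (h₁ t x l ht hx hl0) _).trans ?_
    rw [← ENNReal.ofReal_mul hc]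
    apply ENNReal.ofReal_le_ofReal
    apply le_of_eq
    have e : l ^ (-a - 1) * t ^ (-N) = l ^ γ * (l * t) ^ (-(μ / 2)) *
        (l * t) ^ (-(((n : ℝ) - 1) / 2)) := by
      rw [mul_assoc, ← Real.rpow_add hlt, Real.mul_rpow hl0.le ht0.le, ← mul_assoc,
        ← Real.rpow_add hl0]
      congr 2
      · rw [hγ, hN]; ring
      · rw [hN]; ring
    calc C₀ * (l ^ γ * (l * t) ^ (-(μ / 2))) * (C₁ * ((l * t) ^ (-(((n : ℝ) - 1) / 2)) *
          Real.exp (-((2 + t - ‖x‖) / 2) * l)))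
        = C₀ * C₁ * (l ^ γ * (l * t) ^ (-(μ / 2)) * (l * t) ^ (-(((n : ℝ) - 1) / 2))) *
          Real.exp (-(D / 2) * l) := by rw [hD]; ring
      _ = _ := by rw [← e]; ring
  -- The term from small arguments decays like `t^{-γ-1} = t^{-N} t^a`, which is enough because `D ≤
  -- 3t`.
  have hB : ∫⁻ y in Metric.ball (0 : Space n) 1, ∫⁻ l in Ioi (0 : ℝ), ENNReal.ofReal
      (C₀ * t ^ (-μ) * (l ^ (γ + 1 - μ - 1) * Real.exp (-t * l))) =
      ENNReal.ofReal (C₀ * t ^ (-μ) * (Real.Gamma (γ + 1 - μ) * t ^ (-(γ + 1 - μ))) * v) := by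
    rw [lintegral_rpow_mul_exp (by linarith) ht0 (by positivity), lintegral_const,
      ENNReal.ofReal_mul (q := v) (by positivity), hv, Measure.restrict_apply_univ,
      measureReal_def, ENNReal.ofReal_toReal measure_ball_lt_top.ne]
  calc kernelNegDeriv μ γ t x
      ≤ ∫⁻ y in Metric.ball (0 : Space n) 1, ∫⁻ l in Ioi (0 : ℝ), (ENNReal.ofReal
        (C₀ * (l ^ γ * (l * t) ^ (-(μ / 2))) * Real.exp (-l * (2 + t) + l * ⟪x, dir y⟫)) +
        ENNReal.ofReal (C₀ * t ^ (-μ) * (l ^ (γ + 1 - μ - 1) * Real.exp (-t * l)))) := by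
        refine lintegral_mono fun y => lintegral_mono_ae
          ((ae_restrict_iff' measurableSet_Ioi).2 (ae_of_all _ fun l hl => ?_))
        exact (ENNReal.ofReal_le_ofReal (hpt y l hl)).trans ENNReal.ofReal_add_le
    _ = _ + _ := by
        rw [← lintegral_add_left]
        · refine lintegral_congr fun y => ?_
          rw [lintegral_add_left (by fun_prop)]
        · apply Measurable.lintegral_prod_right'
            (f := fun z : Space n × ℝ => ENNReal.ofReal (C₀ * (z.2 ^ γ * (z.2 * t) ^ (-(μ / 2))) *
              Real.exp (-z.2 * (2 + t) + z.2 * ⟪x, dir z.1⟫)))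
          fun_prop
    _ ≤ ENNReal.ofReal (C₀ * C₁ * t ^ (-N) * (Real.Gamma (-a) * (D / 2) ^ (- -a))) +
        ENNReal.ofReal (C₀ * t ^ (-μ) * (Real.Gamma (γ + 1 - μ) * t ^ (-(γ + 1 - μ))) * v) := by
        gcongr
        exact hB.le
    _ ≤ _ := by
        rw [← ENNReal.ofReal_add (by positivity) (by positivity)]
        apply ENNReal.ofReal_le_ofReal
        rw [neg_neg, show D / 2 = 1 / 2 * D by ring, Real.mul_rpow (by norm_num) (by linarith)]
        have e : t ^ (-μ) * t ^ (-(γ + 1 - μ)) = t ^ (-N) * t ^ a := by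
          rw [← Real.rpow_add ht0, ← Real.rpow_add ht0]; congr 1; rw [hγ]; ring
        have e2 : t ^ a ≤ (1 / 3) ^ a * D ^ a := by
          rw [← Real.mul_rpow (by norm_num) (by linarith)]
          exact Real.rpow_le_rpow_of_nonpos (by positivity) (by linarith) ha.le
        calc _ = C₀ * C₁ * Real.Gamma (-a) * (1 / 2) ^ a * (t ^ (-N) * D ^ a) +
              C₀ * v * Real.Gamma (γ + 1 - μ) * (t ^ (-μ) * t ^ (-(γ + 1 - μ))) := by ring
          _ ≤ C₀ * C₁ * Real.Gamma (-a) * (1 / 2) ^ a * (t ^ (-N) * D ^ a) +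
              C₀ * v * Real.Gamma (γ + 1 - μ) * (t ^ (-N) * ((1 / 3) ^ a * D ^ a)) := by
              rw [e]; gcongr
          _ = _ := by ring

end EPD

/-! ### Upper and lower bounds for the superposed solutions -/

namespace EPD

lemma bessel_anti {μ s t : ℝ} (hμ : 0 < μ) (hs : 0 < s) (hst : s ≤ t) :
    bessel μ t ≤ bessel μ s := by
  refine integral_mono_ae (integrable_exp_besselMeasure hμ (hs.trans_le hst))
    (integrable_exp_besselMeasure hμ hs) ?_
  filter_upwards [ae_one_lt_besselMeasure μ] with z hz
  rw [Real.exp_le_exp]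
  nlinarith

lemma tendsto_bessel_atTop {μ : ℝ} (hμ : 0 < μ) : Tendsto (bessel μ) atTop (𝓝 0) := by
  obtain ⟨C, hC, h⟩ := besselNegDeriv_upper hμ
  have h0 : Tendsto (fun t : ℝ => 2 * C * Real.exp (-t)) atTop (𝓝 0) := by
    simpa using (Real.tendsto_exp_neg_atTop_nhds_zero).const_mul (2 * C)
  refine squeeze_zero' ?_ ?_ h0
  · filter_upwards [eventually_gt_atTop 0] with t ht using (bessel_pos hμ ht).le
  · filter_upwards [eventually_ge_atTop 1] with t ht
    have ht0 : 0 < t := by linarith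
    refine (bessel_le_besselNegDeriv hμ ht0).trans ((h t ht0).trans ?_)
    have h1 : t ^ (-(μ / 2)) ≤ 1 := Real.rpow_le_one_of_one_le_of_nonpos ht (by linarith)
    have h2 : t ^ (-μ) ≤ 1 := Real.rpow_le_one_of_one_le_of_nonpos ht (by linarith)
    have := Real.exp_pos (-t)
    have : 0 < C * Real.exp (-t) := by positivity
    nlinarith

lemma hasDerivAt_bessel_comp_mul {μ l s : ℝ} (hμ : 0 < μ) (hl : 0 < l) (hs : 0 < s) :
    HasDerivAt (fun s => bessel μ (l * s)) (-(l * besselNegDeriv μ (l * s))) s := by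
  have h := (hasDerivAt_bessel hμ (mul_pos hl hs)).comp s ((hasDerivAt_id s).const_mul l)
  refine HasDerivAt.congr_deriv (f := fun s => bessel μ (l * s)) h ?_
  simp [mul_comm]

lemma ofReal_bessel_eq_lintegral {μ l t : ℝ} (hμ : 0 < μ) (hl : 0 < l) (ht : 0 < t) :
    ENNReal.ofReal (bessel μ (l * t)) =
      ∫⁻ s in Ioi t, ENNReal.ofReal (l * besselNegDeriv μ (l * s)) := by
  have hd : ∀ s ∈ Ioi t, HasDerivAt (fun s => bessel μ (l * s))
      (-(l * besselNegDeriv μ (l * s))) s := fun s hs =>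
    hasDerivAt_bessel_comp_mul hμ hl (ht.trans hs)
  have hc : ContinuousWithinAt (fun s => bessel μ (l * s)) (Ici t) t :=
    (hasDerivAt_bessel_comp_mul hμ hl ht).continuousAt.continuousWithinAt
  have hneg : ∀ s ∈ Ioi t, -(l * besselNegDeriv μ (l * s)) ≤ 0 := fun s hs => by
    have := besselNegDeriv_pos hμ (mul_pos hl (ht.trans hs))
    have := mul_pos hl this
    linarith
  have hlim : Tendsto (fun s => bessel μ (l * s)) atTop (𝓝 0) :=
    (tendsto_bessel_atTop hμ).comp (tendsto_id.const_mul_atTop hl)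
  have hi := integrableOn_Ioi_deriv_of_nonpos hc hd hneg hlim
  have he := integral_Ioi_of_hasDerivAt_of_nonpos hc hd hneg hlim
  rw [← ofReal_integral_eq_lintegral_ofReal]
  · rw [integral_neg] at he
    congr 1; linarith
  · simpa using! hi.neg
  · refine (ae_restrict_iff' measurableSet_Ioi).2 (ae_of_all _ fun s hs => ?_)
    have := hneg s hs
    simp only [Pi.zero_apply]; linarith

/-- Each `b(lt)` tends to `0` at infinity, so the kernel is recovered from its time derivative; no
separate upper bound for `b` is needed. -/
lemma kernel_eq_lintegral {n : ℕ} {μ γ t : ℝ} (hμ : 0 < μ) (ht : 0 < t) (x : Space n) :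
    kernel μ γ t x = ∫⁻ s in Ioi t, kernelNegDeriv μ γ s x := by
  have hmd := measurable_dir (n := n)
  have hmb := measurable_besselNegDeriv μ
  unfold kernel kernelNegDeriv
  rw [lintegral_lintegral_swap (μ := volume.restrict (Ioi t))]
  swap
  · refine (Measurable.lintegral_prod_right' (f := fun z : (ℝ × Space n) × ℝ =>
      ENNReal.ofReal (z.2 ^ (γ - 1) * Real.exp (-2 * z.2) * (z.2 * besselNegDeriv μ (z.2 * z.1.1))
      * Real.exp (z.2 * ⟪x, dir z.1.2⟫))) ?_).aemeasurable
    fun_prop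
  refine lintegral_congr fun y => ?_
  rw [lintegral_lintegral_swap (μ := volume.restrict (Ioi t)) (by fun_prop)]
  refine setLIntegral_congr_fun measurableSet_Ioi fun l hl => ?_
  have hl0 : (0 : ℝ) < l := hl
  have hc : 0 ≤ l ^ (γ - 1) * Real.exp (-2 * l) * Real.exp (l * ⟪x, dir y⟫) := by positivity
  have e1 : ∀ B : ℝ, l ^ (γ - 1) * Real.exp (-2 * l) * B * Real.exp (l * ⟪x, dir y⟫) =
      l ^ (γ - 1) * Real.exp (-2 * l) * Real.exp (l * ⟪x, dir y⟫) * B := fun B => by ring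
  simp only [e1, ENNReal.ofReal_mul hc]
  rw [lintegral_const_mul _ (by fun_prop), ofReal_bessel_eq_lintegral hμ hl0 ht]

/-- Split at `s = 2t`: before it only `(s - t)^a` varies essentially and `a > -1` gives
integrability, after it the integrand is comparable to `s^{a-N}`. -/
lemma lintegral_rpow_mul_sub_rpow_le {N a t : ℝ} (ha : -1 < a) (ha0 : a < 0) (hN : 0 < N)
    (hNa : 1 < N - a) (ht : 0 < t) :
    ∫⁻ s in Ioi t, ENNReal.ofReal (s ^ (-N) * (s - t) ^ a) ≤
      ENNReal.ofReal ((1 / (a + 1) + 2 / (N - a - 1)) * t ^ (1 - N + a)) := by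
  have hsplit : Ioi t = Ioc t (2 * t) ∪ Ioi (2 * t) := (Ioc_union_Ioi_eq_Ioi (by linarith)).symm
  rw [hsplit, add_mul, ENNReal.ofReal_add]
  rotate_left
  · have : 0 < a + 1 := by linarith
    positivity
  · have : 0 < N - a - 1 := by linarith
    positivity
  refine (lintegral_union_le _ _ _).trans (add_le_add ?_ ?_)
  · have hi : IntervalIntegrable (fun s : ℝ => s ^ a) volume 0 t :=
      intervalIntegral.intervalIntegrable_rpow' ha
    have hi2 : IntegrableOn (fun s : ℝ => (s - t) ^ a) (Ioc t (2 * t)) := by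
      have := hi.comp_sub_right t
      rw [intervalIntegrable_iff_integrableOn_Ioc_of_le (by linarith)] at this
      simpa [two_mul] using! this
    have hv : ∫ s in Ioc t (2 * t), (s - t) ^ a = t ^ (a + 1) / (a + 1) := by
      rw [← intervalIntegral.integral_of_le (by linarith),
        intervalIntegral.integral_comp_sub_right (fun s => s ^ a), integral_rpow (Or.inl ha)]
      rw [sub_self, Real.zero_rpow (by linarith), sub_zero, show 2 * t - t = t by ring]
    calc _ ≤ ∫⁻ s in Ioc t (2 * t), ENNReal.ofReal (t ^ (-N) * (s - t) ^ a) := by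
          refine setLIntegral_mono' measurableSet_Ioc fun s hs => ENNReal.ofReal_le_ofReal ?_
          have h1 : 0 ≤ (s - t) ^ a := Real.rpow_nonneg (by linarith [hs.1]) _
          have h2 : s ^ (-N) ≤ t ^ (-N) :=
            Real.rpow_le_rpow_of_nonpos ht hs.1.le (by linarith)
          gcongr
      _ = ENNReal.ofReal (t ^ (-N) * (t ^ (a + 1) / (a + 1))) := by
          rw [← ofReal_integral_eq_lintegral_ofReal (hi2.const_mul _)
            ((ae_restrict_iff' measurableSet_Ioc).2 (ae_of_all _ fun s hs => ?_)),
            integral_const_mul, hv]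
          have : 0 ≤ (s - t) ^ a := Real.rpow_nonneg (by linarith [hs.1]) _
          simp only [Pi.zero_apply]; positivity
      _ ≤ _ := by
          apply ENNReal.ofReal_le_ofReal
          apply le_of_eq
          have e := Real.rpow_add ht (-N) (a + 1)
          rw [show 1 - N + a = -N + (a + 1) by ring, e]
          ring
  · have hlt : a - N < -1 := by linarith
    have h2t : 0 < 2 * t := by linarith
    calc _ ≤ ∫⁻ s in Ioi (2 * t), ENNReal.ofReal ((1 / 2) ^ a * s ^ (a - N)) := by
          refine setLIntegral_mono' measurableSet_Ioi fun s hs => ENNReal.ofReal_le_ofReal ?_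
          have hs' : 2 * t < s := hs
          have hs0 : 0 < s := by linarith
          have h1 : (s - t) ^ a ≤ (1 / 2 * s) ^ a :=
            Real.rpow_le_rpow_of_nonpos (by positivity) (by linarith) ha0.le
          rw [Real.mul_rpow (by norm_num) hs0.le] at h1
          calc s ^ (-N) * (s - t) ^ a ≤ s ^ (-N) * ((1 / 2) ^ a * s ^ a) := by gcongr
            _ = _ := by
              rw [show a - N = -N + a by ring, Real.rpow_add hs0]; ring
      _ = ENNReal.ofReal ((1 / 2) ^ a * (-(2 * t) ^ (a - N + 1) / (a - N + 1))) := by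
          rw [← ofReal_integral_eq_lintegral_ofReal
            ((integrableOn_Ioi_rpow_of_lt hlt h2t).const_mul _)
            ((ae_restrict_iff' measurableSet_Ioi).2 (ae_of_all _ fun s hs => ?_)),
            integral_const_mul, integral_Ioi_rpow_of_lt hlt h2t]
          have : 0 < s := h2t.trans hs
          simp only [Pi.zero_apply]; positivity
      _ ≤ _ := by
          apply ENNReal.ofReal_le_ofReal
          have hpos : 0 < N - a - 1 := by linarith
          have e1 : -(2 * t) ^ (a - N + 1) / (a - N + 1) = (2 * t) ^ (a - N + 1) / (N - a - 1) := by
            rw [show a - N + 1 = -(N - a - 1) by ring, neg_div_neg_eq]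
          have e2 : (1 / 2 : ℝ) ^ a * 2 ^ (a - N + 1) ≤ 2 := by
            rw [one_div, Real.inv_rpow (by norm_num), ← Real.rpow_neg (by norm_num),
              ← Real.rpow_add (by norm_num)]
            calc (2 : ℝ) ^ (-a + (a - N + 1)) ≤ 2 ^ (1 : ℝ) :=
                  Real.rpow_le_rpow_of_exponent_le (by norm_num) (by linarith)
              _ = 2 := Real.rpow_one 2
          rw [e1, Real.mul_rpow (by norm_num) ht.le]
          calc _ = ((1 / 2 : ℝ) ^ a * 2 ^ (a - N + 1)) * (t ^ (a - N + 1) / (N - a - 1)) := by ring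
            _ ≤ 2 * (t ^ (a - N + 1) / (N - a - 1)) := by gcongr
            _ = _ := by rw [show 1 - N + a = a - N + 1 by ring]; ring

/-- The bound for the derivative is integrated over `s > t`, where `2 + s - ‖x‖ ≥ s - t`. The loss
compared with the derivative is exactly one factor `t`, which the additional `1/R` in the tested
equation compensates. -/
lemma kernel_le {n : ℕ} (hn : 1 ≤ n) {μ γ N a : ℝ} (hμ : 0 < μ)
    (hN : N = ((n : ℝ) - 1 + μ) / 2) (hγ : γ = N - 1 - a) (ha1 : -1 < a) (ha : a < 0)
    (hγμ : μ - 1 < γ) (hγ0 : 0 < γ) :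
    ∃ C : ℝ, 0 < C ∧ ∀ (t : ℝ) (x : Space n), 1 ≤ t → ‖x‖ ≤ t + 1 →
      kernel μ γ t x ≤ ENNReal.ofReal (C * (t * (t ^ (-N) * (2 + t - ‖x‖) ^ a))) := by
  obtain ⟨C, hC, h⟩ := kernelNegDeriv_le hn hμ hN hγ ha hγμ
  have hn' : (1 : ℝ) ≤ n := by exact_mod_cast hn
  have hN0 : 0 < N := by rw [hN]; linarith
  have hd1 : 0 < a + 1 := by linarith
  have hd2 : 0 < N - a - 1 := by linarith
  refine ⟨C * (1 / (a + 1) + 2 / (N - a - 1)) * (1 / 3) ^ a, by positivity, fun t x ht hx => ?_⟩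
  have ht0 : 0 < t := by linarith
  have hD3 : 2 + t - ‖x‖ ≤ 3 * t := by have := norm_nonneg x; linarith
  have hD1 : 1 ≤ 2 + t - ‖x‖ := by linarith
  rw [kernel_eq_lintegral hμ ht0]
  calc ∫⁻ s in Ioi t, kernelNegDeriv μ γ s x
      ≤ ∫⁻ s in Ioi t, ENNReal.ofReal C * ENNReal.ofReal (s ^ (-N) * (s - t) ^ a) := by
        refine setLIntegral_mono' measurableSet_Ioi fun s hs => ?_
        have hs' : t < s := hs
        refine (h s x (by linarith) (by linarith)).trans ?_
        rw [← ENNReal.ofReal_mul hC.le]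
        apply ENNReal.ofReal_le_ofReal
        have h1 : (2 + s - ‖x‖) ^ a ≤ (s - t) ^ a :=
          Real.rpow_le_rpow_of_nonpos (by linarith) (by linarith) ha.le
        have : 0 < s := by linarith
        gcongr
    _ ≤ ENNReal.ofReal C *
        ENNReal.ofReal ((1 / (a + 1) + 2 / (N - a - 1)) * t ^ (1 - N + a)) := by
        rw [lintegral_const_mul _ (by fun_prop)]
        gcongr
        exact lintegral_rpow_mul_sub_rpow_le ha1 ha hN0 (by linarith) ht0
    _ ≤ _ := by
        rw [← ENNReal.ofReal_mul hC.le]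
        apply ENNReal.ofReal_le_ofReal
        have e : t ^ (1 - N + a) = t * (t ^ (-N) * t ^ a) := by
          rw [← Real.rpow_add ht0, show 1 - N + a = (-N + a) + 1 by ring,
            Real.rpow_add_one ht0.ne']; ring
        have e2 : t ^ a ≤ (1 / 3) ^ a * (2 + t - ‖x‖) ^ a := by
          rw [← Real.mul_rpow (by norm_num) (by linarith)]
          exact Real.rpow_le_rpow_of_nonpos (by positivity) (by linarith) ha.le
        rw [e]
        calc _ ≤ C * ((1 / (a + 1) + 2 / (N - a - 1)) *
              (t * (t ^ (-N) * ((1 / 3) ^ a * (2 + t - ‖x‖) ^ a)))) := by gcongr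
          _ = _ := by ring

/-- Only frequencies `l` between `1/(2t)` and `1/t` are kept. There `b(lt)` and the exponentials are
bounded below, and the weight `l^{γ-1}` integrates to a multiple of `t^{-γ}`. -/
lemma kernel_lower {n : ℕ} {μ : ℝ} (hμ : 0 < μ) (γ : ℝ) :
    ∃ c : ℝ, 0 < c ∧ ∀ (t : ℝ) (x : Space n), 1 ≤ t → ‖x‖ ≤ t + 1 →
      ENNReal.ofReal (c * t ^ (-γ)) ≤ kernel μ γ t x := by
  set v := volume.real (Metric.ball (0 : Space n) 1) with hv
  have hv0 : 0 < v := by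
    rw [hv, measureReal_def]
    exact ENNReal.toReal_pos (Metric.measure_ball_pos _ _ one_pos).ne' measure_ball_lt_top.ne
  have hb1 := bessel_pos hμ one_pos
  set m : ℝ := min 1 ((1 / 2) ^ (γ - 1)) with hm
  have hm0 : 0 < m := by positivity
  refine ⟨m * Real.exp (-2) * bessel μ 1 * Real.exp (-2) * (1 / 2) * v, by positivity,
    fun t x ht hx => ?_⟩
  have ht0 : 0 < t := by linarith
  have hpt : ∀ (y : Space n), ∀ l ∈ Ioc (1 / (2 * t)) (1 / t),
      m * t ^ (1 - γ) * Real.exp (-2) * bessel μ 1 * Real.exp (-2) ≤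
      l ^ (γ - 1) * Real.exp (-2 * l) * bessel μ (l * t) * Real.exp (l * ⟪x, dir y⟫) := by
    intro y l hl
    have hl0 : 0 < l := lt_trans (by positivity) hl.1
    have hlt1 : l * t ≤ 1 := by
      have := mul_le_mul_of_nonneg_right hl.2 ht0.le
      rwa [one_div_mul_cancel ht0.ne'] at this
    have hlt2 : 1 / 2 ≤ l * t := by
      have := mul_le_mul_of_nonneg_right hl.1.le ht0.le
      calc (1 / 2 : ℝ) = 1 / (2 * t) * t := by field_simp
        _ ≤ _ := this
    have hl1 : l ≤ 1 := by nlinarith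
    have e1 : m * t ^ (1 - γ) ≤ l ^ (γ - 1) := by
      have h1 : m ≤ (l * t) ^ (γ - 1) := by
        rcases le_total 0 (γ - 1) with h | h
        · exact (min_le_right _ _).trans (Real.rpow_le_rpow (by norm_num) hlt2 h)
        · exact (min_le_left _ _).trans
            (Real.one_le_rpow_of_pos_of_le_one_of_nonpos (by positivity) hlt1 h)
      rw [Real.mul_rpow hl0.le ht0.le] at h1
      calc m * t ^ (1 - γ) ≤ l ^ (γ - 1) * t ^ (γ - 1) * t ^ (1 - γ) := by gcongr
        _ = l ^ (γ - 1) := by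
          rw [mul_assoc, ← Real.rpow_add ht0]; simp
    have e2 : Real.exp (-2) ≤ Real.exp (-2 * l) := by rw [Real.exp_le_exp]; linarith
    have e3 : bessel μ 1 ≤ bessel μ (l * t) := bessel_anti hμ (by positivity) hlt1
    have e4 : Real.exp (-2) ≤ Real.exp (l * ⟪x, dir y⟫) := by
      have := inner_dir_ge x y
      rw [Real.exp_le_exp]; nlinarith
    have := bessel_pos hμ (mul_pos hl0 ht0)
    gcongr
  calc ENNReal.ofReal (m * Real.exp (-2) * bessel μ 1 * Real.exp (-2) * (1 / 2) * v * t ^ (-γ))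
      = ∫⁻ y in Metric.ball (0 : Space n) 1, ∫⁻ l in Ioc (1 / (2 * t)) (1 / t),
        ENNReal.ofReal (m * t ^ (1 - γ) * Real.exp (-2) * bessel μ 1 * Real.exp (-2)) := by
        simp only [lintegral_const, Measure.restrict_apply_univ, Real.volume_Ioc]
        rw [← ENNReal.ofReal_mul (by positivity)]
        have hvv : volume (Metric.ball (0 : Space n) 1) = ENNReal.ofReal v := by
          rw [hv, measureReal_def, ENNReal.ofReal_toReal measure_ball_lt_top.ne]
        rw [hvv, ← ENNReal.ofReal_mul]
        · congr 1
          rw [show 1 - γ = -γ + 1 by ring, Real.rpow_add_one ht0.ne']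
          field_simp
          ring
        · have : 0 ≤ 1 / t - 1 / (2 * t) := by
            have : 1 / t - 1 / (2 * t) = 1 / (2 * t) := by field_simp; ring
            rw [this]; positivity
          positivity
    _ ≤ kernel μ γ t x := by
        refine lintegral_mono fun y => ?_
        refine (setLIntegral_mono' measurableSet_Ioc
          fun l hl => ENNReal.ofReal_le_ofReal (hpt y l hl)).trans ?_
        exact lintegral_mono_set fun l hl => lt_trans (by positivity) hl.1

end EPD

namespace EPD

/-! ### The time-integrated form of the equation -/

/-- An energy solution together with its curves `U`, `V`, `G` in `L²`; the initial value is
`U 0`. -/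
structure EnergyCurves {n : ℕ} (μ α p T : ℝ) (u : ℝ → Space n → ℝ)
    (U V : ℝ → Lp ℝ 2 (volume : Measure (Space n)))
    (G : ℝ → Lp (Space n) 2 (volume : Measure (Space n))) : Prop where
  pos : 0 < T
  meas : AEStronglyMeasurable (Function.uncurry u) (volume.restrict (Ioo 0 T ×ˢ univ))
  ae_eq : ∀ t ∈ Ico 0 T, u t =ᵐ[volume] U t
  grad : ∀ t ∈ Ico 0 T, HasWeakGradient (U t) (G t)
  contU : ContinuousOn U (Ico 0 T)
  contG : ContinuousOn G (Ico 0 T)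
  hasDeriv : ∀ t ∈ Ico 0 T, HasDerivWithinAt U (V t) (Ico 0 T) t
  contV : ContinuousOn V (Ico 0 T)
  V_zero : V 0 = 0
  weak : WeakForm μ α p T u (fun t => V t) (fun t => G t)

lemma integral_mul_eq_inner {n : ℕ} (f : Lp ℝ 2 (volume : Measure (Space n))) {w : Space n → ℝ}
    (hw : MemLp w 2 volume) : ∫ x, f x * w x = ⟪hw.toLp w, f⟫ := by
  rw [L2.inner_def]
  refine integral_congr_ae ?_
  filter_upwards [hw.coeFn_toLp] with x hx
  simp [hx]

lemma integral_inner_eq_inner {n : ℕ} (f : Lp (Space n) 2 (volume : Measure (Space n)))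
    {w : Space n → Space n} (hw : MemLp w 2 volume) :
    ∫ x, ⟪f x, w x⟫ = ⟪f, hw.toLp w⟫ := by
  rw [L2.inner_def]
  refine integral_congr_ae ?_
  filter_upwards [hw.coeFn_toLp] with x hx
  rw [hx]

lemma memLp_of_contDiff {n : ℕ} {w : Space n → ℝ} (hw : ContDiff ℝ ∞ w)
    (hc : HasCompactSupport w) : MemLp w 2 volume :=
  hw.continuous.memLp_of_hasCompactSupport hc

lemma continuous_gradient {n : ℕ} {w : Space n → ℝ} (hw : ContDiff ℝ ∞ w) :
    Continuous (∇ w) := by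
  have h : Continuous (fderiv ℝ w) := hw.continuous_fderiv (by simp)
  exact (InnerProductSpace.toDual ℝ (Space n)).symm.continuous.comp h

lemma hasCompactSupport_gradient {n : ℕ} {w : Space n → ℝ} (hc : HasCompactSupport w) :
    HasCompactSupport (∇ w) :=
  (hc.fderiv (𝕜 := ℝ)).comp_left (g := (InnerProductSpace.toDual ℝ (Space n)).symm) (map_zero _)

lemma memLp_gradient {n : ℕ} {w : Space n → ℝ} (hw : ContDiff ℝ ∞ w)
    (hc : HasCompactSupport w) : MemLp (∇ w) 2 volume :=
  (continuous_gradient hw).memLp_of_hasCompactSupport (hasCompactSupport_gradient hc)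

lemma gradient_const_mul {n : ℕ} {w : Space n → ℝ} (hw : ContDiff ℝ ∞ w) (c : ℝ) (x : Space n) :
    ∇ (fun y => c * w y) x = c • ∇ w x := by
  have hd : DifferentiableAt ℝ w x := (hw.differentiable (by simp)) x
  have := (hd.hasGradientAt.hasFDerivAt).const_mul c
  apply HasGradientAt.gradient
  rw [hasGradientAt_iff_hasFDerivAt, map_smul]
  exact this

lemma isTest_mul {n : ℕ} {T : ℝ} {Θ : ℝ → ℝ} (hΘ : ContDiff ℝ ∞ Θ) (hΘc : HasCompactSupport Θ)
    (hΘT : tsupport Θ ⊆ Iio T) {w : Space n → ℝ} (hw : ContDiff ℝ ∞ w)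
    (hc : HasCompactSupport w) : IsTest T (fun z : ℝ × Space n => Θ z.1 * w z.2) := by
  have hsub : tsupport (fun z : ℝ × Space n => Θ z.1 * w z.2) ⊆ tsupport Θ ×ˢ tsupport w := by
    refine closure_minimal ?_ ((isClosed_tsupport _).prod (isClosed_tsupport _))
    rintro ⟨s, x⟩ h
    simp only [Function.mem_support, ne_eq, mul_eq_zero, not_or] at h
    exact ⟨subset_tsupport _ h.1, subset_tsupport _ h.2⟩
  refine ⟨(hΘ.comp contDiff_fst).mul (hw.comp contDiff_snd), ?_, ?_⟩
  · exact (hΘc.prod hc).of_isClosed_subset (isClosed_tsupport _) hsub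
  · exact hsub.trans (prod_mono hΘT (subset_univ _))

/-- The weak form provides integrability against test functions on space-time; here one is used
whose time factor equals `1` on `[0, t]`, which is possible since test functions need not vanish at
`0`. -/
lemma EnergyCurves.integrable_nonlin {n : ℕ} {μ α p T : ℝ} {u : ℝ → Space n → ℝ}
    {U V : ℝ → Lp ℝ 2 (volume : Measure (Space n))}
    {G : ℝ → Lp (Space n) 2 (volume : Measure (Space n))} (h : EnergyCurves μ α p T u U V G)
    {w : Space n → ℝ} (hw : ContDiff ℝ ∞ w) (hc : HasCompactSupport w) {t : ℝ} (ht : t < T) :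
    IntegrableOn (fun z : ℝ × Space n => z.1 ^ α * |u z.1 z.2| ^ p * w z.2) (Ioc 0 t ×ˢ univ) := by
  rcases le_or_gt t 0 with h0 | h0
  · simp [Ioc_eq_empty (not_lt.2 h0)]
  set δ := (T - t) / 2 with hδ
  have hδ0 : 0 < δ := by rw [hδ]; linarith
  set Θ : ℝ → ℝ := fun s => Real.smoothTransition (s + 1) *
    (1 - Real.smoothTransition ((s - t) / δ)) with hΘ
  have hsm : ContDiff ℝ ∞ Θ := by
    refine (Real.smoothTransition.contDiff.comp (by fun_prop)).mul
      (contDiff_const.sub (Real.smoothTransition.contDiff.comp (by fun_prop)))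
  have hsupp : tsupport Θ ⊆ Icc (-1) (t + δ) := by
    refine closure_minimal ?_ isClosed_Icc
    intro s hs
    by_contra hcon
    rw [mem_Icc, not_and_or, not_le, not_le] at hcon
    apply hs
    rcases hcon with h1 | h1
    · simp [hΘ, Real.smoothTransition.zero_of_nonpos (show s + 1 ≤ 0 by linarith)]
    · have : 1 ≤ (s - t) / δ := by rw [le_div_iff₀ hδ0]; linarith
      simp [hΘ, Real.smoothTransition.one_of_one_le this]
  have htest := isTest_mul (T := T) hsm
    (isCompact_Icc.of_isClosed_subset (isClosed_tsupport _) hsupp)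
    (hsupp.trans fun s hs => by
      have := hs.2; rw [mem_Iio]; linarith) hw hc
  have hi := (h.weak _ htest).2.1
  have hi2 := hi.mono_set (prod_mono (Ioc_subset_Ioo_right ht : Ioc 0 t ⊆ Ioo 0 T)
    (subset_univ (univ : Set (Space n))))
  refine hi2.congr_fun (fun z hz => ?_) (measurableSet_Ioc.prod MeasurableSet.univ)
  have hz1 : z.1 ∈ Ioc 0 t := hz.1
  have e1 : Real.smoothTransition (z.1 + 1) = 1 :=
    Real.smoothTransition.one_of_one_le (by linarith [hz1.1])
  have e2 : Real.smoothTransition ((z.1 - t) / δ) = 0 :=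
    Real.smoothTransition.zero_of_nonpos (div_nonpos_of_nonpos_of_nonneg (by linarith [hz1.2]) hδ0.le)
  simp only [hΘ, e1, e2]; ring

/-- The nonlinearity at time `s`, tested with `w`. -/
noncomputable def nonlin {n : ℕ} (α p : ℝ) (u : ℝ → Space n → ℝ) (w : Space n → ℝ) (s : ℝ) : ℝ :=
  ∫ x, s ^ α * |u s x| ^ p * w x

lemma EnergyCurves.integrableOn_nonlin {n : ℕ} {μ α p T : ℝ} {u : ℝ → Space n → ℝ}
    {U V : ℝ → Lp ℝ 2 (volume : Measure (Space n))}
    {G : ℝ → Lp (Space n) 2 (volume : Measure (Space n))} (h : EnergyCurves μ α p T u U V G)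
    {w : Space n → ℝ} (hw : ContDiff ℝ ∞ w) (hc : HasCompactSupport w) {t : ℝ} (ht : t < T) :
    IntegrableOn (nonlin α p u w) (Ioc 0 t) := by
  have hi := h.integrable_nonlin hw hc ht
  rw [IntegrableOn, Measure.volume_eq_prod, ← Measure.prod_restrict, Measure.restrict_univ] at hi
  exact hi.integral_prod_left

lemma EnergyCurves.continuousOn_pairV {n : ℕ} {μ α p T : ℝ} {u : ℝ → Space n → ℝ}
    {U V : ℝ → Lp ℝ 2 (volume : Measure (Space n))}
    {G : ℝ → Lp (Space n) 2 (volume : Measure (Space n))} (h : EnergyCurves μ α p T u U V G)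
    {w : Space n → ℝ} (hw : MemLp w 2 volume) :
    ContinuousOn (fun t => ∫ x, V t x * w x) (Ico 0 T) := by
  simp only [integral_mul_eq_inner _ hw]
  exact continuousOn_const.inner h.contV

lemma EnergyCurves.continuousOn_pairG {n : ℕ} {μ α p T : ℝ} {u : ℝ → Space n → ℝ}
    {U V : ℝ → Lp ℝ 2 (volume : Measure (Space n))}
    {G : ℝ → Lp (Space n) 2 (volume : Measure (Space n))} (h : EnergyCurves μ α p T u U V G)
    {w : Space n → Space n} (hw : MemLp w 2 volume) :
    ContinuousOn (fun t => ∫ x, ⟪G t x, w x⟫) (Ico 0 T) := by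
  simp only [integral_inner_eq_inner _ hw]
  exact h.contG.inner continuousOn_const

lemma EnergyCurves.hasDerivWithinAt_pair {n : ℕ} {μ α p T : ℝ} {u : ℝ → Space n → ℝ}
    {U V : ℝ → Lp ℝ 2 (volume : Measure (Space n))}
    {G : ℝ → Lp (Space n) 2 (volume : Measure (Space n))} (h : EnergyCurves μ α p T u U V G)
    {w : Space n → ℝ} (hw : MemLp w 2 volume) {t : ℝ} (ht : t ∈ Ico 0 T) :
    HasDerivWithinAt (fun t => ∫ x, U t x * w x) (∫ x, V t x * w x) (Ico 0 T) t := by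
  simp only [integral_mul_eq_inner _ hw]
  exact ((innerSL ℝ (hw.toLp w)).hasFDerivAt.comp_hasDerivWithinAt t (h.hasDeriv t ht))

/-- With the integrating factor `s^μ` in the test function the term `μ s^{μ-1}` from its derivative
cancels the damping. -/
lemma EnergyCurves.weak_mul {n : ℕ} {μ α p T : ℝ} {u : ℝ → Space n → ℝ}
    {U V : ℝ → Lp ℝ 2 (volume : Measure (Space n))}
    {G : ℝ → Lp (Space n) 2 (volume : Measure (Space n))} (h : EnergyCurves μ α p T u U V G)
    {w : Space n → ℝ} (hw : ContDiff ℝ ∞ w) (hc : HasCompactSupport w)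
    {θ : ℝ → ℝ} (hθ : ContDiff ℝ ∞ θ) {a b : ℝ} (ha : 0 < a) (hb : b < T)
    (hθs : Function.support θ ⊆ Icc a b) :
    -(∫ s in Ioo 0 T, s ^ μ * deriv θ s * ∫ x, V s x * w x) +
      ∫ s in Ioo 0 T, s ^ μ * θ s * ∫ x, ⟪G s x, ∇ w x⟫ =
    ∫ s in Ioo 0 T, s ^ μ * θ s * nonlin α p u w s := by
  have hθt : tsupport θ ⊆ Icc a b := closure_minimal hθs isClosed_Icc
  have hθc : HasCompactSupport θ := isCompact_Icc.of_isClosed_subset (isClosed_tsupport _) hθt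
  have hdt : tsupport (deriv θ) ⊆ Icc a b := (tsupport_deriv_subset).trans hθt
  have hdc : Continuous (deriv θ) := hθ.continuous_deriv (by simp)
  have hθ0 : ∀ s, s ∉ Icc a b → θ s = 0 := fun s hs => by
    by_contra hne; exact hs (hθs hne)
  have hd0 : ∀ s, s ∉ Icc a b → deriv θ s = 0 := fun s hs =>
    image_eq_zero_of_notMem_tsupport fun hh => hs (hdt hh)
  set Θ : ℝ → ℝ := fun s => s ^ μ * θ s with hΘ
  -- `s^μ` is smooth only away from `0`, and `θ` vanishes near `s ≤ 0`.
  have hΘsm : ContDiff ℝ ∞ Θ := by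
    rw [contDiff_iff_contDiffAt]
    intro s
    rcases lt_or_ge 0 s with hs | hs
    · exact (Real.contDiffAt_rpow_const_of_ne hs.ne').mul hθ.contDiffAt
    · have : Θ =ᶠ[𝓝 s] fun _ => 0 := by
        filter_upwards [Iio_mem_nhds (hs.trans_lt ha)] with r hr
        simp [hΘ, hθ0 r (fun hh => absurd hh.1 (not_le.2 hr))]
      exact contDiffAt_const.congr_of_eventuallyEq this
  have hΘs : Function.support Θ ⊆ Icc a b := fun s hs => hθs fun h0 => hs (by simp [hΘ, h0])
  have hΘt : tsupport Θ ⊆ Icc a b := closure_minimal hΘs isClosed_Icc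
  have htest := isTest_mul (T := T) hΘsm
    (isCompact_Icc.of_isClosed_subset (isClosed_tsupport _) hΘt)
    (hΘt.trans fun s hs => hs.2.trans_lt hb) hw hc
  obtain ⟨-, -, hid⟩ := h.weak _ htest
  have hwL := memLp_of_contDiff hw hc
  have hgL := memLp_gradient hw hc
  have hiV : ∀ s, Integrable fun x => V s x * w x := fun s =>
    (Lp.memLp (V s)).integrable_mul hwL
  have hiG : ∀ s, Integrable fun x => ⟪G s x, ∇ w x⟫ := fun s => by
    refine (L2.integrable_inner (𝕜 := ℝ) (G s) (hgL.toLp _)).congr ?_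
    filter_upwards [hgL.coeFn_toLp] with x hx
    rw [hx]
  have hΘd : ∀ s, 0 < s → deriv Θ s = μ * s ^ (μ - 1) * θ s + s ^ μ * deriv θ s := fun s hs => by
    have := (Real.hasDerivAt_rpow_const (p := μ) (Or.inl hs.ne')).mul
      (hθ.differentiable (by simp) s).hasDerivAt
    exact this.deriv
  set v : ℝ → ℝ := fun s => ∫ x, V s x * w x with hv
  set g : ℝ → ℝ := fun s => ∫ x, ⟪G s x, ∇ w x⟫ with hg
  have e1 : ∀ s ∈ Ioo 0 T, ∫ x, (-(V s x * deriv (fun τ => Θ τ * w x) s)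
      + ⟪G s x, ∇ (fun y => Θ s * w y) x⟫) =
      -(s ^ μ * deriv θ s * v s) + s ^ μ * θ s * g s - μ / s * (Θ s * v s) := by
    intro s hs
    have hd : ∀ x, deriv (fun τ => Θ τ * w x) s = deriv Θ s * w x := fun x =>
      deriv_mul_const (hΘsm.differentiable (by simp) s) _
    simp only [hd, gradient_const_mul hw, inner_smul_right]
    have : ∀ x, -(V s x * (deriv Θ s * w x)) + Θ s * ⟪G s x, ∇ w x⟫ =
        -deriv Θ s * (V s x * w x) + Θ s * ⟪G s x, ∇ w x⟫ := fun x => by ring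
    simp only [this]
    rw [integral_add ((hiV s).const_mul _) ((hiG s).const_mul _), integral_const_mul,
      integral_const_mul, hΘd s hs.1]
    rw [Real.rpow_sub_one hs.1.ne']
    simp only [hΘ, hv, hg]
    ring
  have e2 : ∀ s ∈ Ioo 0 T, ∫ x, μ * V s x / s * (Θ s * w x) = μ / s * (Θ s * v s) := by
    intro s hs
    rw [hv, ← integral_const_mul, ← integral_const_mul]
    refine integral_congr_ae (ae_of_all _ fun x => ?_)
    simp only; ring
  have e3 : ∀ s ∈ Ioo 0 T, ∫ x, s ^ α * |u s x| ^ p * (Θ s * w x) = s ^ μ * θ s * nonlin α p u w s := by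
    intro s hs
    rw [nonlin, ← integral_const_mul]
    refine integral_congr_ae (ae_of_all _ fun x => ?_)
    simp only [hΘ]; ring
  have hcomp : ∀ F : ℝ → ℝ, ContinuousOn F (Icc a b) → (∀ s, s ∉ Icc a b → F s = 0) →
      IntegrableOn F (Ioo 0 T) := fun F hF h0 => by
    have := hF.integrableOn_Icc (μ := volume)
    exact (this.of_forall_sdiff_eq_zero measurableSet_Ioo
      (fun s hs => h0 s hs.2))
  have hsub : Icc a b ⊆ Ico 0 T := fun s hs => ⟨ha.le.trans hs.1, hs.2.trans_lt hb⟩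
  have hvc : ContinuousOn v (Icc a b) := (h.continuousOn_pairV hwL).mono hsub
  have hgc : ContinuousOn g (Icc a b) := (h.continuousOn_pairG hgL).mono hsub
  have hpc : ContinuousOn (fun s : ℝ => s ^ μ) (Icc a b) := fun s hs =>
    (Real.continuousAt_rpow_const s μ (Or.inl (ha.trans_le hs.1).ne')).continuousWithinAt
  have hdivc : ContinuousOn (fun s : ℝ => μ / s) (Icc a b) :=
    continuousOn_const.div continuousOn_id fun s hs => (ha.trans_le hs.1).ne'
  have i1 : IntegrableOn (fun s => s ^ μ * deriv θ s * v s) (Ioo 0 T) :=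
    hcomp _ ((hpc.mul hdc.continuousOn).mul hvc) fun s hs => by simp [hd0 s hs]
  have i2 : IntegrableOn (fun s => s ^ μ * θ s * g s) (Ioo 0 T) :=
    hcomp _ ((hpc.mul hθ.continuous.continuousOn).mul hgc) fun s hs => by simp [hθ0 s hs]
  have i3 : IntegrableOn (fun s => μ / s * (Θ s * v s)) (Ioo 0 T) :=
    hcomp _ (hdivc.mul (hΘsm.continuous.continuousOn.mul hvc)) fun s hs => by
      simp [hΘ, hθ0 s hs]
  rw [setIntegral_congr_fun measurableSet_Ioo e1, setIntegral_congr_fun measurableSet_Ioo e2,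
    setIntegral_congr_fun measurableSet_Ioo e3, integral_sub _ i3, integral_add _ i2,
    integral_neg] at hid
  · linarith
  · exact i1.neg
  · exact i1.neg.add i2

end EPD

/-! ### From test functions in time to fixed times -/

namespace EPD

/-- A smooth step of width `δ` starting at `t`. -/
noncomputable def smoothStep (t δ s : ℝ) : ℝ := Real.smoothTransition ((s - t) / δ)

lemma contDiff_smoothStep (t δ : ℝ) : ContDiff ℝ ∞ (smoothStep t δ) :=
  Real.smoothTransition.contDiff.comp (by fun_prop)

lemma smoothStep_of_le {t δ s : ℝ} (hδ : 0 < δ) (hs : s ≤ t) : smoothStep t δ s = 0 :=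
  Real.smoothTransition.zero_of_nonpos (div_nonpos_of_nonpos_of_nonneg (by linarith) hδ.le)

lemma smoothStep_of_ge {t δ s : ℝ} (hδ : 0 < δ) (hs : t + δ ≤ s) : smoothStep t δ s = 1 :=
  Real.smoothTransition.one_of_one_le (by rw [le_div_iff₀ hδ]; linarith)

lemma smoothStep_mono {t δ : ℝ} (hδ : 0 < δ) : Monotone (smoothStep t δ) := fun a b hab => by
  apply Real.smoothTransition.monotone
  gcongr

lemma smoothStep_nonneg (t δ s : ℝ) : 0 ≤ smoothStep t δ s := Real.smoothTransition.nonneg _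

lemma smoothStep_le_one (t δ s : ℝ) : smoothStep t δ s ≤ 1 := Real.smoothTransition.le_one _

lemma deriv_smoothStep_eq_zero {t δ s : ℝ} (hδ : 0 < δ) (hs : s ∉ Icc t (t + δ)) :
    deriv (smoothStep t δ) s = 0 := by
  rw [mem_Icc, not_and_or, not_le, not_le] at hs
  rcases hs with h | h
  · have : smoothStep t δ =ᶠ[𝓝 s] fun _ => 0 := by
      filter_upwards [Iio_mem_nhds h] with r hr using smoothStep_of_le hδ (le_of_lt hr)
    rw [this.deriv_eq, deriv_const]
  · have : smoothStep t δ =ᶠ[𝓝 s] fun _ => 1 := by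
      filter_upwards [Ioi_mem_nhds h] with r hr using smoothStep_of_ge hδ (le_of_lt hr)
    rw [this.deriv_eq, deriv_const]

lemma deriv_smoothStep_nonneg {t δ : ℝ} (hδ : 0 < δ) (s : ℝ) : 0 ≤ deriv (smoothStep t δ) s :=
  (smoothStep_mono hδ).deriv_nonneg

lemma tendsto_smoothStep (t s : ℝ) :
    Tendsto (fun δ => smoothStep t δ s) (𝓝[>] 0) (𝓝 (if t < s then 1 else 0)) := by
  split_ifs with h
  · refine tendsto_const_nhds.congr' ?_
    filter_upwards [Ioo_mem_nhdsGT (show (0 : ℝ) < s - t by linarith)] with δ hδ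
    exact (smoothStep_of_ge hδ.1 (by linarith [hδ.2])).symm
  · refine tendsto_const_nhds.congr' ?_
    filter_upwards [self_mem_nhdsWithin] with δ hδ
    exact (smoothStep_of_le hδ (not_lt.1 h)).symm

/-- The derivatives of `smoothStep` form an approximate identity. -/
lemma tendsto_integral_deriv_smoothStep {a b t : ℝ} (ht : t ∈ Ioo a b) {F : ℝ → ℝ}
    (hF : ContinuousOn F (Ioo a b)) :
    Tendsto (fun δ => ∫ s in Ioo a b, deriv (smoothStep t δ) s * F s) (𝓝[>] 0) (𝓝 (F t)) := by
  rw [Metric.tendsto_nhdsWithin_nhds]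
  intro ε hε
  have hcont : ContinuousAt F t := hF.continuousAt (Ioo_mem_nhds ht.1 ht.2)
  obtain ⟨η, hη, hηF⟩ := Metric.continuousAt_iff.1 hcont (ε / 2) (by positivity)
  have hgap : 0 < b - t := by linarith [ht.2]
  refine ⟨min η (b - t), by positivity, fun {δ} hδ hdist => ?_⟩
  have hδ0 : (0 : ℝ) < δ := hδ
  rw [dist_zero_right, Real.norm_of_nonneg hδ0.le, lt_min_iff] at hdist
  have hsub : Icc t (t + δ) ⊆ Ioo a b := fun s hs =>
    ⟨ht.1.trans_le hs.1, by linarith [hs.2, hdist.2]⟩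
  have hdc : Continuous (deriv (smoothStep t δ)) :=
    (contDiff_smoothStep t δ).continuous_deriv (by simp)
  have hred : ∀ H : ℝ → ℝ, ∫ s in Ioo a b, deriv (smoothStep t δ) s * H s =
      ∫ s in Icc t (t + δ), deriv (smoothStep t δ) s * H s := fun H =>
    (setIntegral_eq_of_subset_of_forall_sdiff_eq_zero measurableSet_Ioo hsub fun s hs => by
      rw [deriv_smoothStep_eq_zero hδ0 hs.2, zero_mul])
  have hone : ∫ s in Icc t (t + δ), deriv (smoothStep t δ) s = 1 := by
    rw [integral_Icc_eq_integral_Ioc, ← intervalIntegral.integral_of_le (by linarith),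
      intervalIntegral.integral_deriv_eq_sub
        (fun s _ => (contDiff_smoothStep t δ).differentiable (by simp) s)
        (hdc.intervalIntegrable _ _), smoothStep_of_ge hδ0 le_rfl, smoothStep_of_le hδ0 le_rfl]
    norm_num
  have i1 : IntegrableOn (fun s => deriv (smoothStep t δ) s * F s) (Icc t (t + δ)) :=
    (hdc.continuousOn.mul (hF.mono hsub)).integrableOn_Icc
  have i2 : IntegrableOn (fun s => deriv (smoothStep t δ) s) (Icc t (t + δ)) :=
    hdc.continuousOn.integrableOn_Icc
  have hdiff : (∫ s in Icc t (t + δ), deriv (smoothStep t δ) s * F s) - F t =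
      ∫ s in Icc t (t + δ), deriv (smoothStep t δ) s * (F s - F t) := by
    simp only [mul_sub]
    rw [integral_sub i1 (i2.mul_const _), integral_mul_const, hone, one_mul]
  rw [hred, Real.dist_eq, hdiff]
  calc |∫ s in Icc t (t + δ), deriv (smoothStep t δ) s * (F s - F t)|
      ≤ ∫ s in Icc t (t + δ), |deriv (smoothStep t δ) s * (F s - F t)| := abs_integral_le_integral_abs
    _ ≤ ∫ s in Icc t (t + δ), deriv (smoothStep t δ) s * (ε / 2) := by
        refine setIntegral_mono_on ?_ (i2.mul_const _) measurableSet_Icc fun s hs => ?_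
        · have := (i1.sub (i2.mul_const (F t))).abs
          refine this.congr (ae_of_all _ fun s => ?_)
          simp only [Pi.sub_apply, mul_sub]
        · have h0 := deriv_smoothStep_nonneg (t := t) hδ0 s
          rw [abs_mul, abs_of_nonneg h0]
          have := hηF (show dist s t < η by
            rw [Real.dist_eq, abs_of_nonneg (by linarith [hs.1])]; linarith [hs.2, hdist.1])
          rw [Real.dist_eq] at this
          gcongr
    _ = ε / 2 := by rw [integral_mul_const, hone, one_mul]
    _ < ε := by linarith

/-- The time-integrated form of the equation between two positive times. -/
lemma EnergyCurves.integrated_of_pos {n : ℕ} {μ α p T : ℝ} {u : ℝ → Space n → ℝ}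
    {U V : ℝ → Lp ℝ 2 (volume : Measure (Space n))}
    {G : ℝ → Lp (Space n) 2 (volume : Measure (Space n))} (h : EnergyCurves μ α p T u U V G)
    (hμ : 0 < μ)
    {w : Space n → ℝ} (hw : ContDiff ℝ ∞ w) (hc : HasCompactSupport w) {t₁ t₂ : ℝ} (h1 : 0 < t₁)
    (h12 : t₁ ≤ t₂) (h2 : t₂ < T) :
    t₂ ^ μ * (∫ x, V t₂ x * w x) - t₁ ^ μ * (∫ x, V t₁ x * w x) =
      ∫ s in t₁..t₂, s ^ μ * (nonlin α p u w s - ∫ x, ⟪G s x, ∇ w x⟫) := by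
  set v : ℝ → ℝ := fun s => ∫ x, V s x * w x with hv
  set g : ℝ → ℝ := fun s => ∫ x, ⟪G s x, ∇ w x⟫ with hg
  set H := nonlin α p u w with hH
  -- A margin before `T`: steps of width less than `d` starting at `t₂` end before `b`, so the test
  -- functions are admissible.
  set d := (T - t₂) / 2 with hd
  have hd0 : 0 < d := by rw [hd]; linarith
  set b := t₂ + d with hb
  have hbT : b < T := by rw [hb, hd]; linarith
  have hwL := memLp_of_contDiff hw hc
  have hgL := memLp_gradient hw hc
  have hIoo : Ioo 0 T ⊆ Ico 0 T := Ioo_subset_Ico_self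
  have hvc : ContinuousOn v (Ioo 0 T) := (h.continuousOn_pairV hwL).mono hIoo
  have hgc : ContinuousOn g (Ioo 0 T) := (h.continuousOn_pairG hgL).mono hIoo
  have hpc : ContinuousOn (fun s : ℝ => s ^ μ) (Ioo 0 T) :=
    (Real.continuous_rpow_const hμ.le).continuousOn
  have hPc : ContinuousOn (fun s => s ^ μ * v s) (Ioo 0 T) := hpc.mul hvc
  have hlim1 := (tendsto_integral_deriv_smoothStep (t := t₁) ⟨h1, h12.trans_lt h2⟩ hPc)
  have hlim2 := (tendsto_integral_deriv_smoothStep (t := t₂) ⟨h1.trans_le h12, h2⟩ hPc)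
  have hiH : IntegrableOn H (Ioc 0 b) := h.integrableOn_nonlin hw hc hbT
  have hsub : Icc t₁ b ⊆ Ioo 0 T := fun s hs => ⟨h1.trans_le hs.1, hs.2.trans_lt hbT⟩
  have hif : IntegrableOn (fun s => s ^ μ * (H s - g s)) (Icc t₁ b) := by
    have hiH2 : IntegrableOn H (Icc t₁ b) := hiH.mono_set fun s hs => ⟨h1.trans_le hs.1, hs.2⟩
    have hig : IntegrableOn g (Icc t₁ b) := (hgc.mono hsub).integrableOn_Icc
    have := (hiH2.sub hig).continuousOn_mul (hpc.mono hsub) isCompact_Icc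
    exact this
  have hlim3 : Tendsto (fun δ => ∫ s in Icc t₁ b, (smoothStep t₁ δ s - smoothStep t₂ δ s) *
      (s ^ μ * (H s - g s))) (𝓝[>] 0) (𝓝 (∫ s in Icc t₁ b, ((if t₁ < s then 1 else 0) -
        (if t₂ < s then 1 else 0)) * (s ^ μ * (H s - g s)))) := by
    refine tendsto_integral_filter_of_dominated_convergence
      (fun s => |s ^ μ * (H s - g s)|) ?_ ?_ hif.abs ?_
    · refine Eventually.of_forall fun δ => ?_
      exact ((contDiff_smoothStep t₁ δ).continuous.sub
        (contDiff_smoothStep t₂ δ).continuous).aestronglyMeasurable.mul hif.aestronglyMeasurable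
    · refine Eventually.of_forall fun δ => ae_of_all _ fun s => ?_
      rw [norm_mul, Real.norm_eq_abs, Real.norm_eq_abs]
      refine mul_le_of_le_one_left (abs_nonneg _) ?_
      rw [abs_le]
      constructor <;> linarith [smoothStep_nonneg t₁ δ s, smoothStep_nonneg t₂ δ s,
        smoothStep_le_one t₁ δ s, smoothStep_le_one t₂ δ s]
    · refine ae_of_all _ fun s => ?_
      exact ((tendsto_smoothStep t₁ s).sub (tendsto_smoothStep t₂ s)).mul_const _
  have hval : ∫ s in Icc t₁ b, (((if t₁ < s then 1 else 0) - (if t₂ < s then 1 else 0) : ℝ)) *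
      (s ^ μ * (H s - g s)) = ∫ s in t₁..t₂, s ^ μ * (H s - g s) := by
    rw [intervalIntegral.integral_of_le h12]
    have hs2 : Ioc t₁ t₂ ⊆ Icc t₁ b := fun s hs => ⟨hs.1.le, by rw [hb]; linarith [hs.2]⟩
    rw [setIntegral_eq_of_subset_of_forall_sdiff_eq_zero measurableSet_Icc hs2]
    · refine setIntegral_congr_fun measurableSet_Ioc fun s hs => ?_
      simp [hs.1, not_lt.2 hs.2]
    · intro s hs
      by_cases hs1 : t₁ < s
      · have : t₂ < s := by
          by_contra hcon
          exact hs.2 ⟨hs1, not_lt.1 hcon⟩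
        simp [hs1, this]
      · have : ¬ t₂ < s := fun hh => hs1 (h12.trans_lt hh)
        simp [hs1, this]
  -- The test function in time is the difference of two steps, a smooth approximation of the
  -- indicator of `(t₁, t₂]`.
  have hev : ∀ᶠ δ in 𝓝[>] (0 : ℝ),
      (∫ s in Ioo 0 T, deriv (smoothStep t₂ δ) s * (s ^ μ * v s)) -
        (∫ s in Ioo 0 T, deriv (smoothStep t₁ δ) s * (s ^ μ * v s)) =
      ∫ s in Icc t₁ b, (smoothStep t₁ δ s - smoothStep t₂ δ s) * (s ^ μ * (H s - g s)) := by
    filter_upwards [Ioo_mem_nhdsGT hd0] with δ hδ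
    set θ : ℝ → ℝ := fun s => smoothStep t₁ δ s - smoothStep t₂ δ s with hθ
    have hθsm : ContDiff ℝ ∞ θ := (contDiff_smoothStep t₁ δ).sub (contDiff_smoothStep t₂ δ)
    have hθs : Function.support θ ⊆ Icc t₁ b := by
      intro s hs
      by_contra hcon
      apply hs
      rw [mem_Icc, not_and_or, not_le, not_le] at hcon
      rcases hcon with hh | hh
      · simp only [hθ]
        rw [smoothStep_of_le hδ.1 hh.le, smoothStep_of_le hδ.1 (hh.le.trans h12), sub_zero]
      · simp only [hθ]
        have hh' : t₂ + d < s := hh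
        rw [smoothStep_of_ge hδ.1 (by linarith [hδ.2]), smoothStep_of_ge hδ.1 (by linarith [hδ.2]),
          sub_self]
    have hθd : ∀ s, deriv θ s = deriv (smoothStep t₁ δ) s - deriv (smoothStep t₂ δ) s := fun s =>
      deriv_sub ((contDiff_smoothStep t₁ δ).differentiable (by simp) s)
        ((contDiff_smoothStep t₂ δ).differentiable (by simp) s)
    have hwk := h.weak_mul hw hc hθsm h1 hbT hθs
    have hcomp : ∀ (F : ℝ → ℝ) (r : ℝ), r ∈ Icc t₁ t₂ → ContinuousOn F (Ioo 0 T) →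
        IntegrableOn (fun s => deriv (smoothStep r δ) s * F s) (Ioo 0 T) := fun F r hr hF => by
      have hdc : Continuous (deriv (smoothStep r δ)) :=
        (contDiff_smoothStep r δ).continuous_deriv (by simp)
      have := (hdc.continuousOn.mul (hF.mono hsub)).integrableOn_Icc (μ := volume)
      refine this.of_forall_sdiff_eq_zero measurableSet_Ioo fun s hs => ?_
      rw [Pi.mul_apply, deriv_smoothStep_eq_zero hδ.1, zero_mul]
      exact fun hh => hs.2 ⟨hr.1.trans hh.1, by rw [hb]; linarith [hh.2, hr.2, hδ.2]⟩
    have hsplit : ∫ s in Ioo 0 T, s ^ μ * deriv θ s * v s =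
        (∫ s in Ioo 0 T, deriv (smoothStep t₁ δ) s * (s ^ μ * v s)) -
        (∫ s in Ioo 0 T, deriv (smoothStep t₂ δ) s * (s ^ μ * v s)) := by
      rw [← integral_sub (hcomp _ t₁ ⟨le_rfl, h12⟩ hPc) (hcomp _ t₂ ⟨h12, le_rfl⟩ hPc)]
      refine integral_congr_ae (ae_of_all _ fun s => ?_)
      simp only [hθd]; ring
    have hred : ∀ F : ℝ → ℝ, ∫ s in Ioo 0 T, s ^ μ * θ s * F s =
        ∫ s in Icc t₁ b, θ s * (s ^ μ * F s) := fun F => by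
      rw [setIntegral_eq_of_subset_of_forall_sdiff_eq_zero measurableSet_Ioo hsub]
      · refine integral_congr_ae (ae_of_all _ fun s => ?_)
        simp only; ring
      · intro s hs
        have : θ s = 0 := by
          by_contra hne; exact hs.2 (hθs hne)
        simp [this]
    rw [hsplit, hred, hred] at hwk
    have hiH2 : IntegrableOn (fun s => θ s * (s ^ μ * H s)) (Icc t₁ b) := by
      have hiH2 : IntegrableOn H (Icc t₁ b) := hiH.mono_set fun s hs => ⟨h1.trans_le hs.1, hs.2⟩
      exact (hiH2.continuousOn_mul (hpc.mono hsub) isCompact_Icc).continuousOn_mul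
        hθsm.continuous.continuousOn isCompact_Icc
    have hig : IntegrableOn (fun s => θ s * (s ^ μ * g s)) (Icc t₁ b) :=
      (hθsm.continuous.continuousOn.mul ((hpc.mono hsub).mul (hgc.mono hsub))).integrableOn_Icc
    have : ∫ s in Icc t₁ b, θ s * (s ^ μ * (H s - g s)) =
        (∫ s in Icc t₁ b, θ s * (s ^ μ * H s)) - ∫ s in Icc t₁ b, θ s * (s ^ μ * g s) := by
      rw [← integral_sub hiH2 hig]
      refine integral_congr_ae (ae_of_all _ fun s => ?_)
      simp only; ring
    rw [this]
    linarith
  have := tendsto_nhds_unique ((hlim2.sub hlim1).congr' hev) hlim3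
  rw [this, hval]

/-- The time-integrated form of the equation. -/
lemma EnergyCurves.integrated {n : ℕ} {μ α p T : ℝ} {u : ℝ → Space n → ℝ}
    {U V : ℝ → Lp ℝ 2 (volume : Measure (Space n))}
    {G : ℝ → Lp (Space n) 2 (volume : Measure (Space n))} (h : EnergyCurves μ α p T u U V G)
    (hμ : 0 < μ)
    {w : Space n → ℝ} (hw : ContDiff ℝ ∞ w) (hc : HasCompactSupport w) {t : ℝ} (ht : t ∈ Ico 0 T) :
    IntervalIntegrable (fun s => s ^ μ * (nonlin α p u w s - ∫ x, ⟪G s x, ∇ w x⟫)) volume 0 t ∧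
    t ^ μ * (∫ x, V t x * w x) =
      ∫ s in (0 : ℝ)..t, s ^ μ * (nonlin α p u w s - ∫ x, ⟪G s x, ∇ w x⟫) := by
  have hwL := memLp_of_contDiff hw hc
  have hgL := memLp_gradient hw hc
  have hpc : Continuous (fun s : ℝ => s ^ μ) := Real.continuous_rpow_const hμ.le
  have hsub : Icc 0 t ⊆ Ico 0 T := fun s hs => ⟨hs.1, hs.2.trans_lt ht.2⟩
  have hii : IntervalIntegrable (fun s => s ^ μ * (nonlin α p u w s - ∫ x, ⟪G s x, ∇ w x⟫))
      volume 0 t := by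
    have i1 : IntervalIntegrable (nonlin α p u w) volume 0 t := by
      rw [intervalIntegrable_iff_integrableOn_Ioc_of_le ht.1]
      exact h.integrableOn_nonlin hw hc ht.2
    have i2 : IntervalIntegrable (fun s => ∫ x, ⟪G s x, ∇ w x⟫) volume 0 t := by
      apply ContinuousOn.intervalIntegrable
      rw [uIcc_of_le ht.1]
      exact (h.continuousOn_pairG hgL).mono hsub
    exact (i1.sub i2).continuousOn_mul hpc.continuousOn
  refine ⟨hii, ?_⟩
  rcases ht.1.eq_or_lt with h0 | h0
  · rw [← h0, intervalIntegral.integral_same, Real.zero_rpow hμ.ne', zero_mul]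
  have hc1 : ContinuousOn (fun s => s ^ μ * ∫ x, V s x * w x) (Icc 0 t) :=
    hpc.continuousOn.mul ((h.continuousOn_pairV hwL).mono hsub)
  have hc2 : ContinuousOn (fun s => ∫ r in s..t, r ^ μ * (nonlin α p u w r -
      ∫ x, ⟪G r x, ∇ w x⟫)) (Icc 0 t) := by
    have := intervalIntegral.continuousOn_primitive_interval_left (f := fun r =>
      r ^ μ * (nonlin α p u w r - ∫ x, ⟪G r x, ∇ w x⟫)) (μ := volume) (a := 0) (b := t) ?_
    · rwa [uIcc_of_le h0.le] at this
    · rw [uIcc_of_le h0.le, integrableOn_Icc_iff_integrableOn_Ioc]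
      exact (intervalIntegrable_iff_integrableOn_Ioc_of_le h0.le).1 hii
  have hmem : (0 : ℝ) ∈ Icc 0 t := ⟨le_rfl, h0.le⟩
  have hne : (𝓝[Ioc 0 t] (0 : ℝ)).NeBot := by
    have : Ioc 0 t ∈ 𝓝[>] (0 : ℝ) := Ioc_mem_nhdsGT h0
    exact (inferInstance : (𝓝[>] (0 : ℝ)).NeBot).mono
      (le_inf inf_le_left (le_principal_iff.2 this))
  have hl1 := (hc1 0 hmem).mono_left (nhdsWithin_mono 0 (Ioc_subset_Icc_self (a := 0) (b := t)))
  have hl2 := (hc2 0 hmem).mono_left (nhdsWithin_mono 0 (Ioc_subset_Icc_self (a := 0) (b := t)))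
  -- The lower time tends to `0`; the boundary term there disappears because of the factor `0 ^ μ =
  -- 0`.
  have hl3 : Tendsto (fun s => ∫ r in s..t, r ^ μ * (nonlin α p u w r -
      ∫ x, ⟪G r x, ∇ w x⟫)) (𝓝[Ioc 0 t] 0) (𝓝 (t ^ μ * (∫ x, V t x * w x) -
        (0 : ℝ) ^ μ * ∫ x, V 0 x * w x)) := by
    refine (tendsto_const_nhds.sub hl1).congr' ?_
    filter_upwards [self_mem_nhdsWithin] with s hs
    exact h.integrated_of_pos hμ hw hc hs.1 hs.2 ht.2
  have := tendsto_nhds_unique hl3 hl2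
  rw [Real.zero_rpow hμ.ne', zero_mul, sub_zero] at this
  exact this

end EPD

namespace EPD

/-! ### Density of test functions in `H¹` -/

-- The difference is the `ρ`-average of the translates `f(x - y) - f(x)`. Jensen's inequality for
-- the probability measure `ρ dy` and Tonelli bound its square by the average of the squared norms.
open scoped Convolution in
lemma eLpNorm_convolution_sub_le {n : ℕ} {E : Type*} [NormedAddCommGroup E] [NormedSpace ℝ E]
    [CompleteSpace E] {f : Space n → E} (hfm : StronglyMeasurable f) (hf : MemLp f 2 volume)
    (φ : ContDiffBump (0 : Space n)) {ε : ℝ≥0∞}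
    (h : ∀ y ∈ Metric.ball (0 : Space n) φ.rOut,
      eLpNorm (fun x => f (x - y) - f x) 2 volume ≤ ε) :
    eLpNorm (fun x => (φ.normed volume ⋆[ContinuousLinearMap.lsmul ℝ ℝ, volume] f) x - f x) 2
      volume ≤ ε := by
  have hloc : LocallyIntegrable f volume := hf.locallyIntegrable (by norm_num)
  set ρ : Space n → ℝ := φ.normed volume with hρ
  have hρc : Continuous ρ := φ.continuous_normed
  have hρ0 : ∀ y, 0 ≤ ρ y := fun y => φ.nonneg_normed y
  have hρi : ∫⁻ y, ENNReal.ofReal (ρ y) = 1 := by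
    rw [← ofReal_integral_eq_lintegral_ofReal φ.integrable_normed (ae_of_all _ hρ0),
      φ.integral_normed, ENNReal.ofReal_one]
  have hρm : Measurable fun y => ENNReal.ofReal (ρ y) := hρc.measurable.ennreal_ofReal
  have hmeas : StronglyMeasurable fun z : Space n × Space n => f (z.1 - z.2) - f z.1 :=
    (hfm.comp_measurable (measurable_fst.sub measurable_snd)).sub
      (hfm.comp_measurable measurable_fst)
  have hconv : ∀ x, ‖(ρ ⋆[ContinuousLinearMap.lsmul ℝ ℝ, volume] f) x - f x‖ₑ ^ 2 ≤
      ∫⁻ y, ENNReal.ofReal (ρ y) * ‖f (x - y) - f x‖ₑ ^ 2 := by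
    intro x
    have hex : Integrable (fun y => ρ y • f (x - y)) volume :=
      φ.hasCompactSupport_normed.convolutionExists_left (ContinuousLinearMap.lsmul ℝ ℝ) hρc hloc x
    have h1 : (ρ ⋆[ContinuousLinearMap.lsmul ℝ ℝ, volume] f) x - f x =
        ∫ y, ρ y • (f (x - y) - f x) := by
      have h2 : ∫ y, ρ y • f x = f x := φ.integral_normed_smul volume (f x)
      simp_rw [smul_sub]
      rw [integral_sub hex (φ.integrable_normed.smul_const _), h2]
      rfl
    have h3 : ‖(ρ ⋆[ContinuousLinearMap.lsmul ℝ ℝ, volume] f) x - f x‖ₑ ≤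
        ∫⁻ y, ENNReal.ofReal (ρ y) * ‖f (x - y) - f x‖ₑ := by
      rw [h1]
      refine (enorm_integral_le_lintegral_enorm _).trans (lintegral_mono fun y => ?_)
      rw [enorm_smul, Real.enorm_of_nonneg (hρ0 y)]
    set ν : Measure (Space n) := volume.withDensity fun y => ENNReal.ofReal (ρ y) with hν
    have : IsProbabilityMeasure ν := ⟨by rw [hν, withDensity_apply _ MeasurableSet.univ]; simpa⟩
    have hm : StronglyMeasurable fun y => f (x - y) - f x :=
      hmeas.comp_measurable measurable_prodMk_left
    have h4 := eLpNorm_le_eLpNorm_of_exponent_le (μ := ν) (p := 1) (q := 2)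
      (f := fun y => f (x - y) - f x) (by norm_num) hm.aestronglyMeasurable
    rw [eLpNorm_one_eq_lintegral_enorm, hν,
      lintegral_withDensity_eq_lintegral_mul _ hρm hm.enorm] at h4
    have h5 : eLpNorm (fun y => f (x - y) - f x) 2 ν ^ 2 =
        ∫⁻ y, ENNReal.ofReal (ρ y) * ‖f (x - y) - f x‖ₑ ^ 2 := by
      have := eLpNorm_nnreal_pow_eq_lintegral (μ := ν) (f := fun y => f (x - y) - f x)
        (p := 2) (by norm_num)
      simp only [NNReal.coe_ofNat, ENNReal.rpow_ofNat, ENNReal.coe_ofNat] at this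
      rw [this, hν, lintegral_withDensity_eq_lintegral_mul _ hρm (hm.enorm.pow_const 2)]
      rfl
    rw [← h5]
    gcongr
    exact h3.trans h4
  have hsq : ∀ g : Space n → E, eLpNorm g 2 volume ^ 2 = ∫⁻ x, ‖g x‖ₑ ^ 2 := by
    intro g
    have := eLpNorm_nnreal_pow_eq_lintegral (μ := (volume : Measure (Space n))) (f := g)
        (p := 2) (by norm_num)
    simpa using this
  rw [← ENNReal.pow_le_pow_left_iff (n := 2) (by norm_num), hsq]
  calc ∫⁻ x, ‖(ρ ⋆[ContinuousLinearMap.lsmul ℝ ℝ, volume] f) x - f x‖ₑ ^ 2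
      ≤ ∫⁻ x, ∫⁻ y, ENNReal.ofReal (ρ y) * ‖f (x - y) - f x‖ₑ ^ 2 := lintegral_mono hconv
    _ = ∫⁻ y, ∫⁻ x, ENNReal.ofReal (ρ y) * ‖f (x - y) - f x‖ₑ ^ 2 := by
        refine lintegral_lintegral_swap (Measurable.aemeasurable ?_)
        exact (hρm.comp measurable_snd).mul (hmeas.enorm.pow_const 2)
    _ = ∫⁻ y, ENNReal.ofReal (ρ y) * eLpNorm (fun x => f (x - y) - f x) 2 volume ^ 2 := by
        refine lintegral_congr fun y => ?_
        have hm : StronglyMeasurable fun x => f (x - y) - f x :=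
          hmeas.comp_measurable measurable_prodMk_right
        rw [lintegral_const_mul _ (hm.enorm.pow_const 2), hsq]
    _ ≤ ∫⁻ y, ENNReal.ofReal (ρ y) * ε ^ 2 := by
        refine lintegral_mono fun y => ?_
        by_cases hy : y ∈ Metric.ball (0 : Space n) φ.rOut
        · gcongr; exact h y hy
        · have : ρ y = 0 := by
            by_contra h0
            exact hy (φ.support_normed_eq (μ := volume) ▸ h0)
          simp [this]
    _ = ε ^ 2 := by rw [lintegral_mul_const _ hρm, hρi, one_mul]

/-- Continuity of translations in `L²`, read off from the continuity of composition with measure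
preserving maps. -/
lemma exists_eLpNorm_translate_sub_le {n : ℕ} {E : Type*} [NormedAddCommGroup E]
    {f : Space n → E} (hf : MemLp f 2 volume) {ε : ℝ≥0∞} (hε : 0 < ε) :
    ∃ δ > 0, ∀ y ∈ Metric.ball (0 : Space n) δ,
      eLpNorm (fun x => f (x - y) - f x) 2 volume ≤ ε := by
  set F := hf.toLp f with hF
  have hmp : ∀ y : Space n, MeasurePreserving (fun x => x - y) volume volume :=
    fun y => measurePreserving_sub_right volume y
  let g : Space n → C(Space n, Space n) := fun y => ⟨fun x => x - y, by fun_prop⟩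
  have hg : Continuous g := ContinuousMap.continuous_of_continuous_uncurry _ (by
    show Continuous fun z : Space n × Space n => z.2 - z.1
    fun_prop)
  have hc : Continuous fun y => Lp.compMeasurePreserving (g y) (hmp y) F :=
    Continuous.compMeasurePreservingLp continuous_const hg (fun y => hmp y) (by norm_num)
  have h0 := hc.tendsto 0
  rw [EMetric.tendsto_nhds] at h0
  have := h0 ε hε
  obtain ⟨δ, hδ, hb⟩ := Metric.eventually_nhds_iff_ball.1 this
  refine ⟨δ, hδ, fun y hy => ?_⟩
  have h1 := (hb y hy).le
  rw [Lp.edist_def] at h1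
  refine le_trans (le_of_eq (eLpNorm_congr_ae ?_)) h1
  have hFe := hf.coeFn_toLp
  have e1 := Lp.coeFn_compMeasurePreserving F (f := g y) (hmp y)
  have e2 := Lp.coeFn_compMeasurePreserving F (f := g 0) (hmp 0)
  have e3 := (hmp y).quasiMeasurePreserving.ae hFe
  filter_upwards [e1, e2, e3, hFe] with x h1 h2 h3 h4
  rw [Pi.sub_apply, h1, h2]
  simp only [Function.comp, g, ContinuousMap.coe_mk, sub_zero]
  rw [hF, h3, h4]

lemma HasWeakGradient.congr_ae {n : ℕ} {f f' : Space n → ℝ} {g g' : Space n → Space n}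
    (h : HasWeakGradient f g) (hf : f =ᵐ[volume] f') (hg : g =ᵐ[volume] g') :
    HasWeakGradient f' g' := by
  intro ψ hψ hc
  rw [integral_congr_ae (hf.symm.mono fun x hx => by rw [hx] : _ =ᵐ[volume] fun x => f x • ∇ ψ x),
    h ψ hψ hc,
    integral_congr_ae (hg.mono fun x hx => by simp only [hx] :
      (fun x => ψ x • g x) =ᵐ[volume] fun x => ψ x • g' x)]

open scoped Convolution in
lemma eLpNorm_convolution_sub_le' {n : ℕ} {E : Type*} [NormedAddCommGroup E] [NormedSpace ℝ E]
    [CompleteSpace E] {f : Space n → E} (hf : MemLp f 2 volume)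
    (φ : ContDiffBump (0 : Space n)) {ε : ℝ≥0∞}
    (h : ∀ y ∈ Metric.ball (0 : Space n) φ.rOut,
      eLpNorm (fun x => f (x - y) - f x) 2 volume ≤ ε) :
    eLpNorm (fun x => (φ.normed volume ⋆[ContinuousLinearMap.lsmul ℝ ℝ, volume] f) x - f x) 2
      volume ≤ ε := by
  have hae := hf.1.ae_eq_mk
  rw [convolution_congr (ContinuousLinearMap.lsmul ℝ ℝ) (ae_eq_refl (φ.normed volume)) hae]
  rw [eLpNorm_congr_ae (hae.mono fun x hx => by simp only; rw [hx] : _ =ᵐ[volume] fun x =>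
    (φ.normed volume ⋆[ContinuousLinearMap.lsmul ℝ ℝ, volume] (hf.1.mk f)) x - hf.1.mk f x)]
  refine eLpNorm_convolution_sub_le hf.1.stronglyMeasurable_mk ((memLp_congr_ae hae).1 hf) φ
    fun y hy => ?_
  rw [← eLpNorm_congr_ae (_ : (fun x => f (x - y) - f x) =ᵐ[volume] _)]
  · exact h y hy
  · filter_upwards [hae, (measurePreserving_sub_right volume y).quasiMeasurePreserving.ae hae]
      with x h1 h2
    rw [← h1, ← h2]

-- The derivative falls on `ρ`, and `y ↦ ρ (x - y)` is itself an admissible test function for the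
-- weak gradient.
open scoped Convolution in
lemma HasWeakGradient.gradient_convolution {n : ℕ} {f : Space n → ℝ} {g : Space n → Space n}
    (h : HasWeakGradient f g) (hf : MemLp f 2 volume) {ρ : Space n → ℝ} (hρ : ContDiff ℝ ∞ ρ)
    (hρc : HasCompactSupport ρ) (x : Space n) :
    ∇ (ρ ⋆[ContinuousLinearMap.lsmul ℝ ℝ, volume] f) x =
      (ρ ⋆[ContinuousLinearMap.lsmul ℝ ℝ, volume] g) x := by
  have hloc : LocallyIntegrable f volume := hf.locallyIntegrable (by norm_num)
  have hd := hρc.hasFDerivAt_convolution_left (ContinuousLinearMap.lsmul ℝ ℝ) (hρ.of_le (by simp))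
    hloc x
  have hex := ((hρc.fderiv (𝕜 := ℝ)).convolutionExists_left
    ((ContinuousLinearMap.lsmul ℝ ℝ : ℝ →L[ℝ] ℝ →L[ℝ] ℝ).precompL (Space n))
    (hρ.continuous_fderiv (by simp)) hloc x).integrable_swap
  set ψ : Space n → ℝ := fun y => ρ (x - y) with hψ
  have hψs : ContDiff ℝ ∞ ψ := hρ.comp (contDiff_const.sub contDiff_id)
  have hψc : HasCompactSupport ψ := hρc.comp_homeomorph (Homeomorph.subLeft x)
  have hw := h ψ hψs hψc
  have hψd : ∀ y, ∇ ψ y = -∇ ρ (x - y) := by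
    intro y
    apply HasGradientAt.gradient
    rw [hasGradientAt_iff_hasFDerivAt, map_neg]
    have h1 := ((hρ.differentiable (by simp)) (x - y)).hasGradientAt.hasFDerivAt
    have h2 := h1.comp y ((hasFDerivAt_id y).const_sub x)
    refine h2.congr_fderiv ?_
    ext v
    simp
  apply HasGradientAt.gradient
  rw [hasGradientAt_iff_hasFDerivAt]
  refine hd.congr_fderiv ?_
  ext v
  rw [convolution_eq_swap] at *
  have hwi : Integrable (fun y => f y • ∇ ψ y) volume := by
    have : MemLp (fun y => f y • ∇ ψ y) 1 volume :=
      (memLp_gradient hψs hψc).smul hf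
    exact memLp_one_iff_integrable.1 this
  rw [InnerProductSpace.toDual_apply_apply, convolution_eq_swap]
  simp only [ContinuousLinearMap.lsmul_apply]
  have e1 : ∫ y, ρ (x - y) • g y = -∫ y, f y • ∇ ψ y := by rw [hw, neg_neg]
  have hwi' : Integrable (fun y => -(f y • ∇ ψ y)) volume := hwi.neg
  rw [e1, ← integral_neg, real_inner_comm, ← integral_inner hwi',
    ContinuousLinearMap.integral_apply hex]
  refine integral_congr_ae (ae_of_all _ fun y => ?_)
  have h1 := ((hρ.differentiable (by simp)) (x - y)).hasGradientAt.hasFDerivAt.fderiv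
  have h2 : ⟪v, ∇ ρ (x - y)⟫ = fderiv ℝ ρ (x - y) v := by
    rw [h1, InnerProductSpace.toDual_apply_apply, real_inner_comm]
  simp only [ContinuousLinearMap.precompL_apply, ContinuousLinearMap.lsmul_apply, hψd, smul_neg,
    neg_neg, inner_smul_right, h2, smul_eq_mul]
  ring

open scoped Convolution in
/-- A square integrable function with compact support and square integrable weak gradient is
approximated in `H¹` by its mollifications. -/
lemma HasWeakGradient.exists_near_of_hasCompactSupport {n : ℕ} {f : Space n → ℝ}
    {g : Space n → Space n} (h : HasWeakGradient f g) (hf : MemLp f 2 volume)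
    (hg : MemLp g 2 volume) (hfc : HasCompactSupport f) {ε : ℝ≥0∞} (hε : 0 < ε) :
    ∃ ψ : Space n → ℝ, ContDiff ℝ ∞ ψ ∧ HasCompactSupport ψ ∧
      eLpNorm (fun x => ψ x - f x) 2 volume ≤ ε ∧ eLpNorm (fun x => ∇ ψ x - g x) 2 volume ≤ ε := by
  obtain ⟨δ₁, hδ₁, h₁⟩ := exists_eLpNorm_translate_sub_le hf hε
  obtain ⟨δ₂, hδ₂, h₂⟩ := exists_eLpNorm_translate_sub_le hg hε
  have hδ : 0 < min δ₁ δ₂ := lt_min hδ₁ hδ₂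
  let φ : ContDiffBump (0 : Space n) := ⟨min δ₁ δ₂ / 2, min δ₁ δ₂, half_pos hδ, half_lt_self hδ⟩
  have hloc : LocallyIntegrable f volume := hf.locallyIntegrable (by norm_num)
  refine ⟨φ.normed volume ⋆[ContinuousLinearMap.lsmul ℝ ℝ, volume] f,
    φ.hasCompactSupport_normed.contDiff_convolution_left _ φ.contDiff_normed hloc,
    φ.hasCompactSupport_normed.convolution _ hfc, ?_, ?_⟩
  · exact eLpNorm_convolution_sub_le' hf φ fun y hy =>
      h₁ y (Metric.ball_subset_ball (min_le_left _ _) hy)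
  · simp only [h.gradient_convolution hf φ.contDiff_normed φ.hasCompactSupport_normed]
    exact eLpNorm_convolution_sub_le' hg φ fun y hy =>
      h₂ y (Metric.ball_subset_ball (min_le_right _ _) hy)

lemma gradient_mul {n : ℕ} {χ ψ : Space n → ℝ} (hχ : ContDiff ℝ ∞ χ) (hψ : ContDiff ℝ ∞ ψ)
    (x : Space n) : ∇ (fun x => χ x * ψ x) x = χ x • ∇ ψ x + ψ x • ∇ χ x := by
  have h1 := ((hχ.differentiable (by simp)) x).hasGradientAt.hasFDerivAt
  have h2 := ((hψ.differentiable (by simp)) x).hasGradientAt.hasFDerivAt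
  have h3 := h1.mul h2
  apply HasGradientAt.gradient
  rw [hasGradientAt_iff_hasFDerivAt, map_add, map_smul, map_smul]
  exact h3

/-- The product rule for a weak gradient and a smooth factor. -/
lemma HasWeakGradient.smooth_mul {n : ℕ} {f : Space n → ℝ} {g : Space n → Space n}
    (h : HasWeakGradient f g) (hf : MemLp f 2 volume) (hg : MemLp g 2 volume) {χ : Space n → ℝ}
    (hχ : ContDiff ℝ ∞ χ) :
    HasWeakGradient (fun x => χ x * f x) (fun x => χ x • g x + f x • ∇ χ x) := by
  intro ψ hψ hψc
  have hpc : HasCompactSupport fun x => χ x * ψ x :=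
    HasCompactSupport.mul_left (f := χ) (f' := ψ) hψc
  have hps : ContDiff ℝ ∞ fun x => χ x * ψ x := ContDiff.mul hχ hψ
  have h1 := h (fun x => χ x * ψ x) hps hpc
  simp only [gradient_mul hχ hψ, smul_add] at h1
  have hm1 : MemLp (fun x => χ x • ∇ ψ x) 2 volume :=
    Continuous.memLp_of_hasCompactSupport (hχ.continuous.smul (continuous_gradient hψ))
      (HasCompactSupport.smul_left (f := χ) (f' := ∇ ψ) (hasCompactSupport_gradient hψc))
  have hm2 : MemLp (fun x => ψ x • ∇ χ x) 2 volume :=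
    Continuous.memLp_of_hasCompactSupport (hψ.continuous.smul (continuous_gradient hχ))
      hψc.smul_right
  have hm3 : MemLp (fun x => χ x * ψ x) 2 volume :=
    Continuous.memLp_of_hasCompactSupport (hχ.continuous.mul hψ.continuous) hpc
  have i1 : Integrable (fun x => f x • (χ x • ∇ ψ x)) volume :=
    memLp_one_iff_integrable.1 (hm1.smul hf)
  have i2 : Integrable (fun x => f x • (ψ x • ∇ χ x)) volume :=
    memLp_one_iff_integrable.1 (hm2.smul hf)
  have i3 : Integrable (fun x => (χ x * ψ x) • g x) volume :=
    memLp_one_iff_integrable.1 (hg.smul hm3)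
  rw [integral_add i1 i2] at h1
  have e1 : ∫ x, (χ x * f x) • ∇ ψ x = ∫ x, f x • (χ x • ∇ ψ x) := by
    refine integral_congr_ae (ae_of_all _ fun x => ?_)
    simp only [smul_smul]
    rw [mul_comm]
  have e2 : ∫ x, ψ x • (χ x • g x + f x • ∇ χ x) =
      (∫ x, (χ x * ψ x) • g x) + ∫ x, f x • (ψ x • ∇ χ x) := by
    rw [← integral_add i3 i2]
    refine integral_congr_ae (ae_of_all _ fun x => ?_)
    simp only [smul_add, smul_smul]
    rw [mul_comm (ψ x) (χ x), mul_comm (ψ x) (f x)]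
  rw [e1, e2, neg_add, ← h1]
  exact (add_neg_cancel_right _ _).symm

lemma eLpNorm_two_pow_two {X E : Type*} [MeasurableSpace X] [NormedAddCommGroup E] (ν : Measure X)
    (g : X → E) : eLpNorm g 2 ν ^ 2 = ∫⁻ x, ‖g x‖ₑ ^ 2 ∂ν := by
  have := eLpNorm_nnreal_pow_eq_lintegral (μ := ν) (f := g) (p := 2) (by norm_num)
  simpa using this

/-- Dominated convergence applied to the squares, followed by a square root. -/
lemma tendsto_eLpNorm_two_of_dominated {X E E' : Type*} [MeasurableSpace X] [NormedAddCommGroup E]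
    [NormedAddCommGroup E'] {ν : Measure X} {F : ℕ → X → E} {f : X → E'} (hf : MemLp f 2 ν)
    (hF : ∀ k, AEStronglyMeasurable (F k) ν) (hb : ∀ k x, ‖F k x‖ ≤ ‖f x‖)
    (hl : ∀ x, Tendsto (fun k => F k x) atTop (𝓝 0)) :
    Tendsto (fun k => eLpNorm (F k) 2 ν) atTop (𝓝 0) := by
  have h1 : Tendsto (fun k => ∫⁻ x, ‖F k x‖ₑ ^ 2 ∂ν) atTop (𝓝 (∫⁻ _, 0 ∂ν)) := by
    refine tendsto_lintegral_of_dominated_convergence' (fun x => ‖f x‖ₑ ^ 2)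
      (fun k => (hF k).enorm.pow_const 2) (fun k => ae_of_all _ fun x => ?_) ?_
      (ae_of_all _ fun x => ?_)
    · have := enorm_le_iff_norm_le.2 (hb k x)
      exact pow_le_pow_left' this 2
    · rw [← eLpNorm_two_pow_two]
      exact ENNReal.pow_ne_top hf.2.ne
    · have := ENNReal.Tendsto.pow (n := 2) (hl x).enorm
      simpa using this
  simp only [lintegral_zero, ← eLpNorm_two_pow_two] at h1
  have h2 := h1.ennrpow_const (1 / 2 : ℝ)
  refine (h2.congr fun k => ?_).trans (by simp)
  rw [← ENNReal.rpow_natCast, ← ENNReal.rpow_mul]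
  norm_num

/-- Test functions are dense in `H¹`. -/
lemma HasWeakGradient.exists_near {n : ℕ} {f : Space n → ℝ} {g : Space n → Space n}
    (h : HasWeakGradient f g) (hf : MemLp f 2 volume) (hg : MemLp g 2 volume)
    {ε : ℝ≥0∞} (hε : 0 < ε) :
    ∃ ψ : Space n → ℝ, ContDiff ℝ ∞ ψ ∧ HasCompactSupport ψ ∧
      eLpNorm (fun x => ψ x - f x) 2 volume ≤ ε ∧ eLpNorm (fun x => ∇ ψ x - g x) 2 volume ≤ ε := by
  let φ : ContDiffBump (0 : Space n) := ⟨1, 2, one_pos, one_lt_two⟩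
  -- Truncation at radius of order `k + 1`: the gradient of the cut-off is of size `r k`, so its
  -- contribution vanishes in the limit.
  set r : ℕ → ℝ := fun k => ((k : ℝ) + 1)⁻¹ with hr
  have hr0 : ∀ k, 0 < r k := fun k => by positivity
  have hr1 : ∀ k, r k ≤ 1 := fun k => inv_le_one_of_one_le₀ (by simp)
  have hrt : Tendsto r atTop (𝓝 0) := by
    simpa [hr] using tendsto_one_div_add_atTop_nhds_zero_nat (𝕜 := ℝ)
  set χ : ℕ → Space n → ℝ := fun k x => φ (r k • x) with hχ
  have hφs : ContDiff ℝ ∞ φ := φ.contDiff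
  have hχs : ∀ k, ContDiff ℝ ∞ (χ k) := fun k => hφs.comp (contDiff_const_smul _)
  have hχc : ∀ k, HasCompactSupport (χ k) := fun k =>
    φ.hasCompactSupport.comp_homeomorph (Homeomorph.smulOfNeZero (r k) (hr0 k).ne')
  have hgr : ∀ k x, ∇ (χ k) x = r k • ∇ φ (r k • x) := by
    intro k x
    have h1 := ((hφs.differentiable (by simp)) (r k • x)).hasGradientAt.hasFDerivAt
    have h2 := h1.comp x ((hasFDerivAt_id x).const_smul (r k))
    apply HasGradientAt.gradient
    rw [hasGradientAt_iff_hasFDerivAt, map_smul]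
    refine h2.congr_fderiv ?_
    ext v
    simp
  obtain ⟨M, hM⟩ := (continuous_gradient hφs).norm.bddAbove_range_of_hasCompactSupport
    (hasCompactSupport_gradient φ.hasCompactSupport).norm
  have hM' : ∀ x, ‖∇ φ x‖ ≤ M := fun x => hM ⟨x, rfl⟩
  have hM0 : 0 ≤ M := (norm_nonneg _).trans (hM' 0)
  have hχl : ∀ x, Tendsto (fun k => χ k x - 1) atTop (𝓝 0) := by
    intro x
    have h1 : Tendsto (fun k => φ (r k • x)) atTop (𝓝 (φ ((0 : ℝ) • x))) :=
      (φ.continuous.tendsto _).comp (hrt.smul_const x)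
    have h2 : φ ((0 : ℝ) • x) = 1 := φ.one_of_mem_closedBall (by simp [φ])
    rw [h2] at h1
    simpa using h1.sub_const 1
  have hχb : ∀ k x, ‖χ k x - 1‖ ≤ 1 := by
    intro k x
    rw [Real.norm_eq_abs, abs_le]
    constructor <;> linarith [φ.nonneg (x := r k • x), φ.le_one (x := r k • x)]
  have c1 : Tendsto (fun k => eLpNorm (fun x => (χ k x - 1) * f x) 2 volume) atTop (𝓝 0) := by
    refine tendsto_eLpNorm_two_of_dominated hf (fun k => ?_) (fun k x => ?_) (fun x => ?_)
    · exact ((hχs k).continuous.sub continuous_const).aestronglyMeasurable.mul hf.1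
    · rw [norm_mul]; exact mul_le_of_le_one_left (norm_nonneg _) (hχb k x)
    · simpa using (hχl x).mul_const (f x)
  have c2 : Tendsto (fun k => eLpNorm (fun x => (χ k x - 1) • g x) 2 volume) atTop (𝓝 0) := by
    refine tendsto_eLpNorm_two_of_dominated hg (fun k => ?_) (fun k x => ?_) (fun x => ?_)
    · exact ((hχs k).continuous.sub continuous_const).aestronglyMeasurable.smul hg.1
    · rw [norm_smul]; exact mul_le_of_le_one_left (norm_nonneg _) (hχb k x)
    · simpa using (hχl x).smul_const (g x)
  have hb3 : ∀ k x, ‖f x • ∇ (χ k) x‖ ≤ r k * (M * |f x|) := by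
    intro k x
    rw [norm_smul, hgr, norm_smul, Real.norm_of_nonneg (hr0 k).le, Real.norm_eq_abs]
    have := mul_le_mul_of_nonneg_left (hM' (r k • x)) (mul_nonneg (abs_nonneg (f x)) (hr0 k).le)
    linarith
  have m3 : ∀ k, AEStronglyMeasurable (fun x => f x • ∇ (χ k) x) volume := fun k =>
    hf.1.smul (continuous_gradient (hχs k)).aestronglyMeasurable
  have c3 : Tendsto (fun k => eLpNorm (fun x => f x • ∇ (χ k) x) 2 volume) atTop (𝓝 0) := by
    refine tendsto_eLpNorm_two_of_dominated (hf.const_mul M) m3 (fun k x => ?_) (fun x => ?_)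
    · refine (hb3 k x).trans ?_
      rw [norm_mul, Real.norm_of_nonneg hM0, Real.norm_eq_abs]
      exact mul_le_of_le_one_left (by positivity) (hr1 k)
    · refine squeeze_zero_norm (fun k => hb3 k x) ?_
      simpa using hrt.mul_const (M * |f x|)
  -- Three shares pay for the truncation error of `f`, that of `g` and the gradient of the cut-off;
  -- the fourth pays for the mollification.
  have hε4 : 0 < ε / 4 := ENNReal.div_pos hε.ne' (by norm_num)
  obtain ⟨k, hk1, hk2, hk3⟩ := ((c1.eventually_le_const hε4).and
    ((c2.eventually_le_const hε4).and (c3.eventually_le_const hε4))).exists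
  have hf' : MemLp (fun x => χ k x * f x) 2 volume := by
    refine hf.of_le ((hχs k).continuous.aestronglyMeasurable.mul hf.1) (ae_of_all _ fun x => ?_)
    rw [norm_mul, Real.norm_of_nonneg φ.nonneg]
    exact mul_le_of_le_one_left (norm_nonneg _) φ.le_one
  have hg1 : MemLp (fun x => χ k x • g x) 2 volume := by
    refine hg.of_le ((hχs k).continuous.aestronglyMeasurable.smul hg.1) (ae_of_all _ fun x => ?_)
    rw [norm_smul, Real.norm_of_nonneg φ.nonneg]
    exact mul_le_of_le_one_left (norm_nonneg _) φ.le_one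
  have hg2 : MemLp (fun x => f x • ∇ (χ k) x) 2 volume := by
    refine (hf.const_mul M).of_le (m3 k) (ae_of_all _ fun x => (hb3 k x).trans ?_)
    rw [norm_mul, Real.norm_of_nonneg hM0, Real.norm_eq_abs]
    exact mul_le_of_le_one_left (by positivity) (hr1 k)
  obtain ⟨ψ, hψ, hψc, e1, e2⟩ := (h.smooth_mul hf hg (hχs k)).exists_near_of_hasCompactSupport
    hf' (hg1.add hg2) (hχc k).mul_right hε4
  have h4 : ε / 4 + ε / 4 + ε / 4 + ε / 4 = ε := by
    have := ENNReal.mul_div_cancel (a := 4) (b := ε) (by norm_num) (by norm_num)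
    calc ε / 4 + ε / 4 + ε / 4 + ε / 4 = 4 * (ε / 4) := by ring
      _ = ε := this
  refine ⟨ψ, hψ, hψc, ?_, ?_⟩
  · have : (fun x => ψ x - f x) = (fun x => ψ x - χ k x * f x) + fun x => (χ k x - 1) * f x := by
      ext x; simp; ring
    rw [this]
    refine (eLpNorm_add_le (hψ.continuous.aestronglyMeasurable.sub hf'.1) (((hχs k).continuous.sub continuous_const).aestronglyMeasurable.mul hf.1) (by norm_num)).trans ?_
    refine (add_le_add e1 hk1).trans ?_
    rw [add_assoc] at h4
    exact le_self_add.trans h4.le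
  · have : (fun x => ∇ ψ x - g x) = ((fun x => ∇ ψ x - (χ k x • g x + f x • ∇ (χ k) x)) +
        fun x => (χ k x - 1) • g x) + fun x => f x • ∇ (χ k) x := by
      ext1 x; simp only [Pi.add_apply, sub_smul, one_smul]; abel
    rw [this]
    have m1 : AEStronglyMeasurable (fun x => ∇ ψ x - (χ k x • g x + f x • ∇ (χ k) x)) volume :=
      (continuous_gradient hψ).aestronglyMeasurable.sub (hg1.add hg2).1
    have m2 : AEStronglyMeasurable (fun x => (χ k x - 1) • g x) volume :=
      ((hχs k).continuous.sub continuous_const).aestronglyMeasurable.smul hg.1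
    refine (eLpNorm_add_le (m1.add m2) (m3 k) (by norm_num)).trans ?_
    refine (add_le_add ((eLpNorm_add_le m1 m2 (by norm_num)).trans (add_le_add e2 hk2)) hk3).trans ?_
    exact le_self_add.trans h4.le

end EPD

namespace EPD

/-! ### The Sobolev embedding of `H¹` -/

lemma eLpNorm_fderiv_eq_gradient {n : ℕ} (ψ : Space n → ℝ) (r : ℝ≥0∞) :
    eLpNorm (fderiv ℝ ψ) r volume = eLpNorm (∇ ψ) r volume := by
  refine eLpNorm_congr_norm_ae (ae_of_all _ fun x => ?_)
  rw [gradient, LinearIsometryEquiv.norm_map]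

/-- Interpolation between `L²` and `L^q`. -/
lemma eLpNorm_le_of_interpolation {X E : Type*} [MeasurableSpace X] [NormedAddCommGroup E]
    {ν : Measure X} {f : X → E} (hf : AEStronglyMeasurable f ν) {q r : ℝ} (hr : 2 ≤ r)
    (hrq : r ≤ q) {A : ℝ≥0∞} (h2 : eLpNorm f 2 ν ≤ A) (hq : eLpNorm f (ENNReal.ofReal q) ν ≤ A) :
    eLpNorm f (ENNReal.ofReal r) ν ≤ A := by
  rcases hr.eq_or_lt with rfl | hr2
  · simpa using h2
  have hr0 : 0 < r := by linarith
  have hq0 : 0 < q := by linarith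
  have key : ∀ s : ℝ, 0 < s → eLpNorm f (ENNReal.ofReal s) ν ^ s = ∫⁻ x, ‖f x‖ₑ ^ s ∂ν := by
    intro s hs
    have := eLpNorm_nnreal_pow_eq_lintegral (μ := ν) (f := f) (p := s.toNNReal) (by simpa using hs)
    rw [Real.coe_toNNReal s hs.le] at this
    exact this
  set θ := (q - r) / (q - 2) with hθ
  have hq2 : 0 < q - 2 := by linarith
  have hθ0 : 0 ≤ θ := div_nonneg (by linarith) hq2.le
  have hθ1 : 0 ≤ 1 - θ := by
    rw [hθ, sub_nonneg, div_le_one hq2]; linarith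
  have hsum : 2 * θ + q * (1 - θ) = r := by rw [hθ]; field_simp; ring
  have h1 := ENNReal.lintegral_mul_norm_pow_le (μ := ν) (f := fun x => ‖f x‖ₑ ^ (2 : ℝ))
    (g := fun x => ‖f x‖ₑ ^ q) (hf.enorm.pow_const _) (hf.enorm.pow_const _) hθ0 hθ1 (by ring)
  rw [← ENNReal.rpow_le_rpow_iff hr0, key r hr0]
  have e : ∀ a : ℝ≥0∞, (a ^ (2 : ℝ)) ^ θ * (a ^ q) ^ (1 - θ) = a ^ r := by
    intro a
    rw [← ENNReal.rpow_mul, ← ENNReal.rpow_mul, ← ENNReal.rpow_add_of_nonneg _ _ (by positivity)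
      (by positivity), hsum]
  simp only [e] at h1
  refine h1.trans ?_
  rw [← key 2 (by norm_num), ← key q hq0, ← e A]
  have h2' : eLpNorm f (ENNReal.ofReal 2) ν ≤ A := by simpa using h2
  gcongr

/-- The inequality between a test function and its gradient that yields the Sobolev embedding. -/
def SobolevBound (n : ℕ) (q : ℝ) : Prop :=
  ∃ C : ℝ≥0∞, C ≠ ⊤ ∧ ∀ ψ : Space n → ℝ, ContDiff ℝ ∞ ψ → HasCompactSupport ψ →
    eLpNorm ψ (ENNReal.ofReal q) volume ≤ C * (eLpNorm ψ 2 volume + eLpNorm (∇ ψ) 2 volume)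

lemma SobolevBound.mono {n : ℕ} {q r : ℝ} (h : SobolevBound n q) (hr : 2 ≤ r) (hrq : r ≤ q) :
    SobolevBound n r := by
  obtain ⟨C, hC, h⟩ := h
  refine ⟨C + 1, by simp [hC], fun ψ hψ hψc => ?_⟩
  refine eLpNorm_le_of_interpolation hψ.continuous.aestronglyMeasurable hr hrq ?_ ?_
  · rw [add_mul, one_mul]
    exact le_self_add.trans le_add_self
  · refine (h ψ hψ hψc).trans ?_
    gcongr
    exact le_self_add

/-- The Gagliardo–Nirenberg–Sobolev inequality with exponent `2`; it uses only the gradient. -/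
lemma sobolevBound_critical {n : ℕ} (hn : 3 ≤ n) : SobolevBound n (2 * n / (n - 2)) := by
  have hn' : (3 : ℝ) ≤ n := by exact_mod_cast hn
  have hq : (0 : ℝ) < 2 * n / (n - 2) := div_pos (by linarith) (by linarith)
  refine ⟨(SNormLESNormFDerivOfEqConst ℝ (volume : Measure (Space n)) ((2 : NNReal) : ℝ) : NNReal),
    ENNReal.coe_ne_top,
    fun ψ hψ hψc => ?_⟩
  have h := eLpNorm_le_eLpNorm_fderiv_of_eq (μ := (volume : Measure (Space n)))
    (hψ.of_le (by simp) : ContDiff ℝ 1 ψ) hψc (p := 2)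
    (p' := (2 * (n : ℝ) / (n - 2)).toNNReal) (by norm_num) (by simp; omega) (by
      rw [Real.coe_toNNReal _ hq.le, finrank_euclideanSpace_fin]
      have : (n : ℝ) - 2 ≠ 0 := by linarith
      norm_num
      field_simp)
  rw [eLpNorm_fderiv_eq_gradient] at h
  exact h.trans (mul_le_mul' le_rfl le_add_self)

/-- In the plane the exponent `2` has no finite conjugate. Instead the Sobolev inequality is applied
to `ψ²`, whose gradient `2ψ∇ψ` is estimated by Hölder in `L^r · L²`, so that a bound in `L^r`
improves to one in `L^{2r}`. -/
lemma sobolevBound_double {r : ℝ} (hr : 2 ≤ r) (h : SobolevBound 2 r) :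
    SobolevBound 2 (r * 2) := by
  obtain ⟨C, hC, h⟩ := h
  have hr0 : 0 < r := by linarith
  -- The Hölder exponent `1/s = 1/r + 1/2`; in dimension two its Sobolev conjugate is `r`.
  set s : ℝ := 2 * r / (2 + r) with hs
  have hs0 : 0 < s := by positivity
  have hs1 : 1 ≤ s := by rw [hs, le_div_iff₀ (by positivity)]; linarith
  set K : ℝ≥0∞ := ((SNormLESNormFDerivOfEqConst ℝ (volume : Measure (Space 2))
    (s.toNNReal : ℝ) : NNReal) : ℝ≥0∞) with hK
  -- The added `1` makes the square of the constant dominate `K * (2 * C)`, so no square root has to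
  -- be taken.
  refine ⟨K * (2 * C) + 1, by
    simp only [ne_eq, ENNReal.add_eq_top, ENNReal.one_ne_top, or_false]
    exact ENNReal.mul_ne_top ENNReal.coe_ne_top (ENNReal.mul_ne_top (by norm_num) hC),
    fun ψ hψ hψc => ?_⟩
  set H := eLpNorm ψ 2 volume + eLpNorm (∇ ψ) 2 volume with hH
  have hsq : ContDiff ℝ ∞ fun x => ψ x ^ 2 := hψ.pow 2
  have hsqc : HasCompactSupport fun x => ψ x ^ 2 := hψc.comp_left (g := fun y => y ^ 2) (by simp)
  have h1 := eLpNorm_le_eLpNorm_fderiv_of_eq (μ := (volume : Measure (Space 2)))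
    (hsq.of_le (by simp) : ContDiff ℝ 1 _) hsqc (p := s.toNNReal) (p' := r.toNNReal)
    (by simpa using hs1) (by simp) (by
      rw [Real.coe_toNNReal _ hr0.le, NNReal.coe_inv, Real.coe_toNNReal _ hs0.le,
        finrank_euclideanSpace_fin, hs]
      push_cast
      field_simp
      ring)
  have e1 : eLpNorm (fun x => ψ x ^ 2) (r.toNNReal : ℝ≥0∞) volume =
      eLpNorm ψ (ENNReal.ofReal (r * 2)) volume ^ 2 := by
    have := eLpNorm_norm_rpow (μ := (volume : Measure (Space 2))) (p := ENNReal.ofReal r) ψ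
      (q := 2) (by norm_num)
    rw [← ENNReal.ofReal_mul hr0.le] at this
    simp only [ENNReal.rpow_ofNat, Real.rpow_ofNat, Real.norm_eq_abs, sq_abs] at this
    exact this
  have e2 : ∀ x, ‖fderiv ℝ (fun x => ψ x ^ 2) x‖ = ‖(2 * ψ x) • ∇ ψ x‖ := by
    intro x
    have := (((hψ.differentiable (by simp)) x).hasFDerivAt.pow 2).fderiv
    rw [this, norm_smul, norm_smul (2 * ψ x), gradient, LinearIsometryEquiv.norm_map]
    simp
  have e3 : eLpNorm (fderiv ℝ fun x => ψ x ^ 2) (s.toNNReal : ℝ≥0∞) volume ≤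
      2 * (eLpNorm ψ (ENNReal.ofReal r) volume * eLpNorm (∇ ψ) 2 volume) := by
    rw [eLpNorm_congr_norm_ae (ae_of_all _ e2)]
    have hol : ENNReal.HolderTriple (ENNReal.ofReal r) 2 (s.toNNReal : ℝ≥0∞) := by
      constructor
      have a1 : (ENNReal.ofReal r)⁻¹ = ENNReal.ofReal r⁻¹ := (ENNReal.ofReal_inv_of_pos hr0).symm
      have a2 : (s.toNNReal : ℝ≥0∞)⁻¹ = ENNReal.ofReal s⁻¹ := (ENNReal.ofReal_inv_of_pos hs0).symm
      have a3 : (2 : ℝ≥0∞)⁻¹ = ENNReal.ofReal 2⁻¹ := by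
        rw [ENNReal.ofReal_inv_of_pos (by norm_num)]; simp
      rw [a1, a2, a3, ← ENNReal.ofReal_add (by positivity) (by positivity), hs]
      congr 1
      field_simp
    have := eLpNorm_smul_le_mul_eLpNorm (μ := (volume : Measure (Space 2)))
      (p := ENNReal.ofReal r) (q := 2) (r := (s.toNNReal : ℝ≥0∞)) (φ := fun x => 2 * ψ x)
      (f := ∇ ψ) (continuous_gradient hψ).aestronglyMeasurable
      (continuous_const.mul hψ.continuous).aestronglyMeasurable
    refine this.trans ?_
    have e4 : eLpNorm (fun x => 2 * ψ x) (ENNReal.ofReal r) volume =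
        2 * eLpNorm ψ (ENNReal.ofReal r) volume := by
      have := eLpNorm_const_smul (2 : ℝ) ψ (ENNReal.ofReal r) (volume : Measure (Space 2))
      simpa [Pi.smul_def, Real.enorm_eq_ofReal_abs] using this
    rw [e4, mul_assoc]
  rw [← ENNReal.pow_le_pow_left_iff (n := 2) (by norm_num), ← e1]
  have h5 : eLpNorm ψ (ENNReal.ofReal r) volume ≤ C * H := h ψ hψ hψc
  have h6 : eLpNorm (∇ ψ) 2 volume ≤ H := le_add_self
  calc eLpNorm (fun x => ψ x ^ 2) (r.toNNReal : ℝ≥0∞) volume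
      ≤ K * (2 * ((C * H) * H)) := 
        h1.trans (mul_le_mul' le_rfl (e3.trans (by gcongr)))
    _ = (K * (2 * C)) * H ^ 2 := by ring
    _ ≤ (K * (2 * C) + 1) ^ 2 * H ^ 2 := by
        gcongr
        calc K * (2 * C) ≤ K * (2 * C) + 1 := le_self_add
          _ ≤ (K * (2 * C) + 1) ^ 2 := le_self_pow₀ le_add_self (by norm_num)
    _ = ((K * (2 * C) + 1) * H) ^ 2 := by ring

/-- For `n ≥ 3` the condition on `p` places `2p` below the critical exponent; for `n = 2` repeated
doubling from `L²` passes every exponent. Interpolation with `L²` does the rest. -/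
lemma sobolevBound_of_wellPosedPower {n : ℕ} (hn : 2 ≤ n) {p : ℝ} (hp : 1 ≤ p)
    (h : WellPosedPower n p) : SobolevBound n (2 * p) := by
  rcases hn.eq_or_lt with rfl | h3
  · have key : ∀ k : ℕ, SobolevBound 2 (2 * 2 ^ k) := by
      intro k
      induction k with
      | zero => exact ⟨1, by simp, fun ψ _ _ => by simp⟩
      | succ k ih =>
        have := sobolevBound_double (r := 2 * 2 ^ k) (by
          have := one_le_pow₀ (M₀ := ℝ) (a := 2) (n := k) (by norm_num); linarith) ih
        rwa [mul_assoc, ← pow_succ] at this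
    obtain ⟨k, hk⟩ := pow_unbounded_of_one_lt p (one_lt_two : (1 : ℝ) < 2)
    exact (key k).mono (by linarith) (by linarith)
  · have h3' : (3 : ℝ) ≤ n := by exact_mod_cast h3
    have := h h3
    refine (sobolevBound_critical h3).mono (by linarith) ?_
    rw [mul_div_assoc]
    linarith

/-- Approximation by test functions in `H¹`; the `L^q` norm is lower semicontinuous along an almost
everywhere convergent subsequence. -/
lemma HasWeakGradient.eLpNorm_le {n : ℕ} {q : ℝ} {C : ℝ≥0∞} (hC : C ≠ ⊤)
    (hS : ∀ ψ : Space n → ℝ, ContDiff ℝ ∞ ψ → HasCompactSupport ψ →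
      eLpNorm ψ (ENNReal.ofReal q) volume ≤ C * (eLpNorm ψ 2 volume + eLpNorm (∇ ψ) 2 volume))
    {f : Space n → ℝ} {g : Space n → Space n} (h : HasWeakGradient f g)
    (hf : MemLp f 2 volume) (hg : MemLp g 2 volume) :
    eLpNorm f (ENNReal.ofReal q) volume ≤ C * (eLpNorm f 2 volume + eLpNorm g 2 volume) := by
  -- At `k = 0` the tolerance is `∞`, which is harmless.
  have hε : ∀ k : ℕ, (0 : ℝ≥0∞) < ((k : ℝ≥0∞))⁻¹ := fun k => by simp
  choose ψ hψ hψc e1 e2 using fun k => h.exists_near hf hg (hε k)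
  have hlim : Tendsto (fun k => eLpNorm (ψ k - f) 2 volume) atTop (𝓝 0) :=
    tendsto_of_tendsto_of_tendsto_of_le_of_le tendsto_const_nhds ENNReal.tendsto_inv_nat_nhds_zero
      (fun _ => zero_le) e1
  obtain ⟨ns, hns, hae⟩ := (tendstoInMeasure_of_tendsto_eLpNorm (by norm_num)
    (fun k => (hψ k).continuous.aestronglyMeasurable) hf.1 hlim).exists_seq_tendsto_ae
  refine (Lp.eLpNorm_lim_le_liminf_eLpNorm (f := fun k => ψ (ns k))
    (fun k => (hψ _).continuous.aestronglyMeasurable) f hae).trans ?_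
  have hb : ∀ k, eLpNorm (ψ k) (ENNReal.ofReal q) volume ≤
      C * ((eLpNorm f 2 volume + (k : ℝ≥0∞)⁻¹) + (eLpNorm g 2 volume + (k : ℝ≥0∞)⁻¹)) := by
    intro k
    refine (hS _ (hψ k) (hψc k)).trans ?_
    gcongr
    · have : ψ k = f + fun x => ψ k x - f x := by ext x; simp
      rw [this]
      refine (eLpNorm_add_le hf.1 ((hψ k).continuous.aestronglyMeasurable.sub hf.1)
        (by norm_num)).trans ?_
      gcongr
      exact e1 k
    · have : ∇ (ψ k) = g + fun x => ∇ (ψ k) x - g x := by ext1 x; simp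
      rw [this]
      refine (eLpNorm_add_le hg.1 ((continuous_gradient (hψ k)).aestronglyMeasurable.sub hg.1)
        (by norm_num)).trans ?_
      gcongr
      exact e2 k
  have ht : Tendsto (fun k : ℕ => C * ((eLpNorm f 2 volume + (k : ℝ≥0∞)⁻¹) +
      (eLpNorm g 2 volume + (k : ℝ≥0∞)⁻¹))) atTop
      (𝓝 (C * ((eLpNorm f 2 volume + 0) + (eLpNorm g 2 volume + 0)))) :=
    ENNReal.Tendsto.const_mul ((tendsto_const_nhds.add ENNReal.tendsto_inv_nat_nhds_zero).add
      (tendsto_const_nhds.add ENNReal.tendsto_inv_nat_nhds_zero)) (Or.inr hC)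
  rw [add_zero, add_zero] at ht
  rw [← (ht.comp hns.tendsto_atTop).liminf_eq]
  exact liminf_le_liminf (Eventually.of_forall fun k => hb (ns k))

end EPD

namespace EPD

/-! ### The power nonlinearity on `L^{2p}` -/

/-- Bernoulli's inequality applied to the quotient of the smaller by the larger modulus. -/
lemma abs_rpow_sub_rpow_le {p : ℝ} (hp : 1 < p) (a b : ℝ) :
    |(|a| ^ p - |b| ^ p)| ≤ p * (|a - b| * (|a| + |b|) ^ (p - 1)) := by
  have key : ∀ x y : ℝ, 0 ≤ y → y ≤ x → x ^ p - y ^ p ≤ p * ((x - y) * x ^ (p - 1)) := by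
    intro x y hy hxy
    rcases hy.trans hxy |>.eq_or_lt with hx | hx
    · rw [← hx] at hxy ⊢
      have : y = 0 := le_antisymm hxy hy
      simp [this]
    have h1 := one_add_mul_self_le_rpow_one_add (s := y / x - 1) (by
      have : 0 ≤ y / x := by positivity
      linarith) hp.le
    have h2 : (1 + (y / x - 1)) ^ p = y ^ p / x ^ p := by
      rw [← Real.div_rpow hy hx.le]; congr 1; ring
    have h3 : x ^ p = x * x ^ (p - 1) := by
      rw [← Real.rpow_one_add' hx.le (by linarith)]; congr 1; ring
    have h4 : 0 < x ^ p := Real.rpow_pos_of_pos hx p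
    rw [h2, le_div_iff₀ h4] at h1
    have h5 : (1 + p * (y / x - 1)) * x ^ p = x ^ p - p * ((x - y) * x ^ (p - 1)) := by
      rw [h3]; field_simp; ring
    linarith
  have main : ∀ x y : ℝ, |y| ≤ |x| →
      |(|x| ^ p - |y| ^ p)| ≤ p * (|x - y| * (|x| + |y|) ^ (p - 1)) := by
    intro x y h
    rw [abs_of_nonneg (sub_nonneg.2 (Real.rpow_le_rpow (abs_nonneg _) h (by linarith)))]
    refine (key _ _ (abs_nonneg y) h).trans ?_
    have h6 : |x| - |y| ≤ |x - y| := abs_sub_abs_le_abs_sub x y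
    have h7 : |x| ^ (p - 1) ≤ (|x| + |y|) ^ (p - 1) :=
      Real.rpow_le_rpow (abs_nonneg _) (by linarith [abs_nonneg y]) (by linarith)
    gcongr
  rcases le_total |b| |a| with h | h
  · exact main a b h
  · rw [abs_sub_comm, abs_sub_comm a b, add_comm |a|]; exact main b a h

/-- Hölder with `1/2 = 1/(2p) + (p-1)/(2p)`. This is where the embedding into `L^{2p}` meets the
power nonlinearity. -/
lemma eLpNorm_mul_abs_rpow_le {X : Type*} [MeasurableSpace X] {ν : Measure X} {p : ℝ} (hp : 1 < p)
    {a b : X → ℝ} (ha : AEStronglyMeasurable a ν) (hb : AEStronglyMeasurable b ν) :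
    eLpNorm (fun x => a x * |b x| ^ (p - 1)) 2 ν ≤
      eLpNorm a (ENNReal.ofReal (2 * p)) ν * eLpNorm b (ENNReal.ofReal (2 * p)) ν ^ (p - 1) := by
  have hp1 : 0 < p - 1 := by linarith
  have hq : 0 < 2 * p / (p - 1) := by positivity
  have hol : ENNReal.HolderTriple (ENNReal.ofReal (2 * p)) (ENNReal.ofReal (2 * p / (p - 1))) 2 := by
    constructor
    rw [← ENNReal.ofReal_inv_of_pos (by positivity), ← ENNReal.ofReal_inv_of_pos hq,
      ← ENNReal.ofReal_add (by positivity) (by positivity)]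
    have : (2 : ℝ≥0∞)⁻¹ = ENNReal.ofReal 2⁻¹ := by
      rw [ENNReal.ofReal_inv_of_pos (by norm_num)]; simp
    rw [this]
    congr 1
    field_simp
    ring
  have hbm : AEStronglyMeasurable (fun x => |b x| ^ (p - 1)) ν :=
    (hb.aemeasurable.abs.pow_const _).aestronglyMeasurable
  have h1 := eLpNorm_smul_le_mul_eLpNorm (μ := ν) (p := ENNReal.ofReal (2 * p))
    (q := ENNReal.ofReal (2 * p / (p - 1))) (r := 2) (φ := a) (f := fun x => |b x| ^ (p - 1)) hbm ha
  have h2 := eLpNorm_norm_rpow (μ := ν) (p := ENNReal.ofReal (2 * p / (p - 1))) b hp1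
  rw [← ENNReal.ofReal_mul hq.le, div_mul_cancel₀ _ hp1.ne'] at h2
  simp only [Real.norm_eq_abs] at h2
  rw [h2] at h1
  exact h1

lemma memLp_abs_rpow {X : Type*} [MeasurableSpace X] {ν : Measure X} {p : ℝ} (hp : 1 < p)
    {f : X → ℝ} (hf : MemLp f (ENNReal.ofReal (2 * p)) ν) : MemLp (fun x => |f x| ^ p) 2 ν := by
  refine ⟨(hf.1.aemeasurable.abs.pow_const _).aestronglyMeasurable, ?_⟩
  have h2 := eLpNorm_norm_rpow (μ := ν) (p := 2) f (q := p) (by linarith)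
  have h3 : (2 : ℝ≥0∞) * ENNReal.ofReal p = ENNReal.ofReal (2 * p) := by
    rw [ENNReal.ofReal_mul (by norm_num)]; simp
  rw [h3] at h2
  simp only [Real.norm_eq_abs] at h2
  rw [h2]
  exact ENNReal.rpow_lt_top_of_nonneg (by linarith) hf.2.ne

lemma eLpNorm_abs_rpow_sub_le {X : Type*} [MeasurableSpace X] {ν : Measure X} {p : ℝ} (hp : 1 < p)
    {a b : X → ℝ} (ha : AEStronglyMeasurable a ν) (hb : AEStronglyMeasurable b ν) :
    eLpNorm (fun x => |a x| ^ p - |b x| ^ p) 2 ν ≤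
      ENNReal.ofReal p * (eLpNorm (fun x => a x - b x) (ENNReal.ofReal (2 * p)) ν *
        (eLpNorm a (ENNReal.ofReal (2 * p)) ν + eLpNorm b (ENNReal.ofReal (2 * p)) ν) ^ (p - 1)) := by
  have hp0 : 0 < p := by linarith
  have hs : AEStronglyMeasurable (fun x => |a x| + |b x|) ν :=
    (ha.aemeasurable.abs.add hb.aemeasurable.abs).aestronglyMeasurable
  calc eLpNorm (fun x => |a x| ^ p - |b x| ^ p) 2 ν
      ≤ eLpNorm (fun x => p • ((a x - b x) * |(|a x| + |b x|)| ^ (p - 1))) 2 ν := by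
        refine eLpNorm_mono fun x => ?_
        rw [Real.norm_eq_abs, norm_smul, norm_mul, Real.norm_of_nonneg hp0.le,
          abs_of_nonneg (add_nonneg (abs_nonneg (a x)) (abs_nonneg (b x))),
          Real.norm_of_nonneg (Real.rpow_nonneg (by positivity) _), Real.norm_eq_abs]
        exact abs_rpow_sub_rpow_le hp _ _
    _ = ENNReal.ofReal p * eLpNorm (fun x => (a x - b x) * |(|a x| + |b x|)| ^ (p - 1)) 2 ν := by
        have := eLpNorm_const_smul p (fun x => (a x - b x) * |(|a x| + |b x|)| ^ (p - 1)) 2 ν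
        rw [Real.enorm_of_nonneg hp0.le] at this
        exact this
    _ ≤ _ := by
        gcongr
        refine (eLpNorm_mul_abs_rpow_le hp (ha.sub hb) hs).trans ?_
        have h2 : eLpNorm (fun x => |a x| + |b x|) (ENNReal.ofReal (2 * p)) ν ≤
            eLpNorm a (ENNReal.ofReal (2 * p)) ν + eLpNorm b (ENNReal.ofReal (2 * p)) ν := by
          refine (eLpNorm_add_le ha.norm hb.norm ?_).trans ?_
          · rw [← ENNReal.ofReal_one]; exact ENNReal.ofReal_le_ofReal (by linarith)
          · rw [eLpNorm_norm, eLpNorm_norm]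
        have : 0 ≤ p - 1 := by linarith
        gcongr
        exact le_rfl

/-- The function `|f|^p` in `L²`, where it is square integrable. -/
noncomputable def absPow {n : ℕ} (p : ℝ) (f : Lp ℝ 2 (volume : Measure (Space n))) :
    Lp ℝ 2 (volume : Measure (Space n)) :=
  open scoped Classical in
  if h : MemLp (fun x => |f x| ^ p) 2 volume then h.toLp _ else 0

lemma coeFn_absPow {n : ℕ} {p : ℝ} (hp : 1 < p) {f : Lp ℝ 2 (volume : Measure (Space n))}
    (hf : MemLp f (ENNReal.ofReal (2 * p)) volume) : absPow p f =ᵐ[volume] fun x => |f x| ^ p := by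
  have h := memLp_abs_rpow hp hf
  rw [absPow, dif_pos h]
  exact h.coeFn_toLp

lemma HasWeakGradient.sub {n : ℕ} {f f' : Lp ℝ 2 (volume : Measure (Space n))}
    {g g' : Lp (Space n) 2 (volume : Measure (Space n))} (h : HasWeakGradient f g)
    (h' : HasWeakGradient f' g') : HasWeakGradient (f - f' : Lp ℝ 2 _) (g - g' : Lp _ 2 _) := by
  intro ψ hψ hc
  have hm := memLp_of_contDiff hψ hc
  have hm' := memLp_gradient hψ hc
  have i1 : ∀ f : Lp ℝ 2 (volume : Measure (Space n)), Integrable (fun x => f x • ∇ ψ x) volume :=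
    fun f => memLp_one_iff_integrable.1 (hm'.smul (Lp.memLp f))
  have i2 : ∀ g : Lp (Space n) 2 (volume : Measure (Space n)),
      Integrable (fun x => ψ x • g x) volume :=
    fun g => memLp_one_iff_integrable.1 ((Lp.memLp g).smul hm)
  have e1 : ∫ x, (f - f' : Lp ℝ 2 _) x • ∇ ψ x = ∫ x, (f x • ∇ ψ x - f' x • ∇ ψ x) :=
    integral_congr_ae ((Lp.coeFn_sub f f').mono fun x hx => by
      simp only [hx, Pi.sub_apply, sub_smul])
  have e2 : ∫ x, ψ x • (g - g' : Lp _ 2 _) x = ∫ x, (ψ x • g x - ψ x • g' x) :=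
    integral_congr_ae ((Lp.coeFn_sub g g').mono fun x hx => by
      simp only [hx, Pi.sub_apply, smul_sub])
  rw [e1, e2, integral_sub (i1 f) (i1 f'), integral_sub (i2 g) (i2 g'), h ψ hψ hc, h' ψ hψ hc]
  abel

lemma HasWeakGradient.const_smul {n : ℕ} {f : Lp ℝ 2 (volume : Measure (Space n))}
    {g : Lp (Space n) 2 (volume : Measure (Space n))} (h : HasWeakGradient f g) (c : ℝ) :
    HasWeakGradient (c • f : Lp ℝ 2 _) (c • g : Lp _ 2 _) := by
  intro ψ hψ hc
  have e1 : ∫ x, (c • f : Lp ℝ 2 _) x • ∇ ψ x = ∫ x, c • (f x • ∇ ψ x) :=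
    integral_congr_ae ((Lp.coeFn_smul c f).mono fun x hx => by
      simp only [hx, Pi.smul_apply, smul_assoc])
  have e2 : ∫ x, ψ x • (c • g : Lp _ 2 _) x = ∫ x, c • (ψ x • g x) :=
    integral_congr_ae ((Lp.coeFn_smul c g).mono fun x hx => by
      simp only [hx, Pi.smul_apply]; rw [smul_comm])
  rw [e1, e2, integral_smul, integral_smul, h ψ hψ hc, smul_neg]

/-- The constant `C` of the Sobolev embedding `H¹ ⊂ L^{2p}`, for elements of `L²`. -/
def SobolevConst (n : ℕ) (p : ℝ) (C : NNReal) : Prop :=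
  ∀ (f : Space n → ℝ) (g : Space n → Space n), HasWeakGradient f g → MemLp f 2 volume →
    MemLp g 2 volume →
    eLpNorm f (ENNReal.ofReal (2 * p)) volume ≤ C * (eLpNorm f 2 volume + eLpNorm g 2 volume)

lemma exists_sobolevConst {n : ℕ} (hn : 2 ≤ n) {p : ℝ} (hp : 1 ≤ p) (h : WellPosedPower n p) :
    ∃ C, SobolevConst n p C := by
  obtain ⟨C, hC, hS⟩ := sobolevBound_of_wellPosedPower hn hp h
  lift C to NNReal using hC
  exact ⟨C, fun f g hfg hf hg => hfg.eLpNorm_le ENNReal.coe_ne_top hS hf hg⟩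

variable {n : ℕ} {μ α p T : ℝ} {u : ℝ → Space n → ℝ}
  {U V : ℝ → Lp ℝ 2 (volume : Measure (Space n))}
  {G : ℝ → Lp (Space n) 2 (volume : Measure (Space n))} {C : NNReal}

lemma EnergyCurves.memLp (h : EnergyCurves μ α p T u U V G) (hS : SobolevConst n p C) {t : ℝ}
    (ht : t ∈ Ico 0 T) : MemLp (U t) (ENNReal.ofReal (2 * p)) volume := by
  refine ⟨Lp.aestronglyMeasurable _, (hS _ _ (h.grad t ht) (Lp.memLp _) (Lp.memLp _)).trans_lt ?_⟩
  exact ENNReal.mul_lt_top ENNReal.coe_lt_top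
    (ENNReal.add_lt_top.2 ⟨Lp.eLpNorm_lt_top _, Lp.eLpNorm_lt_top _⟩)

/-- Continuity with values in `H¹` passes to `L^{2p}` by applying the Sobolev inequality to
differences. -/
lemma EnergyCurves.tendsto_eLpNorm_sub (h : EnergyCurves μ α p T u U V G)
    (hS : SobolevConst n p C) {t : ℝ} (ht : t ∈ Ico 0 T) :
    Tendsto (fun s => eLpNorm (fun x => U s x - U t x) (ENNReal.ofReal (2 * p)) volume)
      (𝓝[Ico 0 T] t) (𝓝 0) := by
  have h1 : Tendsto (fun s => (C : ℝ≥0∞) * (edist (U s) (U t) + edist (G s) (G t)))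
      (𝓝[Ico 0 T] t) (𝓝 (C * (0 + 0))) := by
    refine ENNReal.Tendsto.const_mul (Tendsto.add ?_ ?_) (Or.inr ENNReal.coe_ne_top)
    · exact tendsto_iff_edist_tendsto_0.1 (h.contU t ht)
    · exact tendsto_iff_edist_tendsto_0.1 (h.contG t ht)
  rw [add_zero, mul_zero] at h1
  refine tendsto_of_tendsto_of_tendsto_of_le_of_le' tendsto_const_nhds h1
    (Eventually.of_forall fun _ => zero_le) ?_
  filter_upwards [self_mem_nhdsWithin] with s hs
  have h2 := hS _ _ ((h.grad s hs).sub (h.grad t ht)) (Lp.memLp _) (Lp.memLp _)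
  rw [eLpNorm_congr_ae (Lp.coeFn_sub (U s) (U t)), ← Lp.enorm_def, ← Lp.enorm_def,
    ← edist_eq_enorm_sub, ← edist_eq_enorm_sub] at h2
  exact h2

lemma EnergyCurves.continuousOn_absPow (h : EnergyCurves μ α p T u U V G) (hp : 1 < p)
    (hS : SobolevConst n p C) : ContinuousOn (fun s => absPow p (U s)) (Ico 0 T) := by
  intro t ht
  rw [ContinuousWithinAt, tendsto_iff_edist_tendsto_0]
  have h1 := h.tendsto_eLpNorm_sub hS ht
  set r := ENNReal.ofReal (2 * p) with hr
  have hr1 : 1 ≤ r := by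
    rw [hr, ← ENNReal.ofReal_one]; exact ENNReal.ofReal_le_ofReal (by linarith)
  have hb : ∀ s, eLpNorm (U s) r volume ≤ eLpNorm (fun x => U s x - U t x) r volume +
      eLpNorm (U t) r volume := by
    intro s
    have := eLpNorm_add_le (μ := volume) (f := fun x => U s x - U t x) (g := U t) (p := r)
      ((Lp.aestronglyMeasurable _).sub (Lp.aestronglyMeasurable _)) (Lp.aestronglyMeasurable _) hr1
    refine le_trans (le_of_eq ?_) this
    congr 1
    ext x
    simp
  set B := eLpNorm (U t) r volume with hB
  have hBt : B ≠ ⊤ := (h.memLp hS ht).2.ne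
  have h2 : Tendsto (fun s => ENNReal.ofReal p * (eLpNorm (fun x => U s x - U t x) r volume *
      (eLpNorm (fun x => U s x - U t x) r volume + B + B) ^ (p - 1))) (𝓝[Ico 0 T] t)
      (𝓝 (ENNReal.ofReal p * (0 * (0 + B + B) ^ (p - 1)))) := by
    refine ENNReal.Tendsto.const_mul (ENNReal.Tendsto.mul h1 (Or.inr ?_) ?_ (Or.inr ?_))
      (Or.inr ENNReal.ofReal_ne_top)
    · exact ENNReal.rpow_ne_top_of_nonneg (by linarith) (by simp [hBt])
    · exact ((h1.add tendsto_const_nhds).add tendsto_const_nhds).ennrpow_const _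
    · simp
  rw [zero_mul, mul_zero] at h2
  refine tendsto_of_tendsto_of_tendsto_of_le_of_le' tendsto_const_nhds h2
    (Eventually.of_forall fun _ => zero_le) ?_
  filter_upwards [self_mem_nhdsWithin] with s hs
  rw [Lp.edist_def]
  have e1 : (absPow p (U s) - absPow p (U t) : Space n → ℝ) =ᵐ[volume]
      fun x => |U s x| ^ p - |U t x| ^ p := by
    filter_upwards [coeFn_absPow hp (h.memLp hS hs), coeFn_absPow hp (h.memLp hS ht)] with x h1 h2
    rw [Pi.sub_apply, h1, h2]
  rw [eLpNorm_congr_ae e1]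
  refine (eLpNorm_abs_rpow_sub_le hp (Lp.aestronglyMeasurable _)
    (Lp.aestronglyMeasurable _)).trans ?_
  have : 0 ≤ p - 1 := by linarith
  gcongr
  exact hb s

/-- On compact time intervals the nonlinearity is dominated by a linear term in `L²` and a small
linear term in `L^{2p}`. -/
lemma EnergyCurves.exists_absPow_le (h : EnergyCurves μ α p T u U V G) (hp : 1 < p)
    (hS : SobolevConst n p C) {b : ℝ} (hb : b < T) {η : ℝ} (hη : 0 < η) :
    ∃ R : ℝ, 0 ≤ R ∧ ∀ s ∈ Icc 0 b, ∀ f : Space n → ℝ, AEStronglyMeasurable f volume →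
      eLpNorm (fun x => f x * |U s x| ^ (p - 1)) 2 volume ≤
        ENNReal.ofReal R * eLpNorm f 2 volume +
          ENNReal.ofReal η * eLpNorm f (ENNReal.ofReal (2 * p)) volume := by
  set r := ENNReal.ofReal (2 * p) with hr
  have hq : 0 < p - 1 := by linarith
  have hc : 0 < (3 : ℝ) ^ (p - 1) := by positivity
  -- The factor `2` accounts for the two small pieces below, and `3 ^ (p - 1)` for splitting the
  -- power of a sum of three terms.
  obtain ⟨η', hη', hη1⟩ : ∃ η' : ℝ, 0 < η' ∧ 2 * ((3 : ℝ) ^ (p - 1) * η' ^ (p - 1)) ≤ η := by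
    refine ⟨(η / (2 * 3 ^ (p - 1))) ^ (p - 1)⁻¹, by positivity, ?_⟩
    rw [Real.rpow_inv_rpow (by positivity) hq.ne']
    apply le_of_eq
    field_simp
  refine isCompact_Icc.induction_on (p := fun K => ∃ R : ℝ, 0 ≤ R ∧ ∀ s ∈ K,
    ∀ f : Space n → ℝ, AEStronglyMeasurable f volume →
      eLpNorm (fun x => f x * |U s x| ^ (p - 1)) 2 volume ≤
        ENNReal.ofReal R * eLpNorm f 2 volume + ENNReal.ofReal η * eLpNorm f r volume)
    ⟨0, le_rfl, by simp⟩ ?_ ?_ ?_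
  · rintro A B hAB ⟨R, hR, hR'⟩
    exact ⟨R, hR, fun s hs => hR' s (hAB hs)⟩
  · rintro A B ⟨R, hR, hR'⟩ ⟨Q, hQ, hQ'⟩
    refine ⟨max R Q, hR.trans (le_max_left _ _), fun s hs f hf => ?_⟩
    rcases hs with hs | hs
    · refine (hR' s hs f hf).trans ?_
      gcongr
      exact le_max_left _ _
    · refine (hQ' s hs f hf).trans ?_
      gcongr
      exact le_max_right _ _
  · intro t ht
    have ht' : t ∈ Ico 0 T := ⟨ht.1, ht.2.trans_lt hb⟩
    -- Near a time `t`, `U s` is a part bounded by `M`, the tail `E` of `U t`, and the increment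
    -- `F`; the last two are small in `L^{2p}`. Compactness of `[0, b]` makes the bound uniform.
    obtain ⟨M, hM0, hM⟩ := (h.memLp hS ht').eLpNorm_indicator_norm_ge_pos_le
      (Lp.stronglyMeasurable _) hη'
    have hev := (h.tendsto_eLpNorm_sub hS ht').eventually_le_const
      (ENNReal.ofReal_pos.2 hη')
    have hsub : Icc 0 b ⊆ Ico 0 T := fun s hs => ⟨hs.1, hs.2.trans_lt hb⟩
    refine ⟨_, nhdsWithin_mono _ hsub hev, 3 ^ (p - 1) * M ^ (p - 1), by positivity,
      fun s hs f hf => ?_⟩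
    set F : Space n → ℝ := fun x => U s x - U t x with hF
    set E : Space n → ℝ := {x | M ≤ ‖U t x‖₊}.indicator (U t) with hE
    have hFm : AEStronglyMeasurable F volume :=
      (Lp.aestronglyMeasurable _).sub (Lp.aestronglyMeasurable _)
    have hEm : AEStronglyMeasurable E volume := by
      refine ((Lp.stronglyMeasurable (U t)).indicator ?_).aestronglyMeasurable
      exact measurableSet_le measurable_const (Lp.stronglyMeasurable (U t)).measurable.nnnorm.coe_nnreal_real
    have hpt : ∀ x, |U s x| ^ (p - 1) ≤ 3 ^ (p - 1) *
        (M ^ (p - 1) + (|F x| ^ (p - 1) + |E x| ^ (p - 1))) := by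
      intro x
      have h1 : |U s x| ≤ |F x| + (|E x| + M) := by
        have h2 : |U s x| ≤ |F x| + |U t x| := by
          have := abs_add_le (U s x - U t x) (U t x); simpa [hF] using this
        have h3 : |U t x| ≤ |E x| + M := by
          by_cases hx : x ∈ {x | M ≤ ‖U t x‖₊}
          · rw [hE, indicator_of_mem hx]; linarith
          · rw [hE, indicator_of_notMem hx]
            simp only [mem_ofPred_eq, coe_nnnorm, Real.norm_eq_abs, not_le] at hx
            simpa using hx.le
        linarith
      set m := max M (max |F x| |E x|) with hm
      have hm0 : 0 ≤ m := hM0.le.trans (le_max_left _ _)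
      have h4 : |U s x| ≤ 3 * m := by
        have := le_max_left M (max |F x| |E x|)
        have := (le_max_left |F x| |E x|).trans (le_max_right M _)
        have := (le_max_right |F x| |E x|).trans (le_max_right M _)
        linarith
      refine (Real.rpow_le_rpow (abs_nonneg _) h4 hq.le).trans ?_
      rw [Real.mul_rpow (by norm_num) hm0]
      gcongr
      have p1 : 0 ≤ M ^ (p - 1) := by positivity
      have p2 : 0 ≤ |F x| ^ (p - 1) := by positivity
      have p3 : 0 ≤ |E x| ^ (p - 1) := by positivity
      rcases max_choice M (max |F x| |E x|) with h5 | h5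
      · rw [hm, h5]; linarith
      · rcases max_choice |F x| |E x| with h6 | h6 <;> rw [hm, h5, h6] <;> linarith
    set c : ℝ := 3 ^ (p - 1) with hcdef
    have hFm' : AEStronglyMeasurable (fun x => f x * |F x| ^ (p - 1)) volume :=
      hf.mul (hFm.aemeasurable.abs.pow_const _).aestronglyMeasurable
    have hEm' : AEStronglyMeasurable (fun x => f x * |E x| ^ (p - 1)) volume :=
      hf.mul (hEm.aemeasurable.abs.pow_const _).aestronglyMeasurable
    have hsm : ∀ (a : ℝ), 0 ≤ a → ∀ g : Space n → ℝ,
        eLpNorm (fun x => a * g x) 2 volume = ENNReal.ofReal a * eLpNorm g 2 volume := by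
      intro a ha g
      have := eLpNorm_const_smul a g 2 (volume : Measure (Space n))
      rw [Real.enorm_of_nonneg ha] at this
      exact this
    have small : ∀ g : Space n → ℝ, AEStronglyMeasurable g volume →
        eLpNorm g r volume ≤ ENNReal.ofReal η' →
        eLpNorm (fun x => f x * |g x| ^ (p - 1)) 2 volume ≤
          ENNReal.ofReal (η' ^ (p - 1)) * eLpNorm f r volume := by
      intro g hg hgη
      refine (eLpNorm_mul_abs_rpow_le hp hf hg).trans ?_
      rw [mul_comm, ← ENNReal.ofReal_rpow_of_pos hη']
      gcongr
    calc eLpNorm (fun x => f x * |U s x| ^ (p - 1)) 2 volume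
        ≤ eLpNorm (fun x => c * (M ^ (p - 1) * |f x| +
            (|f x * |F x| ^ (p - 1)| + |f x * |E x| ^ (p - 1)|))) 2 volume := by
          refine eLpNorm_mono fun x => ?_
          rw [norm_mul, Real.norm_of_nonneg (Real.rpow_nonneg (abs_nonneg _) _), Real.norm_eq_abs,
            Real.norm_of_nonneg (by positivity), abs_mul, abs_mul,
            abs_of_nonneg (Real.rpow_nonneg (abs_nonneg (F x)) _),
            abs_of_nonneg (Real.rpow_nonneg (abs_nonneg (E x)) _)]
          refine (mul_le_mul_of_nonneg_left (hpt x) (abs_nonneg _)).trans (le_of_eq ?_)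
          ring
      _ = ENNReal.ofReal c * eLpNorm (fun x => M ^ (p - 1) * |f x| +
            (|f x * |F x| ^ (p - 1)| + |f x * |E x| ^ (p - 1)|)) 2 volume := hsm c hc.le _
      _ ≤ ENNReal.ofReal c * (ENNReal.ofReal (M ^ (p - 1)) * eLpNorm f 2 volume +
            (ENNReal.ofReal (η' ^ (p - 1)) * eLpNorm f r volume +
              ENNReal.ofReal (η' ^ (p - 1)) * eLpNorm f r volume)) := by
          refine mul_le_mul' le_rfl ?_
          refine (eLpNorm_add_le (hf.norm.const_mul _) (hFm'.norm.add hEm'.norm)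
            (by norm_num)).trans ?_
          refine add_le_add ?_ ?_
          · rw [hsm _ (by positivity)]
            exact mul_le_mul' le_rfl (eLpNorm_norm f).le
          · refine (eLpNorm_add_le hFm'.norm hEm'.norm (by norm_num)).trans ?_
            refine add_le_add ?_ ?_
            · exact (eLpNorm_norm _).le.trans (small F hFm hs)
            · exact (eLpNorm_norm _).le.trans (small E hEm hM)
      _ = ENNReal.ofReal (c * M ^ (p - 1)) * eLpNorm f 2 volume +
            ENNReal.ofReal (2 * (c * η' ^ (p - 1))) * eLpNorm f r volume := by
          rw [ENNReal.ofReal_mul hc.le, ENNReal.ofReal_mul (by norm_num : (0 : ℝ) ≤ 2),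
            ENNReal.ofReal_mul hc.le, ENNReal.ofReal_ofNat]
          ring
      _ ≤ _ := by
          gcongr

end EPD

namespace EPD

/-! ### The weighted energy inequality -/

/-- A smooth bounded weight whose logarithmic gradient is at most `Λ`. -/
structure IsWeight {n : ℕ} (S : Space n → ℝ) (Λ : ℝ) : Prop where
  rate_nonneg : 0 ≤ Λ
  smooth : ContDiff ℝ ∞ S
  nonneg : ∀ x, 0 ≤ S x
  le_one : ∀ x, S x ≤ 1
  grad_le : ∀ x, ‖∇ S x‖ ≤ Λ * S x

lemma IsWeight.memLp_top {n : ℕ} {S : Space n → ℝ} {Λ : ℝ} (h : IsWeight S Λ) :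
    MemLp S ∞ volume :=
  memLp_top_of_bound h.smooth.continuous.aestronglyMeasurable 1
    (ae_of_all _ fun x => by rw [Real.norm_of_nonneg (h.nonneg x)]; exact h.le_one x)

/-- Multiplication with a bounded function, as an operator on `L²`. -/
noncomputable def mulOp {n : ℕ} {E : Type*} [NormedAddCommGroup E] [NormedSpace ℝ E]
    {S : Space n → ℝ} (hS : MemLp S ∞ volume) :
    Lp E 2 (volume : Measure (Space n)) →L[ℝ] Lp E 2 (volume : Measure (Space n)) :=
  (ContinuousLinearMap.lsmul ℝ ℝ : ℝ →L[ℝ] E →L[ℝ] E).holderL volume ∞ 2 2 (hS.toLp S)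

lemma coeFn_mulOp {n : ℕ} {E : Type*} [NormedAddCommGroup E] [NormedSpace ℝ E]
    {S : Space n → ℝ} (hS : MemLp S ∞ volume) (f : Lp E 2 (volume : Measure (Space n))) :
    mulOp hS f =ᵐ[volume] fun x => S x • f x := by
  have h1 := (ContinuousLinearMap.lsmul ℝ ℝ : ℝ →L[ℝ] E →L[ℝ] E).coeFn_holder (r := 2)
    (hS.toLp S) f
  filter_upwards [h1, hS.coeFn_toLp] with x h1 h2
  change (ContinuousLinearMap.holder 2 (ContinuousLinearMap.lsmul ℝ ℝ : ℝ →L[ℝ] E →L[ℝ] E)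
    (hS.toLp S) f) x = _
  rw [h1, h2]
  simp

lemma inner_mulOp {n : ℕ} {E : Type*} [NormedAddCommGroup E] [InnerProductSpace ℝ E]
    {S : Space n → ℝ} (hS : MemLp S ∞ volume) (f g : Lp E 2 (volume : Measure (Space n))) :
    ⟪f, mulOp hS g⟫ = ⟪mulOp hS f, g⟫ := by
  rw [L2.inner_def, L2.inner_def]
  refine integral_congr_ae ?_
  filter_upwards [coeFn_mulOp hS f, coeFn_mulOp hS g] with x h1 h2
  rw [h1, h2, real_inner_smul_left, real_inner_smul_right]

/-- The gradient of the product of an `H¹` function with the square of a weight. -/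
lemma IsWeight.exists_gradient {n : ℕ} {S : Space n → ℝ} {Λ : ℝ} (h : IsWeight S Λ)
    {W : Lp ℝ 2 (volume : Measure (Space n))} {Γ : Lp (Space n) 2 (volume : Measure (Space n))}
    (hW : HasWeakGradient W Γ) (X : Lp (Space n) 2 (volume : Measure (Space n))) :
    ∃ Γ' : Lp (Space n) 2 (volume : Measure (Space n)),
      HasWeakGradient (mulOp h.memLp_top (mulOp h.memLp_top W)) Γ' ∧
      ⟪mulOp h.memLp_top X, mulOp h.memLp_top Γ⟫ -
        2 * Λ * (‖mulOp h.memLp_top W‖ * ‖mulOp h.memLp_top X‖) ≤ ⟪X, Γ'⟫ := by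
  set A : Lp ℝ 2 (volume : Measure (Space n)) →L[ℝ] Lp ℝ 2 (volume : Measure (Space n)) :=
    mulOp h.memLp_top with hA
  set B : Lp (Space n) 2 (volume : Measure (Space n)) →L[ℝ]
    Lp (Space n) 2 (volume : Measure (Space n)) := mulOp h.memLp_top with hB
  have hS2 : ContDiff ℝ ∞ fun x => S x * S x := h.smooth.mul h.smooth
  have hprod := hW.smooth_mul (Lp.memLp W) (Lp.memLp Γ) hS2
  have hgr : ∀ x, ∇ (fun x => S x * S x) x = (2 * S x) • ∇ S x := by
    intro x
    rw [gradient_mul h.smooth h.smooth, ← add_smul]; congr 1; ring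
  have hm : MemLp (fun x => W x • ∇ (fun x => S x * S x) x) 2 volume := by
    refine ((Lp.memLp W).const_mul (2 * Λ)).of_le ((Lp.aestronglyMeasurable W).smul
      (continuous_gradient hS2).aestronglyMeasurable) (ae_of_all _ fun x => ?_)
    have h0 := h.nonneg x
    have h1 := h.le_one x
    have h2 := h.grad_le x
    have h3 : 0 ≤ Λ * S x := (norm_nonneg _).trans h2
    have h4 : S x * ‖∇ S x‖ ≤ |Λ| := by
      calc S x * ‖∇ S x‖ ≤ 1 * (Λ * S x) := by gcongr
        _ ≤ |Λ| * 1 := by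
          rw [one_mul]
          exact mul_le_mul (le_abs_self _) h1 h0 (abs_nonneg _)
        _ = |Λ| := mul_one _
    rw [norm_smul, hgr, norm_smul, norm_mul (2 * Λ), Real.norm_eq_abs (2 * Λ), abs_mul,
      Real.norm_of_nonneg (by linarith : 0 ≤ 2 * S x), abs_of_pos (by norm_num : (0:ℝ) < 2),
      mul_comm]
    refine mul_le_mul_of_nonneg_right ?_ (norm_nonneg _)
    linarith
  refine ⟨B (B Γ) + hm.toLp _, ?_, ?_⟩
  · refine hprod.congr_ae ?_ ?_
    · filter_upwards [coeFn_mulOp h.memLp_top (A W), coeFn_mulOp h.memLp_top W] with x h1 h2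
      rw [h1, h2, smul_eq_mul, smul_eq_mul, mul_assoc]
    · filter_upwards [Lp.coeFn_add (B (B Γ)) (hm.toLp _), hm.coeFn_toLp,
        coeFn_mulOp h.memLp_top (B Γ), coeFn_mulOp h.memLp_top Γ] with x h1 h2 h3 h4
      rw [h1, Pi.add_apply, h2, h3, h4, smul_smul]
  · have e := inner_mulOp h.memLp_top X (B Γ)
    rw [← hB] at e
    rw [inner_add_right, e]
    -- The term with `∇(S²) = 2S∇S`: one factor `S` goes to `W`, while `‖∇S‖ ≤ ΛS` supplies the
    -- other for `X`.
    have key : |⟪X, hm.toLp _⟫| ≤ 2 * Λ * (‖A W‖ * ‖B X‖) := by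
      have i1 : Integrable (fun x => ‖A W x‖ * ‖B X x‖) volume :=
        memLp_one_iff_integrable.1 ((Lp.memLp (B X)).norm.mul (Lp.memLp (A W)).norm)
      have hcs : ∫ x, ‖A W x‖ * ‖B X x‖ ≤ ‖A W‖ * ‖B X‖ := by
        have h1 := integral_mul_le_Lp_mul_Lq_of_nonneg (μ := (volume : Measure (Space n)))
          (p := 2) (q := 2) (by constructor <;> norm_num)
          (f := fun x => ‖A W x‖) (g := fun x => ‖B X x‖) (ae_of_all _ fun x => norm_nonneg _)
          (ae_of_all _ fun x => norm_nonneg _) (by simpa using (Lp.memLp (A W)).norm)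
          (by simpa using (Lp.memLp (B X)).norm)
        have e1 : ∀ {E : Type} [NormedAddCommGroup E] [InnerProductSpace ℝ E]
            (f : Lp E 2 (volume : Measure (Space n))),
            (∫ x, ‖f x‖ ^ (2 : ℝ)) ^ (1 / 2 : ℝ) = ‖f‖ := by
          intro E _ _ f
          have : ∫ x, ‖f x‖ ^ (2 : ℝ) = ‖f‖ ^ 2 := by
            rw [← real_inner_self_eq_norm_sq, L2.inner_def]
            refine integral_congr_ae (ae_of_all _ fun x => ?_)
            simp
          rw [this, ← Real.sqrt_eq_rpow, Real.sqrt_sq (norm_nonneg _)]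
        rwa [e1, e1] at h1
      rw [L2.inner_def]
      refine (abs_integral_le_integral_abs).trans ?_
      have hΛ : ∀ᵐ x ∂(volume : Measure (Space n)), |⟪X x, hm.toLp _ x⟫| ≤
          2 * Λ * (‖A W x‖ * ‖B X x‖) := by
        filter_upwards [hm.coeFn_toLp, coeFn_mulOp h.memLp_top W, coeFn_mulOp h.memLp_top X]
          with x h1 h2 h3
        rw [h1, h2, h3, hgr, real_inner_smul_right, real_inner_smul_right, abs_mul, abs_mul,
          norm_smul, norm_smul, Real.norm_of_nonneg (h.nonneg x), Real.norm_eq_abs,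
          abs_of_nonneg (mul_nonneg zero_le_two (h.nonneg x))]
        have h5 : |⟪X x, ∇ S x⟫| ≤ ‖X x‖ * (Λ * S x) :=
          (abs_real_inner_le_norm _ _).trans
            (mul_le_mul_of_nonneg_left (h.grad_le x) (norm_nonneg _))
        have h6 : 0 ≤ |W x| * (2 * S x) :=
          mul_nonneg (abs_nonneg _) (mul_nonneg zero_le_two (h.nonneg x))
        nlinarith [mul_le_mul_of_nonneg_left h5 h6]
      calc ∫ x, |⟪X x, hm.toLp _ x⟫| ≤ ∫ x, 2 * Λ * (‖A W x‖ * ‖B X x‖) := by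
            refine integral_mono_ae ?_ (i1.const_mul _) hΛ
            exact (L2.integrable_inner X (hm.toLp _)).abs
        _ = 2 * Λ * ∫ x, ‖A W x‖ * ‖B X x‖ := integral_const_mul _ _
        _ ≤ 2 * Λ * (‖A W‖ * ‖B X‖) := by
            have := h.rate_nonneg
            gcongr
    have := (abs_le.1 key).1
    linarith

variable {n : ℕ} {μ α p T : ℝ} {u : ℝ → Space n → ℝ}
  {U V : ℝ → Lp ℝ 2 (volume : Measure (Space n))}
  {G : ℝ → Lp (Space n) 2 (volume : Measure (Space n))} {C : NNReal}

/-- The right hand side of the equation `V' - div G = forcing`, as a curve in `L²`. -/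
noncomputable def forcing (μ α p : ℝ) (U V : ℝ → Lp ℝ 2 (volume : Measure (Space n))) (s : ℝ) :
    Lp ℝ 2 (volume : Measure (Space n)) :=
  s ^ α • absPow p (U s) - (μ / s) • V s

lemma EnergyCurves.continuousOn_source (h : EnergyCurves μ α p T u U V G) (hα : 0 ≤ α)
    (hp : 1 < p) (hS : SobolevConst n p C) :
    ContinuousOn (fun s => s ^ α • absPow p (U s)) (Ico 0 T) :=
  (Real.continuous_rpow_const hα).continuousOn.smul (h.continuousOn_absPow hp hS)

lemma EnergyCurves.continuousOn_forcing (h : EnergyCurves μ α p T u U V G) (hα : 0 ≤ α)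
    (hp : 1 < p) (hS : SobolevConst n p C) :
    ContinuousOn (forcing μ α p U V) (Ioo 0 T) := by
  have h1 : ContinuousOn (fun s : ℝ => μ / s) (Ioo 0 T) :=
    continuousOn_const.div continuousOn_id fun s hs => hs.1.ne'
  exact ((h.continuousOn_source hα hp hS).mono Ioo_subset_Ico_self).sub
    (h1.smul (h.contV.mono Ioo_subset_Ico_self))

lemma EnergyCurves.nonlin_eq_inner (h : EnergyCurves μ α p T u U V G) (hp : 1 < p)
    (hS : SobolevConst n p C) {w : Space n → ℝ} (hw : MemLp w 2 volume) {s : ℝ}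
    (hs : s ∈ Ico 0 T) : nonlin α p u w s = ⟪hw.toLp w, s ^ α • absPow p (U s)⟫ := by
  rw [inner_smul_right, ← integral_mul_eq_inner _ hw, ← integral_const_mul, nonlin]
  refine integral_congr_ae ?_
  filter_upwards [h.ae_eq s hs, coeFn_absPow hp (h.memLp hS hs)] with x h1 h2
  rw [h1, h2, mul_assoc]

/-- Now `|u|^p` is a continuous curve in `L²`, so the weighted identity of `EnergyCurves.integrated`
can be differentiated and the factor `t^μ` removed at positive times. -/
lemma EnergyCurves.difference_test (h : EnergyCurves μ α p T u U V G) (hμ : 0 < μ) (hα : 0 ≤ α)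
    (hp : 1 < p) (hS : SobolevConst n p C) {w : Space n → ℝ} (hw : ContDiff ℝ ∞ w)
    (hc : HasCompactSupport w) {a b : ℝ} (ha : 0 < a) (hab : a ≤ b) (hb : b < T) :
    ⟪(memLp_of_contDiff hw hc).toLp w, V b - V a - ∫ s in a..b, forcing μ α p U V s⟫ +
      ⟪(memLp_gradient hw hc).toLp (∇ w), ∫ s in a..b, G s⟫ = 0 := by
  set W := (memLp_of_contDiff hw hc).toLp w with hW
  set Γ := (memLp_gradient hw hc).toLp (∇ w) with hΓ
  have hsub : ∀ s ∈ uIcc a b, s ∈ Ioo 0 T := fun s hs => by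
    rw [uIcc_of_le hab] at hs
    exact ⟨ha.trans_le hs.1, hs.2.trans_lt hb⟩
  set k : ℝ → ℝ := fun s => ⟪W, s ^ α • absPow p (U s)⟫ - ⟪Γ, G s⟫ with hk
  have hkc : ContinuousOn k (Ico 0 T) :=
    (continuousOn_const.inner (h.continuousOn_source hα hp hS)).sub
      (continuousOn_const.inner h.contG)
  have hkeq : ∀ s ∈ Ico 0 T, nonlin α p u w s - ∫ x, ⟪G s x, ∇ w x⟫ = k s := by
    intro s hs
    rw [h.nonlin_eq_inner hp hS (memLp_of_contDiff hw hc) hs,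
      integral_inner_eq_inner _ (memLp_gradient hw hc), real_inner_comm _ (G s)]
  have hstar : ∀ t ∈ Ico 0 T, t ^ μ * ⟪W, V t⟫ = ∫ s in (0 : ℝ)..t, s ^ μ * k s := by
    intro t ht
    rw [← integral_mul_eq_inner, (h.integrated hμ hw hc ht).2]
    refine intervalIntegral.integral_congr fun s hs => ?_
    rw [uIcc_of_le ht.1] at hs
    simp only [hkeq s ⟨hs.1, hs.2.trans_lt ht.2⟩]
  have hfc : ContinuousOn (fun s => s ^ μ * k s) (Ico 0 T) :=
    (Real.continuous_rpow_const hμ.le).continuousOn.mul hkc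
  have hder : ∀ t ∈ Ioo 0 T, HasDerivAt (fun s => ⟪W, V s⟫) (k t - μ / t * ⟪W, V t⟫) t := by
    intro t ht
    have hnt : Ico 0 T ∈ 𝓝 t := Ico_mem_nhds ht.1 ht.2
    have h1 : HasDerivAt (fun t => ∫ s in (0 : ℝ)..t, s ^ μ * k s) (t ^ μ * k t) t := by
      refine intervalIntegral.integral_hasDerivAt_right ?_ ?_ (hfc.continuousAt hnt)
      · refine (hfc.mono ?_).intervalIntegrable
        rw [uIcc_of_le ht.1.le]
        exact fun s hs => ⟨hs.1, hs.2.trans_lt ht.2⟩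
      · exact hfc.stronglyMeasurableAtFilter_nhdsWithin measurableSet_Ico t |>.filter_mono
          (by rw [nhdsWithin_eq_nhds.2 hnt])
    have h2 : HasDerivAt (fun s : ℝ => s ^ (-μ)) (-μ * t ^ (-μ - 1)) t := by
      simpa using Real.hasDerivAt_rpow_const (x := t) (p := -μ) (Or.inl ht.1.ne')
    have h3 := h2.mul h1
    have h4 : (fun s => ⟪W, V s⟫) =ᶠ[𝓝 t]
        (fun s : ℝ => s ^ (-μ)) * fun t => ∫ s in (0 : ℝ)..t, s ^ μ * k s := by
      filter_upwards [Ioo_mem_nhds ht.1 ht.2] with s hs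
      rw [Pi.mul_apply, ← hstar s ⟨hs.1.le, hs.2⟩, ← mul_assoc, ← Real.rpow_add hs.1]
      simp
    refine (h3.congr_of_eventuallyEq h4).congr_deriv ?_
    rw [← hstar t ⟨ht.1.le, ht.2⟩, Real.rpow_sub_one ht.1.ne', Real.rpow_neg ht.1.le]
    have : t ^ μ ≠ 0 := (Real.rpow_pos_of_pos ht.1 μ).ne'
    have := ht.1.ne'
    field_simp
    ring
  have hVc : ContinuousOn (fun s => ⟪W, V s⟫) (Ico 0 T) := continuousOn_const.inner h.contV
  have hFc := h.continuousOn_forcing hα hp hS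
  have hIntg : ∀ s ∈ Ioo 0 T, k s - μ / s * ⟪W, V s⟫ = ⟪W, forcing μ α p U V s⟫ - ⟪Γ, G s⟫ := by
    intro s _
    rw [hk, forcing, inner_sub_right, inner_smul_right _ _ (μ / s)]
    ring
  have cF : ContinuousOn (forcing μ α p U V) (uIcc a b) := hFc.mono hsub
  have cG : ContinuousOn G (uIcc a b) := h.contG.mono fun s hs => Ioo_subset_Ico_self (hsub s hs)
  have hftc := intervalIntegral.integral_eq_sub_of_hasDerivAt
    (f := fun s => ⟪W, V s⟫) (f' := fun s => k s - μ / s * ⟪W, V s⟫) (a := a) (b := b)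
    (fun s hs => hder s (hsub s hs)) (by
      refine ContinuousOn.intervalIntegrable ?_
      refine ContinuousOn.congr (f := fun s => ⟪W, forcing μ α p U V s⟫ - ⟪Γ, G s⟫) ?_
        fun s hs => hIntg s (hsub s hs)
      exact (continuousOn_const.inner cF).sub (continuousOn_const.inner cG))
  have e1 : ∫ s in a..b, (k s - μ / s * ⟪W, V s⟫) =
      ⟪W, ∫ s in a..b, forcing μ α p U V s⟫ - ⟪Γ, ∫ s in a..b, G s⟫ := by
    rw [intervalIntegral.integral_congr fun s hs => hIntg s (hsub s hs),
      intervalIntegral.integral_sub (continuousOn_const.inner cF).intervalIntegrable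
        (continuousOn_const.inner cG).intervalIntegrable]
    congr 1
    · exact ContinuousLinearMap.intervalIntegral_comp_comm (innerSL ℝ W) cF.intervalIntegrable
    · exact ContinuousLinearMap.intervalIntegral_comp_comm (innerSL ℝ Γ) cG.intervalIntegrable
  rw [e1] at hftc
  rw [inner_sub_right, inner_sub_right]
  linarith

/-- The equation, integrated in time and tested with an `H¹` function. -/
lemma EnergyCurves.difference (h : EnergyCurves μ α p T u U V G) (hμ : 0 < μ) (hα : 0 ≤ α)
    (hp : 1 < p) (hS : SobolevConst n p C) {W : Lp ℝ 2 (volume : Measure (Space n))}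
    {Γ : Lp (Space n) 2 (volume : Measure (Space n))} (hW : HasWeakGradient W Γ) {a b : ℝ}
    (ha : 0 < a) (hab : a ≤ b) (hb : b < T) :
    ⟪W, V b - V a - ∫ s in a..b, forcing μ α p U V s⟫ + ⟪Γ, ∫ s in a..b, G s⟫ = 0 := by
  set X := V b - V a - ∫ s in a..b, forcing μ α p U V s with hX
  set Y := ∫ s in a..b, G s with hY
  -- The functional of `(W, Γ)` is bounded in the `H¹` norm and vanishes on test functions, which
  -- are dense.
  have key : ∀ ε : ℝ, 0 < ε → |⟪W, X⟫ + ⟪Γ, Y⟫| ≤ ε * (‖X‖ + ‖Y‖) := by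
    intro ε hε
    obtain ⟨ψ, hψ, hψc, e1, e2⟩ := hW.exists_near (Lp.memLp W) (Lp.memLp Γ)
      (ENNReal.ofReal_pos.2 hε)
    have h0 := h.difference_test hμ hα hp hS hψ hψc ha hab hb
    rw [← hX, ← hY] at h0
    set W' := (memLp_of_contDiff hψ hψc).toLp ψ with hW'
    set Γ' := (memLp_gradient hψ hψc).toLp (∇ ψ) with hΓ'
    have d1 : ‖W' - W‖ ≤ ε := by
      rw [← ENNReal.ofReal_le_ofReal_iff hε.le, ofReal_norm, Lp.enorm_def]
      refine le_trans (le_of_eq (eLpNorm_congr_ae ?_)) e1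
      filter_upwards [Lp.coeFn_sub W' W, (memLp_of_contDiff hψ hψc).coeFn_toLp] with x h1 h2
      rw [h1, Pi.sub_apply, h2]
    have d2 : ‖Γ' - Γ‖ ≤ ε := by
      rw [← ENNReal.ofReal_le_ofReal_iff hε.le, ofReal_norm, Lp.enorm_def]
      refine le_trans (le_of_eq (eLpNorm_congr_ae ?_)) e2
      filter_upwards [Lp.coeFn_sub Γ' Γ, (memLp_gradient hψ hψc).coeFn_toLp] with x h1 h2
      rw [h1, Pi.sub_apply, h2]
    have e : ⟪W, X⟫ + ⟪Γ, Y⟫ = -(⟪W' - W, X⟫ + ⟪Γ' - Γ, Y⟫) := by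
      rw [inner_sub_left, inner_sub_left]; linarith
    rw [e, abs_neg]
    calc |⟪W' - W, X⟫ + ⟪Γ' - Γ, Y⟫| ≤ |⟪W' - W, X⟫| + |⟪Γ' - Γ, Y⟫| := abs_add_le _ _
      _ ≤ ‖W' - W‖ * ‖X‖ + ‖Γ' - Γ‖ * ‖Y‖ :=
        add_le_add (abs_real_inner_le_norm _ _) (abs_real_inner_le_norm _ _)
      _ ≤ ε * ‖X‖ + ε * ‖Y‖ := by gcongr
      _ = ε * (‖X‖ + ‖Y‖) := by ring
  by_contra hne
  have hpos : 0 < |⟪W, X⟫ + ⟪Γ, Y⟫| := abs_pos.2 hne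
  have h1 := key (|⟪W, X⟫ + ⟪Γ, Y⟫| / (2 * (‖X‖ + ‖Y‖ + 1))) (by positivity)
  rw [div_mul_eq_mul_div, le_div_iff₀ (by positivity)] at h1
  nlinarith [norm_nonneg X, norm_nonneg Y]

end EPD

namespace EPD

/-! ### Averages in time -/

/-- The average of a curve over `[t, t + τ]`. -/
noncomputable def avg {H : Type*} [NormedAddCommGroup H] [NormedSpace ℝ H] (τ : ℝ) (Y : ℝ → H)
    (t : ℝ) : H := τ⁻¹ • ∫ s in t..t + τ, Y s

lemma norm_avg_le {H : Type*} [NormedAddCommGroup H] [NormedSpace ℝ H] {Y : ℝ → H} {M : ℝ} (hM : ∀ s, ‖Y s‖ ≤ M) {τ : ℝ} (hτ : 0 < τ) (t : ℝ) :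
    ‖avg τ Y t‖ ≤ M := by
  have h1 := intervalIntegral.norm_integral_le_of_norm_le_const (a := t) (b := t + τ) (f := Y)
    (C := M) fun s _ => hM s
  rw [avg, norm_smul, norm_inv, Real.norm_of_nonneg hτ.le, inv_mul_le_iff₀ hτ]
  rw [add_sub_cancel_left, abs_of_pos hτ] at h1
  linarith

section avg

variable {H : Type*} [NormedAddCommGroup H] [NormedSpace ℝ H] [CompleteSpace H] {Y : ℝ → H}

lemma hasDerivAt_avg (hY : Continuous Y) (τ t : ℝ) :
    HasDerivAt (avg τ Y) (τ⁻¹ • (Y (t + τ) - Y t)) t := by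
  have hi : ∀ a b, IntervalIntegrable Y volume a b := fun a b => hY.intervalIntegrable a b
  have h1 : ∀ x, HasDerivAt (fun t => ∫ s in (0 : ℝ)..t, Y s) (Y x) x := fun x =>
    intervalIntegral.integral_hasDerivAt_right (hi _ _) hY.aestronglyMeasurable.stronglyMeasurableAtFilter
      hY.continuousAt
  have h2 : (fun t => ∫ s in t..t + τ, Y s) =
      fun t => (∫ s in (0 : ℝ)..t + τ, Y s) - ∫ s in (0 : ℝ)..t, Y s := by
    ext1 t
    rw [intervalIntegral.integral_interval_sub_left (hi _ _) (hi _ _)]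
  have h3 : HasDerivAt (fun t => ∫ s in t..t + τ, Y s) (Y (t + τ) - Y t) t := by
    rw [h2]
    exact (HasDerivAt.comp_add_const t τ (h1 (t + τ))).sub (h1 t)
  exact h3.const_smul τ⁻¹

lemma continuous_avg (hY : Continuous Y) (τ : ℝ) : Continuous (avg τ Y) :=
  continuous_iff_continuousAt.2 fun t => (hasDerivAt_avg hY τ t).continuousAt

lemma tendsto_avg (hY : Continuous Y) (t : ℝ) :
    Tendsto (fun τ => avg τ Y t) (𝓝[>] 0) (𝓝 (Y t)) := by
  have h1 : HasDerivAt (fun τ => ∫ s in t..τ, Y s) (Y t) t :=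
    intervalIntegral.integral_hasDerivAt_right (hY.intervalIntegrable _ _)
      hY.aestronglyMeasurable.stronglyMeasurableAtFilter hY.continuousAt
  have h2 := (hasDerivAt_iff_tendsto_slope_zero.1 h1).mono_left
    (nhdsWithin_mono (0 : ℝ) (fun x hx => ne_of_gt hx : Ioi (0 : ℝ) ⊆ {0}ᶜ))
  simpa [avg] using h2

end avg

variable {n : ℕ} {μ α p T : ℝ} {u : ℝ → Space n → ℝ}
  {U V : ℝ → Lp ℝ 2 (volume : Measure (Space n))}
  {G : ℝ → Lp (Space n) 2 (volume : Measure (Space n))} {C : NNReal} {S : Space n → ℝ} {Λ : ℝ}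

lemma EnergyCurves.sub_eq_integral (h : EnergyCurves μ α p T u U V G) {a b : ℝ} (ha : 0 < a)
    (hab : a ≤ b) (hb : b < T) : U b - U a = ∫ s in a..b, V s := by
  have hsub : ∀ s ∈ uIcc a b, s ∈ Ioo 0 T := fun s hs => by
    rw [uIcc_of_le hab] at hs
    exact ⟨ha.trans_le hs.1, hs.2.trans_lt hb⟩
  refine (intervalIntegral.integral_eq_sub_of_hasDerivAt (fun s hs => ?_) ?_).symm
  · exact (h.hasDeriv s (Ioo_subset_Ico_self (hsub s hs))).hasDerivAt
      (Ico_mem_nhds (hsub s hs).1 (hsub s hs).2)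
  · exact (h.contV.mono fun s hs => Ioo_subset_Ico_self (hsub s hs)).intervalIntegrable

set_option maxHeartbeats 2000000 in
/-- The weighted energy inequality on a compact time interval away from the singular time. -/
lemma EnergyCurves.energy_sub_le (h : EnergyCurves μ α p T u U V G) (hμ : 0 < μ) (hα : 0 ≤ α)
    (hp : 1 < p) (hS : SobolevConst n p C) (hw : IsWeight S Λ) {a b : ℝ} (ha : 0 < a)
    (hab : a ≤ b) (hb : b < T) :
    (‖mulOp hw.memLp_top (V b)‖ ^ 2 + ‖mulOp hw.memLp_top (G b)‖ ^ 2) / 2 -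
      (‖mulOp hw.memLp_top (V a)‖ ^ 2 + ‖mulOp hw.memLp_top (G a)‖ ^ 2) / 2 ≤
    ∫ s in a..b, (⟪mulOp hw.memLp_top (forcing μ α p U V s), mulOp hw.memLp_top (V s)⟫ +
      2 * Λ * (‖mulOp hw.memLp_top (V s)‖ * ‖mulOp hw.memLp_top (G s)‖)) := by
  set A : Lp ℝ 2 (volume : Measure (Space n)) →L[ℝ] Lp ℝ 2 (volume : Measure (Space n)) :=
    mulOp hw.memLp_top with hA
  set B : Lp (Space n) 2 (volume : Measure (Space n)) →L[ℝ]
    Lp (Space n) 2 (volume : Measure (Space n)) := mulOp hw.memLp_top with hB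
  -- Room beyond `b` for averages over `[t, t + τ]`. Composing with the clamp `κ` makes every curve
  -- continuous and bounded on the whole line.
  obtain ⟨b', hbb', hb'T⟩ := exists_between hb
  set κ : ℝ → ℝ := fun s => max a (min s b') with hκ
  have hκc : Continuous κ := by fun_prop
  have hκm : ∀ s, κ s ∈ Icc a b' := fun s =>
    ⟨le_max_left _ _, max_le (hab.trans hbb'.le) (min_le_right _ _)⟩
  have hκI : ∀ s, κ s ∈ Ioo 0 T := fun s =>
    ⟨ha.trans_le (hκm s).1, (hκm s).2.trans_lt hb'T⟩
  have hκe : ∀ s ∈ Icc a b', κ s = s := fun s hs => by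
    simp only [hκ, min_eq_left hs.2, max_eq_right hs.1]
  set F := forcing μ α p U V with hF
  have cV : Continuous fun s => V (κ s) :=
    (h.contV.mono Ioo_subset_Ico_self).comp_continuous hκc hκI
  have cG : Continuous fun s => G (κ s) :=
    (h.contG.mono Ioo_subset_Ico_self).comp_continuous hκc hκI
  have cF : Continuous fun s => F (κ s) := (h.continuousOn_forcing hα hp hS).comp_continuous hκc hκI
  have hbd : ∀ {H : Type} [NormedAddCommGroup H] (Y : ℝ → H), Continuous (fun s => Y (κ s)) →
      ∃ M, ∀ s, ‖Y (κ s)‖ ≤ M := by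
    intro H _ Y hY
    obtain ⟨M, hM⟩ := (isCompact_Icc (a := a) (b := b')).exists_bound_of_continuousOn
      hY.continuousOn
    refine ⟨M, fun s => ?_⟩
    have := hM (κ s) (hκm s)
    rwa [hκe (κ s) (hκm s)] at this
  obtain ⟨MV, hMV⟩ := hbd V cV
  obtain ⟨MG, hMG⟩ := hbd G cG
  obtain ⟨MF, hMF⟩ := hbd F cF
  have hMV0 : 0 ≤ MV := (norm_nonneg _).trans (hMV 0)
  have hMG0 : 0 ≤ MG := (norm_nonneg _).trans (hMG 0)
  have hMF0 : 0 ≤ MF := (norm_nonneg _).trans (hMF 0)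
  set v : ℝ → ℝ → Lp ℝ 2 (volume : Measure (Space n)) := fun τ => avg τ fun s => V (κ s) with hv
  set g : ℝ → ℝ → Lp (Space n) 2 (volume : Measure (Space n)) :=
    fun τ => avg τ fun s => G (κ s) with hg
  set f : ℝ → ℝ → Lp ℝ 2 (volume : Measure (Space n)) := fun τ => avg τ fun s => F (κ s) with hf
  set r : ℝ → ℝ → ℝ := fun τ t => ⟪A (f τ t), A (v τ t)⟫ +
    2 * Λ * (‖A (v τ t)‖ * ‖B (g τ t)‖) with hr
  set e : ℝ → ℝ → ℝ := fun τ t => (‖A (v τ t)‖ ^ 2 + ‖B (g τ t)‖ ^ 2) / 2 with he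
  have hrc : ∀ τ, Continuous (r τ) := by
    intro τ
    have c1 : Continuous fun t => A (v τ t) := A.continuous.comp (continuous_avg cV τ)
    have c2 : Continuous fun t => A (f τ t) := A.continuous.comp (continuous_avg cF τ)
    have c3 : Continuous fun t => B (g τ t) := B.continuous.comp (continuous_avg cG τ)
    exact (c2.inner c1).add ((c1.norm.mul c3.norm).const_mul (2 * Λ))
  have hIntg : ∀ {H : Type} [NormedAddCommGroup H] [NormedSpace ℝ H] (Y : ℝ → H) (τ t : ℝ),
      0 < τ → τ < b' - b → t ∈ Icc a b → ∫ s in t..t + τ, Y (κ s) = ∫ s in t..t + τ, Y s := by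
    intro H _ _ Y τ t hτ hτb ht
    refine intervalIntegral.integral_congr fun s hs => ?_
    rw [uIcc_of_le (by linarith)] at hs
    simp only [hκe s ⟨ht.1.trans hs.1, by linarith [hs.2, ht.2]⟩]
  have main : ∀ τ, 0 < τ → τ < b' - b → e τ b - e τ a ≤ ∫ s in a..b, r τ s := by
    intro τ hτ hτb
    have hd : ∀ t, HasDerivAt (e τ)
        (⟪A (v τ t), A (τ⁻¹ • (V (κ (t + τ)) - V (κ t)))⟫ +
          ⟪B (g τ t), B (τ⁻¹ • (G (κ (t + τ)) - G (κ t)))⟫) t := by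
      intro t
      have d1 := (A.hasFDerivAt.comp_hasDerivAt t (hasDerivAt_avg cV τ t)).norm_sq
      have d2 := (B.hasFDerivAt.comp_hasDerivAt t (hasDerivAt_avg cG τ t)).norm_sq
      refine HasDerivAt.congr_deriv (f := e τ) ((d1.add d2).div_const 2) ?_
      simp only [Function.comp, hv, hg]
      ring
    have hcd : Continuous fun t => ⟪A (v τ t), A (τ⁻¹ • (V (κ (t + τ)) - V (κ t)))⟫ +
          ⟪B (g τ t), B (τ⁻¹ • (G (κ (t + τ)) - G (κ t)))⟫ := by
      have c1 : Continuous fun t => A (v τ t) := A.continuous.comp (continuous_avg cV τ)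
      have c3 : Continuous fun t => B (g τ t) := B.continuous.comp (continuous_avg cG τ)
      have c4 : Continuous fun t => A (τ⁻¹ • (V (κ (t + τ)) - V (κ t))) :=
        A.continuous.comp (((cV.comp (continuous_add_const τ)).sub cV).const_smul τ⁻¹)
      have c5 : Continuous fun t => B (τ⁻¹ • (G (κ (t + τ)) - G (κ t))) :=
        B.continuous.comp (((cG.comp (continuous_add_const τ)).sub cG).const_smul τ⁻¹)
      exact (c1.inner c4).add (c3.inner c5)
    rw [← intervalIntegral.integral_eq_sub_of_hasDerivAt (fun t _ => hd t)
      (hcd.intervalIntegrable _ _)]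
    refine intervalIntegral.integral_mono_on hab (hcd.intervalIntegrable _ _)
      ((hrc τ).intervalIntegrable _ _) fun t ht => ?_
    have ht0 : 0 < t := ha.trans_le ht.1
    have htτ : t + τ < T := by linarith [ht.2]
    have htI : t ∈ Ico 0 T := ⟨ht0.le, by linarith⟩
    have htI' : t + τ ∈ Ico 0 T := ⟨by linarith, htτ⟩
    have k1 : κ t = t := hκe t ⟨ht.1, by linarith [ht.2]⟩
    have k2 : κ (t + τ) = t + τ := hκe _ ⟨by linarith [ht.1], by linarith [ht.2]⟩
    rw [k1, k2]
    set D := τ⁻¹ • (G (t + τ) - G t) with hD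
    -- The time derivative is only in `L²` and cannot be used as a test function. Its average is a
    -- difference quotient of `U`, hence lies in `H¹`, and its gradient is the time derivative of
    -- the averaged gradient.
    have hvt : v τ t = τ⁻¹ • (U (t + τ) - U t) := by
      rw [h.sub_eq_integral ht0 (by linarith) htτ, ← hIntg V τ t hτ hτb ht]
      rfl
    have hvg : HasWeakGradient (v τ t) D := by
      rw [hvt]
      exact ((h.grad _ htI').sub (h.grad _ htI)).const_smul τ⁻¹
    -- The equation is tested with `S²` times the averaged time derivative; the averaged gradient
    -- plays the role of `X`.
    obtain ⟨Γ, hΓ1, hΓ2⟩ := hw.exists_gradient hvg (g τ t)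
    have hdiff := h.difference hμ hα hp hS hΓ1 ht0 (by linarith : t ≤ t + τ) htτ
    have e1 : (∫ s in t..t + τ, F s) = τ • f τ t := by
      rw [← hIntg F τ t hτ hτb ht, hf]
      simp only [avg, smul_smul, mul_inv_cancel₀ hτ.ne', one_smul]
    have e2 : (∫ s in t..t + τ, G s) = τ • g τ t := by
      rw [← hIntg G τ t hτ hτb ht, hg]
      simp only [avg, smul_smul, mul_inv_cancel₀ hτ.ne', one_smul]
    have e3 : V (t + τ) - V t = τ • (τ⁻¹ • (V (t + τ) - V t)) := by
      rw [smul_smul, mul_inv_cancel₀ hτ.ne', one_smul]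
    rw [← hF, e1, e2, e3, ← smul_sub, inner_smul_right, inner_smul_right, ← mul_add,
      mul_eq_zero, inner_sub_right, ← hA] at hdiff
    replace hdiff := hdiff.resolve_left hτ.ne'
    have s1 : ∀ z, ⟪A (A (v τ t)), z⟫ = ⟪A z, A (v τ t)⟫ := fun z => by
      rw [real_inner_comm, hA, inner_mulOp]
    rw [s1, s1, real_inner_comm _ Γ] at hdiff
    rw [← hA, ← hB] at hΓ2
    rw [real_inner_comm _ (A (v τ t))]
    simp only [hr]
    linarith
  have hnh : ∀ᶠ τ in 𝓝[>] (0 : ℝ), 0 < τ ∧ τ < b' - b :=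
    Ioo_mem_nhdsGT (by linarith : (0 : ℝ) < b' - b)
  have lv : ∀ t, Tendsto (fun τ => A (v τ t)) (𝓝[>] 0) (𝓝 (A (V (κ t)))) := fun t =>
    (A.continuous.tendsto _).comp (tendsto_avg cV t)
  have lf : ∀ t, Tendsto (fun τ => A (f τ t)) (𝓝[>] 0) (𝓝 (A (F (κ t)))) := fun t =>
    (A.continuous.tendsto _).comp (tendsto_avg cF t)
  have lg : ∀ t, Tendsto (fun τ => B (g τ t)) (𝓝[>] 0) (𝓝 (B (G (κ t)))) := fun t =>
    (B.continuous.tendsto _).comp (tendsto_avg cG t)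
  have le : ∀ t, Tendsto (fun τ => e τ t) (𝓝[>] 0)
      (𝓝 ((‖A (V (κ t))‖ ^ 2 + ‖B (G (κ t))‖ ^ 2) / 2)) := fun t =>
    ((((lv t).norm.pow 2).add ((lg t).norm.pow 2)).div_const 2)
  have lr : Tendsto (fun τ => ∫ s in a..b, r τ s) (𝓝[>] 0)
      (𝓝 (∫ s in a..b, (⟪A (F (κ s)), A (V (κ s))⟫ +
        2 * Λ * (‖A (V (κ s))‖ * ‖B (G (κ s))‖)))) := by
    refine intervalIntegral.tendsto_integral_filter_of_dominated_convergence
      (fun _ => (‖A‖ * MF) * (‖A‖ * MV) + 2 * Λ * ((‖A‖ * MV) * (‖B‖ * MG)))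
      (Eventually.of_forall fun τ => (hrc τ).aestronglyMeasurable) ?_
      (by simp) (ae_of_all _ fun t _ => ?_)
    · filter_upwards [hnh] with τ hτ
      refine ae_of_all _ fun t _ => ?_
      have b1 : ‖A (f τ t)‖ ≤ ‖A‖ * MF := (A.le_opNorm _).trans
        (mul_le_mul_of_nonneg_left (norm_avg_le hMF hτ.1 t) (norm_nonneg _))
      have b2 : ‖A (v τ t)‖ ≤ ‖A‖ * MV := (A.le_opNorm _).trans
        (mul_le_mul_of_nonneg_left (norm_avg_le hMV hτ.1 t) (norm_nonneg _))
      have b3 : ‖B (g τ t)‖ ≤ ‖B‖ * MG := (B.le_opNorm _).trans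
        (mul_le_mul_of_nonneg_left (norm_avg_le hMG hτ.1 t) (norm_nonneg _))
      have hΛ := hw.rate_nonneg
      refine (norm_add_le _ _).trans (add_le_add ?_ ?_)
      · exact (abs_real_inner_le_norm _ _).trans (by gcongr)
      · rw [Real.norm_of_nonneg (by positivity)]
        gcongr
    · exact ((lf t).inner (lv t)).add (((lv t).norm.mul (lg t).norm).const_mul (2 * Λ))
  have hfin := le_of_tendsto_of_tendsto ((le b).sub (le a)) lr (by
    filter_upwards [hnh] with τ hτ using main τ hτ.1 hτ.2)
  rw [hκe a ⟨le_rfl, by linarith⟩, hκe b ⟨hab, hbb'.le⟩] at hfin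
  refine hfin.trans (le_of_eq (intervalIntegral.integral_congr fun s hs => ?_))
  rw [uIcc_of_le hab] at hs
  simp only [hκe s ⟨hs.1, by linarith [hs.2]⟩]

end EPD

namespace EPD

/-! ### Finite speed of propagation -/

/-- Grönwall's lemma when the integral inequality is known only between positive times; continuity
of `E` extends it down to `0`, where the damping coefficient is singular. -/
lemma le_mul_exp_of_sub_le_integral {E : ℝ → ℝ} {κ b : ℝ} (hb : 0 < b) (hκ : 0 ≤ κ)
    (hc : ContinuousOn E (Icc 0 b))
    (h : ∀ a t, 0 < a → a ≤ t → t ≤ b → E t - E a ≤ κ * ∫ s in a..t, E s) :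
    E b ≤ E 0 * Real.exp (κ * b) := by
  have hIntg : ∀ a ∈ Icc 0 b, ∀ t ∈ Icc 0 b, IntervalIntegrable E volume a t := fun a ha t ht =>
    (hc.mono (ordConnected_Icc.uIcc_subset ha ht)).intervalIntegrable
  have h0m : (0 : ℝ) ∈ Icc 0 b := ⟨le_rfl, hb.le⟩
  set J : ℝ → ℝ := fun t => ∫ s in (0 : ℝ)..t, E s with hJ
  have hJc : ContinuousOn J (Icc 0 b) := by
    have := intervalIntegral.continuousOn_primitive_interval (μ := volume) (f := E) (a := 0) (b := b)
      (by rw [uIcc_of_le hb.le]; exact hc.integrableOn_Icc)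
    rwa [uIcc_of_le hb.le] at this
  have h0 : ∀ t ∈ Ioc 0 b, E t ≤ E 0 + κ * J t := by
    intro t ht
    have hmem : ∀ᶠ a in 𝓝[>] (0 : ℝ), a ∈ Ioo 0 t := Ioo_mem_nhdsGT ht.1
    have hle : 𝓝[>] (0 : ℝ) ≤ 𝓝[Icc 0 b] 0 := by
      rw [← nhdsWithin_Ioo_eq_nhdsGT hb]
      exact nhdsWithin_mono _ Ioo_subset_Icc_self
    have l1 : Tendsto E (𝓝[>] 0) (𝓝 (E 0)) := (hc 0 h0m).mono_left hle
    have l2 : Tendsto J (𝓝[>] 0) (𝓝 (J 0)) := (hJc 0 h0m).mono_left hle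
    have l3 : Tendsto (fun a => E a + κ * (J t - J a)) (𝓝[>] 0)
        (𝓝 (E 0 + κ * (J t - J 0))) := l1.add ((tendsto_const_nhds.sub l2).const_mul κ)
    have hJ0 : J 0 = 0 := by simp [hJ]
    rw [hJ0, sub_zero] at l3
    refine ge_of_tendsto l3 ?_
    filter_upwards [hmem] with a ha
    have h1 := h a t ha.1 ha.2.le ht.2
    have h2 : J t - J a = ∫ s in a..t, E s :=
      intervalIntegral.integral_interval_sub_left (hIntg _ h0m _ ⟨ht.1.le, ht.2⟩)
        (hIntg _ h0m _ ⟨ha.1.le, ha.2.le.trans ht.2⟩)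
    rw [h2]
    linarith
  -- The majorant of `E` times the integrating factor is nonincreasing.
  set Ψ : ℝ → ℝ := fun t => (E 0 + κ * J t) * Real.exp (-κ * t) with hΨ
  have hanti : AntitoneOn Ψ (Icc 0 b) := by
    have hd : ∀ t ∈ Ioo 0 b, HasDerivAt Ψ ((κ * E t) * Real.exp (-κ * t) +
        (E 0 + κ * J t) * (Real.exp (-κ * t) * -κ)) t := by
      intro t ht
      have hJd : HasDerivAt J (E t) t := by
        refine intervalIntegral.integral_hasDerivAt_right (hIntg _ h0m _ ⟨ht.1.le, ht.2.le⟩) ?_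
          (hc.continuousAt (Icc_mem_nhds ht.1 ht.2))
        exact hc.stronglyMeasurableAtFilter_nhdsWithin measurableSet_Icc t |>.filter_mono
          (by rw [nhdsWithin_eq_nhds.2 (Icc_mem_nhds ht.1 ht.2)])
      have he : HasDerivAt (fun t => Real.exp (-κ * t)) (Real.exp (-κ * t) * -κ) t := by
        simpa using ((hasDerivAt_id t).const_mul (-κ)).exp
      exact ((hJd.const_mul κ).const_add (E 0)).mul he
    refine antitoneOn_of_deriv_nonpos (convex_Icc 0 b) ?_ ?_ ?_
    · exact (continuousOn_const.add (hJc.const_mul κ)).mul (by fun_prop)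
    · rw [interior_Icc]
      exact fun t ht => (hd t ht).differentiableAt.differentiableWithinAt
    · rw [interior_Icc]
      intro t ht
      rw [(hd t ht).deriv]
      have h1 := h0 t ⟨ht.1, ht.2.le⟩
      have h2 := Real.exp_pos (-κ * t)
      have : (κ * E t) * Real.exp (-κ * t) + (E 0 + κ * J t) * (Real.exp (-κ * t) * -κ) =
          κ * Real.exp (-κ * t) * (E t - (E 0 + κ * J t)) := by ring
      rw [this]
      exact mul_nonpos_of_nonneg_of_nonpos (by positivity) (by linarith)
  have h1 := hanti h0m ⟨hb.le, le_rfl⟩ hb.le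
  have h2 : Ψ 0 = E 0 := by simp [hΨ, hJ]
  rw [h2, hΨ] at h1
  have h3 := h0 b ⟨hb, le_rfl⟩
  have h4 : Real.exp (-κ * b) * Real.exp (κ * b) = 1 := by
    rw [← Real.exp_add]; simp
  have h5 := mul_le_mul_of_nonneg_right h1 (Real.exp_pos (κ * b)).le
  simp only at h5
  rw [mul_assoc, h4, mul_one] at h5
  linarith

/-- Testing with functions supported in `O` and the fundamental lemma of the calculus of variations.
It transfers support properties of `u` to its gradient. -/
lemma HasWeakGradient.ae_eq_zero {n : ℕ} {f : Space n → ℝ} {g : Space n → Space n}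
    (h : HasWeakGradient f g) (hg : MemLp g 2 volume) {O : Set (Space n)} (hO : IsOpen O)
    (hf : ∀ᵐ x, x ∈ O → f x = 0) : ∀ᵐ x, x ∈ O → g x = 0 := by
  refine hO.ae_eq_zero_of_integral_contDiff_smul_eq_zero
    ((hg.locallyIntegrable (by norm_num)).locallyIntegrableOn O) fun ψ hψ hψc hs => ?_
  have h1 := h ψ hψ hψc
  have h2 : ∫ x, f x • ∇ ψ x = 0 := by
    refine integral_eq_zero_of_ae ?_
    filter_upwards [hf] with x hx
    by_cases hxO : x ∈ O
    · simp [hx hxO]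
    · have : ∇ ψ x = 0 := by
        have h3 : x ∉ tsupport ψ := fun h => hxO (hs h)
        rw [gradient, fderiv_of_notMem_tsupport ℝ h3, map_zero]
      simp [this]
  rw [h2] at h1
  exact (neg_eq_zero.1 h1.symm)

/-- The logistic weight in the direction `e`. -/
noncomputable def logistic {n : ℕ} (Λ : ℝ) (e : Space n) (c : ℝ) (x : Space n) : ℝ :=
  Real.sigmoid (Λ * (⟪e, x⟫ - c))

/-- The sigmoid satisfies `σ' = σ(1 - σ) ≤ σ`. Unlike an exponential it is bounded, so the weighted
norms are finite for every `L²` function. -/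
lemma isWeight_logistic {n : ℕ} {Λ : ℝ} (hΛ : 0 ≤ Λ) {e : Space n} (he : ‖e‖ = 1) (c : ℝ) :
    IsWeight (logistic Λ e c) Λ where
  rate_nonneg := hΛ
  smooth := by
    have h1 : ContDiff ℝ ∞ fun x : Space n => Λ * (⟪e, x⟫ - c) :=
      contDiff_const.mul ((contDiff_const.inner ℝ contDiff_id).sub contDiff_const)
    exact (contDiff_sigmoid.of_le le_top).comp h1
  nonneg x := Real.sigmoid_nonneg _
  le_one x := Real.sigmoid_le_one _
  grad_le x := by
    have h1 : HasFDerivAt (fun x : Space n => Λ * (⟪e, x⟫ - c)) (Λ • innerSL ℝ e) x :=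
      (((innerSL ℝ e).hasFDerivAt (x := x)).sub_const c).const_mul Λ
    have h2 := (Real.hasDerivAt_sigmoid (Λ * (⟪e, x⟫ - c))).comp_hasFDerivAt x h1
    have h3 : fderiv ℝ (logistic Λ e c) x = _ := h2.fderiv
    rw [gradient, LinearIsometryEquiv.norm_map, h3, norm_smul, norm_smul, innerSL_apply_norm, he,
      mul_one, Real.norm_of_nonneg hΛ]
    set z := Λ * (⟪e, x⟫ - c) with hz
    have p0 := Real.sigmoid_nonneg z
    have p1 := Real.sigmoid_le_one z
    rw [Real.norm_of_nonneg (mul_nonneg p0 (by linarith))]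
    have : logistic Λ e c x = Real.sigmoid z := rfl
    rw [this]
    nlinarith [mul_nonneg (mul_nonneg p0 p0) hΛ]

/-- `σ(z) ≤ e^z`, and `⟪e, x⟫ ≤ 1` in the unit ball; this makes the initial weighted energy
exponentially small in `Λ`. -/
lemma logistic_le {n : ℕ} {Λ : ℝ} (hΛ : 0 ≤ Λ) {e : Space n} (he : ‖e‖ = 1) (c : ℝ)
    {x : Space n} (hx : ‖x‖ ≤ 1) : logistic Λ e c x ≤ Real.exp (-(Λ * (c - 1))) := by
  have h1 : ⟪e, x⟫ ≤ 1 := by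
    refine (real_inner_le_norm e x).trans ?_
    rw [he, one_mul]; exact hx
  have h2 : ∀ z : ℝ, Real.sigmoid z ≤ Real.exp z := by
    intro z
    rw [Real.sigmoid_def, ← neg_neg z, Real.exp_neg (-z), neg_neg]
    exact inv_anti₀ (Real.exp_pos _) (by linarith)
  refine (h2 _).trans (Real.exp_le_exp.2 ?_)
  nlinarith

lemma norm_mulOp_le {n : ℕ} {E : Type*} [NormedAddCommGroup E] [NormedSpace ℝ E]
    {S : Space n → ℝ} (hS : MemLp S ∞ volume) (f : Lp E 2 (volume : Measure (Space n))) {c : ℝ}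
    (hf : ∀ᵐ x, |S x| * ‖f x‖ ≤ c * ‖f x‖) : ‖mulOp hS f‖ ≤ c * ‖f‖ := by
  refine Lp.norm_le_mul_norm_of_ae_le_mul ?_
  filter_upwards [hf, coeFn_mulOp hS f] with x h1 h2
  rw [h2, norm_smul]
  exact h1

variable {n : ℕ} {μ α p T : ℝ} {u : ℝ → Space n → ℝ}
  {U V : ℝ → Lp ℝ 2 (volume : Measure (Space n))}
  {G : ℝ → Lp (Space n) 2 (volume : Measure (Space n))} {C : NNReal} {S : Space n → ℝ} {Λ : ℝ}

/-- The weighted nonlinearity is bounded by the weighted energy norms. -/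
lemma EnergyCurves.norm_mulOp_absPow_le (h : EnergyCurves μ α p T u U V G) (hp : 1 < p)
    (hS : SobolevConst n p C) (hw : IsWeight S Λ) {s R η : ℝ} (hs : s ∈ Ico 0 T) (hR : 0 ≤ R)
    (hη : 0 ≤ η)
    (hb : ∀ f : Space n → ℝ, AEStronglyMeasurable f volume →
      eLpNorm (fun x => f x * |U s x| ^ (p - 1)) 2 volume ≤
        ENNReal.ofReal R * eLpNorm f 2 volume +
          ENNReal.ofReal η * eLpNorm f (ENNReal.ofReal (2 * p)) volume) :
    ‖mulOp hw.memLp_top (absPow p (U s))‖ ≤ R * ‖mulOp hw.memLp_top (U s)‖ +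
      η * (C * (‖mulOp hw.memLp_top (U s)‖ +
        (‖mulOp hw.memLp_top (G s)‖ + Λ * ‖mulOp hw.memLp_top (U s)‖))) := by
  set A : Lp ℝ 2 (volume : Measure (Space n)) →L[ℝ] Lp ℝ 2 (volume : Measure (Space n)) :=
    mulOp hw.memLp_top with hA
  set B : Lp (Space n) 2 (volume : Measure (Space n)) →L[ℝ]
    Lp (Space n) 2 (volume : Measure (Space n)) := mulOp hw.memLp_top with hB
  have hAU := coeFn_mulOp hw.memLp_top (U s)
  rw [← hA] at hAU
  have hΛ := hw.rate_nonneg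
  have hgm : AEStronglyMeasurable (fun x => U s x • ∇ S x) volume :=
    (Lp.aestronglyMeasurable (U s)).smul (continuous_gradient hw.smooth).aestronglyMeasurable
  have hgb : ∀ᵐ x, ‖U s x • ∇ S x‖ ≤ Λ * ‖A (U s) x‖ := by
    filter_upwards [hAU] with x hx
    rw [hx, norm_smul, norm_smul, Real.norm_of_nonneg (hw.nonneg x)]
    have := mul_le_mul_of_nonneg_left (hw.grad_le x) (norm_nonneg (U s x))
    linarith
  have hgL : MemLp (fun x => U s x • ∇ S x) 2 volume := by
    refine ((Lp.memLp (A (U s))).const_mul Λ).of_le hgm (hgb.mono fun x hx => ?_)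
    rw [norm_mul, Real.norm_of_nonneg hΛ]; exact hx
  have hgn : ‖hgL.toLp _‖ ≤ Λ * ‖A (U s)‖ := by
    refine Lp.norm_le_mul_norm_of_ae_le_mul ?_
    filter_upwards [hgL.coeFn_toLp, hgb] with x h1 h2
    rw [h1]; exact h2
  have hwg : HasWeakGradient (A (U s)) (B (G s) + hgL.toLp _ : Lp (Space n) 2 _) := by
    refine ((h.grad s hs).smooth_mul (Lp.memLp _) (Lp.memLp _) hw.smooth).congr_ae ?_ ?_
    · filter_upwards [hAU] with x hx
      rw [hx, smul_eq_mul]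
    · filter_upwards [Lp.coeFn_add (B (G s)) (hgL.toLp _), hgL.coeFn_toLp,
        coeFn_mulOp hw.memLp_top (G s)] with x h1 h2 h3
      rw [h1, Pi.add_apply, h2, h3]
  have hsob := hS _ _ hwg (Lp.memLp _) (Lp.memLp _)
  have h1 := hb (A (U s)) (Lp.aestronglyMeasurable _)
  -- The weight is attached to a single factor, `S|U|^p = |SU| |U|^{p-1}` in modulus, and the
  -- Sobolev inequality is used for `SU`, whose gradient costs at most an additional `Λ‖SU‖`.
  have e1 : eLpNorm (A (absPow p (U s))) 2 volume =
      eLpNorm (fun x => A (U s) x * |U s x| ^ (p - 1)) 2 volume := by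
    refine eLpNorm_congr_norm_ae ?_
    filter_upwards [hAU, coeFn_mulOp hw.memLp_top (absPow p (U s)),
      coeFn_absPow hp (h.memLp hS hs)] with x h1 h2 h3
    rw [h1, h2, h3, smul_eq_mul, smul_eq_mul, norm_mul, norm_mul, norm_mul, mul_assoc]
    congr 1
    rw [Real.norm_of_nonneg (Real.rpow_nonneg (abs_nonneg _) _),
      Real.norm_of_nonneg (Real.rpow_nonneg (abs_nonneg _) _), Real.norm_eq_abs,
      ← Real.rpow_one_add' (abs_nonneg _) (by linarith)]
    congr 1
    ring
  rw [← e1] at h1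
  have h2 := h1.trans (add_le_add le_rfl (mul_le_mul' le_rfl hsob))
  have hC0 : (0 : ℝ) ≤ C := C.2
  have n1 : ‖B (G s) + hgL.toLp _‖ ≤ ‖B (G s)‖ + Λ * ‖A (U s)‖ :=
    (norm_add_le _ _).trans (add_le_add le_rfl hgn)
  have e2 : ‖A (absPow p (U s))‖ ≤ R * ‖A (U s)‖ + η * (C * (‖A (U s)‖ +
      ‖B (G s) + hgL.toLp _‖)) := by
    rw [← ENNReal.ofReal_le_ofReal_iff (by positivity), ENNReal.ofReal_add (by positivity)
      (by positivity), ENNReal.ofReal_mul hR, ENNReal.ofReal_mul hη, ENNReal.ofReal_mul hC0,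
      ENNReal.ofReal_add (by positivity) (by positivity), ofReal_norm, ofReal_norm,
      ofReal_norm, Lp.enorm_def, Lp.enorm_def, Lp.enorm_def, ENNReal.ofReal_coe_nnreal]
    exact h2
  refine e2.trans ?_
  gcongr

/-- The weighted energy. -/
noncomputable def energy (hw : IsWeight S Λ) (U V : ℝ → Lp ℝ 2 (volume : Measure (Space n)))
    (G : ℝ → Lp (Space n) 2 (volume : Measure (Space n))) (t : ℝ) : ℝ :=
  (‖mulOp hw.memLp_top (V t)‖ ^ 2 + ‖mulOp hw.memLp_top (G t)‖ ^ 2 +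
    ‖mulOp hw.memLp_top (U t)‖ ^ 2) / 2

lemma EnergyCurves.continuousOn_energy (h : EnergyCurves μ α p T u U V G) (hw : IsWeight S Λ) :
    ContinuousOn (energy hw U V G) (Ico 0 T) := by
  have c1 := ((mulOp (E := ℝ) hw.memLp_top).continuous.comp_continuousOn h.contV).norm.pow 2
  have c2 := ((mulOp (E := Space n) hw.memLp_top).continuous.comp_continuousOn h.contG).norm.pow 2
  have c3 := ((mulOp (E := ℝ) hw.memLp_top).continuous.comp_continuousOn h.contU).norm.pow 2
  exact ((c1.add c2).add c3).div_const 2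

-- The square of `U` is included in the energy so that the nonlinearity is controlled by the energy
-- itself. What matters is the coefficient of `Λ` in the exponent: `2` from the unit propagation
-- speed, plus a multiple of `η`.
set_option maxHeartbeats 1000000 in
lemma EnergyCurves.energy_le (h : EnergyCurves μ α p T u U V G) (hμ : 0 < μ) (hα : 0 ≤ α)
    (hp : 1 < p) (hS : SobolevConst n p C) (hw : IsWeight S Λ) {b R η : ℝ} (hb0 : 0 < b)
    (hb : b < T) (hR : 0 ≤ R) (hη : 0 ≤ η)
    (hRη : ∀ s ∈ Icc 0 b, ∀ f : Space n → ℝ, AEStronglyMeasurable f volume →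
      eLpNorm (fun x => f x * |U s x| ^ (p - 1)) 2 volume ≤
        ENNReal.ofReal R * eLpNorm f 2 volume +
          ENNReal.ofReal η * eLpNorm f (ENNReal.ofReal (2 * p)) volume) :
    energy hw U V G b ≤ energy hw U V G 0 *
      Real.exp ((b ^ α * (R + η * C * (2 + Λ)) + 2 * Λ + 1) * b) := by
  have hΛ := hw.rate_nonneg
  have hC0 : (0 : ℝ) ≤ C := C.2
  set A : Lp ℝ 2 (volume : Measure (Space n)) →L[ℝ] Lp ℝ 2 (volume : Measure (Space n)) :=
    mulOp hw.memLp_top with hA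
  set B : Lp (Space n) 2 (volume : Measure (Space n)) →L[ℝ]
    Lp (Space n) 2 (volume : Measure (Space n)) := mulOp hw.memLp_top with hB
  have hEc := h.continuousOn_energy hw
  refine le_mul_exp_of_sub_le_integral hb0 (by positivity)
    (hEc.mono fun s hs => ⟨hs.1, hs.2.trans_lt hb⟩) fun a t ha hat htb => ?_
  have htT : t < T := htb.trans_lt hb
  have hsub : ∀ s ∈ uIcc a t, s ∈ Ioo 0 T := fun s hs => by
    rw [uIcc_of_le hat] at hs
    exact ⟨ha.trans_le hs.1, hs.2.trans_lt htT⟩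
  have cV : ContinuousOn (fun s => A (V s)) (uIcc a t) :=
    A.continuous.comp_continuousOn (h.contV.mono fun s hs => Ioo_subset_Ico_self (hsub s hs))
  have cU : ContinuousOn (fun s => A (U s)) (uIcc a t) :=
    A.continuous.comp_continuousOn (h.contU.mono fun s hs => Ioo_subset_Ico_self (hsub s hs))
  have cG : ContinuousOn (fun s => B (G s)) (uIcc a t) :=
    B.continuous.comp_continuousOn (h.contG.mono fun s hs => Ioo_subset_Ico_self (hsub s hs))
  have cF : ContinuousOn (fun s => A (forcing μ α p U V s)) (uIcc a t) :=
    A.continuous.comp_continuousOn ((h.continuousOn_forcing hα hp hS).mono hsub)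
  have i1 : IntervalIntegrable (fun s => ⟪A (forcing μ α p U V s), A (V s)⟫ +
      2 * Λ * (‖A (V s)‖ * ‖B (G s)‖)) volume a t :=
    ((cF.inner (𝕜 := ℝ) cV).add ((cV.norm.mul cG.norm).const_mul (2 * Λ))).intervalIntegrable
  have i2 : IntervalIntegrable (fun s => ⟪A (U s), A (V s)⟫) volume a t :=
    (cU.inner (𝕜 := ℝ) cV).intervalIntegrable
  have hfirst := h.energy_sub_le hμ hα hp hS hw ha hat htT
  rw [← hA, ← hB] at hfirst
  have hsecond : ‖A (U t)‖ ^ 2 / 2 - ‖A (U a)‖ ^ 2 / 2 = ∫ s in a..t, ⟪A (U s), A (V s)⟫ := by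
    refine (intervalIntegral.integral_eq_sub_of_hasDerivAt (f := fun s => ‖A (U s)‖ ^ 2 / 2)
      (fun s hs => ?_) i2).symm
    have d := (h.hasDeriv s (Ioo_subset_Ico_self (hsub s hs))).hasDerivAt
      (Ico_mem_nhds (hsub s hs).1 (hsub s hs).2)
    have d1 := (A.hasFDerivAt.comp_hasDerivAt s d).norm_sq
    refine HasDerivAt.congr_deriv (f := fun s => ‖A (U s)‖ ^ 2 / 2) (d1.div_const 2) ?_
    simp only [Function.comp]
    ring
  have hsum : energy hw U V G t - energy hw U V G a ≤ ∫ s in a..t,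
      ((⟪A (forcing μ α p U V s), A (V s)⟫ + 2 * Λ * (‖A (V s)‖ * ‖B (G s)‖)) +
        ⟪A (U s), A (V s)⟫) := by
    rw [intervalIntegral.integral_add i1 i2, ← hsecond]
    simp only [energy, ← hA, ← hB]
    linarith
  refine hsum.trans ?_
  rw [← intervalIntegral.integral_const_mul]
  refine intervalIntegral.integral_mono_on hat (i1.add i2)
    ((hEc.mono fun s hs => Ioo_subset_Ico_self (hsub s hs)).const_mul _).intervalIntegrable
    fun s hs => ?_
  have hs0 : 0 < s := ha.trans_le hs.1
  have hsb : s ≤ b := hs.2.trans htb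
  have hsI : s ∈ Ico 0 T := ⟨hs0.le, hsb.trans_lt hb⟩
  have hn := h.norm_mulOp_absPow_le hp hS hw hsI hR hη (hRη s ⟨hs0.le, hsb⟩)
  rw [← hA, ← hB] at hn
  have hf : ⟪A (forcing μ α p U V s), A (V s)⟫ ≤
      b ^ α * (‖A (absPow p (U s))‖ * ‖A (V s)‖) := by
    rw [forcing, map_sub, map_smul, map_smul, inner_sub_left, real_inner_smul_left,
      real_inner_smul_left, real_inner_self_eq_norm_sq]
    have q1 : s ^ α * ⟪A (absPow p (U s)), A (V s)⟫ ≤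
        s ^ α * (‖A (absPow p (U s))‖ * ‖A (V s)‖) :=
      mul_le_mul_of_nonneg_left (real_inner_le_norm _ _) (Real.rpow_nonneg hs0.le _)
    have q2 : s ^ α * (‖A (absPow p (U s))‖ * ‖A (V s)‖) ≤
        b ^ α * (‖A (absPow p (U s))‖ * ‖A (V s)‖) :=
      mul_le_mul_of_nonneg_right (Real.rpow_le_rpow hs0.le hsb hα) (by positivity)
    -- The damping has a favourable sign and is dropped, so its singularity at `s = 0` does no harm.
    have q3 : 0 ≤ μ / s * ‖A (V s)‖ ^ 2 := by positivity
    linarith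
  have hUV : ⟪A (U s), A (V s)⟫ ≤ ‖A (U s)‖ * ‖A (V s)‖ := real_inner_le_norm _ _
  simp only [energy, ← hA, ← hB]
  set x := ‖A (V s)‖ with hx
  set y := ‖B (G s)‖ with hy
  set z := ‖A (U s)‖ with hz
  have x0 : 0 ≤ x := norm_nonneg _
  have y0 : 0 ≤ y := norm_nonneg _
  have z0 : 0 ≤ z := norm_nonneg _
  set E := (x ^ 2 + y ^ 2 + z ^ 2) / 2 with hE
  have pxz : z * x ≤ E := by rw [hE]; nlinarith [sq_nonneg (z - x), sq_nonneg y]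
  have pxy : y * x ≤ E := by rw [hE]; nlinarith [sq_nonneg (y - x), sq_nonneg z]
  have hbα : 0 ≤ b ^ α := Real.rpow_nonneg hb0.le _
  have hk : ‖A (absPow p (U s))‖ * x ≤ (R + η * C * (2 + Λ)) * E := by
    have k1 := mul_le_mul_of_nonneg_right hn x0
    have hηC : 0 ≤ η * C := by positivity
    have k2 : (R * z + η * (C * (z + (y + Λ * z)))) * x =
        R * (z * x) + η * C * ((1 + Λ) * (z * x)) + η * C * (y * x) := by ring
    rw [k2] at k1
    have k3 := mul_le_mul_of_nonneg_left pxz hR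
    have k4 := mul_le_mul_of_nonneg_left (mul_le_mul_of_nonneg_left pxz (by linarith : 0 ≤ 1 + Λ)) hηC
    have k5 := mul_le_mul_of_nonneg_left pxy hηC
    linarith
  have hk2 := mul_le_mul_of_nonneg_left hk hbα
  have hk3 := mul_le_mul_of_nonneg_left pxy (by linarith : 0 ≤ 2 * Λ)
  linarith

/-- Half-space form of finite speed: data supported in the unit ball do not reach
`⟪e, x⟫ > c` by the time `b < c - 1`. -/
lemma EnergyCurves.ae_eq_zero_of_lt (h : EnergyCurves μ α p T u U V G) (hμ : 0 < μ) (hα : 0 ≤ α)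
    (hp : 1 < p) (hS : SobolevConst n p C) (h0 : ∀ᵐ x, 1 < ‖x‖ → U 0 x = 0) {b c : ℝ}
    (hb0 : 0 < b) (hb : b < T) (hc : 1 + b < c) {e : Space n} (he : ‖e‖ = 1) :
    ∀ᵐ x, c < ⟪e, x⟫ → U b x = 0 := by
  have hC0 : (0 : ℝ) ≤ C := C.2
  set d := c - 1 - b with hd
  have hd0 : 0 < d := by rw [hd]; linarith
  -- Chosen so that the nonlinearity contributes at most `dΛ` to the exponent.
  set η := d / (b ^ α * C * b + 1) with hη
  have hη0 : 0 < η := by positivity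
  have hηd : b ^ α * (η * C) * b ≤ d := by
    rw [hη]
    have : 0 ≤ b ^ α * C * b := by positivity
    rw [show b ^ α * (d / (b ^ α * C * b + 1) * C) * b =
      d * ((b ^ α * C * b) / (b ^ α * C * b + 1)) by ring]
    exact mul_le_of_le_one_right hd0.le ((div_le_one (by linarith)).2 (by linarith))
  obtain ⟨R, hR, hRη⟩ := h.exists_absPow_le hp hS hb hη0
  set K := (‖G 0‖ ^ 2 + ‖U 0‖ ^ 2) / 2 with hK
  set Q := (b ^ α * (R + η * C * 2) + 1) * b with hQ
  have hT0 : (0 : ℝ) ∈ Ico 0 T := ⟨le_rfl, h.pos⟩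
  have hG0 : ∀ᵐ x, x ∈ {x : Space n | 1 < ‖x‖} → G 0 x = 0 :=
    (h.grad 0 hT0).ae_eq_zero (Lp.memLp _) (isOpen_lt continuous_const continuous_norm) h0
  -- The exponent collects `-2Λ(c - 1)` from the data, `2Λb` from propagation and at most `dΛ` from
  -- the nonlinearity, hence at most `-dΛ` in total.
  have bound : ∀ Λ : ℝ, 0 ≤ Λ → ∀ hw : IsWeight (logistic Λ e c) Λ,
      ‖mulOp hw.memLp_top (U b)‖ ^ 2 ≤ 2 * K * Real.exp (Q - d * Λ) := by
    intro Λ hΛ hw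
    have h1 := h.energy_le hμ hα hp hS hw hb0 hb hR hη0.le hRη
    set x := Real.exp (-(Λ * (c - 1))) with hx
    have hsm : ∀ y : Space n, ‖y‖ ≤ 1 → |logistic Λ e c y| ≤ x := fun y hy => by
      rw [abs_of_nonneg (hw.nonneg y)]; exact logistic_le hΛ he c hy
    have n1 : ‖mulOp hw.memLp_top (U 0)‖ ≤ x * ‖U 0‖ := by
      refine norm_mulOp_le _ _ ?_
      filter_upwards [h0] with y hy
      rcases le_or_gt ‖y‖ 1 with h2 | h2
      · exact mul_le_mul_of_nonneg_right (hsm y h2) (norm_nonneg _)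
      · simp [hy h2]
    have n2 : ‖mulOp hw.memLp_top (G 0)‖ ≤ x * ‖G 0‖ := by
      refine norm_mulOp_le _ _ ?_
      filter_upwards [hG0] with y hy
      rcases le_or_gt ‖y‖ 1 with h2 | h2
      · exact mul_le_mul_of_nonneg_right (hsm y h2) (norm_nonneg _)
      · simp [hy h2]
    have hE0 : energy hw U V G 0 ≤ x ^ 2 * K := by
      rw [energy, h.V_zero, map_zero, norm_zero, hK]
      have m1 := pow_le_pow_left₀ (norm_nonneg _) n1 2
      have m2 := pow_le_pow_left₀ (norm_nonneg _) n2 2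
      rw [mul_pow] at m1 m2
      linarith
    have hEb : ‖mulOp hw.memLp_top (U b)‖ ^ 2 ≤ 2 * energy hw U V G b := by
      rw [energy]
      nlinarith [sq_nonneg ‖mulOp hw.memLp_top (V b)‖, sq_nonneg ‖mulOp hw.memLp_top (G b)‖]
    have h2 : energy hw U V G b ≤ x ^ 2 * K *
        Real.exp ((b ^ α * (R + η * C * (2 + Λ)) + 2 * Λ + 1) * b) :=
      h1.trans (mul_le_mul_of_nonneg_right hE0 (Real.exp_pos _).le)
    have hK0 : 0 ≤ K := by rw [hK]; positivity
    have h3 : x ^ 2 * Real.exp ((b ^ α * (R + η * C * (2 + Λ)) + 2 * Λ + 1) * b) ≤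
        Real.exp (Q - d * Λ) := by
      rw [hx, ← Real.exp_nat_mul, ← Real.exp_add, Real.exp_le_exp, hQ]
      have := mul_le_mul_of_nonneg_right hηd hΛ
      push_cast
      have hc' : c - 1 = d + b := by rw [hd]; ring
      rw [hc']
      nlinarith
    have h4 := mul_le_mul_of_nonneg_left h3 hK0
    nlinarith
  have hlim : Tendsto (fun Λ : ℝ => 2 * K * Real.exp (Q - d * Λ)) atTop (𝓝 0) := by
    have h1 : Tendsto (fun Λ : ℝ => Q - d * Λ) atTop atBot :=
      tendsto_atBot_add_const_left _ Q (tendsto_neg_atTop_atBot.comp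
        (tendsto_id.const_mul_atTop hd0))
    simpa using (Real.tendsto_exp_atBot.comp h1).const_mul (2 * K)
  -- In this half-space the weight is at least `1/2` for every `Λ`, so the unweighted integral is at
  -- most four times the weighted one.
  have hzero : ∫⁻ x in {x : Space n | c < ⟪e, x⟫}, ‖U b x‖ₑ ^ 2 = 0 := by
    have hmeas : MeasurableSet {x : Space n | c < ⟪e, x⟫} :=
      (isOpen_lt continuous_const (by fun_prop)).measurableSet
    have hle : ∀ Λ : ℝ, 0 ≤ Λ → ∫⁻ x in {x : Space n | c < ⟪e, x⟫}, ‖U b x‖ₑ ^ 2 ≤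
        ENNReal.ofReal (4 * (2 * K * Real.exp (Q - d * Λ))) := by
      intro Λ hΛ
      have hw := isWeight_logistic hΛ he c
      have h1 := bound Λ hΛ hw
      have h2 : ∫⁻ x in {x : Space n | c < ⟪e, x⟫}, ‖U b x‖ₑ ^ 2 ≤
          ∫⁻ x, 4 * ‖mulOp hw.memLp_top (U b) x‖ₑ ^ 2 := by
        refine le_trans ?_ (setLIntegral_le_lintegral {x : Space n | c < ⟪e, x⟫} _)
        refine lintegral_mono_ae ?_
        filter_upwards [ae_restrict_mem hmeas, ae_restrict_of_ae (coeFn_mulOp hw.memLp_top (U b))]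
          with x hx h3
        rw [h3, enorm_smul, mul_pow, ← mul_assoc]
        have h4 : (1 : ℝ≥0∞) ≤ 4 * ‖logistic Λ e c x‖ₑ ^ 2 := by
          have h5 : (2 : ℝ)⁻¹ ≤ logistic Λ e c x := by
            rw [← Real.sigmoid_zero]
            exact Real.sigmoid_le (mul_nonneg hΛ (sub_nonneg.2 (le_of_lt hx)))
          rw [Real.enorm_of_nonneg (hw.nonneg x), ← ENNReal.ofReal_pow (hw.nonneg x),
            show (4 : ℝ≥0∞) = ENNReal.ofReal 4 by simp, ← ENNReal.ofReal_mul (by norm_num),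
            ← ENNReal.ofReal_one]
          refine ENNReal.ofReal_le_ofReal ?_
          nlinarith
        calc ‖U b x‖ₑ ^ 2 = 1 * ‖U b x‖ₑ ^ 2 := (one_mul _).symm
          _ ≤ _ := mul_le_mul' h4 le_rfl
      refine h2.trans ?_
      rw [lintegral_const_mul' _ _ (by norm_num), ← eLpNorm_two_pow_two, ← Lp.enorm_def,
        ← ofReal_norm, ← ENNReal.ofReal_pow (norm_nonneg _),
        show (4 : ℝ≥0∞) = ENNReal.ofReal 4 by simp, ← ENNReal.ofReal_mul (by norm_num)]
      refine ENNReal.ofReal_le_ofReal ?_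
      linarith
    have hl2 := ENNReal.tendsto_ofReal (hlim.const_mul 4)
    rw [mul_zero, ENNReal.ofReal_zero] at hl2
    refine le_antisymm (ge_of_tendsto hl2 ?_) zero_le
    filter_upwards [eventually_ge_atTop 0] with Λ hΛ using hle Λ hΛ
  have hmeas : MeasurableSet {x : Space n | c < ⟪e, x⟫} :=
    (isOpen_lt continuous_const (by fun_prop)).measurableSet
  rw [lintegral_eq_zero_iff ((Lp.stronglyMeasurable (U b)).enorm.pow_const 2)] at hzero
  have := (ae_restrict_iff' hmeas).1 hzero
  filter_upwards [this] with x hx hxc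
  have h6 := hx hxc
  simpa using h6

/-- Finite speed of propagation in the range where the nonlinearity is controlled by the energy. -/
theorem EnergyCurves.supportedInCone (h : EnergyCurves μ α p T u U V G) (hμ : 0 < μ) (hα : 0 ≤ α)
    (hp : 1 < p) (hS : SobolevConst n p C) (h0 : ∀ᵐ x, 1 < ‖x‖ → U 0 x = 0) :
    SupportedInCone T u := by
  intro t ht
  have hU : ∀ᵐ x, t + 1 < ‖x‖ → U t x = 0 := by
    rcases ht.1.eq_or_lt with rfl | ht0
    · simpa using h0
    -- The exterior of the ball is a union of half-spaces; countably many directions and rational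
    -- thresholds suffice, so the exceptional sets remain null.
    obtain ⟨D, hDc, hDd⟩ := TopologicalSpace.exists_countable_dense (Space n)
    have key : ∀ y ∈ D, ∀ c : ℚ, 1 + t < c → y ≠ 0 →
        ∀ᵐ x, (c : ℝ) < ⟪dir y, x⟫ → U t x = 0 := by
      intro y _ c hc hy
      exact h.ae_eq_zero_of_lt hμ hα hp hS h0 ht0 ht.2 hc (norm_dir hy)
    have key2 : ∀ᵐ x, ∀ y ∈ D, ∀ c : ℚ, 1 + t < c → y ≠ 0 → (c : ℝ) < ⟪dir y, x⟫ →
        U t x = 0 := by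
      rw [ae_ball_iff hDc]
      intro y hy
      rw [ae_all_iff]
      intro c
      by_cases hc : 1 + t < c
      · by_cases hy0 : y = 0
        · exact ae_of_all _ fun x _ h => absurd hy0 h
        · filter_upwards [key y hy c hc hy0] with x hx _ _ using hx
      · exact ae_of_all _ fun x h => absurd h hc
    filter_upwards [key2] with x hx hxt
    have hx0 : 0 < ‖x‖ := by linarith [ht.1]
    have hxne : x ≠ 0 := norm_pos_iff.1 hx0
    have hcont : ContinuousAt (fun y : Space n => ⟪dir y, x⟫) x := by
      have h1 : ContinuousAt (fun y : Space n => ‖y‖⁻¹) x :=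
        continuous_norm.continuousAt.inv₀ hx0.ne'
      exact (h1.smul continuousAt_id).inner continuousAt_const
    have hval : ⟪dir x, x⟫ = ‖x‖ := by
      rw [dir, real_inner_smul_left, real_inner_self_eq_norm_sq]
      field_simp
    obtain ⟨c, hc1, hc2⟩ := exists_rat_btwn hxt
    have hnh : ∀ᶠ y in 𝓝 x, (c : ℝ) < ⟪dir y, x⟫ ∧ y ≠ 0 :=
      (hcont.eventually_const_lt (hval.symm ▸ hc2 : (c : ℝ) < ⟪dir x, x⟫)).and (isOpen_ne.mem_nhds hxne)
    obtain ⟨y, hy, hyD⟩ := mem_closure_iff_nhds.1 (hDd x) _ hnh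
    exact hx y hyD c (by linarith) hy.2 hy.1
  filter_upwards [h.ae_eq t ht, hU] with x h1 h2 h3
  rw [h1, h2 h3]

end EPD

namespace EPD

/-! ### Cut-off functions in time -/

/-- A bump function on `[1/2, 1]` with a zero of order `k` at the end points. -/
noncomputable def hump (k : ℕ) (s : ℝ) : ℝ := max ((s - 1 / 2) * (1 - s)) 0 ^ k

/-- The decreasing cut-off function with derivative `-hump k`, vanishing on `[1, ∞)`. -/
noncomputable def cutoff (k : ℕ) (s : ℝ) : ℝ := ∫ r in s..1, hump k r

lemma continuous_hump (k : ℕ) : Continuous (hump k) := by unfold hump; fun_prop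

lemma hump_nonneg (k : ℕ) (s : ℝ) : 0 ≤ hump k s := by unfold hump; positivity

lemma hump_base_le_one (s : ℝ) : max ((s - 1 / 2) * (1 - s)) 0 ≤ 1 :=
  max_le (by nlinarith [sq_nonneg (s - 3 / 4)]) zero_le_one

lemma hump_le_one (k : ℕ) (s : ℝ) : hump k s ≤ 1 :=
  pow_le_one₀ (le_max_right _ _) (hump_base_le_one s)

lemma hump_of_le {k : ℕ} (hk : k ≠ 0) {s : ℝ} (hs : s ≤ 1 / 2) : hump k s = 0 := by
  have : max ((s - 1 / 2) * (1 - s)) 0 = 0 :=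
    max_eq_right (mul_nonpos_of_nonpos_of_nonneg (by linarith) (by linarith))
  rw [hump, this, zero_pow hk]

lemma hump_of_ge {k : ℕ} (hk : k ≠ 0) {s : ℝ} (hs : 1 ≤ s) : hump k s = 0 := by
  have : max ((s - 1 / 2) * (1 - s)) 0 = 0 :=
    max_eq_right (mul_nonpos_of_nonneg_of_nonpos (by linarith) (by linarith))
  rw [hump, this, zero_pow hk]

lemma hump_pos {k : ℕ} {s : ℝ} (h1 : 1 / 2 < s) (h2 : s < 1) : 0 < hump k s :=
  pow_pos (lt_max_of_lt_left (mul_pos (by linarith) (by linarith))) k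

lemma hasDerivAt_max_zero_pow (k : ℕ) (x : ℝ) :
    HasDerivAt (fun y : ℝ => max y 0 ^ (k + 2)) ((k + 2 : ℕ) * max x 0 ^ (k + 1)) x := by
  rcases lt_trichotomy x 0 with hx | rfl | hx
  · have h1 : (fun y : ℝ => max y 0 ^ (k + 2)) =ᶠ[𝓝 x] fun _ => 0 := by
      filter_upwards [gt_mem_nhds hx] with y hy
      simp [max_eq_right hy.le]
    refine ((hasDerivAt_const x (0 : ℝ)).congr_of_eventuallyEq h1).congr_deriv ?_
    simp [max_eq_right hx.le]
  · have h0 : ((k + 2 : ℕ) : ℝ) * max (0 : ℝ) 0 ^ (k + 1) = 0 := by simp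
    rw [h0, hasDerivAt_iff_isLittleO_nhds_zero]
    simp only [zero_add, max_self, smul_zero, sub_zero, ne_eq, Nat.add_eq_zero_iff,
      OfNat.ofNat_ne_zero, and_false, not_false_eq_true, zero_pow]
    have h2 : (fun h : ℝ => max h 0 ^ (k + 2)) =O[𝓝 0] fun h : ℝ => h ^ (k + 2) := by
      refine Asymptotics.IsBigO.of_bound 1 (Eventually.of_forall fun h => ?_)
      rw [norm_pow, norm_pow, one_mul, Real.norm_of_nonneg (le_max_right _ _), Real.norm_eq_abs]
      exact pow_le_pow_left₀ (le_max_right _ _) (max_le (le_abs_self _) (abs_nonneg _)) _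
    refine h2.trans_isLittleO ?_
    have := Asymptotics.isLittleO_pow_pow (𝕜 := ℝ) (m := 1) (n := k + 2) (by omega)
    simpa using this
  · have h1 : (fun y : ℝ => max y 0 ^ (k + 2)) =ᶠ[𝓝 x] fun y => y ^ (k + 2) := by
      filter_upwards [lt_mem_nhds hx] with y hy
      simp [max_eq_left hy.le]
    refine ((hasDerivAt_pow (k + 2) x).congr_of_eventuallyEq h1).congr_deriv ?_
    simp [max_eq_left hx.le]

/-- The derivative of `hump (k + 2)`. -/
noncomputable def humpDeriv (k : ℕ) (s : ℝ) : ℝ :=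
  ((k + 2 : ℕ) * max ((s - 1 / 2) * (1 - s)) 0 ^ (k + 1)) * (3 / 2 - 2 * s)

lemma hasDerivAt_hump (k : ℕ) (s : ℝ) : HasDerivAt (hump (k + 2)) (humpDeriv k s) s := by
  have h1 : HasDerivAt (fun s : ℝ => (s - 1 / 2) * (1 - s)) (3 / 2 - 2 * s) s := by
    refine (((hasDerivAt_id s).sub_const (1 / 2)).mul ((hasDerivAt_id s).const_sub 1)).congr_deriv ?_
    simp only [id]
    ring
  exact (hasDerivAt_max_zero_pow k _).comp s h1

lemma continuous_humpDeriv (k : ℕ) : Continuous (humpDeriv k) := by unfold humpDeriv; fun_prop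

lemma hump_le_rpow {p : ℝ} (hp : 1 ≤ p) (k : ℕ) (s : ℝ) : hump k s ≤ hump k s ^ (1 / p) := by
  have h0 : 0 < p := by linarith
  calc hump k s = hump k s ^ (1 : ℝ) := (Real.rpow_one _).symm
    _ ≤ hump k s ^ (1 / p) := Real.rpow_le_rpow_of_exponent_ge' (hump_nonneg k s) (hump_le_one k s)
      (by positivity) ((div_le_one h0).2 hp)

/-- The derivative has a zero of order `k + 1`, the root `hump^{1/p}` one of order `(k + 2)/p`, and
`p/(p-1) ≤ k + 2` says that the latter is no larger. This lets derivatives of the cut-off be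
absorbed by Hölder's inequality. -/
lemma abs_humpDeriv_le {p : ℝ} (hp : 1 < p) {k : ℕ} (hk : p / (p - 1) ≤ k + 2) (s : ℝ) :
    |humpDeriv k s| ≤ (k + 2) * hump (k + 2) s ^ (1 / p) := by
  have hp1 : 0 < p - 1 := by linarith
  set q := max ((s - 1 / 2) * (1 - s)) 0 with hq
  have hq0 : 0 ≤ q := le_max_right _ _
  have hq1 : q ≤ 1 := hump_base_le_one s
  rcases hq0.eq_or_lt with h0 | h0
  · have : humpDeriv k s = 0 := by rw [humpDeriv, ← hq, ← h0]; simp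
    rw [this, abs_zero]
    exact mul_nonneg (by positivity) (Real.rpow_nonneg (hump_nonneg _ _) _)
  have hin : 0 < (s - 1 / 2) * (1 - s) := by
    by_contra hcon
    rw [not_lt] at hcon
    rw [hq, max_eq_right hcon] at h0
    exact lt_irrefl _ h0
  have hs : |3 / 2 - 2 * s| ≤ 1 := by
    rw [abs_le]
    constructor <;> nlinarith
  have e1 : hump (k + 2) s ^ (1 / p) = q ^ (((k + 2 : ℕ) : ℝ) * (1 / p)) := by
    rw [hump, ← hq, ← Real.rpow_natCast, ← Real.rpow_mul hq0]
  have e2 : q ^ (k + 1) ≤ hump (k + 2) s ^ (1 / p) := by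
    rw [e1, ← Real.rpow_natCast]
    refine Real.rpow_le_rpow_of_exponent_ge h0 hq1 ?_
    rw [div_le_iff₀ hp1] at hk
    push_cast
    rw [mul_one_div, div_le_iff₀ (by linarith)]
    linarith
  rw [humpDeriv, ← hq, abs_mul, abs_of_nonneg (by positivity)]
  push_cast
  calc ((k : ℝ) + 2) * q ^ (k + 1) * |3 / 2 - 2 * s| ≤ ((k : ℝ) + 2) * q ^ (k + 1) * 1 := by gcongr
    _ ≤ ((k : ℝ) + 2) * hump (k + 2) s ^ (1 / p) := by rw [mul_one]; gcongr

lemma hasDerivAt_cutoff (k : ℕ) (s : ℝ) : HasDerivAt (cutoff k) (-hump k s) s :=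
  intervalIntegral.integral_hasDerivAt_left ((continuous_hump k).intervalIntegrable _ _)
    (continuous_hump k).aestronglyMeasurable.stronglyMeasurableAtFilter
    (continuous_hump k).continuousAt

lemma continuous_cutoff (k : ℕ) : Continuous (cutoff k) :=
  continuous_iff_continuousAt.2 fun s => (hasDerivAt_cutoff k s).continuousAt

lemma cutoff_of_ge {k : ℕ} (hk : k ≠ 0) {s : ℝ} (hs : 1 ≤ s) : cutoff k s = 0 := by
  rw [cutoff, intervalIntegral.integral_symm, neg_eq_zero]
  refine intervalIntegral.integral_zero_ae (ae_of_all _ fun r hr => ?_)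
  rw [uIoc_of_le hs] at hr
  exact hump_of_ge hk hr.1.le

lemma cutoff_of_le {k : ℕ} (hk : k ≠ 0) {s : ℝ} (hs : s ≤ 1 / 2) : cutoff k s = cutoff k 0 := by
  have h1 : ∀ s : ℝ, s ≤ 1 / 2 → cutoff k s = cutoff k (1 / 2) := by
    intro s hs
    rw [cutoff, cutoff, ← intervalIntegral.integral_add_adjacent_intervals (b := 1 / 2)
      ((continuous_hump k).intervalIntegrable _ _) ((continuous_hump k).intervalIntegrable _ _)]
    rw [add_eq_right]
    refine intervalIntegral.integral_zero_ae (ae_of_all _ fun r hr => ?_)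
    rw [uIoc_of_le hs] at hr
    exact hump_of_le hk hr.2
  rw [h1 s hs, h1 0 (by norm_num)]

lemma cutoff_anti (k : ℕ) : Antitone (cutoff k) := by
  refine antitone_of_deriv_nonpos (fun s => (hasDerivAt_cutoff k s).differentiableAt) fun s => ?_
  rw [(hasDerivAt_cutoff k s).deriv]
  linarith [hump_nonneg k s]

lemma cutoff_nonneg {k : ℕ} (hk : k ≠ 0) (s : ℝ) : 0 ≤ cutoff k s := by
  rw [← cutoff_of_ge hk (le_max_right s 1)]
  exact cutoff_anti k (le_max_left _ _)

lemma cutoff_zero_pos (k : ℕ) (hk : k ≠ 0) : 0 < cutoff k 0 := by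
  rw [← cutoff_of_le hk le_rfl, cutoff]
  exact intervalIntegral.intervalIntegral_pos_of_pos_on
    ((continuous_hump k).intervalIntegrable _ _) (fun x hx => hump_pos hx.1 hx.2) (by norm_num)

/-! ### Testing the equation in time -/

/-- Integration by parts for absolutely continuous functions: the nonlinear moment is merely
integrable in time. -/
lemma integral_mul_primitive {k b : ℝ → ℝ} {a c : ℝ} (hk : IntervalIntegrable k volume a c)
    (hb : IntervalIntegrable b volume a c) :
    ∫ x in a..c, k x * (∫ y in a..x, b y) =
      (∫ x in a..c, k x) * (∫ x in a..c, b x) - ∫ x in a..c, (∫ y in a..x, k y) * b x := by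
  have h1 := (hk.absolutelyContinuousOnInterval_intervalIntegral (c := a) (by simp))
  have h2 := (hb.absolutelyContinuousOnInterval_intervalIntegral (c := a) (by simp))
  have h3 := h1.integral_mul_deriv_eq_deriv_mul h2
  simp only [intervalIntegral.integral_same, mul_zero, sub_zero] at h3
  have e1 : ∫ x in a..c, (∫ y in a..x, k y) * deriv (fun x => ∫ y in a..x, b y) x =
      ∫ x in a..c, (∫ y in a..x, k y) * b x := by
    refine intervalIntegral.integral_congr_ae ?_
    filter_upwards [hb.ae_hasDerivAt_integral] with x hx hxm
    rw [(hx (uIoc_subset_uIcc hxm) a (by simp)).deriv]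
  have e2 : ∫ x in a..c, deriv (fun x => ∫ y in a..x, k y) x * (∫ y in a..x, b y) =
      ∫ x in a..c, k x * (∫ y in a..x, b y) := by
    refine intervalIntegral.integral_congr_ae ?_
    filter_upwards [hk.ae_hasDerivAt_integral] with x hx hxm
    rw [(hx (uIoc_subset_uIcc hxm) a (by simp)).deriv]
  rw [e1, e2] at h3
  linarith

/-- Integration by parts for a primitive `P` of an integrable function `k`. -/
lemma integral_mul_eq_sub_of_primitive {k P B B' : ℝ → ℝ} {a c : ℝ} (hac : a ≤ c)
    (hk : IntervalIntegrable k volume a c)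
    (hP : ∀ x ∈ Icc a c, P x = P a + ∫ y in a..x, k y)
    (hB : ∀ x ∈ Icc a c, HasDerivAt B (B' x) x) (hB' : ContinuousOn B' (Icc a c)) :
    ∫ x in a..c, k x * B x = P c * B c - P a * B a - ∫ x in a..c, P x * B' x := by
  have hBi : ∀ x ∈ Icc a c, IntervalIntegrable B' volume a x := fun x hx =>
    (hB'.mono (by rw [uIcc_of_le hx.1]; exact Icc_subset_Icc_right hx.2)).intervalIntegrable
  have hBint : ∀ x ∈ Icc a c, B x = B a + ∫ y in a..x, B' y := by
    intro x hx
    rw [intervalIntegral.integral_eq_sub_of_hasDerivAt (fun y hy => hB y ?_) (hBi x hx)]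
    · ring
    · rw [uIcc_of_le hx.1] at hy
      exact ⟨hy.1, hy.2.trans hx.2⟩
  have hcm : c ∈ Icc a c := ⟨hac, le_rfl⟩
  have hbc := hBi c hcm
  have main := integral_mul_primitive hk hbc
  have c1 : ContinuousOn (fun x => ∫ y in a..x, B' y) (uIcc a c) :=
    intervalIntegral.continuousOn_primitive_interval' hbc (by simp)
  have c2 : ContinuousOn (fun x => ∫ y in a..x, k y) (uIcc a c) :=
    intervalIntegral.continuousOn_primitive_interval' hk (by simp)
  have e1 : ∫ x in a..c, k x * B x = B a * (∫ x in a..c, k x) +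
      ∫ x in a..c, k x * (∫ y in a..x, B' y) := by
    rw [← intervalIntegral.integral_const_mul, ← intervalIntegral.integral_add (hk.const_mul _)
      (hk.mul_continuousOn c1)]
    refine intervalIntegral.integral_congr fun x hx => ?_
    rw [uIcc_of_le hac] at hx
    simp only [hBint x hx]
    ring
  have e2 : ∫ x in a..c, P x * B' x = P a * (∫ x in a..c, B' x) +
      ∫ x in a..c, (∫ y in a..x, k y) * B' x := by
    rw [← intervalIntegral.integral_const_mul, ← intervalIntegral.integral_add (hbc.const_mul _)
      (hbc.continuousOn_mul c2)]
    refine intervalIntegral.integral_congr fun x hx => ?_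
    rw [uIcc_of_le hac] at hx
    simp only [hP x hx]
    ring
  rw [e1, e2, main, hP c hcm, hBint c hcm]
  ring

/-- A solution `ϑ` of the adjoint equation `(t^μ ϑ')' = λ² t^μ ϑ` on `t > 0` that is nonnegative and
nonincreasing, with `ϑ' = -ϑn`. -/
structure IsAdjoint (μ lam : ℝ) (ϑ ϑn : ℝ → ℝ) : Prop where
  hasDeriv : ∀ t, 0 < t → HasDerivAt ϑ (-ϑn t) t
  hasDeriv_neg : ∀ t, 0 < t → HasDerivAt (fun s => s ^ μ * ϑn s) (-(lam ^ 2 * (t ^ μ * ϑ t))) t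
  nonneg : ∀ t, 0 < t → 0 ≤ ϑ t
  neg_nonneg : ∀ t, 0 < t → 0 ≤ ϑn t

lemma IsAdjoint.continuousOn {μ lam : ℝ} {ϑ ϑn : ℝ → ℝ} (h : IsAdjoint μ lam ϑ ϑn) :
    ContinuousOn ϑ (Ioi 0) := fun t ht => (h.hasDeriv t ht).continuousAt.continuousWithinAt

lemma IsAdjoint.continuousOn_neg {μ lam : ℝ} {ϑ ϑn : ℝ → ℝ} (h : IsAdjoint μ lam ϑ ϑn) :
    ContinuousOn ϑn (Ioi 0) := by
  intro t ht
  have h1 : ContinuousAt (fun s : ℝ => s ^ (-μ) * (s ^ μ * ϑn s)) t :=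
    (Real.continuousAt_rpow_const t (-μ) (Or.inl (ne_of_gt ht))).mul
      (h.hasDeriv_neg t ht).continuousAt
  refine (h1.congr ?_).continuousWithinAt
  filter_upwards [lt_mem_nhds ht] with s hs
  rw [← mul_assoc, ← Real.rpow_add hs]
  simp

/-- The functional `M` of a solution satisfies `(t^μ M')' = t^μ (H + λ² M)` in integrated form. -/
structure IsMoment (μ lam T : ℝ) (M M' H : ℝ → ℝ) : Prop where
  hasDeriv : ∀ t ∈ Ico 0 T, HasDerivWithinAt M (M' t) (Ico 0 T) t
  cont : ContinuousOn M' (Ico 0 T)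
  integrable : ∀ t ∈ Ico 0 T,
    IntervalIntegrable (fun s => s ^ μ * (H s + lam ^ 2 * M s)) volume 0 t
  eq : ∀ t ∈ Ico 0 T, t ^ μ * M' t = ∫ s in (0 : ℝ)..t, s ^ μ * (H s + lam ^ 2 * M s)
  nonneg : ∀ t, 0 ≤ t → 0 ≤ H t

section Test

variable {μ lam T R : ℝ} {M M' H ϑ ϑn : ℝ → ℝ} {k : ℕ}

/-- The remainder that the cut-off produces in the tested equation. -/
noncomputable def cutoffError (μ R : ℝ) (k : ℕ) (ϑ ϑn : ℝ → ℝ) (t : ℝ) : ℝ :=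
  2 * (t ^ μ * ϑn t) * (hump (k + 2) (t / R) / R) -
    ϑ t * (μ * t ^ (μ - 1) * (hump (k + 2) (t / R) / R) + t ^ μ * (humpDeriv k (t / R) / R ^ 2))

/-- Two integrations by parts move the derivatives from `M` to `ϑη`. The terms with `λ²` cancel by
the equation for `ϑ`, and only those where a derivative hits the cut-off remain. -/
lemma IsMoment.test (hM : IsMoment μ lam T M M' H) (hϑ : IsAdjoint μ lam ϑ ϑn)
    (hRT : R < T) {a : ℝ} (ha : 0 < a) (haR : a ≤ R) :
    (∫ t in a..R, t ^ μ * (H t * ϑ t * cutoff (k + 2) (t / R))) +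
        a ^ μ * M' a * (ϑ a * cutoff (k + 2) (a / R)) +
        M a * (a ^ μ * ϑn a * cutoff (k + 2) (a / R) +
          a ^ μ * ϑ a * (hump (k + 2) (a / R) / R)) =
      ∫ t in a..R, M t * cutoffError μ R k ϑ ϑn t := by
  have hR : 0 < R := ha.trans_le haR
  have hk2 : k + 2 ≠ 0 := by omega
  set η := fun t => cutoff (k + 2) (t / R) with hη
  set g := fun t => hump (k + 2) (t / R) / R with hg
  set g' := fun t => humpDeriv k (t / R) / R ^ 2 with hg'
  have hηd : ∀ t, HasDerivAt η (-g t) t := by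
    intro t
    have := (hasDerivAt_cutoff (k + 2) (t / R)).comp t ((hasDerivAt_id t).div_const R)
    refine HasDerivAt.congr_deriv (f := η) this ?_
    simp only [hg]; ring
  have hgd : ∀ t, HasDerivAt g (g' t) t := by
    intro t
    have := ((hasDerivAt_hump k (t / R)).comp t ((hasDerivAt_id t).div_const R)).div_const R
    refine HasDerivAt.congr_deriv (f := g) this ?_
    simp only [hg']; field_simp
  have hηR : η R = 0 := by
    simp only [hη, div_self hR.ne']; exact cutoff_of_ge hk2 le_rfl
  have hgR : g R = 0 := by
    simp only [hg, div_self hR.ne', hump_of_ge hk2 le_rfl, zero_div]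
  have hsub : ∀ t ∈ Icc a R, 0 < t := fun t ht => ha.trans_le ht.1
  have hsubT : ∀ t ∈ Icc a R, t ∈ Ico 0 T := fun t ht => ⟨(hsub t ht).le, ht.2.trans_lt hRT⟩
  have hII : uIcc a R = Icc a R := uIcc_of_le haR
  -- This is `-t^μ (ϑη)'`.
  set D := fun t => t ^ μ * ϑn t * η t + t ^ μ * ϑ t * g t with hD
  set B' := fun t => -(ϑn t * η t + ϑ t * g t) with hB'
  have hBd : ∀ t, 0 < t → HasDerivAt (fun t => ϑ t * η t) (B' t) t := by
    intro t ht
    refine HasDerivAt.congr_deriv (f := fun t => ϑ t * η t) ((hϑ.hasDeriv t ht).mul (hηd t)) ?_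
    simp only [hB']; ring
  have hpow : ∀ t : ℝ, 0 < t → HasDerivAt (fun s : ℝ => s ^ μ) (μ * t ^ (μ - 1)) t := fun t ht =>
    Real.hasDerivAt_rpow_const (Or.inl ht.ne')
  set E := cutoffError μ R k ϑ ϑn with hE
  have hDd : ∀ t, 0 < t → HasDerivAt D (-(lam ^ 2 * (t ^ μ * ϑ t)) * η t - E t) t := by
    intro t ht
    have d1 := (hϑ.hasDeriv_neg t ht).mul (hηd t)
    have d2 := ((hpow t ht).mul (hϑ.hasDeriv t ht)).mul (hgd t)
    refine HasDerivAt.congr_deriv (f := D) (d1.add d2) ?_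
    simp only [hE, cutoffError, hg, hg', Pi.mul_apply]
    ring
  have cη : Continuous η := (continuous_cutoff _).comp (continuous_id.div_const R)
  have cg : Continuous g := ((continuous_hump _).comp (continuous_id.div_const R)).div_const R
  have cg' : Continuous g' :=
    ((continuous_humpDeriv _).comp (continuous_id.div_const R)).div_const (R ^ 2)
  have cϑ : ContinuousOn ϑ (Icc a R) := hϑ.continuousOn.mono hsub
  have cϑn : ContinuousOn ϑn (Icc a R) := hϑ.continuousOn_neg.mono hsub
  have cpow : ∀ q : ℝ, ContinuousOn (fun t : ℝ => t ^ q) (Icc a R) := fun q =>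
    continuousOn_id.rpow_const fun t ht => Or.inl (hsub t ht).ne'
  have cB' : ContinuousOn B' (Icc a R) :=
    ((cϑn.mul cη.continuousOn).add (cϑ.mul cg.continuousOn)).neg
  have cE : ContinuousOn E (Icc a R) := by
    have c1 := ((((cpow μ).mul cϑn).const_mul 2).mul cg.continuousOn).sub
      (cϑ.mul ((((cpow (μ - 1)).const_mul μ).mul cg.continuousOn).add
        ((cpow μ).mul cg'.continuousOn)))
    exact c1
  have cM : ContinuousOn M (Icc a R) := fun t ht =>
    ((hM.hasDeriv t (hsubT t ht)).continuousWithinAt).mono hsubT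
  have cM' : ContinuousOn M' (Icc a R) := hM.cont.mono hsubT
  have hkint : ∀ x ∈ Icc a R, IntervalIntegrable
      (fun s => s ^ μ * (H s + lam ^ 2 * M s)) volume a x := fun x hx =>
    (hM.integrable a (hsubT a ⟨le_rfl, haR⟩)).symm.trans (hM.integrable x (hsubT x hx))
  have hRm : R ∈ Icc a R := ⟨haR, le_rfl⟩
  have ham : a ∈ Icc a R := ⟨le_rfl, haR⟩
  have ibp1 := integral_mul_eq_sub_of_primitive (P := fun t => t ^ μ * M' t)
    (B := fun t => ϑ t * η t) (B' := B') haR (hkint R hRm) (fun x hx => by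
      rw [hM.eq x (hsubT x hx), hM.eq a (hsubT a ham),
        intervalIntegral.integral_add_adjacent_intervals (hM.integrable a (hsubT a ham))
          (hkint x hx)]) (fun x hx => hBd x (hsub x hx)) cB'
  simp only [hηR, mul_zero, zero_sub] at ibp1
  have e1 : ∫ x in a..R, x ^ μ * M' x * B' x = -∫ x in a..R, M' x * D x := by
    rw [← intervalIntegral.integral_neg]
    refine intervalIntegral.integral_congr fun x _ => ?_
    simp only [hB', hD]; ring
  have cD : ContinuousOn D (Icc a R) := fun t ht =>
    (hDd t (hsub t ht)).continuousAt.continuousWithinAt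
  have cD' : ContinuousOn (fun t => -(lam ^ 2 * (t ^ μ * ϑ t)) * η t - E t) (Icc a R) :=
    ((((cpow μ).mul cϑ).const_mul (lam ^ 2)).neg.mul cη.continuousOn).sub cE
  have ibp2 := intervalIntegral.integral_mul_deriv_eq_deriv_mul (u := D) (v := M)
    (u' := fun t => -(lam ^ 2 * (t ^ μ * ϑ t)) * η t - E t) (v' := M') (a := a) (b := R)
    (fun x hx => hDd x (hsub x (hII ▸ hx)))
    (fun x hx => (hM.hasDeriv x (hsubT x (hII ▸ hx))).hasDerivAt
      (Ico_mem_nhds (hsub x (hII ▸ hx)) (hsubT x (hII ▸ hx)).2))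
    (hII ▸ cD').intervalIntegrable (hII ▸ cM').intervalIntegrable
  have hDR : D R = 0 := by simp only [hD, hηR, hgR]; ring
  rw [hDR, zero_mul, zero_sub] at ibp2
  have e2 : ∫ x in a..R, M' x * D x = ∫ x in a..R, D x * M' x :=
    intervalIntegral.integral_congr fun x _ => mul_comm _ _
  have iM : IntervalIntegrable (fun x => M x * (lam ^ 2 * (x ^ μ * ϑ x) * η x)) volume a R :=
    (hII ▸ cM.mul ((((cpow μ).mul cϑ).const_mul (lam ^ 2)).mul cη.continuousOn) :
      ContinuousOn _ (uIcc a R)).intervalIntegrable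
  have iE : IntervalIntegrable (fun x => M x * E x) volume a R :=
    (hII ▸ cM.mul cE : ContinuousOn _ (uIcc a R)).intervalIntegrable
  have e3 : ∫ x in a..R, (-(lam ^ 2 * (x ^ μ * ϑ x)) * η x - E x) * M x =
      -(∫ x in a..R, M x * (lam ^ 2 * (x ^ μ * ϑ x) * η x)) - ∫ x in a..R, M x * E x := by
    have iMn : IntervalIntegrable (fun x => -(M x * (lam ^ 2 * (x ^ μ * ϑ x) * η x))) volume a R :=
      iM.neg
    rw [← intervalIntegral.integral_neg, ← intervalIntegral.integral_sub iMn iE]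
    refine intervalIntegral.integral_congr fun x _ => ?_
    ring
  have e4 : ∫ t in a..R, t ^ μ * (H t * ϑ t * η t) =
      (∫ x in a..R, x ^ μ * (H x + lam ^ 2 * M x) * (ϑ x * η x)) -
        ∫ x in a..R, M x * (lam ^ 2 * (x ^ μ * ϑ x) * η x) := by
    rw [← intervalIntegral.integral_sub _ iM]
    · refine intervalIntegral.integral_congr fun x _ => ?_
      ring
    · exact (hkint R hRm).mul_continuousOn (hII ▸ cϑ.mul cη.continuousOn)
  rw [e4, ibp1, e1, e2, ibp2, e3]
  simp only [hD]
  ring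

lemma IsMoment.continuousOn (hM : IsMoment μ lam T M M' H) : ContinuousOn M (Ico 0 T) :=
  fun t ht => (hM.hasDeriv t ht).continuousWithinAt

lemma IsMoment.intervalIntegrable_test (hM : IsMoment μ lam T M M' H) (hϑ : IsAdjoint μ lam ϑ ϑn)
    {b c : ℝ} (hb : 0 < b) (hbc : b ≤ c) (hcT : c < T) :
    IntervalIntegrable (fun t => t ^ μ * (H t * ϑ t * cutoff (k + 2) (t / R))) volume b c := by
  have hsub : ∀ t ∈ uIcc b c, t ∈ Ioi (0 : ℝ) := fun t ht => by
    rw [uIcc_of_le hbc] at ht; exact hb.trans_le ht.1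
  have hsubT : ∀ t ∈ uIcc b c, t ∈ Ico 0 T := fun t ht => by
    rw [uIcc_of_le hbc] at ht
    exact ⟨(hb.trans_le ht.1).le, ht.2.trans_lt hcT⟩
  have i0 : IntervalIntegrable (fun s => s ^ μ * (H s + lam ^ 2 * M s)) volume b c :=
    (hM.integrable b (hsubT b left_mem_uIcc)).symm.trans
      (hM.integrable c (hsubT c right_mem_uIcc))
  have i1 : IntervalIntegrable (fun s => s ^ μ * (lam ^ 2 * M s)) volume b c := by
    refine ContinuousOn.intervalIntegrable ?_
    exact (continuousOn_id.rpow_const fun t ht => Or.inl (ne_of_gt (hsub t ht))).mul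
      ((hM.continuousOn.mono hsubT).const_mul _)
  have i2 := (i0.sub i1).mul_continuousOn ((hϑ.continuousOn.mono hsub).mul
    ((continuous_cutoff (k + 2)).comp (continuous_id.div_const R)).continuousOn)
  refine i2.congr (fun s _ => ?_)
  simp only [Function.comp, id, Pi.mul_apply]
  ring

/-- The limit `a → 0` of `IsMoment.test`. Since `ϑ` may blow up at `0`, the boundary terms are
handled by their sign and the lower bound `m`, not by taking their limits. -/
lemma IsMoment.test_le (hM : IsMoment μ lam T M M' H) (hϑ : IsAdjoint μ lam ϑ ϑn) (hμ : 0 < μ)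
    {p : ℝ} (hp : 1 < p) (hk : p / (p - 1) ≤ k + 2) (hM0 : 0 < M 0) {m : ℝ}
    (hmϑ : ∀ a ∈ Ioc (0 : ℝ) 1, m ≤ a ^ μ * ϑn a) (hR : 2 ≤ R) (hRT : R < T) :
    m * cutoff (k + 2) 0 * M 0 +
        ∫ t in (1 : ℝ)..R, t ^ μ * (H t * ϑ t * cutoff (k + 2) (t / R)) ≤
      ∫ t in R / 2..R, t ^ μ * |M t| * ((k + 4 + 2 * μ) * hump (k + 2) (t / R) ^ (1 / p) *
        (ϑn t / R + ϑ t / R ^ 2)) := by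
  have hk2 : k + 2 ≠ 0 := by omega
  have hR0 : 0 < R := by linarith
  have h0T : (0 : ℝ) ∈ Ico 0 T := ⟨le_rfl, by linarith⟩
  set η0 := cutoff (k + 2) 0 with hη0
  have hη0p : 0 < η0 := cutoff_zero_pos _ hk2
  have hMc : ContinuousOn M (Ico 0 T) := hM.continuousOn
  have hMt : Tendsto M (𝓝[>] 0) (𝓝 (M 0)) := by
    refine (hMc 0 h0T).mono_left ?_
    rw [← nhdsWithin_Ioo_eq_nhdsGT h0T.2]
    exact nhdsWithin_mono _ Ioo_subset_Ico_self
  obtain ⟨a0, ha0, hpos⟩ : ∃ a0 > 0, ∀ s ∈ Ioo 0 a0, 0 < M s := by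
    have := hMt.eventually_const_lt hM0
    obtain ⟨a0, ha0, hs⟩ := mem_nhdsGT_iff_exists_Ioo_subset.1 this
    exact ⟨a0, ha0, hs⟩
  set W := ∫ t in (1 : ℝ)..R, t ^ μ * (H t * ϑ t * cutoff (k + 2) (t / R)) with hW
  set Z := ∫ t in R / 2..R, t ^ μ * |M t| * ((k + 4 + 2 * μ) * hump (k + 2) (t / R) ^ (1 / p) *
        (ϑn t / R + ϑ t / R ^ 2)) with hZ
  have cE : ContinuousOn (cutoffError μ R k ϑ ϑn) (Ioi 0) := by
    have cg : Continuous fun t => hump (k + 2) (t / R) / R :=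
      ((continuous_hump _).comp (continuous_id.div_const R)).div_const R
    have cg' : Continuous fun t => humpDeriv k (t / R) / R ^ 2 :=
      ((continuous_humpDeriv _).comp (continuous_id.div_const R)).div_const (R ^ 2)
    have cpow : ∀ q : ℝ, ContinuousOn (fun t : ℝ => t ^ q) (Ioi 0) := fun q =>
      continuousOn_id.rpow_const fun t ht => Or.inl (ne_of_gt ht)
    exact ((((cpow μ).mul hϑ.continuousOn_neg).const_mul 2).mul cg.continuousOn).sub
      (hϑ.continuousOn.mul ((((cpow (μ - 1)).const_mul μ).mul cg.continuousOn).add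
        ((cpow μ).mul cg'.continuousOn)))
  have herr : ∀ t, 0 < t → t ≤ R / 2 → cutoffError μ R k ϑ ϑn t = 0 := by
    intro t _ ht
    have h1 : t / R ≤ 1 / 2 := by rw [div_le_iff₀ hR0]; linarith
    have h2 : humpDeriv k (t / R) = 0 := by
      have : max ((t / R - 1 / 2) * (1 - t / R)) 0 = 0 :=
        max_eq_right (mul_nonpos_of_nonpos_of_nonneg (by linarith) (by linarith))
      rw [humpDeriv, this]; simp
    simp only [cutoffError, hump_of_le hk2 h1, h2]
    ring
  have hbound : ∀ t ∈ Icc (R / 2) R, M t * cutoffError μ R k ϑ ϑn t ≤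
      t ^ μ * |M t| * ((k + 4 + 2 * μ) * hump (k + 2) (t / R) ^ (1 / p) *
        (ϑn t / R + ϑ t / R ^ 2)) := by
    intro t ht
    have ht0 : 0 < t := by linarith [ht.1]
    have hϑ0 := hϑ.nonneg t ht0
    have hϑn0 := hϑ.neg_nonneg t ht0
    set G := hump (k + 2) (t / R) ^ (1 / p) with hG
    have hG0 : 0 ≤ G := Real.rpow_nonneg (hump_nonneg _ _) _
    have hgG : hump (k + 2) (t / R) ≤ G := hump_le_rpow hp.le _ _
    have hg0 := hump_nonneg (k + 2) (t / R)
    have hg'G : |humpDeriv k (t / R)| ≤ (k + 2) * G := abs_humpDeriv_le hp hk _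
    have htμ : 0 < t ^ μ := Real.rpow_pos_of_pos ht0 μ
    have hE : |cutoffError μ R k ϑ ϑn t| ≤
        t ^ μ * ((k + 4 + 2 * μ) * G * (ϑn t / R + ϑ t / R ^ 2)) := by
      -- On the strip `1/t ≤ 2/R`; this is the origin of `2 * μ` in the constant.
      have e1 : t ^ (μ - 1) ≤ t ^ μ * (2 / R) := by
        rw [Real.rpow_sub_one ht0.ne', div_eq_mul_inv]
        refine mul_le_mul_of_nonneg_left ?_ htμ.le
        rw [inv_le_comm₀ ht0 (by positivity), inv_div]
        exact ht.1
      have b1 : |2 * (t ^ μ * ϑn t) * (hump (k + 2) (t / R) / R)| ≤ t ^ μ * (2 * G * (ϑn t / R)) := by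
        rw [abs_of_nonneg (by positivity)]
        have : 2 * (t ^ μ * ϑn t) * (hump (k + 2) (t / R) / R) =
          t ^ μ * (2 * hump (k + 2) (t / R) * (ϑn t / R)) := by ring
        rw [this]
        gcongr
      have b2 : |ϑ t * (μ * t ^ (μ - 1) * (hump (k + 2) (t / R) / R) +
          t ^ μ * (humpDeriv k (t / R) / R ^ 2))| ≤
          t ^ μ * ((k + 2 + 2 * μ) * G * (ϑ t / R ^ 2)) := by
        rw [abs_mul, abs_of_nonneg hϑ0]
        have b3 : |μ * t ^ (μ - 1) * (hump (k + 2) (t / R) / R) +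
            t ^ μ * (humpDeriv k (t / R) / R ^ 2)| ≤
            μ * (t ^ μ * (2 / R)) * (G / R) + t ^ μ * ((k + 2) * G / R ^ 2) := by
          refine (abs_add_le _ _).trans (add_le_add ?_ ?_)
          · have : 0 ≤ t ^ (μ - 1) := Real.rpow_nonneg ht0.le _
            rw [abs_of_nonneg (by positivity)]
            gcongr
          · rw [abs_mul, abs_of_pos htμ, abs_div, abs_of_pos (by positivity : 0 < R ^ 2)]
            gcongr
        refine (mul_le_mul_of_nonneg_left b3 hϑ0).trans (le_of_eq ?_)
        field_simp
        ring
      have b4 : |cutoffError μ R k ϑ ϑn t| ≤ t ^ μ * (2 * G * (ϑn t / R)) +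
          t ^ μ * ((k + 2 + 2 * μ) * G * (ϑ t / R ^ 2)) :=
        (abs_sub _ _).trans (add_le_add b1 b2)
      refine b4.trans ?_
      rw [← mul_add]
      refine mul_le_mul_of_nonneg_left ?_ htμ.le
      have q1 : 0 ≤ G * (ϑn t / R) := by positivity
      have q2 : 0 ≤ G * (ϑ t / R ^ 2) := by positivity
      have hk0 : (0 : ℝ) ≤ k := Nat.cast_nonneg k
      nlinarith [mul_nonneg hk0 q1, mul_nonneg hμ.le q1]
    calc M t * cutoffError μ R k ϑ ϑn t ≤ |M t| * |cutoffError μ R k ϑ ϑn t| := by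
          rw [← abs_mul]; exact le_abs_self _
      _ ≤ |M t| * (t ^ μ * ((k + 4 + 2 * μ) * G * (ϑn t / R + ϑ t / R ^ 2))) := by gcongr
      _ = _ := by ring
  have hmain : ∀ a, 0 < a → a < min a0 1 → m * η0 * M a + W ≤ Z := by
    intro a ha ha1
    have haa0 : a < a0 := ha1.trans_le (min_le_left _ _)
    have ha11 : a < 1 := ha1.trans_le (min_le_right _ _)
    have haR2 : a / R ≤ 1 / 2 := by rw [div_le_iff₀ hR0]; linarith
    have haT : a ∈ Ico 0 T := ⟨ha.le, by linarith⟩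
    have htest := hM.test (k := k) hϑ hRT ha (by linarith : a ≤ R)
    rw [hump_of_le hk2 haR2, cutoff_of_le hk2 haR2, ← hη0, zero_div, mul_zero, add_zero] at htest
    have hMa := hpos a ⟨ha, haa0⟩
    -- `M` is positive near `0`, hence so is the integrand in the equation for `a^μ M'`; the
    -- possibly large factor `ϑ a` then multiplies something nonnegative.
    have hPa : 0 ≤ a ^ μ * M' a := by
      rw [hM.eq a haT]
      refine intervalIntegral.integral_nonneg_of_ae_restrict ha.le ?_
      rw [EventuallyLE, ae_restrict_iff' measurableSet_Icc]
      have hne : ∀ᵐ s : ℝ, s ≠ 0 := by simp [ae_iff]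
      filter_upwards [hne] with s hs0 hs
      have hs' : 0 < s := lt_of_le_of_ne hs.1 (Ne.symm hs0)
      have h1 := hpos s ⟨hs', hs.2.trans_lt haa0⟩
      have h2 := hM.nonneg s hs'.le
      simp only [Pi.zero_apply]
      positivity
    have hϑa := hϑ.nonneg a ha
    have hIntg := fun b c (hb : 0 < b) (hbc : b ≤ c) (hcR : c ≤ R) =>
      hM.intervalIntegrable_test (k := k) (R := R) hϑ hb hbc (hcR.trans_lt hRT)
    have hsplit : W ≤ ∫ t in a..R, t ^ μ * (H t * ϑ t * cutoff (k + 2) (t / R)) := by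
      rw [← intervalIntegral.integral_add_adjacent_intervals (hIntg a 1 ha ha11.le (by linarith))
        (hIntg 1 R one_pos (by linarith) le_rfl)]
      have : 0 ≤ ∫ t in a..1, t ^ μ * (H t * ϑ t * cutoff (k + 2) (t / R)) := by
        refine intervalIntegral.integral_nonneg ha11.le fun t ht => ?_
        have ht0 : 0 < t := ha.trans_le ht.1
        have := hϑ.nonneg t ht0
        have := hM.nonneg t ht0.le
        have := cutoff_nonneg hk2 (t / R)
        positivity
      linarith
    have hMcE : ContinuousOn (fun t => M t * cutoffError μ R k ϑ ϑn t) (Icc a R) :=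
      (hMc.mono fun t ht => ⟨(ha.trans_le ht.1).le, ht.2.trans_lt hRT⟩).mul
        (cE.mono fun t ht => ha.trans_le ht.1)
    have hright : ∫ t in a..R, M t * cutoffError μ R k ϑ ϑn t ≤ Z := by
      have haR' : a ≤ R / 2 := by linarith
      rw [← intervalIntegral.integral_add_adjacent_intervals (b := R / 2)
        (hMcE.mono (by rw [uIcc_of_le haR']; exact Icc_subset_Icc_right (by linarith))).intervalIntegrable
        (hMcE.mono (by
          rw [uIcc_of_le (by linarith)]; exact Icc_subset_Icc_left haR')).intervalIntegrable]
      have hz : ∫ t in a..R / 2, M t * cutoffError μ R k ϑ ϑn t = 0 := by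
        refine intervalIntegral.integral_zero_ae (ae_of_all _ fun t ht => ?_)
        rw [uIoc_of_le haR'] at ht
        rw [herr t (ha.trans ht.1) ht.2, mul_zero]
      rw [hz, zero_add]
      refine intervalIntegral.integral_mono_on (by linarith) ?_ ?_ hbound
      · exact (hMcE.mono (by
          rw [uIcc_of_le (by linarith)]; exact Icc_subset_Icc_left haR')).intervalIntegrable
      · refine ContinuousOn.intervalIntegrable ?_
        rw [uIcc_of_le (by linarith)]
        have hsub : ∀ t ∈ Icc (R / 2) R, t ∈ Ioi (0 : ℝ) := fun t ht => by
          have := ht.1; rw [mem_Ioi]; linarith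
        have c1 : ContinuousOn (fun t : ℝ => t ^ μ * |M t|) (Icc (R / 2) R) :=
          (continuousOn_id.rpow_const fun t ht => Or.inl (ne_of_gt (hsub t ht))).mul
            (hMc.mono fun t ht => ⟨(hsub t ht).le, ht.2.trans_lt hRT⟩).abs
        have c2 : ContinuousOn (fun t : ℝ => (k + 4 + 2 * μ) * hump (k + 2) (t / R) ^ (1 / p))
            (Icc (R / 2) R) := by
          refine (Continuous.const_mul ?_ _).continuousOn
          exact (Real.continuous_rpow_const (by positivity)).comp
            ((continuous_hump _).comp (continuous_id.div_const R))
        exact c1.mul (c2.mul (((hϑ.continuousOn_neg.mono hsub).div_const R).add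
          ((hϑ.continuousOn.mono hsub).div_const (R ^ 2))))
    have hma := hmϑ a ⟨ha, ha11.le⟩
    have hma2 : m * η0 * M a ≤ M a * (a ^ μ * ϑn a * η0) := by
      have := mul_le_mul_of_nonneg_right hma (mul_nonneg hη0p.le hMa.le)
      linarith
    have hpb : 0 ≤ a ^ μ * M' a * (ϑ a * η0) := mul_nonneg hPa (mul_nonneg hϑa hη0p.le)
    linarith
  have hlim : Tendsto (fun a => m * η0 * M a + W) (𝓝[>] 0) (𝓝 (m * η0 * M 0 + W)) :=
    (hMt.const_mul _).add_const W
  refine le_of_tendsto hlim ?_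
  filter_upwards [Ioo_mem_nhdsGT (lt_min ha0 one_pos)] with a ha using hmain a ha.1 ha.2

end Test

end EPD

namespace EPD

/-! ### Exponential moments of a solution -/

section Moments

variable {n : ℕ}

/-- The exponential `e^{l x·e}`, cut off outside the ball of radius `T + 3` (for `T > -2`). -/
noncomputable def planeWave (T l : ℝ) (e x : Space n) : ℝ :=
  Real.smoothTransition (3 + T - ‖x‖) * Real.exp (l * ⟪x, e⟫)

lemma planeWave_nonneg (T l : ℝ) (e x : Space n) : 0 ≤ planeWave T l e x :=
  mul_nonneg (Real.smoothTransition.nonneg _) (Real.exp_pos _).le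

lemma planeWave_eq {T l : ℝ} {e x : Space n} (hx : ‖x‖ ≤ T + 2) :
    planeWave T l e x = Real.exp (l * ⟪x, e⟫) := by
  rw [planeWave, Real.smoothTransition.one_of_one_le (by linarith), one_mul]

lemma planeWave_eq_zero {T l : ℝ} {e x : Space n} (hx : T + 3 ≤ ‖x‖) : planeWave T l e x = 0 := by
  rw [planeWave, Real.smoothTransition.zero_of_nonpos (by linarith), zero_mul]

lemma contDiff_exp_inner (l : ℝ) (e : Space n) :
    ContDiff ℝ ∞ (fun x : Space n => Real.exp (l * ⟪x, e⟫)) := by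
  have : ContDiff ℝ ∞ (fun x : Space n => ⟪x, e⟫) := contDiff_id.inner ℝ contDiff_const
  exact (contDiff_const.mul this).exp

/-- The norm fails to be smooth only at the origin, near which the cut-off is constant. -/
lemma contDiff_planeWave {T : ℝ} (hT : 0 < T) (l : ℝ) (e : Space n) :
    ContDiff ℝ ∞ (planeWave T l e) := by
  rw [contDiff_iff_contDiffAt]
  intro x
  by_cases hx : x = 0
  · refine (contDiff_exp_inner l e).contDiffAt.congr_of_eventuallyEq ?_
    filter_upwards [Metric.ball_mem_nhds x (by linarith : 0 < T + 2)] with y hy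
    rw [hx, mem_ball_zero_iff] at hy
    exact planeWave_eq hy.le
  · refine ContDiffAt.mul ?_ (contDiff_exp_inner l e).contDiffAt
    exact Real.smoothTransition.contDiff.contDiffAt.comp x
      (contDiffAt_const.sub (contDiffAt_norm ℝ hx))

lemma hasCompactSupport_planeWave (T l : ℝ) (e : Space n) :
    HasCompactSupport (planeWave T l e) := by
  refine HasCompactSupport.intro (isCompact_closedBall (0 : Space n) (T + 3)) fun x hx => ?_
  rw [mem_closedBall_zero_iff, not_le] at hx
  exact planeWave_eq_zero hx.le

lemma gradient_planeWave {T l : ℝ} {e x : Space n} (hx : ‖x‖ < T + 2) :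
    ∇ (planeWave T l e) x = (l * planeWave T l e x) • e := by
  have h1 : planeWave T l e =ᶠ[𝓝 x] fun x => Real.exp (l * ⟪x, e⟫) := by
    filter_upwards [(isOpen_lt continuous_norm continuous_const).mem_nhds hx] with y hy
    exact planeWave_eq (le_of_lt hy)
  rw [h1.gradient_eq, planeWave_eq hx.le]
  have h2 : HasFDerivAt (fun x : Space n => ⟪x, e⟫) (innerSL ℝ e) x := by
    have := (innerSL ℝ e).hasFDerivAt (x := x)
    refine this.congr_of_eventuallyEq (Eventually.of_forall fun y => ?_)
    simp [real_inner_comm]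
  have h3 := (h2.const_mul l).exp
  apply HasGradientAt.gradient
  rw [hasGradientAt_iff_hasFDerivAt]
  have h4 : InnerProductSpace.toDual ℝ (Space n) ((l * Real.exp (l * ⟪x, e⟫)) • e) =
      Real.exp (l * ⟪x, e⟫) • l • innerSL ℝ e := by
    ext y
    simp only [InnerProductSpace.toDual_apply_apply, inner_smul_left, smul_apply,
      innerSL_apply_apply, smul_eq_mul, conj_trivial]
    ring
  rw [h4]
  exact h3

variable {μ α p T : ℝ} {u : ℝ → Space n → ℝ}
  {U V : ℝ → Lp ℝ 2 (volume : Measure (Space n))}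
  {G : ℝ → Lp (Space n) 2 (volume : Measure (Space n))}

lemma EnergyCurves.ae_eq_zero_of_cone (h : EnergyCurves μ α p T u U V G)
    (hcone : SupportedInCone T u) {t : ℝ} (ht : t ∈ Ico 0 T) :
    ∀ᵐ x, t + 1 < ‖x‖ → U t x = 0 := by
  filter_upwards [hcone t ht, h.ae_eq t ht] with x hx hxU hlt
  rw [← hxU, hx hlt]

lemma nonlin_nonneg {w : Space n → ℝ} (hw : ∀ x, 0 ≤ w x) {t : ℝ} (ht : 0 ≤ t) :
    0 ≤ nonlin α p u w t :=
  integral_nonneg fun x => by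
    have := hw x
    simp only [Pi.zero_apply]
    positivity

/-- The cone lies where the cut-off is `1`, so `∇w = l w e` may be used there. Applying this once,
then the weak gradient, then this again realises `Δ e^{l x·e} = l² e^{l x·e}` with first derivatives
only. -/
lemma EnergyCurves.integral_inner_gradient_planeWave (h : EnergyCurves μ α p T u U V G)
    (hcone : SupportedInCone T u) (l : ℝ) {e : Space n} (he : ‖e‖ = 1) {t : ℝ} (ht : t ∈ Ico 0 T) :
    ∫ x, ⟪G t x, ∇ (planeWave T l e) x⟫ = -(l ^ 2 * ∫ x, U t x * planeWave T l e x) := by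
  have hT := h.pos
  have hw := contDiff_planeWave hT l e
  have hc := hasCompactSupport_planeWave T l e
  have hU0 := h.ae_eq_zero_of_cone hcone ht
  have hG0 := (h.grad t ht).ae_eq_zero (Lp.memLp _)
    (isOpen_lt continuous_const continuous_norm) hU0
  have hwg := h.grad t ht _ hw hc
  have i1 : Integrable (fun x => U t x • ∇ (planeWave T l e) x) :=
    memLp_one_iff_integrable.1 ((memLp_gradient hw hc).smul (Lp.memLp (U t)))
  have i2 : Integrable (fun x => planeWave T l e x • G t x) :=
    memLp_one_iff_integrable.1 ((Lp.memLp (G t)).smul (memLp_of_contDiff hw hc))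
  have e1 : ∫ x, ⟪e, U t x • ∇ (planeWave T l e) x⟫ = l * ∫ x, U t x * planeWave T l e x := by
    rw [← integral_const_mul]
    refine integral_congr_ae ?_
    filter_upwards [hU0] with x hx
    by_cases hlt : t + 1 < ‖x‖
    · simp [hx hlt]
    · rw [gradient_planeWave (by linarith [ht.2] : ‖x‖ < T + 2), inner_smul_right, inner_smul_right,
        real_inner_self_eq_norm_sq, he]
      ring
  have e2 : ∫ x, ⟪G t x, ∇ (planeWave T l e) x⟫ = l * ∫ x, ⟪e, planeWave T l e x • G t x⟫ := by
    rw [← integral_const_mul]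
    refine integral_congr_ae ?_
    filter_upwards [hG0] with x hx
    by_cases hlt : t + 1 < ‖x‖
    · simp [hx hlt]
    · rw [gradient_planeWave (by linarith [ht.2] : ‖x‖ < T + 2), inner_smul_right, inner_smul_right,
        real_inner_comm]
      ring
  rw [integral_inner i1, hwg, inner_neg_right] at e1
  rw [e2, integral_inner i2]
  linear_combination -l * e1

lemma EnergyCurves.isMoment (h : EnergyCurves μ α p T u U V G) (hμ : 0 < μ)
    (hcone : SupportedInCone T u) (l : ℝ) {e : Space n} (he : ‖e‖ = 1) :
    IsMoment μ l T (fun t => ∫ x, U t x * planeWave T l e x)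
      (fun t => ∫ x, V t x * planeWave T l e x) (nonlin α p u (planeWave T l e)) := by
  have hw := contDiff_planeWave h.pos l e
  have hc := hasCompactSupport_planeWave T l e
  have hwL := memLp_of_contDiff hw hc
  have heq : ∀ t ∈ Ico 0 T, EqOn
      (fun s => s ^ μ * (nonlin α p u (planeWave T l e) s - ∫ x, ⟪G s x, ∇ (planeWave T l e) x⟫))
      (fun s => s ^ μ * (nonlin α p u (planeWave T l e) s +
        l ^ 2 * ∫ x, U s x * planeWave T l e x)) (Icc 0 t) := fun t ht s hs => by
    have := h.integral_inner_gradient_planeWave hcone l he ⟨hs.1, hs.2.trans_lt ht.2⟩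
    simp only [this, sub_neg_eq_add]
  refine ⟨fun t ht => h.hasDerivWithinAt_pair hwL ht, h.continuousOn_pairV hwL, fun t ht => ?_,
    fun t ht => ?_, fun t ht => nonlin_nonneg (planeWave_nonneg T l e) ht⟩
  · refine (h.integrated hμ hw hc ht).1.congr fun s hs => heq t ht ?_
    rw [uIoc_of_le ht.1] at hs
    exact Ioc_subset_Icc_self hs
  · rw [(h.integrated hμ hw hc ht).2]
    refine intervalIntegral.integral_congr fun s hs => heq t ht ?_
    rwa [uIcc_of_le ht.1] at hs

/-- Rescaling of the equation for `b`; the factor `l^{1-μ}` restores the homogeneity of `t^μ`. -/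
lemma isAdjoint_bessel (hμ : 0 < μ) {l : ℝ} (hl : 0 < l) :
    IsAdjoint μ l (fun t => bessel μ (l * t)) (fun t => l * besselNegDeriv μ (l * t)) where
  hasDeriv t ht := hasDerivAt_bessel_comp_mul hμ hl ht
  hasDeriv_neg t ht := by
    have h1 := (hasDerivAt_rpow_mul_besselNegDeriv hμ (mul_pos hl ht)).comp t
      ((hasDerivAt_id t).const_mul l)
    have h2 := h1.const_mul (l ^ (1 - μ))
    have hll : l ^ (1 - μ) * l ^ μ = l := by
      rw [← Real.rpow_add hl]; simp
    have h3 : HasDerivAt (fun s => s ^ μ * (l * besselNegDeriv μ (l * s)))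
        (l ^ (1 - μ) * (-((l * t) ^ μ * bessel μ (l * t)) * (l * 1))) t := by
      refine h2.congr_of_eventuallyEq ?_
      filter_upwards [lt_mem_nhds ht] with s hs
      simp only [Function.comp]
      rw [Real.mul_rpow hl.le (le_of_lt hs)]
      linear_combination -(s ^ μ * besselNegDeriv μ (l * s)) * hll
    refine h3.congr_deriv ?_
    rw [Real.mul_rpow hl.le ht.le]
    linear_combination -(t ^ μ * bessel μ (l * t)) * l * hll
  nonneg t ht := (bessel_pos hμ (mul_pos hl ht)).le
  neg_nonneg t ht := mul_nonneg hl.le (besselNegDeriv_pos hμ (mul_pos hl ht)).le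

lemma besselNegDeriv_comp_lower (hμ : 0 < μ) {l a : ℝ} (hl : 0 < l) (ha : a ∈ Ioc (0 : ℝ) 1) :
    l ^ (1 - μ) * (Real.Gamma (μ + 1) / μ * Real.exp (-l)) ≤
      a ^ μ * (l * besselNegDeriv μ (l * a)) := by
  have h1 := besselNegDeriv_lower hμ (mul_pos hl ha.1)
  have hG : 0 < Real.Gamma (μ + 1) / μ := div_pos (Real.Gamma_pos_of_pos (by linarith)) hμ
  have hll : l ^ (1 - μ) * l ^ μ = l := by
    rw [← Real.rpow_add hl]; simp
  have h2 : Real.exp (-l) ≤ Real.exp (-(l * a)) := by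
    rw [Real.exp_le_exp]; nlinarith [ha.2]
  calc l ^ (1 - μ) * (Real.Gamma (μ + 1) / μ * Real.exp (-l))
      ≤ l ^ (1 - μ) * ((l * a) ^ μ * besselNegDeriv μ (l * a)) := by
        refine mul_le_mul_of_nonneg_left (le_trans ?_ h1) (Real.rpow_nonneg hl.le _)
        gcongr
    _ = _ := by
        rw [Real.mul_rpow hl.le ha.1.le]
        linear_combination a ^ μ * besselNegDeriv μ (l * a) * hll

/-- The decreasing solution at frequency zero, needed when the superposition of Bessel solutions
just fails to converge. -/
lemma isAdjoint_rpow (hμ : 1 < μ) :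
    IsAdjoint μ 0 (fun t => t ^ (1 - μ)) (fun t => (μ - 1) * t ^ (-μ)) where
  hasDeriv t ht := by
    refine (Real.hasDerivAt_rpow_const (p := 1 - μ) (Or.inl ht.ne')).congr_deriv ?_
    rw [show 1 - μ - 1 = -μ by ring]
    ring
  hasDeriv_neg t ht := by
    have h1 : HasDerivAt (fun _ : ℝ => μ - 1) 0 t := hasDerivAt_const _ _
    have h2 : HasDerivAt (fun s : ℝ => s ^ μ * ((μ - 1) * s ^ (-μ))) 0 t := by
      refine h1.congr_of_eventuallyEq ?_
      filter_upwards [lt_mem_nhds ht] with s hs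
      have : s ^ μ * s ^ (-μ) = 1 := by rw [← Real.rpow_add hs]; simp
      linear_combination (μ - 1) * this
    exact h2.congr_deriv (by simp)
  nonneg t ht := Real.rpow_nonneg ht.le _
  neg_nonneg t ht := mul_nonneg (by linarith) (Real.rpow_nonneg ht.le _)

end Moments

end EPD

namespace EPD

/-! ### The tested equation for the modulus of a solution -/

lemma setLIntegral_strip {n : ℕ} {f : ℝ × Space n → ℝ≥0∞} (hf : Measurable f) (s : Set ℝ) :
    ∫⁻ z in s ×ˢ univ, f z = ∫⁻ t in s, ∫⁻ x, f (t, x) := by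
  rw [Measure.volume_eq_prod, ← Measure.prod_restrict, Measure.restrict_univ,
    lintegral_prod _ hf.aemeasurable]

/-- `v` is a measurable version of `|u|` on `(0, T) × ℝⁿ` that vanishes outside the light cone. -/
structure IsModulus {n : ℕ} (T : ℝ) (u : ℝ → Space n → ℝ) (v : ℝ × Space n → ℝ≥0∞) : Prop where
  meas : Measurable v
  supp : ∀ z, z.1 + 1 < ‖z.2‖ → v z = 0
  ae_eq : ∀ᵐ t, t ∈ Ioo 0 T → ∀ᵐ x, v (t, x) = ‖u t x‖ₑ

section Modulus

variable {n : ℕ} {μ α p T : ℝ} {u : ℝ → Space n → ℝ} {v : ℝ × Space n → ℝ≥0∞}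
  {U V : ℝ → Lp ℝ 2 (volume : Measure (Space n))}
  {G : ℝ → Lp (Space n) 2 (volume : Measure (Space n))}

lemma EnergyCurves.exists_isModulus (h : EnergyCurves μ α p T u U V G)
    (hcone : SupportedInCone T u) : ∃ v, IsModulus T u v := by
  obtain ⟨g, hgm', h1⟩ := h.meas
  have hgm : Measurable g := hgm'.measurable
  have hcm : MeasurableSet {z : ℝ × Space n | ‖z.2‖ ≤ z.1 + 1} :=
    measurableSet_le (by fun_prop) (by fun_prop)
  refine ⟨indicator {z : ℝ × Space n | ‖z.2‖ ≤ z.1 + 1} fun z => ‖g z‖ₑ,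
    hgm.enorm.indicator hcm, fun z hz => ?_, ?_⟩
  · exact indicator_of_notMem (by simpa using hz) _
  · rw [Measure.volume_eq_prod, ← Measure.prod_restrict, Measure.restrict_univ] at h1
    have h2 := Measure.ae_ae_of_ae_prod h1
    rw [ae_restrict_iff' measurableSet_Ioo] at h2
    filter_upwards [h2] with t ht htT
    filter_upwards [ht htT, hcone t ⟨htT.1.le, htT.2⟩] with x hx hx0
    by_cases hlt : t + 1 < ‖x‖
    · rw [hx0 hlt, enorm_zero]
      exact indicator_of_notMem (by simpa using hlt) _
    · rw [indicator_of_mem (by simpa using hlt)]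
      simp only [Function.uncurry] at hx
      rw [hx]

lemma IsModulus.lintegral_nonlin (h : EnergyCurves μ α p T u U V G) (hv : IsModulus T u v)
    (hp : 0 < p) (l : ℝ) (e : Space n) :
    ∀ᵐ t, t ∈ Ioo 0 T → ∫⁻ x, ENNReal.ofReal (t ^ α) * v (t, x) ^ p *
      ENNReal.ofReal (Real.exp (l * ⟪x, e⟫)) =
        ENNReal.ofReal (nonlin α p u (planeWave T l e) t) := by
  -- Integrability of the slices excludes the default value `0` of the integral in `nonlin`; `(0,
  -- T)` is exhausted by the intervals on which it is known.
  have hslice : ∀ᵐ t, t ∈ Ioo 0 T →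
      Integrable (fun x => t ^ α * |u t x| ^ p * planeWave T l e x) := by
    have hw := contDiff_planeWave h.pos l e
    have hc := hasCompactSupport_planeWave T l e
    have h1 : ∀ m : ℕ, ∀ᵐ t, t ∈ Ioc 0 (T - 1 / ((m : ℝ) + 1)) →
        Integrable (fun x => t ^ α * |u t x| ^ p * planeWave T l e x) := by
      intro m
      have hm : (0 : ℝ) < 1 / ((m : ℝ) + 1) := by positivity
      have hi := h.integrable_nonlin hw hc (show T - 1 / ((m : ℝ) + 1) < T by linarith)
      rw [IntegrableOn, Measure.volume_eq_prod, ← Measure.prod_restrict,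
        Measure.restrict_univ] at hi
      have := hi.prod_right_ae
      rwa [ae_restrict_iff' measurableSet_Ioc] at this
    filter_upwards [ae_all_iff.2 h1] with t ht htT
    obtain ⟨m, hm⟩ := exists_nat_one_div_lt (sub_pos.2 htT.2)
    exact ht m ⟨htT.1, by linarith⟩
  filter_upwards [hslice, hv.ae_eq] with t hi hvt htT
  have ht0 : 0 ≤ t := htT.1.le
  rw [nonlin, ofReal_integral_eq_lintegral_ofReal (hi htT) (ae_of_all _ fun x => by
    have := planeWave_nonneg T l e x
    simp only [Pi.zero_apply]
    positivity)]
  refine lintegral_congr_ae ?_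
  filter_upwards [hvt htT] with x hx
  by_cases hlt : t + 1 < ‖x‖
  · have h0 := hv.supp (t, x) hlt
    rw [h0] at hx
    rw [h0, enorm_eq_zero.1 hx.symm, ENNReal.zero_rpow_of_pos hp, abs_zero, Real.zero_rpow hp.ne']
    simp
  · rw [planeWave_eq (by linarith [htT.2]), hx, ENNReal.ofReal_mul (by positivity),
      ENNReal.ofReal_mul (by positivity), Real.enorm_eq_ofReal_abs,
      ENNReal.ofReal_rpow_of_nonneg (abs_nonneg _) hp.le]

lemma IsModulus.enorm_moment_le (h : EnergyCurves μ α p T u U V G) (hv : IsModulus T u v)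
    (l : ℝ) (e : Space n) :
    ∀ᵐ t, t ∈ Ioo 0 T → ENNReal.ofReal |∫ x, U t x * planeWave T l e x| ≤
      ∫⁻ x, v (t, x) * ENNReal.ofReal (Real.exp (l * ⟪x, e⟫)) := by
  filter_upwards [hv.ae_eq] with t hvt htT
  rw [← Real.enorm_eq_ofReal_abs]
  refine (enorm_integral_le_lintegral_enorm _).trans (lintegral_mono_ae ?_)
  filter_upwards [hvt htT, h.ae_eq t ⟨htT.1.le, htT.2⟩] with x hx hxU
  rw [enorm_mul, ← hxU, ← hx]
  by_cases hlt : t + 1 < ‖x‖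
  · simp [hv.supp (t, x) hlt]
  · rw [planeWave_eq (by linarith [htT.2]), Real.enorm_eq_ofReal (Real.exp_pos _).le]

/-- The tested inequality in terms of extended nonnegative integrals over space-time, so that it can
be superposed by Tonelli without integrability questions. -/
lemma IsModulus.test_le (h : EnergyCurves μ α p T u U V G) (hv : IsModulus T u v)
    (hcone : SupportedInCone T u) (hμ : 0 < μ) (hp : 1 < p) {k : ℕ} (hk : p / (p - 1) ≤ k + 2)
    {l : ℝ} {e : Space n} (he : ‖e‖ = 1) {ϑ ϑn : ℝ → ℝ} (hϑ : IsAdjoint μ l ϑ ϑn)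
    (hϑm : Measurable ϑ) (hϑnm : Measurable ϑn) {m : ℝ} (hm : 0 ≤ m)
    (hmϑ : ∀ a ∈ Ioc (0 : ℝ) 1, m ≤ a ^ μ * ϑn a)
    (hM0 : 0 < ∫ x, U 0 x * planeWave T l e x) {R : ℝ} (hR : 2 ≤ R) (hRT : R < T) :
    ENNReal.ofReal (m * cutoff (k + 2) 0 * ∫ x, U 0 x * planeWave T l e x) +
        ∫⁻ z in Ioc 1 R ×ˢ (univ : Set (Space n)),
          ENNReal.ofReal (z.1 ^ (μ + α) * cutoff (k + 2) (z.1 / R)) * v z ^ p *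
            ENNReal.ofReal (ϑ z.1 * Real.exp (l * ⟪z.2, e⟫)) ≤
      ∫⁻ z in Ioc (R / 2) R ×ˢ (univ : Set (Space n)),
        ENNReal.ofReal (z.1 ^ μ * ((k + 4 + 2 * μ) * hump (k + 2) (z.1 / R) ^ (1 / p))) * v z *
          ENNReal.ofReal ((ϑn z.1 / R + ϑ z.1 / R ^ 2) * Real.exp (l * ⟪z.2, e⟫)) := by
  have hk2 : k + 2 ≠ 0 := by omega
  have hR0 : 0 < R := by linarith
  have hM := h.isMoment hμ hcone l he
  have hmain := hM.test_le hϑ hμ hp hk hM0 hmϑ hR hRT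
  have hvm := hv.meas
  have hcm : Measurable (cutoff (k + 2)) := (continuous_cutoff _).measurable
  have hhm : Measurable (hump (k + 2)) := (continuous_hump _).measurable
  rw [setLIntegral_strip (by fun_prop), setLIntegral_strip (by fun_prop)]
  set M := fun t => ∫ x, U t x * planeWave T l e x with hMdef
  set H := nonlin α p u (planeWave T l e) with hH
  have hii := hM.intervalIntegrable_test (k := k) (R := R) hϑ one_pos (by linarith) hRT
  rw [intervalIntegrable_iff_integrableOn_Ioc_of_le (by linarith)] at hii
  have hη := cutoff_nonneg hk2
  have e1 : ∫⁻ t in Ioc 1 R, ∫⁻ x, ENNReal.ofReal (t ^ (μ + α) * cutoff (k + 2) (t / R)) *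
        v (t, x) ^ p * ENNReal.ofReal (ϑ t * Real.exp (l * ⟪x, e⟫)) =
      ENNReal.ofReal (∫ t in (1 : ℝ)..R, t ^ μ * (H t * ϑ t * cutoff (k + 2) (t / R))) := by
    rw [intervalIntegral.integral_of_le (by linarith), ofReal_integral_eq_lintegral_ofReal hii]
    · refine setLIntegral_congr_fun_ae measurableSet_Ioc ?_
      filter_upwards [hv.lintegral_nonlin h (by linarith) l e] with t ht htm
      have ht0 : 0 < t := one_pos.trans htm.1
      have h1 := hϑ.nonneg t ht0
      have h2 := hη (t / R)
      have h3 : 0 ≤ H t := hM.nonneg t ht0.le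
      rw [show t ^ μ * (H t * ϑ t * cutoff (k + 2) (t / R)) =
        t ^ μ * ϑ t * cutoff (k + 2) (t / R) * H t by ring,
        ENNReal.ofReal_mul (p := t ^ μ * ϑ t * cutoff (k + 2) (t / R)) (by positivity),
        ← ht ⟨ht0, htm.2.trans_lt hRT⟩, ← lintegral_const_mul _ (by fun_prop)]
      refine lintegral_congr fun x => ?_
      rw [Real.rpow_add ht0, ENNReal.ofReal_mul h1, ENNReal.ofReal_mul (by positivity),
        ENNReal.ofReal_mul (by positivity), ENNReal.ofReal_mul (by positivity),
        ENNReal.ofReal_mul (by positivity)]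
      ring
    · rw [EventuallyLE, ae_restrict_iff' measurableSet_Ioc]
      refine ae_of_all _ fun t ht => ?_
      have ht0 : 0 < t := one_pos.trans ht.1
      have h1 := hϑ.nonneg t ht0
      have h2 := hη (t / R)
      have h3 : 0 ≤ H t := hM.nonneg t ht0.le
      simp only [Pi.zero_apply]
      positivity
  have hWnn : 0 ≤ ∫ t in (1 : ℝ)..R, t ^ μ * (H t * ϑ t * cutoff (k + 2) (t / R)) := by
    refine intervalIntegral.integral_nonneg (by linarith) fun t ht => ?_
    have ht0 : 0 < t := one_pos.trans_le ht.1
    have h1 := hϑ.nonneg t ht0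
    have h2 := hη (t / R)
    have h3 : 0 ≤ H t := hM.nonneg t ht0.le
    positivity
  rw [e1, ← ENNReal.ofReal_add (mul_nonneg (mul_nonneg hm (hη 0)) hM0.le) hWnn]
  refine (ENNReal.ofReal_le_ofReal hmain).trans ?_
  rw [intervalIntegral.integral_of_le (by linarith)]
  refine (Real.ofReal_le_enorm _).trans ((enorm_integral_le_lintegral_enorm _).trans ?_)
  refine setLIntegral_mono_ae' measurableSet_Ioc ?_
  filter_upwards [hv.enorm_moment_le h l e] with t ht htm
  have ht0 : 0 < t := by linarith [htm.1]
  have h1 := hϑ.nonneg t ht0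
  have h2 := hϑ.neg_nonneg t ht0
  have hg : 0 ≤ hump (k + 2) (t / R) ^ (1 / p) := Real.rpow_nonneg (hump_nonneg _ _) _
  set A := t ^ μ * ((k + 4 + 2 * μ) * hump (k + 2) (t / R) ^ (1 / p)) with hA
  set B := ϑn t / R + ϑ t / R ^ 2 with hB
  have hA0 : 0 ≤ A := by positivity
  have hB0 : 0 ≤ B := by positivity
  rw [show t ^ μ * |M t| * ((k + 4 + 2 * μ) * hump (k + 2) (t / R) ^ (1 / p) * B) =
    A * B * |M t| by rw [hA]; ring, Real.enorm_eq_ofReal (by positivity),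
    ENNReal.ofReal_mul (by positivity)]
  refine (mul_le_mul_right (ht ⟨ht0, htm.2.trans_lt hRT⟩) _).trans ?_
  rw [← lintegral_const_mul _ (by fun_prop)]
  refine lintegral_mono fun x => le_of_eq ?_
  rw [ENNReal.ofReal_mul hA0, ENNReal.ofReal_mul hB0]
  ring

end Modulus

end EPD

namespace EPD

/-! ### Superposition of the tested equations -/

/-- The inequalities that a solution with moments at least `δ e^{-l}` at time `0` satisfies when it
is tested with `ϑ(t) e^{l x·e}`, expressed through its modulus `v`. -/
structure TestBound {n : ℕ} (μ α p T δ : ℝ) (k : ℕ) (v : ℝ × Space n → ℝ≥0∞) : Prop where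
  meas : Measurable v
  supp : ∀ z, z.1 + 1 < ‖z.2‖ → v z = 0
  test : ∀ (l : ℝ) (e : Space n) (ϑ ϑn : ℝ → ℝ) (m R : ℝ), 0 ≤ l → ‖e‖ = 1 →
    IsAdjoint μ l ϑ ϑn → Measurable ϑ → Measurable ϑn → 0 ≤ m →
    (∀ a ∈ Ioc (0 : ℝ) 1, m ≤ a ^ μ * ϑn a) → 2 ≤ R → R < T →
    ENNReal.ofReal (m * cutoff (k + 2) 0 * (δ * Real.exp (-l))) +
        ∫⁻ z in Ioc 1 R ×ˢ (univ : Set (Space n)),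
          ENNReal.ofReal (z.1 ^ (μ + α) * cutoff (k + 2) (z.1 / R)) * v z ^ p *
            ENNReal.ofReal (ϑ z.1 * Real.exp (l * ⟪z.2, e⟫)) ≤
      ∫⁻ z in Ioc (R / 2) R ×ˢ (univ : Set (Space n)),
        ENNReal.ofReal (z.1 ^ μ * ((k + 4 + 2 * μ) * hump (k + 2) (z.1 / R) ^ (1 / p))) * v z *
          ENNReal.ofReal ((ϑn z.1 / R + ϑ z.1 / R ^ 2) * Real.exp (l * ⟪z.2, e⟫))

section Superposition

variable {n : ℕ}

/-- Tonelli's theorem, for a general time profile `b` so that it serves both sides of the tested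
inequality. -/
lemma lintegral_superpose {γ : ℝ} {b : ℝ → ℝ → ℝ} (hb : Measurable (Function.uncurry b))
    {A : ℝ × Space n → ℝ≥0∞} (hA : Measurable A) (S : Set (ℝ × Space n)) :
    ∫⁻ y in Metric.ball (0 : Space n) 1, ∫⁻ l in Ioi (0 : ℝ),
        ENNReal.ofReal (l ^ (γ - 1) * Real.exp (-2 * l)) *
          ∫⁻ z in S, A z * ENNReal.ofReal (b l z.1 * Real.exp (l * ⟪z.2, dir y⟫)) =
      ∫⁻ z in S, A z * ∫⁻ y in Metric.ball (0 : Space n) 1, ∫⁻ l in Ioi (0 : ℝ),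
        ENNReal.ofReal (l ^ (γ - 1) * Real.exp (-2 * l) * b l z.1 *
          Real.exp (l * ⟪z.2, dir y⟫)) := by
  have hd := measurable_dir (n := n)
  set ρ : Measure (Space n × ℝ) :=
    (volume.restrict (Metric.ball (0 : Space n) 1)).prod (volume.restrict (Ioi (0 : ℝ))) with hρ
  have hbm : Measurable fun w : (Space n × ℝ) × (ℝ × Space n) => b w.1.2 w.2.1 :=
    hb.comp (measurable_fst.snd.prodMk measurable_snd.fst)
  have hbm' : Measurable fun w : (ℝ × Space n) × (Space n × ℝ) => b w.2.2 w.1.1 :=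
    hb.comp (measurable_snd.snd.prodMk measurable_fst.fst)
  have hm : Measurable fun w : (Space n × ℝ) × (ℝ × Space n) =>
      ENNReal.ofReal (w.1.2 ^ (γ - 1) * Real.exp (-2 * w.1.2)) *
        (A w.2 * ENNReal.ofReal (b w.1.2 w.2.1 * Real.exp (w.1.2 * ⟪w.2.2, dir w.1.1⟫))) := by
    fun_prop
  have hm2 : ∀ q : Space n × ℝ, Measurable fun z : ℝ × Space n =>
      A z * ENNReal.ofReal (b q.2 z.1 * Real.exp (q.2 * ⟪z.2, dir q.1⟫)) := fun q => by
    have : Measurable fun z : ℝ × Space n => b q.2 z.1 :=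
      hb.comp (measurable_const.prodMk measurable_fst)
    fun_prop
  have hm3 : ∀ z : ℝ × Space n, Measurable fun q : Space n × ℝ =>
      ENNReal.ofReal (q.2 ^ (γ - 1) * Real.exp (-2 * q.2) * b q.2 z.1 *
        Real.exp (q.2 * ⟪z.2, dir q.1⟫)) := fun z => by
    have : Measurable fun q : Space n × ℝ => b q.2 z.1 :=
      hb.comp (measurable_snd.prodMk measurable_const)
    fun_prop
  have e1 := lintegral_prod (μ := volume.restrict (Metric.ball (0 : Space n) 1))
    (ν := volume.restrict (Ioi (0 : ℝ))) (fun q : Space n × ℝ =>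
      ENNReal.ofReal (q.2 ^ (γ - 1) * Real.exp (-2 * q.2)) *
        ∫⁻ z in S, A z * ENNReal.ofReal (b q.2 z.1 * Real.exp (q.2 * ⟪z.2, dir q.1⟫))) (by
      refine Measurable.aemeasurable ?_
      refine Measurable.mul (by fun_prop) ?_
      refine Measurable.lintegral_prod_right' (f := fun w : (Space n × ℝ) × (ℝ × Space n) =>
        A w.2 * ENNReal.ofReal (b w.1.2 w.2.1 * Real.exp (w.1.2 * ⟪w.2.2, dir w.1.1⟫))) ?_
      fun_prop)
  rw [← e1]
  have e2 : ∀ z : ℝ × Space n, ∫⁻ y in Metric.ball (0 : Space n) 1, ∫⁻ l in Ioi (0 : ℝ),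
        ENNReal.ofReal (l ^ (γ - 1) * Real.exp (-2 * l) * b l z.1 *
          Real.exp (l * ⟪z.2, dir y⟫)) = ∫⁻ q, ENNReal.ofReal (q.2 ^ (γ - 1) *
            Real.exp (-2 * q.2) * b q.2 z.1 * Real.exp (q.2 * ⟪z.2, dir q.1⟫)) ∂ρ := fun z =>
    (lintegral_prod (μ := volume.restrict (Metric.ball (0 : Space n) 1))
      (ν := volume.restrict (Ioi (0 : ℝ))) _ (hm3 z).aemeasurable).symm
  simp only [e2]
  have hpos : ∀ᵐ q ∂ρ, 0 < q.2 := by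
    have : ∀ᵐ l ∂(volume.restrict (Ioi (0 : ℝ))), 0 < l := ae_restrict_mem measurableSet_Ioi
    exact Measure.quasiMeasurePreserving_snd.ae this
  calc ∫⁻ q, ENNReal.ofReal (q.2 ^ (γ - 1) * Real.exp (-2 * q.2)) *
        (∫⁻ z in S, A z * ENNReal.ofReal (b q.2 z.1 * Real.exp (q.2 * ⟪z.2, dir q.1⟫))) ∂ρ
      = ∫⁻ q, (∫⁻ z in S, ENNReal.ofReal (q.2 ^ (γ - 1) * Real.exp (-2 * q.2)) *
          (A z * ENNReal.ofReal (b q.2 z.1 * Real.exp (q.2 * ⟪z.2, dir q.1⟫)))) ∂ρ := by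
        refine lintegral_congr fun q => ?_
        rw [lintegral_const_mul _ (hm2 q)]
    _ = ∫⁻ z in S, (∫⁻ q, ENNReal.ofReal (q.2 ^ (γ - 1) * Real.exp (-2 * q.2)) *
          (A z * ENNReal.ofReal (b q.2 z.1 * Real.exp (q.2 * ⟪z.2, dir q.1⟫))) ∂ρ) :=
        lintegral_lintegral_swap hm.aemeasurable
    _ = _ := by
        refine lintegral_congr fun z => ?_
        rw [← lintegral_const_mul _ (hm3 z)]
        refine lintegral_congr_ae ?_
        filter_upwards [hpos] with q hq
        rw [mul_assoc (q.2 ^ (γ - 1) * Real.exp (-2 * q.2)),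
          ENNReal.ofReal_mul (p := q.2 ^ (γ - 1) * Real.exp (-2 * q.2)) (by positivity)]
        ring

lemma lintegral_besselNegDeriv_add_le (μ γ : ℝ) {R : ℝ} (hR : 0 < R) (t : ℝ) (x : Space n) :
    ∫⁻ y in Metric.ball (0 : Space n) 1, ∫⁻ l in Ioi (0 : ℝ),
        ENNReal.ofReal (l ^ (γ - 1) * Real.exp (-2 * l) *
          (l * besselNegDeriv μ (l * t) / R + bessel μ (l * t) / R ^ 2) *
            Real.exp (l * ⟪x, dir y⟫)) ≤
      ENNReal.ofReal (1 / R) * kernelNegDeriv μ γ t x +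
        ENNReal.ofReal (1 / R ^ 2) * kernel μ γ t x := by
  have hd := measurable_dir (n := n)
  have h1 := measurable_bessel μ
  have h2 := measurable_besselNegDeriv μ
  have m1 : Measurable fun w : Space n × ℝ => ENNReal.ofReal (w.2 ^ (γ - 1) * Real.exp (-2 * w.2) *
      (w.2 * besselNegDeriv μ (w.2 * t)) * Real.exp (w.2 * ⟪x, dir w.1⟫)) := by fun_prop
  have m2 : Measurable fun w : Space n × ℝ => ENNReal.ofReal (w.2 ^ (γ - 1) * Real.exp (-2 * w.2) *
      bessel μ (w.2 * t) * Real.exp (w.2 * ⟪x, dir w.1⟫)) := by fun_prop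
  have m1' : Measurable fun y : Space n => ∫⁻ l in Ioi (0 : ℝ), ENNReal.ofReal (l ^ (γ - 1) *
      Real.exp (-2 * l) * (l * besselNegDeriv μ (l * t)) * Real.exp (l * ⟪x, dir y⟫)) :=
    m1.lintegral_prod_right'
  have m2' : Measurable fun y : Space n => ∫⁻ l in Ioi (0 : ℝ), ENNReal.ofReal (l ^ (γ - 1) *
      Real.exp (-2 * l) * bessel μ (l * t) * Real.exp (l * ⟪x, dir y⟫)) :=
    m2.lintegral_prod_right'
  have m1s : ∀ y : Space n, Measurable fun l : ℝ => ENNReal.ofReal (l ^ (γ - 1) *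
      Real.exp (-2 * l) * (l * besselNegDeriv μ (l * t)) * Real.exp (l * ⟪x, dir y⟫)) := fun y => by
    fun_prop
  have m2s : ∀ y : Space n, Measurable fun l : ℝ => ENNReal.ofReal (l ^ (γ - 1) *
      Real.exp (-2 * l) * bessel μ (l * t) * Real.exp (l * ⟪x, dir y⟫)) := fun y => by
    fun_prop
  unfold kernel kernelNegDeriv
  rw [← lintegral_const_mul _ m1', ← lintegral_const_mul _ m2',
    ← lintegral_add_left (m1'.const_mul _)]
  refine lintegral_mono fun y => ?_
  rw [← lintegral_const_mul _ (m1s y), ← lintegral_const_mul _ (m2s y),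
    ← lintegral_add_left ((m1s y).const_mul _)]
  refine lintegral_mono fun l => ?_
  rw [← ENNReal.ofReal_mul (by positivity), ← ENNReal.ofReal_mul (by positivity)]
  refine le_trans (le_of_eq ?_) ENNReal.ofReal_add_le
  congr 1
  ring

variable {μ α p : ℝ}

/-- Superposition of the tested equations with weight `l^{γ-1} e^{-2l}`. -/
lemma exists_superposed (hn : 1 ≤ n) {γ N a : ℝ} (hμ : 0 < μ)
    (hN : N = ((n : ℝ) - 1 + μ) / 2) (hγ : γ = N - 1 - a) (ha1 : -1 < a) (ha : a < 0)
    (hγμ : μ - 1 < γ) (hγ0 : 0 < γ) (hp : 0 < p) (k : ℕ) :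
    ∃ c : ℝ, 0 < c ∧ ∃ C : ℝ, 0 < C ∧ ∀ (T δ : ℝ) (v : ℝ × Space n → ℝ≥0∞), 0 ≤ δ →
      TestBound μ α p T δ k v → ∀ R, 2 ≤ R → R < T →
      ENNReal.ofReal (c * δ) + ∫⁻ z in Ioc 1 R ×ˢ (univ : Set (Space n)),
          ENNReal.ofReal (z.1 ^ (μ + α) * cutoff (k + 2) (z.1 / R)) * v z ^ p *
            ENNReal.ofReal (c * z.1 ^ (-γ)) ≤
        ∫⁻ z in Ioc (R / 2) R ×ˢ (univ : Set (Space n)),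
          ENNReal.ofReal (z.1 ^ μ * ((k + 4 + 2 * μ) * hump (k + 2) (z.1 / R) ^ (1 / p))) * v z *
            ENNReal.ofReal (C / R * (z.1 ^ (-N) * (2 + z.1 - ‖z.2‖) ^ a)) := by
  obtain ⟨C₁, hC₁, h₁⟩ := kernelNegDeriv_le (n := n) hn hμ hN hγ ha hγμ
  obtain ⟨C₂, hC₂, h₂⟩ := kernel_le (n := n) hn hμ hN hγ ha1 ha hγμ hγ0
  obtain ⟨c₁, hc₁, h₃⟩ := kernel_lower (n := n) hμ γ
  have hk2 : k + 2 ≠ 0 := by omega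
  have hη0 := cutoff_zero_pos _ hk2
  have hG : 0 < Real.Gamma (μ + 1) / μ := div_pos (Real.Gamma_pos_of_pos (by linarith)) hμ
  -- The contribution of the data at frequency `l` divided by `δ`: the weight times the lower bound
  -- for `-t^μ ϑ'` times that for the initial moment.
  set j : ℝ → ℝ := fun l => l ^ (γ - 1) * Real.exp (-2 * l) *
    (l ^ (1 - μ) * (Real.Gamma (μ + 1) / μ * Real.exp (-l)) * cutoff (k + 2) 0 * Real.exp (-l))
    with hj
  have hjm : Measurable j := by fun_prop
  set κ : ℝ≥0∞ := ∫⁻ _ in Metric.ball (0 : Space n) 1, ∫⁻ l in Ioi (0 : ℝ),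
    ENNReal.ofReal (j l) with hκ
  have hκ0 : κ ≠ 0 := by
    rw [hκ, setLIntegral_const]
    refine mul_ne_zero ?_ (Metric.measure_ball_pos _ _ one_pos).ne'
    have : 0 < ∫⁻ l in Ioi (0 : ℝ), ENNReal.ofReal (j l) := by
      rw [setLIntegral_pos_iff hjm.ennreal_ofReal]
      have hsub : Ioi (0 : ℝ) ⊆ (Function.support fun l => ENNReal.ofReal (j l)) ∩ Ioi 0 := by
        intro l hl
        have hl' : (0 : ℝ) < l := hl
        refine ⟨?_, hl⟩
        rw [Function.mem_support, ne_eq, ENNReal.ofReal_eq_zero, not_le]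
        simp only [hj]
        positivity
      exact lt_of_lt_of_le (by simp) (measure_mono hsub)
    exact this.ne'
  -- Only positivity of `κ` is needed; truncation at `1` avoids proving that it is finite.
  obtain ⟨c₀, hc₀, hc₀κ⟩ : ∃ c₀ : ℝ, 0 < c₀ ∧ ENNReal.ofReal c₀ ≤ κ := by
    refine ⟨(min κ 1).toReal, ENNReal.toReal_pos ?_ ?_, ?_⟩
    · simp [hκ0]
    · simp
    · rw [ENNReal.ofReal_toReal (by simp)]
      exact min_le_left _ _
  refine ⟨min c₀ c₁, lt_min hc₀ hc₁, C₁ + C₂, by positivity, fun T δ v hδ hv R hR hRT => ?_⟩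
  have hvm := hv.meas
  have hR0 : 0 < R := by linarith
  have hcm : Measurable (cutoff (k + 2)) := (continuous_cutoff _).measurable
  have hhm : Measurable (hump (k + 2)) := (continuous_hump _).measurable
  have hd := measurable_dir (n := n)
  have hb := measurable_bessel μ
  have hbn := measurable_besselNegDeriv μ
  set A : ℝ × Space n → ℝ≥0∞ := fun z =>
    ENNReal.ofReal (z.1 ^ (μ + α) * cutoff (k + 2) (z.1 / R)) * v z ^ p with hA
  set B : ℝ × Space n → ℝ≥0∞ := fun z =>
    ENNReal.ofReal (z.1 ^ μ * ((k + 4 + 2 * μ) * hump (k + 2) (z.1 / R) ^ (1 / p))) * v z with hB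
  have hAm : Measurable A := by fun_prop
  have hBm : Measurable B := by fun_prop
  have hne : ∀ᵐ y : Space n, y ≠ 0 := by
    have : Nonempty (Fin n) := ⟨⟨0, hn⟩⟩
    simp [ae_iff]
  have htest : ∀ᵐ y ∂(volume.restrict (Metric.ball (0 : Space n) 1)), ∀ l ∈ Ioi (0 : ℝ),
      ENNReal.ofReal δ * ENNReal.ofReal (j l) +
        ENNReal.ofReal (l ^ (γ - 1) * Real.exp (-2 * l)) *
          ∫⁻ z in Ioc 1 R ×ˢ (univ : Set (Space n)),
            A z * ENNReal.ofReal (bessel μ (l * z.1) * Real.exp (l * ⟪z.2, dir y⟫)) ≤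
        ENNReal.ofReal (l ^ (γ - 1) * Real.exp (-2 * l)) *
          ∫⁻ z in Ioc (R / 2) R ×ˢ (univ : Set (Space n)),
            B z * ENNReal.ofReal ((l * besselNegDeriv μ (l * z.1) / R +
              bessel μ (l * z.1) / R ^ 2) * Real.exp (l * ⟪z.2, dir y⟫)) := by
    filter_upwards [ae_restrict_of_ae hne] with y hy l hl
    have hl0 : (0 : ℝ) < l := hl
    have := hv.test l (dir y) _ _ (l ^ (1 - μ) * (Real.Gamma (μ + 1) / μ * Real.exp (-l))) R
      hl0.le (norm_dir hy) (isAdjoint_bessel hμ hl0) (by fun_prop) (by fun_prop) (by positivity)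
      (fun a ha => besselNegDeriv_comp_lower hμ hl0 ha) hR hRT
    refine le_trans (le_of_eq ?_) (mul_le_mul_right this _)
    rw [mul_add, ← ENNReal.ofReal_mul hδ, ← ENNReal.ofReal_mul (by positivity)]
    congr 2
    simp only [hj]
    ring
  have hsup := lintegral_mono_ae (htest.mono fun y hy =>
    setLIntegral_mono' (μ := volume) measurableSet_Ioi hy)
  have m0 : ∀ S : Set (ℝ × Space n), Measurable fun w : Space n × ℝ =>
      ∫⁻ z in S, A z * ENNReal.ofReal (bessel μ (w.2 * z.1) * Real.exp (w.2 * ⟪z.2, dir w.1⟫)) := by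
    intro S
    refine Measurable.lintegral_prod_right' (f := fun w : (Space n × ℝ) × (ℝ × Space n) =>
      A w.2 * ENNReal.ofReal (bessel μ (w.1.2 * w.2.1) * Real.exp (w.1.2 * ⟪w.2.2, dir w.1.1⟫))) ?_
    fun_prop
  have eL : ∫⁻ y in Metric.ball (0 : Space n) 1, ∫⁻ l in Ioi (0 : ℝ),
      (ENNReal.ofReal δ * ENNReal.ofReal (j l) +
        ENNReal.ofReal (l ^ (γ - 1) * Real.exp (-2 * l)) *
          ∫⁻ z in Ioc 1 R ×ˢ (univ : Set (Space n)),
            A z * ENNReal.ofReal (bessel μ (l * z.1) * Real.exp (l * ⟪z.2, dir y⟫))) =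
      ENNReal.ofReal δ * κ +
        ∫⁻ z in Ioc 1 R ×ˢ (univ : Set (Space n)), A z * kernel μ γ z.1 z.2 := by
    have s1 : ∀ y : Space n, ∫⁻ l in Ioi (0 : ℝ),
      (ENNReal.ofReal δ * ENNReal.ofReal (j l) +
        ENNReal.ofReal (l ^ (γ - 1) * Real.exp (-2 * l)) *
          ∫⁻ z in Ioc 1 R ×ˢ (univ : Set (Space n)),
            A z * ENNReal.ofReal (bessel μ (l * z.1) * Real.exp (l * ⟪z.2, dir y⟫))) =
      ENNReal.ofReal δ * (∫⁻ l in Ioi (0 : ℝ), ENNReal.ofReal (j l)) + ∫⁻ l in Ioi (0 : ℝ),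
        ENNReal.ofReal (l ^ (γ - 1) * Real.exp (-2 * l)) *
          ∫⁻ z in Ioc 1 R ×ˢ (univ : Set (Space n)),
            A z * ENNReal.ofReal (bessel μ (l * z.1) * Real.exp (l * ⟪z.2, dir y⟫)) := fun y => by
      rw [lintegral_add_left (by fun_prop), lintegral_const_mul _ (by fun_prop)]
    simp only [s1]
    rw [lintegral_add_left (by fun_prop), lintegral_const_mul _ (by fun_prop),
      lintegral_superpose (b := fun l t => bessel μ (l * t))
        (by simp only [Function.uncurry_def]; fun_prop) hAm]
    rfl
  rw [eL, lintegral_superpose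
    (b := fun l t => l * besselNegDeriv μ (l * t) / R + bessel μ (l * t) / R ^ 2)
    (by simp only [Function.uncurry_def]; fun_prop) hBm] at hsup
  refine le_trans (add_le_add ?_ ?_) (hsup.trans ?_)
  · rw [mul_comm _ δ, ENNReal.ofReal_mul hδ]
    exact mul_le_mul_right ((ENNReal.ofReal_le_ofReal (min_le_left _ _)).trans hc₀κ) _
  · refine setLIntegral_mono' (measurableSet_Ioc.prod MeasurableSet.univ) fun z hz => ?_
    have hz1 : 1 < z.1 := hz.1.1
    by_cases hlt : z.1 + 1 < ‖z.2‖
    · simp [hA, hv.supp z hlt, hp]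
    · refine mul_le_mul_right (le_trans ?_ (h₃ z.1 z.2 hz1.le (not_lt.1 hlt))) _
      exact ENNReal.ofReal_le_ofReal (mul_le_mul_of_nonneg_right (min_le_right _ _)
        (Real.rpow_nonneg (by linarith) _))
  · refine setLIntegral_mono' (measurableSet_Ioc.prod MeasurableSet.univ) fun z hz => ?_
    have hzR : R / 2 < z.1 := hz.1.1
    have hzR' : z.1 ≤ R := hz.1.2
    have hz1 : 1 ≤ z.1 := by linarith
    by_cases hlt : z.1 + 1 < ‖z.2‖
    · simp [hB, hv.supp z hlt]
    · have hle := not_lt.1 hlt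
      refine mul_le_mul_right ((lintegral_besselNegDeriv_add_le μ γ hR0 z.1 z.2).trans ?_) _
      refine (add_le_add (mul_le_mul_right (h₁ z.1 z.2 hz1 hle) _)
        (mul_le_mul_right (h₂ z.1 z.2 hz1 hle) _)).trans ?_
      have hX : 0 ≤ z.1 ^ (-N) * (2 + z.1 - ‖z.2‖) ^ a :=
        mul_nonneg (Real.rpow_nonneg (by linarith) _) (Real.rpow_nonneg (by linarith) _)
      rw [← ENNReal.ofReal_mul (by positivity), ← ENNReal.ofReal_mul (by positivity),
        ← ENNReal.ofReal_add (by positivity) (by positivity)]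
      refine ENNReal.ofReal_le_ofReal ?_
      set X := z.1 ^ (-N) * (2 + z.1 - ‖z.2‖) ^ a with hXdef
      -- Here `t ≤ R` turns the factor `t` lost in `kernel_le` into the missing power of `R`.
      have : 1 / R ^ 2 * (C₂ * (z.1 * X)) ≤ C₂ / R * X := by
        rw [show 1 / R ^ 2 * (C₂ * (z.1 * X)) = C₂ * X / R ^ 2 * z.1 by ring,
          show C₂ / R * X = C₂ * X / R ^ 2 * R by field_simp]
        gcongr
      calc _ ≤ 1 / R * (C₁ * X) + C₂ / R * X := by linarith
        _ = _ := by ring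

end Superposition

end EPD

namespace EPD

/-! ### Hölder's inequality on strips of the light cone -/

section Strip

variable {n : ℕ}

/-- Polar coordinates with `r ≤ t + 1 ≤ 2t`; then `s = 2 + t - r` runs from `1` to `2 + t`. -/
lemma lintegral_cone_le (hn : 1 ≤ n) (b : ℝ) {t : ℝ} (ht : 1 ≤ t) :
    ∫⁻ x in Metric.closedBall (0 : Space n) (t + 1), ENNReal.ofReal ((2 + t - ‖x‖) ^ b) ≤
      ENNReal.ofReal (n * volume.real (Metric.ball (0 : Space n) 1) * (2 * t) ^ (n - 1) *
        ∫ s in (1 : ℝ)..2 + t, s ^ b) := by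
  have hne : Nonempty (Fin n) := ⟨⟨0, hn⟩⟩
  set f : ℝ → ℝ := indicator (Iic (t + 1)) fun r => (2 + t - r) ^ b with hf
  have hfm : Measurable f := Measurable.indicator (by fun_prop) measurableSet_Iic
  have hf0 : ∀ r, 0 ≤ f r := fun r => indicator_nonneg (fun s hs => by
    have : s ≤ t + 1 := hs
    exact Real.rpow_nonneg (by linarith) _) r
  have hc : ContinuousOn (fun r : ℝ => (2 + t - r) ^ b) (Icc 0 (t + 1)) := by
    refine ContinuousOn.rpow_const (by fun_prop) fun r hr => Or.inl ?_
    have := hr.2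
    linarith
  obtain ⟨K, hK⟩ := isCompact_Icc.exists_bound_of_continuousOn hc
  have hind : ∀ x : Space n, (Metric.closedBall (0 : Space n) (t + 1)).indicator
      (fun x => ENNReal.ofReal ((2 + t - ‖x‖) ^ b)) x = ENNReal.ofReal (f ‖x‖) := fun x => by
    by_cases hx : ‖x‖ ≤ t + 1
    · rw [indicator_of_mem (by simpa using hx), hf, indicator_of_mem (by simpa using hx)]
    · rw [indicator_of_notMem (by simpa using hx), hf, indicator_of_notMem (by simpa using hx)]
      simp
  rw [← lintegral_indicator Metric.isClosed_closedBall.measurableSet]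
  simp only [hind]
  have hIntg : Integrable (fun x : Space n => f ‖x‖) := by
    have h1 : IntegrableOn (fun x : Space n => f ‖x‖) (Metric.closedBall 0 (t + 1)) := by
      refine Measure.integrableOn_of_bounded (M := K) measure_closedBall_lt_top.ne
        (hfm.comp measurable_norm).aestronglyMeasurable ?_
      rw [ae_restrict_iff' Metric.isClosed_closedBall.measurableSet]
      refine ae_of_all _ fun x hx => ?_
      rw [mem_closedBall_zero_iff] at hx
      rw [hf, indicator_of_mem (by simpa using hx)]
      exact hK _ ⟨norm_nonneg _, hx⟩
    rwa [integrableOn_iff_integrable_of_support_subset] at h1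
    intro x hx
    by_contra hcon
    exact hx (indicator_of_notMem (by simpa using hcon) _)
  rw [← ofReal_integral_eq_lintegral_ofReal hIntg (ae_of_all _ fun x => hf0 _),
    integral_fun_norm_addHaar volume f]
  refine ENNReal.ofReal_le_ofReal ?_
  simp only [finrank_euclideanSpace, Fintype.card_fin, nsmul_eq_mul, smul_eq_mul]
  rw [mul_assoc (n * volume.real (Metric.ball (0 : Space n) 1)), ← mul_assoc (n : ℝ)]
  refine mul_le_mul_of_nonneg_left ?_ (by positivity)
  have e1 : ∫ y in Ioi (0 : ℝ), y ^ (n - 1) * f y =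
      ∫ y in Ioc 0 (t + 1), y ^ (n - 1) * (2 + t - y) ^ b := by
    rw [← Ioi_inter_Iic, ← setIntegral_indicator measurableSet_Iic]
    refine setIntegral_congr_fun measurableSet_Ioi fun y _ => ?_
    simp only [hf, indicator_apply]
    split_ifs <;> simp
  have e2 : ∫ s in (1 : ℝ)..2 + t, s ^ b = ∫ y in (0 : ℝ)..t + 1, (2 + t - y) ^ b := by
    rw [intervalIntegral.integral_comp_sub_left (fun s => s ^ b)]
    congr 1 <;> ring
  rw [e1, e2, ← intervalIntegral.integral_of_le (by linarith),
    ← intervalIntegral.integral_const_mul]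
  have hII : uIcc 0 (t + 1) = Icc 0 (t + 1) := uIcc_of_le (by linarith)
  refine intervalIntegral.integral_mono_on (by linarith)
    (ContinuousOn.intervalIntegrable ?_) (ContinuousOn.intervalIntegrable ?_) fun y hy => ?_
  · rw [hII]
    exact (continuousOn_id.pow _).mul hc
  · rw [hII]
    exact hc.const_mul _
  · refine mul_le_mul_of_nonneg_right (pow_le_pow_left₀ hy.1 (by linarith [hy.2]) _)
      (Real.rpow_nonneg (by linarith [hy.2]) _)

lemma rpow_le_of_half_lt {E t R : ℝ} (hR : 0 < R) (h1 : R / 2 < t) (h2 : t ≤ R) :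
    t ^ E ≤ 2 ^ |E| * R ^ E := by
  have ht : 0 < t := by linarith
  rcases le_or_gt 0 E with hE | hE
  · calc t ^ E ≤ R ^ E := Real.rpow_le_rpow ht.le h2 hE
      _ ≤ 2 ^ |E| * R ^ E :=
        le_mul_of_one_le_left (Real.rpow_nonneg hR.le _)
          (Real.one_le_rpow one_le_two (abs_nonneg _))
  · calc t ^ E ≤ (R / 2) ^ E := Real.rpow_le_rpow_of_nonpos (by linarith) h1.le hE.le
      _ = 2 ^ |E| * R ^ E := by
        rw [Real.div_rpow hR.le zero_le_two, abs_of_neg hE, Real.rpow_neg zero_le_two,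
          div_eq_mul_inv, mul_comm]

lemma exists_lintegral_strip_le (hn : 1 ≤ n) (E : ℝ) :
    ∃ C : ℝ, 0 < C ∧ ∀ b R L : ℝ, 2 ≤ R → ∫ s in (1 : ℝ)..2 + R, s ^ b ≤ L →
      ∫⁻ z in Ioc (R / 2) R ×ˢ (univ : Set (Space n)),
        indicator {z : ℝ × Space n | ‖z.2‖ ≤ z.1 + 1}
          (fun z => ENNReal.ofReal (z.1 ^ E * (2 + z.1 - ‖z.2‖) ^ b)) z ≤
        ENNReal.ofReal (C * R ^ (E + n) * L) := by
  set κ := n * volume.real (Metric.ball (0 : Space n) 1) with hκ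
  have hn0 : (0 : ℝ) < n := by exact_mod_cast hn
  have hκ0 : 0 < κ := by
    refine mul_pos hn0 ?_
    rw [measureReal_def]
    exact ENNReal.toReal_pos (Metric.measure_ball_pos _ _ one_pos).ne' measure_ball_lt_top.ne
  refine ⟨2 ^ |E| * κ * 2 ^ (n - 1), by positivity, fun b R L hR hL => ?_⟩
  have hR0 : 0 < R := by linarith
  have hcm : MeasurableSet {z : ℝ × Space n | ‖z.2‖ ≤ z.1 + 1} :=
    measurableSet_le (by fun_prop) (by fun_prop)
  have hLt : ∀ t, 1 ≤ t → t ≤ R → ∫ s in (1 : ℝ)..2 + t, s ^ b ≤ L := fun t h1 h2 => by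
    refine le_trans ?_ hL
    have hc : ∀ c, 1 ≤ c → IntervalIntegrable (fun s : ℝ => s ^ b) volume 1 c := fun c hc1 => by
      refine ContinuousOn.intervalIntegrable ?_
      rw [uIcc_of_le hc1]
      exact continuousOn_id.rpow_const fun s hs => Or.inl (by have := hs.1; simp; linarith)
    rw [← intervalIntegral.integral_add_adjacent_intervals (hc (2 + t) (by linarith))
      ((hc (2 + t) (by linarith)).symm.trans (hc (2 + R) (by linarith)))]
    have : 0 ≤ ∫ s in (2 + t)..2 + R, s ^ b :=
      intervalIntegral.integral_nonneg (by linarith) fun s hs =>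
        Real.rpow_nonneg (by linarith [hs.1]) _
    linarith
  have hL0 : 0 ≤ L := by
    refine le_trans ?_ hL
    exact intervalIntegral.integral_nonneg (by linarith) fun s hs =>
        Real.rpow_nonneg (by linarith [hs.1]) _
  rw [setLIntegral_strip (Measurable.indicator (by fun_prop) hcm)]
  have hbd : ∀ t ∈ Ioc (R / 2) R, ∫⁻ x : Space n,
      indicator {z : ℝ × Space n | ‖z.2‖ ≤ z.1 + 1}
          (fun z => ENNReal.ofReal (z.1 ^ E * (2 + z.1 - ‖z.2‖) ^ b)) (t, x) ≤
        ENNReal.ofReal (2 ^ |E| * R ^ E * (κ * (2 * R) ^ (n - 1) * L)) := by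
    intro t ht
    have ht1 : 1 ≤ t := by linarith [ht.1]
    have hE0 : 0 ≤ t ^ E := Real.rpow_nonneg (by linarith) _
    have e1 : ∀ x : Space n, indicator {z : ℝ × Space n | ‖z.2‖ ≤ z.1 + 1}
          (fun z => ENNReal.ofReal (z.1 ^ E * (2 + z.1 - ‖z.2‖) ^ b)) (t, x) =
        ENNReal.ofReal (t ^ E) * (Metric.closedBall (0 : Space n) (t + 1)).indicator
          (fun x => ENNReal.ofReal ((2 + t - ‖x‖) ^ b)) x := fun x => by
      by_cases hx : ‖x‖ ≤ t + 1
      · rw [indicator_of_mem (by simpa using hx), indicator_of_mem (by simpa using hx),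
          ENNReal.ofReal_mul hE0]
      · rw [indicator_of_notMem (by simpa using hx), indicator_of_notMem (by simpa using hx),
          mul_zero]
    simp only [e1]
    rw [lintegral_const_mul _ (Measurable.indicator (by fun_prop)
      Metric.isClosed_closedBall.measurableSet),
      lintegral_indicator Metric.isClosed_closedBall.measurableSet]
    refine (mul_le_mul_right (lintegral_cone_le hn b ht1) _).trans ?_
    rw [← ENNReal.ofReal_mul hE0]
    refine ENNReal.ofReal_le_ofReal ?_
    have h1 := hLt t ht1 ht.2
    have h2 : 0 ≤ ∫ s in (1 : ℝ)..2 + t, s ^ b :=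
      intervalIntegral.integral_nonneg (by linarith) fun s hs =>
        Real.rpow_nonneg (by linarith [hs.1]) _
    have h3 := rpow_le_of_half_lt (E := E) hR0 ht.1 ht.2
    have h4 : κ * (2 * t) ^ (n - 1) * (∫ s in (1 : ℝ)..2 + t, s ^ b) ≤
        κ * (2 * R) ^ (n - 1) * L := by
      have := ht.2
      gcongr
    exact mul_le_mul h3 h4 (by positivity) (by positivity)
  refine (setLIntegral_mono' measurableSet_Ioc hbd).trans ?_
  rw [setLIntegral_const, Real.volume_Ioc, ← ENNReal.ofReal_mul (by positivity)]
  refine ENNReal.ofReal_le_ofReal ?_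
  have hRn : R ^ (E + n) = R ^ E * (R ^ (n - 1) * R) := by
    rw [Real.rpow_add hR0, Real.rpow_natCast, ← pow_succ, Nat.sub_add_cancel hn]
  rw [hRn, mul_pow]
  have hpos : 0 ≤ 2 ^ |E| * R ^ E * (κ * (2 ^ (n - 1) * R ^ (n - 1)) * L) := by positivity
  nlinarith [mul_nonneg hpos hR0.le]

/-- Hölder between the weighted `L^p` norm and the weight `D^a` restricted to the cone. The relation
among the exponents makes the latter produce exactly one power of `R`, which the prefactor `1/R`
cancels. -/
lemma exists_holder_strip (hn : 1 ≤ n) {p q ν κ : ℝ} (hpq : p.HolderConjugate q)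
    (hs : ν - κ / p + n / q = 1) (k : ℕ) :
    ∃ C : ℝ, 0 < C ∧ ∀ (a R L : ℝ) (v : ℝ × Space n → ℝ≥0∞), Measurable v →
      (∀ z, z.1 + 1 < ‖z.2‖ → v z = 0) → 2 ≤ R → ∫ s in (1 : ℝ)..2 + R, s ^ (a * q) ≤ L →
      ENNReal.ofReal (1 / R) * ∫⁻ z in Ioc (R / 2) R ×ˢ (univ : Set (Space n)),
          ENNReal.ofReal (z.1 ^ ν * (2 + z.1 - ‖z.2‖) ^ a * hump k (z.1 / R) ^ (1 / p)) * v z ≤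
        ENNReal.ofReal (C * L ^ (1 / q)) *
          (∫⁻ z in Ioc (R / 2) R ×ˢ (univ : Set (Space n)),
            ENNReal.ofReal (z.1 ^ κ * hump k (z.1 / R)) * v z ^ p) ^ (1 / p) := by
  have hp0 := hpq.pos
  have hq0 := hpq.symm.pos
  obtain ⟨C, hC, hstrip⟩ := exists_lintegral_strip_le (n := n) hn (q * (ν - κ / p))
  refine ⟨C ^ (1 / q), by positivity, fun a R L v hvm hsupp hR hL => ?_⟩
  have hR0 : 0 < R := by linarith
  have hL0 : 0 ≤ L := by
    refine le_trans ?_ hL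
    exact intervalIntegral.integral_nonneg (by linarith) fun s hs =>
        Real.rpow_nonneg (by linarith [hs.1]) _
  have hcm : MeasurableSet {z : ℝ × Space n | ‖z.2‖ ≤ z.1 + 1} :=
    measurableSet_le (by fun_prop) (by fun_prop)
  have hhm : Measurable (hump k) := (continuous_hump _).measurable
  have hSm : MeasurableSet (Ioc (R / 2) R ×ˢ (univ : Set (Space n))) :=
    measurableSet_Ioc.prod MeasurableSet.univ
  set f : ℝ × Space n → ℝ≥0∞ := fun z =>
    ENNReal.ofReal (z.1 ^ (κ / p) * hump k (z.1 / R) ^ (1 / p)) * v z with hf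
  set g : ℝ × Space n → ℝ≥0∞ := indicator {z : ℝ × Space n | ‖z.2‖ ≤ z.1 + 1}
    fun z => ENNReal.ofReal (z.1 ^ (ν - κ / p) * (2 + z.1 - ‖z.2‖) ^ a) with hg
  have hfm : Measurable f := by fun_prop
  have hgm : Measurable g := Measurable.indicator (by fun_prop) hcm
  have hfg := ENNReal.lintegral_mul_le_Lp_mul_Lq
    (volume.restrict (Ioc (R / 2) R ×ˢ (univ : Set (Space n)))) hpq hfm.aemeasurable
    hgm.aemeasurable
  have e1 : ∫⁻ z in Ioc (R / 2) R ×ˢ (univ : Set (Space n)),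
          ENNReal.ofReal (z.1 ^ ν * (2 + z.1 - ‖z.2‖) ^ a * hump k (z.1 / R) ^ (1 / p)) * v z =
      ∫⁻ z in Ioc (R / 2) R ×ˢ (univ : Set (Space n)), (f * g) z := by
    refine setLIntegral_congr_fun hSm fun z hz => ?_
    have hz0 : 0 < z.1 := by have := hz.1.1; linarith
    by_cases hx : ‖z.2‖ ≤ z.1 + 1
    · have hh := hump_nonneg k (z.1 / R)
      have hD : 0 ≤ (2 + z.1 - ‖z.2‖) ^ a := Real.rpow_nonneg (by linarith) _
      simp only [Pi.mul_apply, hf, hg]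
      rw [indicator_of_mem (by simpa using hx), mul_right_comm (ENNReal.ofReal _),
        ← ENNReal.ofReal_mul (by positivity)]
      congr 2
      have : z.1 ^ ν = z.1 ^ (κ / p) * z.1 ^ (ν - κ / p) := by
        rw [← Real.rpow_add hz0]; congr 1; ring
      rw [this]; ring
    · simp [hf, hsupp z (not_le.1 hx)]
  have e2 : ∫⁻ z in Ioc (R / 2) R ×ˢ (univ : Set (Space n)), f z ^ p =
      ∫⁻ z in Ioc (R / 2) R ×ˢ (univ : Set (Space n)),
            ENNReal.ofReal (z.1 ^ κ * hump k (z.1 / R)) * v z ^ p := by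
    refine setLIntegral_congr_fun hSm fun z hz => ?_
    have hz0 : 0 < z.1 := by have := hz.1.1; linarith
    have hh := hump_nonneg k (z.1 / R)
    simp only [hf]
    rw [ENNReal.mul_rpow_of_nonneg _ _ hp0.le, ENNReal.ofReal_rpow_of_nonneg (by positivity) hp0.le,
      Real.mul_rpow (by positivity) (by positivity), ← Real.rpow_mul hz0.le, ← Real.rpow_mul hh,
      div_mul_cancel₀ _ hp0.ne', one_div_mul_cancel hp0.ne', Real.rpow_one]
  have e3 : ∫⁻ z in Ioc (R / 2) R ×ˢ (univ : Set (Space n)), g z ^ q ≤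
      ENNReal.ofReal (C * R ^ (q * (ν - κ / p) + n) * L) := by
    refine le_trans (le_of_eq ?_) (hstrip (a * q) R L hR hL)
    refine setLIntegral_congr_fun hSm fun z hz => ?_
    have hz0 : 0 < z.1 := by have := hz.1.1; linarith
    simp only [hg]
    by_cases hx : ‖z.2‖ ≤ z.1 + 1
    · have hD : 0 ≤ (2 + z.1 - ‖z.2‖) := by linarith
      rw [indicator_of_mem (by simpa using hx), indicator_of_mem (by simpa using hx),
        ENNReal.ofReal_rpow_of_nonneg (by positivity) hq0.le,
        Real.mul_rpow (by positivity) (by positivity), ← Real.rpow_mul hz0.le, ← Real.rpow_mul hD,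
        mul_comm q]
    · rw [indicator_of_notMem (by simpa using hx), indicator_of_notMem (by simpa using hx),
        ENNReal.zero_rpow_of_pos hq0]
  have hexp : (q * (ν - κ / p) + n) * (1 / q) = 1 := by
    rw [add_mul, mul_one_div, mul_one_div, mul_div_cancel_left₀ _ hq0.ne', hs]
  rw [e1]
  refine (mul_le_mul_right hfg _).trans ?_
  rw [e2, mul_left_comm, mul_comm (ENNReal.ofReal (C ^ (1 / q) * _))]
  refine mul_le_mul_right ?_ _
  refine (mul_le_mul_right (ENNReal.rpow_le_rpow e3 (by positivity)) _).trans ?_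
  rw [ENNReal.ofReal_rpow_of_nonneg (by positivity) (by positivity),
    ← ENNReal.ofReal_mul (by positivity)]
  refine ENNReal.ofReal_le_ofReal (le_of_eq ?_)
  rw [Real.mul_rpow (by positivity) hL0, Real.mul_rpow (by positivity) (by positivity),
    ← Real.rpow_mul hR0.le, hexp, Real.rpow_one]
  field_simp

end Strip

end EPD

namespace EPD

/-! ### The critical exponents -/

section Exponents

variable {n : ℕ} {μ α p N : ℝ}

lemma one_lt_of_strauss (hn : 1 ≤ n) (hα : 0 ≤ α) (hμ : 0 < μ) (hp : 0 < p)
    (hS : strauss n μ α p = 0) : 1 < p := by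
  have hn' : (1 : ℝ) ≤ n := by exact_mod_cast hn
  rw [strauss] at hS
  by_contra hcon
  have h1 : (n + μ - 1) * p ^ 2 ≤ (n + μ - 1) * p := by
    refine mul_le_mul_of_nonneg_left ?_ (by linarith)
    nlinarith [not_lt.1 hcon]
  nlinarith [mul_nonneg hα hp.le]

/-- The quadratic equation for `p` divided by `2p`, in the form used to balance powers of `R`. -/
lemma strauss_scaling (hp : 0 < p) (hS : strauss n μ α p = 0)
    (hN : N = ((n : ℝ) - 1 + μ) / 2) : N * (p - 1) = 1 + α + 1 / p := by
  rw [strauss] at hS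
  have h : p * (N * (p - 1) - (1 + α + 1 / p)) = 0 := by
    rw [hN]
    field_simp
    linear_combination -hS
  rcases mul_eq_zero.1 h with h | h
  · exact absurd h hp.ne'
  · linarith

lemma mul_le_of_le_muStar (hn : 1 ≤ n) (hα : 0 ≤ α) (hp : 1 < p) (hS : strauss n μ α p = 0)
    (hμ : 0 < μ) (hμ' : μ ≤ muStar n α) : (n : ℝ) + 2 + α ≤ n * p := by
  have hn' : (1 : ℝ) ≤ n := by exact_mod_cast hn
  rw [muStar, le_div_iff₀ (by positivity)] at hμ'
  rw [strauss] at hS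
  set P : ℝ := n + 2 + α with hP
  -- The bound `μ ≤ μ*` says that the quadratic polynomial is nonnegative at `P / n`; it is
  -- multiplied by `n²` here. Hence its positive root is at least `P / n`.
  have h1 : 0 ≤ 2 * (n : ℝ) ^ 2 + (n + μ + 1 + 2 * α) * (n * P) - (n + μ - 1) * P ^ 2 := by
    have : 2 * (n : ℝ) ^ 2 + (n + μ + 1 + 2 * α) * (n * P) - (n + μ - 1) * P ^ 2 =
        2 * (n : ℝ) ^ 2 + P * (n * α + 2 + α) - μ * (P * (2 + α)) := by rw [hP]; ring
    rw [this]; linarith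
  by_contra hcon
  have hlt : n * p < P := not_le.1 hcon
  have hP0 : 0 < P := by positivity
  have hA : 0 < n + μ - 1 := by linarith
  -- subtracting `P²` times the equation for `p` from `p²` times the inequality at `P / n`
  have h3 : 0 ≤ p ^ 2 * (2 * (n : ℝ) ^ 2 + (n + μ + 1 + 2 * α) * (n * P)) - P ^ 2 *
      (2 + (n + μ + 1 + 2 * α) * p) := by
    have := mul_nonneg (sq_nonneg p) h1
    nlinarith [this, hS]
  have h4 : p ^ 2 * (2 * (n : ℝ) ^ 2 + (n + μ + 1 + 2 * α) * (n * P)) - P ^ 2 *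
      (2 + (n + μ + 1 + 2 * α) * p) =
      -((P - n * p) * (2 * (P + n * p) + (n + μ + 1 + 2 * α) * (p * P))) := by ring
  rw [h4] at h3
  have : 0 < (P - n * p) * (2 * (P + n * p) + (n + μ + 1 + 2 * α) * (p * P)) := by
    have := sub_pos.2 hlt
    positivity
  linarith

/-- By the equation for `p`, `(p - 1)((n + 1)p - 2 - μp)` equals `2p(np - (n + 2 + α))`, which is
nonnegative; the claim is `(n + 1)p - 2 ≥ μp` rearranged. This is the only use of the threshold for
`μ`. -/
lemma sub_one_le_of_le_muStar (hn : 1 ≤ n) (hα : 0 ≤ α) (hp : 1 < p) (hS : strauss n μ α p = 0)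
    (hμ : 0 < μ) (hμ' : μ ≤ muStar n α) (hN : N = ((n : ℝ) - 1 + μ) / 2) :
    μ - 1 ≤ N - 1 / p := by
  have h := mul_le_of_le_muStar hn hα hp hS hμ hμ'
  rw [strauss] at hS
  have hp0 : 0 < p := by linarith
  have key : μ * p ≤ (n + 1) * p - 2 := by
    have : 0 ≤ (p - 1) * ((n + 1) * p - 2 - μ * p) := by
      have e : (p - 1) * ((n + 1) * p - 2 - μ * p) = 2 * (p * (n * p - (n + 2 + α))) := by
        linear_combination hS
      rw [e]
      have := sub_nonneg.2 h
      positivity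
    have := nonneg_of_mul_nonneg_right this (by linarith)
    linarith
  have : 1 / p * p = 1 := one_div_mul_cancel hp0.ne'
  rw [hN]
  by_contra hcon
  have h2 := mul_lt_mul_of_pos_right (not_le.1 hcon) hp0
  nlinarith

/-- `(N - 1/p)(p - 1) = α + 2/p`. -/
lemma decay_pos (hp : 1 < p) (hα : 0 ≤ α) (h : N * (p - 1) = 1 + α + 1 / p) : 0 < N - 1 / p := by
  have hp0 : 0 < p := by linarith
  have h1 : (N - 1 / p) * (p - 1) = α + 2 / p := by
    rw [sub_mul, h]; field_simp; ring
  by_contra hcon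
  have := mul_nonpos_of_nonpos_of_nonneg (not_lt.1 hcon) (by linarith : 0 ≤ p - 1)
  have : 0 < 2 / p := by positivity
  linarith

lemma scaling_holder {q : ℝ} (hpq : p.HolderConjugate q) (hN : N = ((n : ℝ) - 1 + μ) / 2)
    (h : N * (p - 1) = 1 + α + 1 / p) :
    μ - N - (μ + α - (N - 1 / p)) / p + n / q = 1 := by
  have hp0 := hpq.pos
  have hq : (n : ℝ) / q = n * (1 - 1 / p) := by
    have := hpq.inv_add_inv_eq_one
    rw [div_eq_mul_inv, one_div]
    congr 1
    linarith
  have hn : (n : ℝ) = 2 * N + 1 - μ := by rw [hN]; ring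
  rw [hq, hn]
  have h' : N * (p - 1) * p = (1 + α) * p + 1 := by rw [h]; field_simp
  field_simp
  linear_combination h'

end Exponents

/-! ### The iteration inequalities -/

section Iteration

variable {n : ℕ} {μ α p N : ℝ}

lemma integral_inv_le {R : ℝ} (hR : 2 ≤ R) :
    ∫ s in (1 : ℝ)..2 + R, s ^ (-1 : ℝ) ≤ 2 * Real.log R := by
  simp only [Real.rpow_neg_one]
  rw [integral_inv_of_pos one_pos (by linarith), div_one,
    show 2 * Real.log R = Real.log (R ^ 2) by rw [Real.log_pow]; norm_num]
  exact Real.log_le_log (by linarith) (by nlinarith)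

lemma integral_rpow_le {b R : ℝ} (hb : b < -1) (hR : 0 ≤ R) :
    ∫ s in (1 : ℝ)..2 + R, s ^ b ≤ 1 / (-b - 1) := by
  have h0 : (0 : ℝ) ∉ uIcc 1 (2 + R) := by
    rw [uIcc_of_le (by linarith)]
    exact fun h => by linarith [h.1]
  rw [integral_rpow (Or.inr ⟨hb.ne, h0⟩), Real.one_rpow]
  have h1 : 0 ≤ (2 + R) ^ (b + 1) := Real.rpow_nonneg (by linarith) _
  rw [show ((2 + R) ^ (b + 1) - 1) / (b + 1) = (1 - (2 + R) ^ (b + 1)) / (-b - 1) by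
    rw [← neg_div_neg_eq]; congr 1 <;> ring]
  exact div_le_div_of_nonneg_right (by linarith) (by linarith)

/-- The weighted norm of `v` in the strip `R / 2 < t ≤ R`. -/
noncomputable def stripNorm (κ p : ℝ) (k : ℕ) (v : ℝ × Space n → ℝ≥0∞) (R : ℝ) : ℝ≥0∞ :=
  ∫⁻ z in Ioc (R / 2) R ×ˢ (univ : Set (Space n)),
    ENNReal.ofReal (z.1 ^ κ * hump k (z.1 / R)) * v z ^ p

/-- The weighted norm of `v` in `1 < t`, cut off at `t = R`. -/
noncomputable def cutNorm (κ p : ℝ) (k : ℕ) (v : ℝ × Space n → ℝ≥0∞) (R : ℝ) : ℝ≥0∞ :=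
  ∫⁻ z in Ioc 1 R ×ˢ (univ : Set (Space n)),
    ENNReal.ofReal (z.1 ^ κ * cutoff k (z.1 / R)) * v z ^ p

/-- The linear functional of `v` that bounds the tested equation. -/
noncomputable def stripMean (ν a p : ℝ) (k : ℕ) (v : ℝ × Space n → ℝ≥0∞) (R : ℝ) : ℝ≥0∞ :=
  ENNReal.ofReal (1 / R) * ∫⁻ z in Ioc (R / 2) R ×ˢ (univ : Set (Space n)),
    ENNReal.ofReal (z.1 ^ ν * (2 + z.1 - ‖z.2‖) ^ a * hump k (z.1 / R) ^ (1 / p)) * v z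

/-- The superposed inequality with its constants divided out. Both terms on the left are kept: each
half of the iteration discards one of them. -/
lemma exists_stripMean (hn : 1 ≤ n) {γ a : ℝ} (hμ : 0 < μ)
    (hN : N = ((n : ℝ) - 1 + μ) / 2) (hγ : γ = N - 1 - a) (ha1 : -1 < a) (ha : a < 0)
    (hγμ : μ - 1 < γ) (hγ0 : 0 < γ) (hp : 0 < p) (k : ℕ) :
    ∃ C : ℝ, 0 < C ∧ ∀ (T δ : ℝ) (v : ℝ × Space n → ℝ≥0∞), 0 ≤ δ →
      TestBound μ α p T δ k v → ∀ R, 2 ≤ R → R < T →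
      ENNReal.ofReal δ + cutNorm (μ + α - γ) p (k + 2) v R ≤
        ENNReal.ofReal C * stripMean (μ - N) a p (k + 2) v R := by
  obtain ⟨c, hc, C, hC, h⟩ := exists_superposed (n := n) (α := α) (p := p) hn hμ hN hγ ha1 ha hγμ
    hγ0 hp k
  refine ⟨1 / c * ((k + 4 + 2 * μ) * C), by positivity, fun T δ v hδ hv R hR hRT => ?_⟩
  have hR0 : 0 < R := by linarith
  have hvm := hv.meas
  have hcm : Measurable (cutoff (k + 2)) := (continuous_cutoff _).measurable
  have hhm : Measurable (hump (k + 2)) := (continuous_hump _).measurable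
  have hη := cutoff_nonneg (k := k + 2) (by omega)
  have hmain := h T δ v hδ hv R hR hRT
  have e1 : ∫⁻ z in Ioc 1 R ×ˢ (univ : Set (Space n)),
          ENNReal.ofReal (z.1 ^ (μ + α) * cutoff (k + 2) (z.1 / R)) * v z ^ p *
            ENNReal.ofReal (c * z.1 ^ (-γ)) =
      ENNReal.ofReal c * cutNorm (μ + α - γ) p (k + 2) v R := by
    rw [cutNorm, ← lintegral_const_mul _ (by fun_prop)]
    refine setLIntegral_congr_fun (measurableSet_Ioc.prod MeasurableSet.univ) fun z hz => ?_
    have hz0 : 0 < z.1 := by have := hz.1.1; linarith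
    have := hη (z.1 / R)
    rw [show μ + α - γ = μ + α + -γ by ring, Real.rpow_add hz0 (μ + α) (-γ),
      ENNReal.ofReal_mul (p := c) hc.le,
      ENNReal.ofReal_mul (p := z.1 ^ (μ + α)) (by positivity),
      ENNReal.ofReal_mul (p := z.1 ^ (μ + α) * z.1 ^ (-γ)) (by positivity),
      ENNReal.ofReal_mul (p := z.1 ^ (μ + α)) (by positivity)]
    ring
  have e2 : ∫⁻ z in Ioc (R / 2) R ×ˢ (univ : Set (Space n)),
          ENNReal.ofReal (z.1 ^ μ * ((k + 4 + 2 * μ) * hump (k + 2) (z.1 / R) ^ (1 / p))) * v z *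
            ENNReal.ofReal (C / R * (z.1 ^ (-N) * (2 + z.1 - ‖z.2‖) ^ a)) =
      ENNReal.ofReal ((k + 4 + 2 * μ) * C) * stripMean (μ - N) a p (k + 2) v R := by
    rw [stripMean, ← mul_assoc, ← ENNReal.ofReal_mul (by positivity),
      ← lintegral_const_mul _ (by fun_prop)]
    refine setLIntegral_congr_fun (measurableSet_Ioc.prod MeasurableSet.univ) fun z hz => ?_
    have hz0 : 0 < z.1 := by have := hz.1.1; linarith
    have hh := hump_nonneg (k + 2) (z.1 / R)
    rw [mul_right_comm, ← ENNReal.ofReal_mul (by positivity),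
      ← mul_assoc (ENNReal.ofReal _) (ENNReal.ofReal _), ← ENNReal.ofReal_mul (by positivity)]
    congr 2
    rw [show μ - N = μ + -N by ring, Real.rpow_add hz0]
    ring
  rw [e1, e2, mul_comm c δ, ENNReal.ofReal_mul hδ] at hmain
  have hcc : ENNReal.ofReal (1 / c) * ENNReal.ofReal c = 1 := by
    rw [← ENNReal.ofReal_mul (by positivity), one_div_mul_cancel hc.ne', ENNReal.ofReal_one]
  calc ENNReal.ofReal δ + cutNorm (μ + α - γ) p (k + 2) v R
      = ENNReal.ofReal (1 / c) * (ENNReal.ofReal δ * ENNReal.ofReal c +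
          ENNReal.ofReal c * cutNorm (μ + α - γ) p (k + 2) v R) := by
        rw [mul_comm (ENNReal.ofReal δ), ← mul_add, ← mul_assoc, hcc, one_mul]
    _ ≤ ENNReal.ofReal (1 / c) *
        (ENNReal.ofReal ((k + 4 + 2 * μ) * C) * stripMean (μ - N) a p (k + 2) v R) :=
        mul_le_mul_right hmain _
    _ = _ := by rw [← mul_assoc, ← ENNReal.ofReal_mul (by positivity)]

/-- The bound for `cutNorm` in the limiting case, where the equation is tested with `t^{1-μ}`. -/
lemma exists_cutNorm_le_of_eq (hn : 1 ≤ n) {a : ℝ} (hμ : 1 < μ)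
    (ha : a ≤ 0) (hNa : μ - N + a = 0) (k : ℕ) :
    ∃ C : ℝ, 0 < C ∧ ∀ (T δ : ℝ) (v : ℝ × Space n → ℝ≥0∞),
      TestBound μ α p T δ k v → ∀ R, 2 ≤ R → R < T →
      cutNorm (μ + α - (μ - 1)) p (k + 2) v R ≤
        ENNReal.ofReal C * stripMean (μ - N) a p (k + 2) v R := by
  have hμ0 : 0 < μ := by linarith
  refine ⟨(k + 4 + 2 * μ) * μ * 3 ^ (-a), by positivity, fun T δ v hv R hR hRT => ?_⟩
  have hR0 : 0 < R := by linarith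
  have hvm := hv.meas
  have hhm : Measurable (hump (k + 2)) := (continuous_hump _).measurable
  have hη := cutoff_nonneg (k := k + 2) (by omega)
  set e : Space n := EuclideanSpace.single ⟨0, hn⟩ 1 with he
  have hmain := hv.test 0 e _ _ 0 R le_rfl (by simp [he]) (isAdjoint_rpow hμ) (by fun_prop)
    (by fun_prop) le_rfl (fun s hs => by
      have := hs.1
      have := sub_pos.2 hμ
      positivity) hR hRT
  refine le_trans (le_of_eq ?_) ((le_add_self).trans (hmain.trans ?_))
  · rw [cutNorm]
    refine setLIntegral_congr_fun (measurableSet_Ioc.prod MeasurableSet.univ) fun z hz => ?_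
    have hz0 : 0 < z.1 := by have := hz.1.1; linarith
    have := hη (z.1 / R)
    simp only [zero_mul, Real.exp_zero, mul_one]
    rw [mul_right_comm, ← ENNReal.ofReal_mul (by positivity)]
    congr 2
    rw [show μ + α - (μ - 1) = μ + α + (1 - μ) by ring, Real.rpow_add hz0 (μ + α)]
    ring
  · rw [stripMean, ← mul_assoc, ← ENNReal.ofReal_mul (by positivity),
      ← lintegral_const_mul _ (by fun_prop)]
    refine setLIntegral_mono' (measurableSet_Ioc.prod MeasurableSet.univ) fun z hz => ?_
    have hzR : z.1 ≤ R := hz.1.2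
    have hz1 : 1 ≤ z.1 := by have := hz.1.1; linarith
    have hz0 : 0 < z.1 := by linarith
    have hh := hump_nonneg (k + 2) (z.1 / R)
    by_cases hlt : z.1 + 1 < ‖z.2‖
    · simp [hv.supp z hlt]
    have hle := not_lt.1 hlt
    simp only [zero_mul, Real.exp_zero, mul_one]
    have hm1 := sub_pos.2 hμ
    rw [mul_right_comm, ← ENNReal.ofReal_mul (by positivity),
      ← mul_assoc (ENNReal.ofReal _) (ENNReal.ofReal _), ← ENNReal.ofReal_mul (by positivity)]
    refine mul_le_mul_left (ENNReal.ofReal_le_ofReal ?_) _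
    set g := hump (k + 2) (z.1 / R) ^ (1 / p) with hg
    have hg0 : 0 ≤ g := by positivity
    have b1 : z.1 ^ μ * ((μ - 1) * z.1 ^ (-μ) / R + z.1 ^ (1 - μ) / R ^ 2) ≤ μ / R := by
      have i1 : z.1 ^ μ * z.1 ^ (-μ) = 1 := by rw [← Real.rpow_add hz0]; simp
      have i2 : z.1 ^ μ * z.1 ^ (1 - μ) = z.1 := by rw [← Real.rpow_add hz0]; simp
      calc z.1 ^ μ * ((μ - 1) * z.1 ^ (-μ) / R + z.1 ^ (1 - μ) / R ^ 2)
          = (μ - 1) / R * (z.1 ^ μ * z.1 ^ (-μ)) + (z.1 ^ μ * z.1 ^ (1 - μ)) / R ^ 2 := by ring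
        _ = (μ - 1) / R + z.1 / R ^ 2 := by rw [i1, i2, mul_one]
        _ ≤ (μ - 1) / R + R / R ^ 2 := by gcongr
        _ = μ / R := by field_simp; ring
    -- Since `D ≤ 3t`, `a ≤ 0` and `μ - N + a = 0`, the weight of `stripMean` is bounded below; the
    -- function `t^{1-μ}` thus leads to the same functional.
    have b2 : 1 ≤ 3 ^ (-a) * (z.1 ^ (μ - N) * (2 + z.1 - ‖z.2‖) ^ a) := by
      have i1 : (3 * z.1) ^ a ≤ (2 + z.1 - ‖z.2‖) ^ a :=
        Real.rpow_le_rpow_of_nonpos (by linarith) (by linarith [norm_nonneg z.2]) ha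
      have i2 : 3 ^ (-a) * (z.1 ^ (μ - N) * (3 * z.1) ^ a) = 1 := by
        rw [Real.mul_rpow (by norm_num) hz0.le, show (3 : ℝ) ^ (-a) * (z.1 ^ (μ - N) *
          (3 ^ a * z.1 ^ a)) = (3 ^ (-a) * 3 ^ a) * (z.1 ^ (μ - N) * z.1 ^ a) by ring,
          ← Real.rpow_add (by norm_num), ← Real.rpow_add hz0, hNa]
        simp
      calc (1 : ℝ) = 3 ^ (-a) * (z.1 ^ (μ - N) * (3 * z.1) ^ a) := i2.symm
        _ ≤ _ := by gcongr
    calc z.1 ^ μ * ((k + 4 + 2 * μ) * g) *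
          ((μ - 1) * z.1 ^ (-μ) / R + z.1 ^ (1 - μ) / R ^ 2)
        = (k + 4 + 2 * μ) * g *
          (z.1 ^ μ * ((μ - 1) * z.1 ^ (-μ) / R + z.1 ^ (1 - μ) / R ^ 2)) := by ring
      _ ≤ (k + 4 + 2 * μ) * g * (μ / R) := by gcongr
      _ ≤ (k + 4 + 2 * μ) * g * (μ / R) *
          (3 ^ (-a) * (z.1 ^ (μ - N) * (2 + z.1 - ‖z.2‖) ^ a)) :=
          le_mul_of_one_le_right (by positivity) b2
      _ = _ := by ring

/-- The same norm over the strip controls both the cut-off norm, with a power of `log R`, and the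
size of the data, without it. The loss comes from `aq = -1`, and it is avoided in the second
estimate by a smaller `a`. -/
lemma exists_iteration (hn : 1 ≤ n) (hα : 0 ≤ α) (hμ : 0 < μ) (hμ' : μ ≤ muStar n α) (hp : 1 < p)
    (hS : strauss n μ α p = 0) (hN : N = ((n : ℝ) - 1 + μ) / 2) (k : ℕ) :
    ∃ C : ℝ, 0 < C ∧ ∀ (T δ : ℝ) (v : ℝ × Space n → ℝ≥0∞), 0 ≤ δ →
      TestBound μ α p T δ k v → ∀ R, 2 ≤ R → R < T →
      cutNorm (μ + α - (N - 1 / p)) p (k + 2) v R ≤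
          ENNReal.ofReal (C * Real.log R ^ (1 - 1 / p)) *
            stripNorm (μ + α - (N - 1 / p)) p (k + 2) v R ^ (1 / p) ∧
        ENNReal.ofReal δ ≤ ENNReal.ofReal C *
          stripNorm (μ + α - (N - 1 / p)) p (k + 2) v R ^ (1 / p) := by
  have hp0 : 0 < p := by linarith
  set q := p / (p - 1) with hq
  have hpq : p.HolderConjugate q := Real.HolderConjugate.conjExponent hp
  have hq1 : 1 / q = 1 - 1 / p := by
    have := hpq.inv_add_inv_eq_one
    rw [one_div, one_div]; linarith
  have hq0 := hpq.symm.pos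
  have hsc := strauss_scaling hp0 hS hN
  have hβ := decay_pos hp hα hsc
  have hβμ := sub_one_le_of_le_muStar hn hα hp hS hμ hμ' hN
  have hpi : 0 < 1 / p := by positivity
  have hpi1 : 1 / p < 1 := by rw [div_lt_one hp0]; exact hp
  obtain ⟨H, hH, holder⟩ := exists_holder_strip (n := n) hn hpq (scaling_holder hpq hN hsc) (k + 2)
  set κ := μ + α - (N - 1 / p) with hκ
  -- With `a = -(1 - 1/p)` one has `γ = N - 1/p`, so the superposition needs `N - 1/p > μ - 1`. In
  -- the case of equality `μ > 1`, because `N - 1/p > 0`, and `t^{1-μ}` takes its place.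
  have first : ∃ C : ℝ, 0 < C ∧ ∀ (T δ : ℝ) (v : ℝ × Space n → ℝ≥0∞), 0 ≤ δ →
      TestBound μ α p T δ k v → ∀ R, 2 ≤ R → R < T →
      cutNorm κ p (k + 2) v R ≤
        ENNReal.ofReal C * stripMean (μ - N) (-(1 - 1 / p)) p (k + 2) v R := by
    rcases hβμ.eq_or_lt with heq | hlt
    · obtain ⟨C, hC, h⟩ := exists_cutNorm_le_of_eq (n := n) (α := α) (p := p) (N := N)
        (a := -(1 - 1 / p)) hn (by linarith : 1 < μ) (by linarith) (by linarith) k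
      refine ⟨C, hC, fun T δ v _ hv R hR hRT => ?_⟩
      have := h T δ v hv R hR hRT
      rwa [heq] at this
    · obtain ⟨C, hC, h⟩ := exists_stripMean (n := n) (α := α) (p := p) (a := -(1 - 1 / p))
        (γ := N - 1 / p) hn hμ hN (by ring) (by linarith) (by linarith) hlt hβ hp0 k
      exact ⟨C, hC, fun T δ v hδ hv R hR hRT => le_add_self.trans (h T δ v hδ hv R hR hRT)⟩
  obtain ⟨C₁, hC₁, h₁⟩ := first
  -- Any value in `(-1, -1/q)` would do: `a > -1` is needed for the kernel and `aq < -1` for a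
  -- bounded integral. Then `γ > N - 1/p ≥ μ - 1` is strict automatically.
  set a := -(1 - 1 / p / 2) with ha
  obtain ⟨C₂, hC₂, h₂⟩ := exists_stripMean (n := n) (α := α) (p := p) (a := a)
    (γ := N - 1 - a) hn hμ hN rfl (by linarith) (by linarith) (by linarith) (by linarith) hp0 k
  have haq : a * q < -1 := by
    have : a < -(1 / q) := by rw [hq1]; linarith
    calc a * q < -(1 / q) * q := by gcongr
      _ = -1 := by field_simp
  set L := 1 / (-(a * q) - 1) with hL
  have hL0 : 0 < L := by rw [hL]; exact div_pos one_pos (by linarith)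
  refine ⟨C₁ * H * 2 ^ (1 - 1 / p) + C₂ * (H * L ^ (1 / q)), by positivity,
    fun T δ v hδ hv R hR hRT => ⟨?_, ?_⟩⟩
  · have hlog : 0 ≤ Real.log R := Real.log_nonneg (by linarith)
    refine (h₁ T δ v hδ hv R hR hRT).trans ?_
    have e : -(1 - 1 / p) * q = -1 := by rw [← hq1]; field_simp
    have := holder (-(1 - 1 / p)) R (2 * Real.log R) v hv.meas hv.supp hR
      (by rw [e]; exact integral_inv_le hR)
    refine (mul_le_mul_right this _).trans ?_
    rw [← mul_assoc, ← ENNReal.ofReal_mul hC₁.le]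
    refine mul_le_mul_left (ENNReal.ofReal_le_ofReal ?_) _
    rw [hq1, Real.mul_rpow zero_le_two hlog]
    have : 0 ≤ C₂ * (H * L ^ (1 / q)) * Real.log R ^ (1 - 1 / p) := by positivity
    rw [← hq1] at *
    nlinarith
  · refine le_trans (le_self_add.trans (h₂ T δ v hδ hv R hR hRT)) ?_
    have := holder a R L v hv.meas hv.supp hR (integral_rpow_le haq (by linarith))
    refine (mul_le_mul_right this _).trans ?_
    rw [← mul_assoc, ← ENNReal.ofReal_mul hC₂.le]
    refine mul_le_mul_left (ENNReal.ofReal_le_ofReal ?_) _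
    have : 0 ≤ C₁ * H * 2 ^ (1 - 1 / p) := by positivity
    linarith

end Iteration

end EPD

namespace EPD

/-! ### Blow-up of the cut-off norm -/

section BlowUp

variable {n : ℕ}

/-- As a function of `τ = log R` the cut-off `η(t e^{-τ})` has derivative `(t/R) (-η')(t/R)`, and
`-η'` is the bump defining the norm over the strip. Integrating over the fixed set `1 < t ≤ T₁`
allows differentiation under the integral. -/
lemma exists_hasDerivAt_cutNorm {κ p T₁ : ℝ} {k : ℕ} (hk : k ≠ 0) {v : ℝ × Space n → ℝ≥0∞}
    (hvm : Measurable v)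
    (hfin : ∫⁻ z in Ioc 1 T₁ ×ˢ (univ : Set (Space n)), ENNReal.ofReal (z.1 ^ κ) * v z ^ p ≠ ⊤) :
    ∃ F F' : ℝ → ℝ, (∀ τ, 0 < τ → HasDerivAt F (F' τ) τ) ∧ (∀ τ, 0 ≤ F τ) ∧ (∀ τ, 0 ≤ F' τ) ∧
      (∀ τ, 2 ≤ Real.exp τ → Real.exp τ ≤ T₁ →
        ENNReal.ofReal (F τ) ≤ cutNorm κ p k v (Real.exp τ)) ∧
      (∀ τ, 2 ≤ Real.exp τ → Real.exp τ ≤ T₁ →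
        stripNorm κ p k v (Real.exp τ) ≤ ENNReal.ofReal (2 * F' τ)) := by
  have hSm : MeasurableSet (Ioc 1 T₁ ×ˢ (univ : Set (Space n))) :=
    measurableSet_Ioc.prod MeasurableSet.univ
  set m := (volume : Measure (ℝ × Space n)).restrict (Ioc 1 T₁ ×ˢ univ) with hm
  set q : ℝ × Space n → ℝ≥0∞ := fun z => ENNReal.ofReal (z.1 ^ κ) * v z ^ p with hq
  have hqm : Measurable q := by fun_prop
  set Q : ℝ × Space n → ℝ := fun z => (q z).toReal with hQ
  have hQm : Measurable Q := hqm.ennreal_toReal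
  have hQ0 : ∀ z, 0 ≤ Q z := fun z => ENNReal.toReal_nonneg
  have hQi : Integrable Q m := integrable_toReal_of_lintegral_ne_top hqm.aemeasurable hfin
  have hqae : ∀ᵐ z ∂m, q z = ENNReal.ofReal (Q z) := by
    filter_upwards [ae_lt_top hqm hfin] with z hz
    exact (ENNReal.ofReal_toReal hz.ne).symm
  have hmem : ∀ᵐ z ∂m, z ∈ Ioc 1 T₁ ×ˢ (univ : Set (Space n)) := ae_restrict_mem hSm
  have hcm : Measurable (cutoff k) := (continuous_cutoff _).measurable
  have hhm : Measurable (hump k) := (continuous_hump _).measurable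
  have hη := cutoff_nonneg hk
  have hdiv : ∀ t τ : ℝ, t / Real.exp τ = t * Real.exp (-τ) := fun t τ => by
    rw [Real.exp_neg, div_eq_mul_inv]
  have key : ∀ τ : ℝ, 0 < τ →
      Integrable (fun z => Q z * (hump k (z.1 * Real.exp (-τ)) * (z.1 * Real.exp (-τ)))) m ∧
      HasDerivAt (fun τ => ∫ z, Q z * cutoff k (z.1 * Real.exp (-τ)) ∂m)
        (∫ z, Q z * (hump k (z.1 * Real.exp (-τ)) * (z.1 * Real.exp (-τ))) ∂m) τ := by
    intro τ hτ
    refine hasDerivAt_integral_of_dominated_loc_of_deriv_le (bound := fun z => Q z * T₁)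
      (F' := fun τ z => Q z * (hump k (z.1 * Real.exp (-τ)) * (z.1 * Real.exp (-τ))))
      (Ioi_mem_nhds hτ) ?_ ?_ ?_ ?_ (hQi.mul_const _) ?_
    · exact Eventually.of_forall fun s => Measurable.aestronglyMeasurable (by fun_prop)
    · refine (hQi.mul_const (cutoff k 0)).mono' (Measurable.aestronglyMeasurable (by fun_prop)) ?_
      filter_upwards [hmem] with z hz
      have hz1 : 0 < z.1 := one_pos.trans hz.1.1
      rw [Real.norm_of_nonneg (mul_nonneg (hQ0 z) (hη _))]
      exact mul_le_mul_of_nonneg_left (cutoff_anti k (by positivity)) (hQ0 z)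
    · exact Measurable.aestronglyMeasurable (by fun_prop)
    · filter_upwards [hmem] with z hz s hs
      have hz1 : 0 < z.1 := one_pos.trans hz.1.1
      have hh := hump_nonneg k (z.1 * Real.exp (-s))
      rw [Real.norm_of_nonneg (mul_nonneg (hQ0 z) (by positivity))]
      refine mul_le_mul_of_nonneg_left ?_ (hQ0 z)
      have h1 : z.1 * Real.exp (-s) ≤ T₁ := by
        calc z.1 * Real.exp (-s) ≤ z.1 * 1 := by
              gcongr
              rw [Real.exp_le_one_iff]
              have : (0 : ℝ) < s := hs
              linarith
          _ ≤ T₁ := by rw [mul_one]; exact hz.1.2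
      calc _ ≤ 1 * (z.1 * Real.exp (-s)) := by
            gcongr
            exact hump_le_one k _
        _ ≤ T₁ := by rw [one_mul]; exact h1
    · refine ae_of_all _ fun z s _ => ?_
      have h1 : HasDerivAt (fun s => z.1 * Real.exp (-s)) (z.1 * (Real.exp (-s) * -1)) s :=
        ((hasDerivAt_neg s).exp).const_mul z.1
      have h2 := ((hasDerivAt_cutoff k (z.1 * Real.exp (-s))).comp s h1).const_mul (Q z)
      refine HasDerivAt.congr_deriv (f := fun s => Q z * cutoff k (z.1 * Real.exp (-s))) h2 ?_
      ring
  refine ⟨_, _, fun τ hτ => (key τ hτ).2, fun τ => ?_, fun τ => ?_,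
    fun τ h2 hT => ?_, fun τ h2 hT => ?_⟩
  · exact integral_nonneg fun z => mul_nonneg (hQ0 z) (hη _)
  · refine integral_nonneg_of_ae ?_
    filter_upwards [hmem] with z hz
    have hz1 : 0 < z.1 := one_pos.trans hz.1.1
    have hh := hump_nonneg k (z.1 * Real.exp (-τ))
    have := hQ0 z
    simp only [Pi.zero_apply]
    positivity
  · have hi : Integrable (fun z => Q z * cutoff k (z.1 * Real.exp (-τ))) m := by
      refine (hQi.mul_const (cutoff k 0)).mono' (Measurable.aestronglyMeasurable (by fun_prop)) ?_
      filter_upwards [hmem] with z hz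
      have hz1 : 0 < z.1 := one_pos.trans hz.1.1
      rw [Real.norm_of_nonneg (mul_nonneg (hQ0 z) (hη _))]
      exact mul_le_mul_of_nonneg_left (cutoff_anti k (by positivity)) (hQ0 z)
    rw [ofReal_integral_eq_lintegral_ofReal hi (ae_of_all _ fun z => mul_nonneg (hQ0 z) (hη _)),
      cutNorm, ← lintegral_indicator (s := Ioc 1 (Real.exp τ) ×ˢ univ)
        (measurableSet_Ioc.prod MeasurableSet.univ)]
    refine le_trans (lintegral_mono_ae ?_) (setLIntegral_le_lintegral _ _)
    filter_upwards [hmem] with z hz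
    have hz1 : 0 < z.1 := one_pos.trans hz.1.1
    by_cases hzR : z.1 ≤ Real.exp τ
    · rw [indicator_of_mem (show z ∈ Ioc 1 (Real.exp τ) ×ˢ univ from ⟨⟨hz.1.1, hzR⟩, trivial⟩),
        ENNReal.ofReal_mul (hQ0 z), ENNReal.ofReal_mul (by positivity), hdiv, mul_right_comm]
      exact mul_le_mul_left ENNReal.ofReal_toReal_le _
    · rw [← hdiv, cutoff_of_ge hk]
      · simp
      · rw [one_le_div (Real.exp_pos _)]
        exact (not_le.1 hzR).le
  · have hτ : 0 < τ := by
      by_contra hcon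
      have := Real.exp_le_one_iff.2 (not_lt.1 hcon)
      linarith
    rw [← integral_const_mul, ofReal_integral_eq_lintegral_ofReal ((key τ hτ).1.const_mul 2),
      stripNorm]
    · refine (lintegral_mono_set (prod_mono
        (Ioc_subset_Ioc (show (1 : ℝ) ≤ Real.exp τ / 2 by linarith) hT) le_rfl)).trans ?_
      refine lintegral_mono_ae ?_
      filter_upwards [hmem, hqae] with z hz hzq
      have hz1 : 0 < z.1 := one_pos.trans hz.1.1
      have hh := hump_nonneg k (z.1 * Real.exp (-τ))
      have e1 : ENNReal.ofReal (z.1 ^ κ * hump k (z.1 / Real.exp τ)) * v z ^ p =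
          q z * ENNReal.ofReal (hump k (z.1 * Real.exp (-τ))) := by
        rw [ENNReal.ofReal_mul (by positivity), hdiv, mul_right_comm]
      rw [e1, hzq, ← ENNReal.ofReal_mul (hQ0 z)]
      refine ENNReal.ofReal_le_ofReal ?_
      rw [mul_left_comm 2]
      refine mul_le_mul_of_nonneg_left ?_ (hQ0 z)
      -- Where the bump is nonzero `t/R > 1/2`, which explains the factor `2`.
      rcases le_or_gt (z.1 * Real.exp (-τ)) (1 / 2) with hle | hgt
      · rw [hump_of_le hk hle]; simp
      · nlinarith
    · filter_upwards [hmem] with z hz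
      have hz1 : 0 < z.1 := one_pos.trans hz.1.1
      have hh := hump_nonneg k (z.1 * Real.exp (-τ))
      have := hQ0 z
      simp only [Pi.zero_apply]
      positivity

/-- A function with `F' ≥ c δ^p` and `F' ≥ c τ^{1-p} F^p` blows up before `2 K δ^{-p(p-1)}`. -/
lemma exists_blowUp_time {p c : ℝ} (hp : 1 < p) (hc : 0 < c) :
    ∃ K : ℝ, 0 < K ∧ ∀ (δ σ : ℝ) (F F' : ℝ → ℝ), 0 < δ → δ ≤ 1 →
      σ = K * δ ^ (-(p * (p - 1))) →
      (∀ τ ∈ Icc 1 (2 * σ), HasDerivAt F (F' τ) τ) → (∀ τ, 0 ≤ F τ) →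
      (∀ τ ∈ Icc 1 (2 * σ), c * δ ^ p ≤ F' τ) →
      (∀ τ ∈ Icc 1 (2 * σ), c * (τ ^ (1 - p) * F τ ^ p) ≤ F' τ) → False := by
  have hp1 : 0 < p - 1 := by linarith
  set A := (p - 1) * c * 2 ^ (1 - p) with hA
  have hA0 : 0 < A := by positivity
  -- The bound `2` ensures `σ ≥ 2`; the other entry is what the comparison at the end requires.
  refine ⟨max 2 ((c / 2) ^ (1 - p) / A), by positivity, ?_⟩
  set K := max 2 ((c / 2) ^ (1 - p) / A) with hK
  intro δ σ F F' hδ hδ1 hσ hF hF0 h1 h2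
  have hD1 : 1 ≤ δ ^ (-(p * (p - 1))) :=
    Real.one_le_rpow_of_pos_of_le_one_of_nonpos hδ hδ1 (by nlinarith)
  have hK2 : 2 ≤ K := le_max_left _ _
  have hσ2 : 2 ≤ σ := by rw [hσ]; nlinarith
  have hσ0 : 0 < σ := by linarith
  have hIntg : ∀ a b : ℝ, interior (Icc a b) = Ioo a b := fun a b => interior_Icc
  -- Up to time `σ` the constant lower bound for `F'` makes `F` grow linearly; `τ - 1 ≥ σ/2` because
  -- `σ ≥ 2`.
  have hgrow : ∀ τ ∈ Icc σ (2 * σ), c * δ ^ p * (σ / 2) ≤ F τ := by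
    intro τ hτ
    have hsub : Icc 1 τ ⊆ Icc 1 (2 * σ) := Icc_subset_Icc_right hτ.2
    have := (convex_Icc 1 τ).mul_sub_le_image_sub_of_le_deriv
      (fun x hx => (hF x (hsub hx)).continuousAt.continuousWithinAt)
      (fun x hx => (hF x (hsub (interior_subset hx))).differentiableAt.differentiableWithinAt)
      (C := c * δ ^ p) (fun x hx => by
        rw [(hF x (hsub (interior_subset hx))).deriv]
        exact h1 x (hsub (interior_subset hx))) 1 ⟨le_rfl, by linarith [hτ.1]⟩ τ
        ⟨by linarith [hτ.1], le_rfl⟩ (by linarith [hτ.1])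
    have hF1 := hF0 1
    have hcδ : 0 < c * δ ^ p := by positivity
    have : c * δ ^ p * (σ / 2) ≤ c * δ ^ p * (τ - 1) :=
      mul_le_mul_of_nonneg_left (by linarith [hτ.1]) hcδ.le
    linarith
  have hX0 : 0 < c * δ ^ p * (σ / 2) := by positivity
  have hFpos : ∀ τ ∈ Icc σ (2 * σ), 0 < F τ := fun τ hτ => hX0.trans_le (hgrow τ hτ)
  have hsub : Icc σ (2 * σ) ⊆ Icc 1 (2 * σ) := Icc_subset_Icc_left (by linarith)
  have hGd : ∀ τ ∈ Icc σ (2 * σ), HasDerivAt (fun s => F s ^ (1 - p))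
      (F' τ * (1 - p) * F τ ^ (1 - p - 1)) τ := fun τ hτ =>
    (hF τ (hsub hτ)).rpow_const (Or.inl (hFpos τ hτ).ne')
  -- On `[σ, 2σ]` the superlinear bound makes `F^{1-p}` decrease at rate at least `Aσ^{1-p}`. For
  -- `σ` of order `δ^{-p(p-1)}` it would become negative, which is impossible.
  have hdec := (convex_Icc σ (2 * σ)).image_sub_le_mul_sub_of_deriv_le
    (fun x hx => (hGd x hx).continuousAt.continuousWithinAt)
    (fun x hx => (hGd x (interior_subset hx)).differentiableAt.differentiableWithinAt)
    (C := -(A * σ ^ (1 - p))) (fun x hx => by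
      have hx' := interior_subset hx
      have hx0 : 0 < x := by linarith [hx'.1]
      have hFx := hFpos x hx'
      rw [(hGd x hx').deriv]
      have i1 := h2 x (hsub hx')
      have i2 : (2 * σ) ^ (1 - p) ≤ x ^ (1 - p) :=
        Real.rpow_le_rpow_of_nonpos hx0 hx'.2 (by linarith)
      have i3 : F x ^ p * F x ^ (1 - p - 1) = 1 := by
        rw [← Real.rpow_add hFx]; simp
      have i4 : 0 < F x ^ (1 - p - 1) := Real.rpow_pos_of_pos hFx _
      have i5 : c * (2 * σ) ^ (1 - p) ≤ F' x * F x ^ (1 - p - 1) := by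
        calc c * (2 * σ) ^ (1 - p) ≤ c * x ^ (1 - p) := by gcongr
          _ = c * (x ^ (1 - p) * F x ^ p) * F x ^ (1 - p - 1) := by
            linear_combination -(c * x ^ (1 - p)) * i3
          _ ≤ _ := mul_le_mul_of_nonneg_right i1 i4.le
      rw [Real.mul_rpow zero_le_two hσ0.le] at i5
      have i6 := mul_le_mul_of_nonneg_left i5 hp1.le
      rw [hA]
      linarith)
    σ ⟨le_rfl, by linarith⟩ (2 * σ) ⟨by linarith, le_rfl⟩ (by linarith)
  have hend : 0 < F (2 * σ) ^ (1 - p) :=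
    Real.rpow_pos_of_pos (hFpos _ ⟨by linarith, le_rfl⟩) _
  have hstart : F σ ^ (1 - p) ≤ (c * δ ^ p * (σ / 2)) ^ (1 - p) :=
    Real.rpow_le_rpow_of_nonpos hX0 (hgrow σ ⟨le_rfl, by linarith⟩) (by linarith)
  have hX : (c * δ ^ p * (σ / 2)) ^ (1 - p) =
      (c / 2) ^ (1 - p) * δ ^ (-(p * (p - 1))) * σ ^ (1 - p) := by
    rw [show c * δ ^ p * (σ / 2) = c / 2 * δ ^ p * σ by ring, Real.mul_rpow (by positivity) hσ0.le,
      Real.mul_rpow (by positivity) (by positivity), ← Real.rpow_mul hδ.le]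
    congr 3
    ring
  have hs0 : 0 < σ ^ (1 - p) := by positivity
  have hfin : A * σ * σ ^ (1 - p) < (c / 2) ^ (1 - p) * δ ^ (-(p * (p - 1))) * σ ^ (1 - p) := by
    rw [← hX]
    have : A * σ * σ ^ (1 - p) = A * σ ^ (1 - p) * (2 * σ - σ) := by ring
    rw [this]
    linarith
  have hlt := lt_of_mul_lt_mul_right hfin hs0.le
  have hKA : (c / 2) ^ (1 - p) ≤ A * K := by
    have := le_max_right 2 ((c / 2) ^ (1 - p) / A)
    rw [← hK, div_le_iff₀ hA0] at this
    linarith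
  rw [hσ, ← mul_assoc] at hlt
  have := lt_of_mul_lt_mul_right hlt (by linarith)
  linarith

lemma exists_time_bound {μ α p : ℝ} (hn : 1 ≤ n) (hα : 0 ≤ α) (hμ : 0 < μ)
    (hμ' : μ ≤ muStar n α) (hp : 1 < p) (hS : strauss n μ α p = 0) (k : ℕ) :
    ∃ K : ℝ, 0 < K ∧ ∀ (T δ : ℝ) (v : ℝ × Space n → ℝ≥0∞), 0 < δ → δ ≤ 1 →
      TestBound μ α p T δ k v →
      (∀ κ T₁ : ℝ, T₁ < T →
        ∫⁻ z in Ioc 1 T₁ ×ˢ (univ : Set (Space n)), ENNReal.ofReal (z.1 ^ κ) * v z ^ p ≠ ⊤) →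
      T ≤ Real.exp (K * δ ^ (-(p * (p - 1)))) := by
  have hp0 : 0 < p := by linarith
  obtain ⟨C, hC, hit⟩ := exists_iteration (N := ((n : ℝ) - 1 + μ) / 2) hn hα hμ hμ' hp hS rfl k
  set κ := μ + α - (((n : ℝ) - 1 + μ) / 2 - 1 / p) with hκ
  have hc : 0 < 1 / (2 * C ^ p) := by positivity
  obtain ⟨K, hK, hblow⟩ := exists_blowUp_time hp hc
  refine ⟨2 * K, by positivity, fun T δ v hδ hδ1 hv hfin => ?_⟩
  by_contra hcon
  rw [not_le, mul_assoc] at hcon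
  set σ := K * δ ^ (-(p * (p - 1))) with hσ
  obtain ⟨F, F', hd, hF0, hF0', hcut, hstrip⟩ := exists_hasDerivAt_cutNorm (k := k + 2)
    (by omega) hv.meas (hfin κ _ hcon)
  have hexp : ∀ τ ∈ Icc 1 (2 * σ), 2 ≤ Real.exp τ ∧ Real.exp τ ≤ Real.exp (2 * σ) := fun τ hτ =>
    ⟨by linarith [Real.add_one_le_exp τ, hτ.1], Real.exp_le_exp.2 hτ.2⟩
  -- Raises an iteration inequality to the power `p` and replaces the norm over the strip by `2F'`.
  have hroot : ∀ τ ∈ Icc 1 (2 * σ), ∀ X B : ℝ, 0 ≤ X → 0 ≤ B →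
      ENNReal.ofReal X ≤ ENNReal.ofReal B * stripNorm κ p (k + 2) v (Real.exp τ) ^ (1 / p) →
      X ^ p ≤ B ^ p * (2 * F' τ) := by
    intro τ hτ X B hX hB h
    obtain ⟨h2, hT⟩ := hexp τ hτ
    have h3 := ENNReal.rpow_le_rpow h hp0.le
    rw [ENNReal.mul_rpow_of_nonneg _ _ hp0.le, ← ENNReal.rpow_mul, one_div_mul_cancel hp0.ne',
      ENNReal.rpow_one, ENNReal.ofReal_rpow_of_nonneg hX hp0.le,
      ENNReal.ofReal_rpow_of_nonneg hB hp0.le] at h3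
    have h4 := h3.trans (mul_le_mul_right (hstrip τ h2 hT) _)
    rw [← ENNReal.ofReal_mul (by positivity)] at h4
    have := hF0' τ
    exact (ENNReal.ofReal_le_ofReal_iff (by positivity)).1 h4
  refine hblow δ σ F F' hδ hδ1 hσ (fun τ hτ => hd τ (by linarith [hτ.1])) hF0 (fun τ hτ => ?_)
    (fun τ hτ => ?_)
  · have := hroot τ hτ δ C hδ.le hC.le
      (hit T δ v hδ.le hv _ (hexp τ hτ).1 ((hexp τ hτ).2.trans_lt hcon)).2
    rw [div_mul_eq_mul_div, one_mul, div_le_iff₀ (by positivity)]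
    linarith
  · have hτ0 : 0 < τ := by linarith [hτ.1]
    have := (hit T δ v hδ.le hv _ (hexp τ hτ).1 ((hexp τ hτ).2.trans_lt hcon)).1
    rw [Real.log_exp] at this
    have := hroot τ hτ (F τ) _ (hF0 τ) (by positivity)
      ((hcut τ (hexp τ hτ).1 (hexp τ hτ).2).trans this)
    rw [Real.mul_rpow hC.le (by positivity), ← Real.rpow_mul hτ0.le,
      show (1 - 1 / p) * p = p - 1 by field_simp] at this
    have e : τ ^ (1 - p) * τ ^ (p - 1) = 1 := by rw [← Real.rpow_add hτ0]; simp
    rw [div_mul_eq_mul_div, one_mul, div_le_iff₀ (by positivity)]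
    calc τ ^ (1 - p) * F τ ^ p ≤ τ ^ (1 - p) * (C ^ p * τ ^ (p - 1) * (2 * F' τ)) := by gcongr
      _ = (τ ^ (1 - p) * τ ^ (p - 1)) * (F' τ * (2 * C ^ p)) := by ring
      _ = _ := by rw [e, one_mul]

end BlowUp

end EPD

/-! ### Verification of the hypotheses for a solution, and the lifespan bound -/

namespace EPD

section Conclusion

variable {n : ℕ} {μ α p T : ℝ} {u : ℝ → Space n → ℝ} {v : ℝ × Space n → ℝ≥0∞}
  {U V : ℝ → Lp ℝ 2 (volume : Measure (Space n))}
  {G : ℝ → Lp (Space n) 2 (volume : Measure (Space n))}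

/-- Frequency `0` turns the plane wave into a plain spatial cut-off equal to `1` on the cone. Away
from `t = 0` the powers `t^κ` and `t^α` are comparable. -/
lemma IsModulus.lintegral_ne_top (h : EnergyCurves μ α p T u U V G) (hv : IsModulus T u v)
    (hp : 0 < p) (κ : ℝ) {T₁ : ℝ} (hT₁ : T₁ < T) :
    ∫⁻ z in Ioc 1 T₁ ×ˢ (univ : Set (Space n)), ENNReal.ofReal (z.1 ^ κ) * v z ^ p ≠ ⊤ := by
  have hvm := hv.meas
  have hw := contDiff_planeWave h.pos 0 (0 : Space n)
  have hc := hasCompactSupport_planeWave T 0 (0 : Space n)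
  have hi := (h.integrableOn_nonlin hw hc hT₁).mono_set
    (Ioc_subset_Ioc_left zero_le_one : Ioc 1 T₁ ⊆ Ioc 0 T₁)
  have hpc : ContinuousOn (fun t : ℝ => t ^ (κ - α)) (Icc 1 T₁) :=
    continuousOn_id.rpow_const fun t ht => Or.inl (by have := ht.1; simp only [id]; linarith)
  obtain ⟨B, hB⟩ := isCompact_Icc.exists_bound_of_continuousOn hpc
  rw [setLIntegral_strip (by fun_prop)]
  refine ne_of_lt (lt_of_le_of_lt (b := ∫⁻ t in Ioc 1 T₁, ENNReal.ofReal B *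
    ENNReal.ofReal (nonlin α p u (planeWave T 0 (0 : Space n)) t)) ?_ ?_)
  · refine setLIntegral_mono_ae' measurableSet_Ioc ?_
    filter_upwards [hv.lintegral_nonlin h hp 0 0] with t ht htm
    have ht0 : 0 < t := one_pos.trans htm.1
    rw [← ht ⟨ht0, htm.2.trans_lt hT₁⟩, ← lintegral_const_mul _ (by fun_prop)]
    refine lintegral_mono fun x => ?_
    simp only [zero_mul, Real.exp_zero, ENNReal.ofReal_one, mul_one]
    rw [← mul_assoc]
    refine mul_le_mul_left ?_ _
    have hb := (le_abs_self _).trans (hB t ⟨htm.1.le, htm.2⟩)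
    have hB0 : 0 ≤ B := (norm_nonneg _).trans (hB t ⟨htm.1.le, htm.2⟩)
    rw [← ENNReal.ofReal_mul hB0]
    refine ENNReal.ofReal_le_ofReal ?_
    calc t ^ κ = t ^ (κ - α) * t ^ α := by rw [← Real.rpow_add ht0]; simp
      _ ≤ B * t ^ α := by gcongr
  · rw [lintegral_const_mul' _ _ ENNReal.ofReal_ne_top]
    exact ENNReal.mul_lt_top ENNReal.ofReal_lt_top hi.lintegral_lt_top

lemma integrable_of_supported {u₀ : Space n → ℝ} (hu₀ : MemLp u₀ 2 volume)
    (hsupp : ∀ᵐ x, 1 < ‖x‖ → u₀ x = 0) : Integrable u₀ := by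
  have hball : MeasurableSet (Metric.closedBall (0 : Space n) 1) :=
    Metric.isClosed_closedBall.measurableSet
  have hfin : IsFiniteMeasure (volume.restrict (Metric.closedBall (0 : Space n) 1)) :=
    ⟨by rw [Measure.restrict_apply_univ]; exact measure_closedBall_lt_top⟩
  have h1 : IntegrableOn u₀ (Metric.closedBall 0 1) :=
    (hu₀.restrict (Metric.closedBall 0 1)).integrable (by norm_num)
  refine ((integrable_indicator_iff hball).2 h1).congr ?_
  filter_upwards [hsupp] with x hx
  by_cases hx1 : ‖x‖ ≤ 1
  · rw [indicator_of_mem (by simpa using hx1)]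
  · rw [indicator_of_notMem (by simpa using hx1), hx (not_le.1 hx1)]

/-- The data are nonnegative and live in the unit ball, where `e^{l x·e} ≥ e^{-l}`. -/
lemma EnergyCurves.moment_zero_lower (h : EnergyCurves μ α p T u U V G) {ε : ℝ} (hε : 0 < ε)
    {u₀ : Space n → ℝ} (hu₀ : MemLp u₀ 2 volume) (hpos : ∀ᵐ x, 0 ≤ u₀ x)
    (hsupp : ∀ᵐ x, 1 < ‖x‖ → u₀ x = 0) (hU : U 0 =ᵐ[volume] fun x => ε * u₀ x) {l : ℝ}
    (hl : 0 ≤ l) {e : Space n} (he : ‖e‖ = 1) :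
    ε * (∫ x, u₀ x) * Real.exp (-l) ≤ ∫ x, U 0 x * planeWave T l e x := by
  have hT := h.pos
  have hi : Integrable (fun x => U 0 x * planeWave T l e x) :=
    (Lp.memLp (U 0)).integrable_mul
      (memLp_of_contDiff (contDiff_planeWave hT l e) (hasCompactSupport_planeWave T l e))
  rw [mul_right_comm, ← integral_const_mul]
  refine integral_mono_ae ((integrable_of_supported hu₀ hsupp).const_mul _) hi ?_
  filter_upwards [hpos, hsupp, hU] with x hx0 hx hxU
  simp only [hxU]
  by_cases hx1 : 1 < ‖x‖
  · simp [hx hx1]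
  · have hx1' := not_lt.1 hx1
    rw [planeWave_eq (by linarith), mul_right_comm]
    refine mul_le_mul_of_nonneg_left (Real.exp_le_exp.2 ?_) (mul_nonneg hε.le hx0)
    have := (abs_le.1 (abs_real_inner_le_norm x e)).1
    rw [he, mul_one] at this
    nlinarith

lemma EnergyCurves.testBound (h : EnergyCurves μ α p T u U V G) (hv : IsModulus T u v)
    (hcone : SupportedInCone T u) (hμ : 0 < μ) (hp : 1 < p) {k : ℕ} (hk : p / (p - 1) ≤ k + 2)
    {δ : ℝ} (hδ : 0 < δ) (hM : ∀ (l : ℝ) (e : Space n), 0 ≤ l → ‖e‖ = 1 →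
      δ * Real.exp (-l) ≤ ∫ x, U 0 x * planeWave T l e x) :
    TestBound μ α p T δ k v where
  meas := hv.meas
  supp := hv.supp
  test l e ϑ ϑn m R hl he hϑ hϑm hϑnm hm hmϑ hR hRT := by
    have h0 := hM l e hl he
    have h1 : 0 < δ * Real.exp (-l) := by positivity
    refine le_trans ?_
      (hv.test_le h hcone hμ hp hk he hϑ hϑm hϑnm hm hmϑ (h1.trans_le h0) hR hRT)
    have hη := cutoff_nonneg (k := k + 2) (by omega) 0
    gcongr

end Conclusion

end EPD

theorem theorem1p1 (n : ℕ) (hn : 2 ≤ n) (α : ℝ) (hα : 0 ≤ α) (hα2 : n = 2 → 0 < α)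
    (μ : ℝ) (hμ : 0 < μ) (hμ' : μ ≤ EPD.muStar n α)
    (p : ℝ) (hp : 0 < p) (hpS : EPD.strauss n μ α p = 0)
    (u₀ : EPD.Space n → ℝ) (hu₀ : EPD.MemH1 u₀)
    (hpos : ∀ᵐ x, 0 ≤ u₀ x) (hne : ¬ ∀ᵐ x, u₀ x = 0)
    (hsupp : ∀ᵐ x, 1 < ‖x‖ → u₀ x = 0) :
    ∃ ε₀ : ℝ, 0 < ε₀ ∧ ∃ C : ℝ, 0 < C ∧ ∀ ε : ℝ, 0 < ε → ε ≤ ε₀ →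
      EPD.lifespan μ α p (fun x => ε * u₀ x)
        ≤ ENNReal.ofReal (Real.exp (C * ε ^ (-(p * (p - 1))))) := by
  have hn1 : 1 ≤ n := by omega
  have hp1 := EPD.one_lt_of_strauss hn1 hα hμ hp hpS
  obtain ⟨k, hk⟩ := exists_nat_ge (p / (p - 1))
  have hk' : p / (p - 1) ≤ (k : ℝ) + 2 := by linarith
  obtain ⟨K, hK, hbound⟩ := EPD.exists_time_bound hn1 hα hμ hμ' hp1 hpS k
  have hui := EPD.integrable_of_supported hu₀.1 hsupp
  set d := ∫ x, u₀ x with hd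
  have hd0 : 0 < d := by
    refine lt_of_le_of_ne (integral_nonneg_of_ae hpos) fun h0 => hne ?_
    exact (integral_eq_zero_iff_of_nonneg_ae hpos hui).1 h0.symm
  -- The effective size of the data is `δ = εd`; the choice of `ε₀` gives `δ ≤ 1`, and `δ^{-p(p-1)}`
  -- splits off the power of `d`.
  refine ⟨1 / d, by positivity, K * d ^ (-(p * (p - 1))), by positivity, fun ε hε hε₀ => ?_⟩
  refine sSup_le ?_
  rintro _ ⟨T, u, rfl, ⟨hT, hmeas, -, U, V, G, hU, hG, hcU, hcG, hdU, hcV, hU0, hV0, hweak⟩, hprop⟩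
  refine ENNReal.ofReal_le_ofReal ?_
  have h : EPD.EnergyCurves μ α p T u U V G :=
    ⟨hT, hmeas, hU, hG, hcU, hcG, hdU, hcV, hV0, hweak⟩
  -- Finite speed is proved where the Sobolev embedding is available and is part of the notion of
  -- solution otherwise.
  have hcone : EPD.SupportedInCone T u := by
    by_cases hwp : EPD.WellPosedPower n p
    · obtain ⟨B, hB⟩ := EPD.exists_sobolevConst hn hp1.le hwp
      refine h.supportedInCone hμ hα hp1 hB ?_
      filter_upwards [hU0, hsupp] with x hx hx0 hlt
      rw [hx, hx0 hlt, mul_zero]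
    · exact hprop hwp
  obtain ⟨v, hv⟩ := h.exists_isModulus hcone
  have hδ : 0 < ε * d := mul_pos hε hd0
  have hδ1 : ε * d ≤ 1 := by rwa [le_div_iff₀ hd0] at hε₀
  have htb := h.testBound hv hcone hμ hp1 hk' hδ fun l e hl he =>
    h.moment_zero_lower hε hu₀.1 hpos hsupp hU0 hl he
  have := hbound T (ε * d) v hδ hδ1 htb fun κ T₁ hT₁ => hv.lintegral_ne_top h hp κ hT₁
  rwa [Real.mul_rpow hε.le hd0.le, mul_comm (ε ^ _), ← mul_assoc] at this
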